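/- **Setting.** Let $T^\star\in\mathbb R^{d_1\times\cdots\times d_m}$ ($m\ge1$; entrywise inner product $\langle\cdot,\cdot\rangle$, Frobenius norm $\|\cdot\|_F$) be a tensor of multilinear rank exactly $r=(r_1,\dots,r_m)$ with Tucker decomposition $T^\star=\mathcal C^\star\times_1U_1\cdots\times_mU_m$, the $U_k$ having orthonormal columns. Put $\bar d=\max_kd_k$, $d^\star=\prod_kd_k$. Given a linear identification constraint $\mathcal C(T^\star)=0$, let $\mathbb T$ be the intersection of $\ker\mathcal C$ with the tangent space at $T^\star$ of the rank-$r$ tensors, and $P_{\mathbb T}$ the orthogonal projection onto it. The target is $\psi(T)=\langle\Gamma,T\rangle$. Observations $(X_i,Y_i)$, $i=1,\dots,n$ ($n\ge1$), are i.i.d.: $X_i\sim\Pi$, and given $X_i$, $Y_i$ has density $e^{\ell(\cdot,\eta^\star_i)}$, $\eta_i^\star=\langle T^\star,X_i\rangle$, with respect to a fixed ($s$-finite) measure, where $\ell$ is jointly measurable, differentiable in $\eta$, and its score $s=\partial_\eta\ell$ is centred. Let $I(\eta)=\mathbb E[s(Y,\eta)^2\mid\eta]$, $\tilde s=s/I$,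 $\langle GU,V\rangle=\mathbb E[I(\eta^\star)\langle U,X\rangle\langle V,X\rangle]$, $A=P_{\mathbb T}GP_{\mathbb T}$ on $\mathbb T$. Write $\Phi$ for the standard normal distribution function and $d_K(S)=\sup_t|P(S\le t)-\Phi(t)|$. **(1) Leading term and combined bound.** Let $\delta>0$ be the effective dimension of the design and assume: (R1) $0<c_I\le I(\eta^\star)\le C_I$ for $\Pi$-almost every $X$; (R3) $\|P_{\mathbb T}X\|_F\le C_{\rm proj}\sqrt{\bar d/\delta}$ for $\Pi$-almost every $X$; isotropy, $\mathbb E\langle H,X\rangle^2=\|H\|_F^2/\delta$ for $H\in\mathbb T$; and $P_{\mathbb T}\Gamma\ne0$. Consider either * the whitened case: $Z_i=\tilde s(Y_i,\eta_i^\star)\langle H_{\rm ws},X_i\rangle$, $H_{\rm ws}=\delta P_{\mathbb T}\Gamma$, with (R2) $\mathbb E[|\tilde s(Y,\eta^\star)|^3\mid X]\le M_3$ almost surely; or * the efficient case: $Z_i=s(Y_i,\eta_i^\star)\langle H^\star,X_i\rangle$, $H^\star=A^{-1}P_{\mathbb T}\Gamma$, with $\mathbb E\|X\|_F^2<\infty$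 and (R2) $\mathbb E[|s(Y,\eta^\star)|^3\mid X]\le M_3$ almost surely. Let $v^2=\mathrm{Var}(Z_1)$. There is a constant $C$ depending only on $c_I,C_I,M_3,C_{\rm proj}$ such that $$d_K\Bigl(\tfrac1{\sqrt n\,v}\sum_{i=1}^nZ_i\Bigr)\le C\sqrt{\bar d/n},$$ and, for every estimator (real random variable) $\hat\psi_n$, with $R_n=\hat\psi_n-\psi(T^\star)-\frac1n\sum_iZ_i$ and $\rho_n=\sqrt n\,R_n/v$, and for every deterministic $r_n>0$, $$d_K\Bigl(\tfrac{\sqrt n(\hat\psi_n-\psi(T^\star))}{v}\Bigr)\le C\sqrt{\bar d/n}+\frac{r_n}{\sqrt{2\pi}}+P(|\rho_n|>r_n).$$ **(2) Rates for the one-step estimators.** Now specialise to the BTL model, $Y\in\{0,1\}$, $P(Y=1\mid X)=e^{\eta^\star}/(1+e^{\eta^\star})$, with uniform pairwise comparisons along mode 1: $X=E_{(a,u)}-E_{(b,u)}$ with a uniform context $u$ (joint index of modes $2,\dots,m$) and a uniform unordered pair $\{a,b\}\subset\{1,\dots,d_1\}$, $d_1\ge2$; $\mathcal C(T)=0$ means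 $\sum_aT_{a,u}=0$ for all $u$. The effective comparison dimension is $d_{\rm eff}=\frac{d_1-1}2\prod_{k\ge2}d_k$, and $H_{\rm ws}=d_{\rm eff}P_{\mathbb T}\Gamma$. Assume $\|T^\star\|_\infty\le B$; $\mu$-incoherence, $\|e_a^\top U_k\|_2^2\le\mu r_k/d_k$ for all $k,a$; the condition number of $T^\star$ (largest over smallest singular value over all unfoldings of the core) is at most $\kappa$; $\|T^\star\|_F\ge c_0\sqrt{d^\star}$; $\Gamma\ne0$ has at most $M$ nonzero entries; and $\|P_{\mathbb T}\Gamma\|_F\ge\alpha\sqrt{\bar d/d^\star}\,\|\Gamma\|_F$, with $c_0,\alpha>0$. The initial estimator $\hat T$ (given with its orthonormal Tucker factors, of multilinear rank $r$) is a measurable function of a first-stage sample independent of the evaluation sample $(X_i,Y_i)_{i\le n}$; let $\hat{\mathbb T}$, $P_{\hat{\mathbb T}}$ be the signal tangent space and projection at $\hat T$, let $\langle\hat GU,V\rangle=\mathbb E_X[I(\langle\hat T,X\rangle)\langle U,X\rangle\langle V,X\rangle]$ ($X$ a fresh design point) be the plug-in information operator, $\hat A=P_{\hat{\mathbb T}}\hat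 GP_{\hat{\mathbb T}}$ on $\hat{\mathbb T}$, and $$\hat\psi_{\rm ws}=\langle\Gamma,\hat T\rangle+\frac1n\sum_{i=1}^n\tilde s(Y_i,\langle\hat T,X_i\rangle)\langle d_{\rm eff}P_{\hat{\mathbb T}}\Gamma,X_i\rangle,\qquad\hat\psi_{\rm eff}=\langle\Gamma,\hat T\rangle+\frac1n\sum_{i=1}^ns(Y_i,\langle\hat T,X_i\rangle)\langle\hat A^{-1}P_{\hat{\mathbb T}}\Gamma,X_i\rangle.$$ Let $c,C_1>0$ and let $v_{\rm ws},v_{\rm eff}$ be the standard deviations of the corresponding $Z_1$. There is a constant $C$ depending only on $m,r,\mu,\kappa,B,c_0,\alpha,M,c,C_1$ such that: * (whitened) if, except on an event of probability at most $p$, $\hat T$ satisfies the zero-sum constraint and $\|\hat T-T^\star\|_\infty\le C_1\sqrt{\bar d\log^c\bar d/n}$, then $$d_K\Bigl(\tfrac{\sqrt n(\hat\psi_{\rm ws}-\psi(T^\star))}{v_{\rm ws}}\Bigr)\le C\sqrt{\frac{\bar d\log^{2c}\bar d}{n}}+p;$$ * (efficient) if $\|A^{-1}\|_{\infty\to\infty}\le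 C_Ad^\star$ and, except on an event of probability at most $p$, the same two properties hold together with $\|\hat A^{-1}\|_{\infty\to\infty}\le C_Ad^\star$, where $\|A^{-1}\|_{\infty\to\infty}=\sup_{\|V\|_\infty\le1}\|A^{-1}P_{\mathbb T}V\|_\infty$ and likewise for $\hat A$, then $$d_K\Bigl(\tfrac{\sqrt n(\hat\psi_{\rm eff}-\psi(T^\star))}{v_{\rm eff}}\Bigr)\le C\,C_A\sqrt{\frac{\bar d\log^{2c}\bar d}{n}}+p.$$ In particular, if $p=0$ the bounds are $O(\sqrt{\bar d\log^{2c}\bar d/n})$ and $O(C_A\sqrt{\bar d\log^{2c}\bar d/n})$. -/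

import Mathlib

open MeasureTheory ProbabilityTheory
open scoped ENNReal Matrix

noncomputable section

namespace PairwiseBE

/-! ### Tensors and the Tucker tangent space -/

/-- Real tensors with mode sizes `d 0, …, d m` (order `m + 1`); the inner product is the entrywise
one and the norm is the Frobenius norm. -/
abbrev Tensor {m : ℕ} (d : Fin (m + 1) → ℕ) : Type :=
  EuclideanSpace ℝ ((k : Fin (m + 1)) → Fin (d k))

/-- `d̄`, the largest mode size. -/
def dbar {m : ℕ} (d : Fin (m + 1) → ℕ) : ℕ := Finset.univ.sup d

/-- `d⋆`, the number of entries. -/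
def dstar {m : ℕ} (d : Fin (m + 1) → ℕ) : ℕ := ∏ k, d k

/-- The multilinear product `C ×₀ U₀ ×₁ ⋯ ×ₘ Uₘ`. -/
def tucker {m : ℕ} {d r : Fin (m + 1) → ℕ} (C : Tensor r)
    (U : (k : Fin (m + 1)) → Matrix (Fin (d k)) (Fin (r k)) ℝ) : Tensor d :=
  WithLp.toLp 2 fun i => ∑ j : (k : Fin (m + 1)) → Fin (r k), C j * ∏ k, U k (i k) (j k)

/-- The mode-`k` unfolding: rows are indexed by mode `k`, columns by all the other modes. -/
def unfold {m : ℕ} {r : Fin (m + 1) → ℕ} (C : Tensor r) (k : Fin (m + 1)) :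
    Matrix (Fin (r k)) ((j : Fin m) → Fin (r (k.succAbove j))) ℝ :=
  fun a b => C (Fin.insertNth (α := fun k => Fin (r k)) k a b)

/-- A tensor of multilinear rank exactly `r`, given by a Tucker decomposition with orthonormal
factors. -/
structure TuckerPoint {m : ℕ} (d r : Fin (m + 1) → ℕ) where
  core : Tensor r
  factor : (k : Fin (m + 1)) → Matrix (Fin (d k)) (Fin (r k)) ℝ
  orthonormal : ∀ k, (factor k)ᵀ * factor k = 1
  full_rank : ∀ k, LinearIndependent ℝ (fun a => unfold core k a)

namespace TuckerPoint

variable {m : ℕ} {d r : Fin (m + 1) → ℕ}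

/-- The tensor represented by the decomposition. -/
def tensor (P : TuckerPoint d r) : Tensor d := tucker P.core P.factor

/-- The tangent space at `P.tensor` of the manifold of tensors of multilinear rank `r`: the range
of the differential of `(C, U) ↦ tucker C U` at `(P.core, P.factor)`. -/
def tangent (P : TuckerPoint d r) : Submodule ℝ (Tensor d) :=
  Submodule.span ℝ
    ({H | ∃ C' : Tensor r, H = tucker C' P.factor} ∪
     {H | ∃ (k : Fin (m + 1)) (W : Matrix (Fin (d k)) (Fin (r k)) ℝ),
        H = tucker P.core (Function.update P.factor k W)})

/-- The signal tangent space: tangent directions that satisfy the identification constraint, whose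
solution set is `K`. -/
def signalTangent (P : TuckerPoint d r) (K : Submodule ℝ (Tensor d)) : Submodule ℝ (Tensor d) :=
  P.tangent ⊓ K

/-- `μ`-incoherence of the factors. -/
def Incoherent (P : TuckerPoint d r) (μ : ℝ) : Prop :=
  ∀ k (a : Fin (d k)), ∑ j, P.factor k a j ^ 2 ≤ μ * r k / d k

/-- The condition number is at most `κ`: all singular values of all the unfoldings of the core
(which have full row rank) lie in a common interval `[lam, κ * lam]` with `lam > 0`. -/
def CondLE (P : TuckerPoint d r) (κ : ℝ) : Prop :=
  ∃ lam : ℝ, 0 < lam ∧ ∀ k (x : EuclideanSpace ℝ (Fin (r k))),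
    lam * ‖x‖ ≤ ‖WithLp.toLp 2 ((unfold P.core k)ᵀ *ᵥ (x : Fin (r k) → ℝ))‖ ∧
    ‖WithLp.toLp 2 ((unfold P.core k)ᵀ *ᵥ (x : Fin (r k) → ℝ))‖ ≤ κ * lam * ‖x‖

end TuckerPoint

/-! ### Single-index observation models -/

/-- A single-index likelihood: given the index `η`, the observation has density
`exp (logLik y η)` with respect to `base`; the likelihood is differentiable in `η` and its score
is centred. -/
structure SingleIndexModel (𝒴 : Type*) [MeasurableSpace 𝒴] where
  base : Measure 𝒴
  sFinite : SFinite base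
  logLik : 𝒴 → ℝ → ℝ
  measurable_logLik : Measurable (Function.uncurry logLik)
  normalized : ∀ η, ∫⁻ y, ENNReal.ofReal (Real.exp (logLik y η)) ∂base = 1
  differentiable : ∀ y, Differentiable ℝ (logLik y)
  score_centered :
    ∀ η, ∫ y, deriv (logLik y) η ∂(base.withDensity fun y => ENNReal.ofReal (Real.exp (logLik y η)))
      = 0

namespace SingleIndexModel

variable {𝒴 : Type*} [MeasurableSpace 𝒴] {m : ℕ} {d : Fin (m + 1) → ℕ}

/-- The law of the observation given the index. -/
def obs (M : SingleIndexModel 𝒴) : Kernel ℝ 𝒴 :=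
  haveI := M.sFinite
  (Kernel.const ℝ M.base).withDensity fun η y => ENNReal.ofReal (Real.exp (M.logLik y η))

/-- The score `s(y, η)`. -/
def score (M : SingleIndexModel 𝒴) (y : 𝒴) (η : ℝ) : ℝ := deriv (M.logLik y) η

/-- The Fisher information `I(η)`. -/
def fisher (M : SingleIndexModel 𝒴) (η : ℝ) : ℝ := ∫ y, M.score y η ^ 2 ∂(M.obs η)

/-- The whitened score `s(y, η) / I(η)`. -/
def whitenedScore (M : SingleIndexModel 𝒴) (y : 𝒴) (η : ℝ) : ℝ := M.score y η / M.fisher η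

/-- The joint law of `(X, Y)` when `X` has law `𝒟` and `Y` given `X` has index `⟨T, X⟩`. -/
def law (M : SingleIndexModel 𝒴) (𝒟 : Measure (Tensor d)) (T : Tensor d) :
    Measure (Tensor d × 𝒴) :=
  𝒟 ⊗ₘ (M.obs.comap (fun x => inner ℝ T x) (by fun_prop))

/-- `s(Y, ⟨T, X⟩) ⟨H, X⟩` as a function of `(X, Y)`. -/
def infl (M : SingleIndexModel 𝒴) (T H : Tensor d) (z : Tensor d × 𝒴) : ℝ :=
  M.score z.2 (inner ℝ T z.1) * inner ℝ H z.1

/-- `(s(Y, ⟨T, X⟩) / I(⟨T, X⟩)) ⟨H, X⟩` as a function of `(X, Y)`. -/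
def whitenedInfl (M : SingleIndexModel 𝒴) (T H : Tensor d) (z : Tensor d × 𝒴) : ℝ :=
  M.whitenedScore z.2 (inner ℝ T z.1) * inner ℝ H z.1

/-- The information operator `G` at `T`, `⟨G U, V⟩ = E[I(⟨T, X⟩) ⟨U, X⟩ ⟨V, X⟩]`, through its
matrix in the canonical basis. -/
def infoOp (M : SingleIndexModel 𝒴) (𝒟 : Measure (Tensor d)) (T : Tensor d) :
    Tensor d →L[ℝ] Tensor d :=
  Matrix.toEuclideanCLM (𝕜 := ℝ)
    (Matrix.of fun i j => ∫ x, M.fisher (inner ℝ T x) * (x i * x j) ∂𝒟)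

end SingleIndexModel

/-- `A⁻¹ P_𝕋 V` for `A = P_𝕋 G P_𝕋 : 𝕋 → 𝕋`. -/
def infoSolve {m : ℕ} {d : Fin (m + 1) → ℕ} (𝕋 : Submodule ℝ (Tensor d))
    (G : Tensor d →L[ℝ] Tensor d) (V : Tensor d) : Tensor d :=
  ((Ring.inverse (𝕋.orthogonalProjectionOnto ∘L G ∘L 𝕋.subtypeL : 𝕋 →L[ℝ] 𝕋))
    (𝕋.orthogonalProjectionOnto V) : Tensor d)

/-- `‖A⁻¹‖_{∞→∞} = sup_{‖V‖_∞ ≤ 1} ‖A⁻¹ P_𝕋 V‖_∞ ≤ c`. -/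
def InfoInvNormLE {m : ℕ} {d : Fin (m + 1) → ℕ} (𝕋 : Submodule ℝ (Tensor d))
    (G : Tensor d →L[ℝ] Tensor d) (c : ℝ) : Prop :=
  ∀ V : Tensor d, (∀ i, |V i| ≤ 1) → ∀ i, |infoSolve 𝕋 G V i| ≤ c

/-- Conditions on the design law `𝒟` at the true signal, `δ` being the effective dimension of the
design: the identification constraint `𝒞`, Fisher information bounds, the tangent-projection
bound, and isotropy on the signal tangent space. -/
structure RegularDesign {m : ℕ} {d r : Fin (m + 1) → ℕ} {q : ℕ} {𝒴 : Type*} [MeasurableSpace 𝒴]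
    (M : SingleIndexModel 𝒴) (𝒟 : Measure (Tensor d)) (P : TuckerPoint d r)
    (𝒞 : Tensor d →ₗ[ℝ] (Fin q → ℝ)) (δ cI CI Cproj : ℝ) : Prop where
  effDim_pos : 0 < δ
  constraint : 𝒞 P.tensor = 0
  fisher_bounds : ∀ᵐ x ∂𝒟, cI ≤ M.fisher (inner ℝ P.tensor x) ∧
    M.fisher (inner ℝ P.tensor x) ≤ CI
  proj_bound : ∀ᵐ x ∂𝒟,
    ‖(P.signalTangent (LinearMap.ker 𝒞)).starProjection x‖ ≤ Cproj * √((dbar d : ℝ) / δ)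
  isotropic : ∀ H ∈ P.signalTangent (LinearMap.ker 𝒞), ∫ x, (inner ℝ H x) ^ 2 ∂𝒟 = ‖H‖ ^ 2 / δ

/-- `E[|s(Y, η⋆)|³ | X] ≤ M₃` for almost every design point, for a score-type function `s`. -/
def ThirdMomentLE {m : ℕ} {d : Fin (m + 1) → ℕ} {𝒴 : Type*} [MeasurableSpace 𝒴]
    (M : SingleIndexModel 𝒴) (s : 𝒴 → ℝ → ℝ) (𝒟 : Measure (Tensor d)) (T : Tensor d) (M₃ : ℝ) :
    Prop :=
  ∀ᵐ x ∂𝒟, Integrable (fun y => |s y (inner ℝ T x)| ^ 3) (M.obs (inner ℝ T x)) ∧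
    ∫ y, |s y (inner ℝ T x)| ^ 3 ∂(M.obs (inner ℝ T x)) ≤ M₃

/-! ### The Bradley–Terry–Luce model with uniform comparisons along mode `0` -/

theorem btl_hasDerivAt (y : Bool) (η : ℝ) :
    HasDerivAt (fun η : ℝ => (if y then η else 0) - Real.log (1 + Real.exp η))
      ((if y then 1 else 0) - Real.exp η / (1 + Real.exp η)) η := by
  have hpos : (0 : ℝ) < 1 + Real.exp η := by positivity
  have h2 : HasDerivAt (fun η : ℝ => Real.log (1 + Real.exp η))
      (Real.exp η / (1 + Real.exp η)) η :=
    ((Real.hasDerivAt_exp η).const_add 1).log hpos.ne'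
  refine HasDerivAt.fun_sub ?_ h2
  cases y
  · simpa using hasDerivAt_const η (0 : ℝ)
  · simpa using hasDerivAt_id' η

theorem btl_deriv (y : Bool) (η : ℝ) :
    deriv (fun η : ℝ => (if y then η else 0) - Real.log (1 + Real.exp η)) η =
      (if y then 1 else 0) - Real.exp η / (1 + Real.exp η) :=
  (btl_hasDerivAt y η).deriv

theorem btl_differentiable (y : Bool) :
    Differentiable ℝ (fun η : ℝ => (if y then η else 0) - Real.log (1 + Real.exp η)) :=
  fun η => (btl_hasDerivAt y η).differentiableAt

/-- The BTL model: `Y ∈ {0, 1}` with `P(Y = 1 | η) = e^η / (1 + e^η)`, that is,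
log-likelihood `y η - log (1 + e^η)` with respect to counting measure. -/
def btl : SingleIndexModel Bool where
  base := Measure.count
  sFinite := inferInstance
  logLik y η := (if y then η else 0) - Real.log (1 + Real.exp η)
  measurable_logLik := by
    have h : Measurable fun p : Bool × ℝ =>
        (if p.1 then p.2 else 0) - Real.log (1 + Real.exp p.2) := by
      apply Measurable.sub
      · exact Measurable.ite (measurable_fst (measurableSet_singleton true)) measurable_snd
          measurable_const
      · fun_prop
    exact h
  normalized η := by
    have hpos : (0 : ℝ) < 1 + Real.exp η := by positivity
    rw [lintegral_count, tsum_bool, ← ENNReal.ofReal_add (Real.exp_pos _).le (Real.exp_pos _).le]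
    simp only [Bool.false_eq_true, if_false, if_true, Real.exp_sub, Real.exp_zero,
      Real.exp_log hpos]
    rw [← add_div, div_self hpos.ne', ENNReal.ofReal_one]
  differentiable y := btl_differentiable y
  score_centered η := by
    have hpos : (0 : ℝ) < 1 + Real.exp η := by positivity
    rw [integral_withDensity_eq_integral_toReal_smul (by fun_prop)
      (Filter.Eventually.of_forall fun _ => ENNReal.ofReal_lt_top),
      integral_fintype (Integrable.of_finite)]
    have e : ∀ x : ℝ, (ENNReal.ofReal (Real.exp x)).toReal = Real.exp x := fun x =>
      ENNReal.toReal_ofReal (Real.exp_pos x).le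
    simp only [e]
    simp only [Fintype.sum_bool, Measure.real, Measure.count_singleton, ENNReal.toReal_one,
      btl_deriv, smul_eq_mul, Bool.false_eq_true, if_false, if_true, Real.exp_sub, Real.exp_zero,
      Real.exp_log hpos]
    field_simp
    ring

/-- The contexts: joint indices of the modes other than mode `0`. -/
abbrev Context {m : ℕ} (d : Fin (m + 1) → ℕ) : Type := (j : Fin m) → Fin (d j.succ)

/-- The comparison tensor `E_{(a, u)} - E_{(b, u)}`. -/
def atom {m : ℕ} {d : Fin (m + 1) → ℕ} (u : Context d) (a b : Fin (d 0)) : Tensor d :=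
  EuclideanSpace.single (Fin.cons (α := fun k => Fin (d k)) a u) 1 -
    EuclideanSpace.single (Fin.cons (α := fun k => Fin (d k)) b u) 1

/-- The uniform pairwise-comparison design: a uniform context and a uniform unordered pair. -/
def uniformDesign {m : ℕ} (d : Fin (m + 1) → ℕ) : Measure (Tensor d) :=
  ((Fintype.card (Context d) * (d 0).choose 2 : ℕ) : ℝ≥0∞)⁻¹ •
    ∑ u : Context d, ∑ a : Fin (d 0), ∑ b ∈ Finset.Ioi a, Measure.dirac (atom u a b)

/-- The effective comparison dimension `D (d₀ - 1) / 2`, `D` the number of contexts: on the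
zero-sum subspace, the uniform design satisfies `E[⟨H, X⟩ X] = H / effDim`. -/
def effDim {m : ℕ} (d : Fin (m + 1) → ℕ) : ℝ := (∏ j : Fin m, (d j.succ : ℝ)) * ((d 0 : ℝ) - 1) / 2

/-- Tensors that sum to zero along mode `0` in every context. -/
def zeroSum {m : ℕ} (d : Fin (m + 1) → ℕ) : Submodule ℝ (Tensor d) where
  carrier := {H | ∀ u : Context d, ∑ a, H (Fin.cons (α := fun k => Fin (d k)) a u) = 0}
  add_mem' := by
    intro x y hx hy u
    simp [Finset.sum_add_distrib, hx u, hy u]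
  zero_mem' := by
    intro u
    simp
  smul_mem' := by
    intro c x hx u
    simp [← Finset.mul_sum, hx u]

/-- Assumptions on the true signal `P.tensor` and on the functional `T ↦ ⟨Γ, T⟩`. -/
structure SignalAssumptions {m : ℕ} {d r : Fin (m + 1) → ℕ} (P : TuckerPoint d r) (Γ : Tensor d)
    (μ κ B cS α : ℝ) (M : ℕ) : Prop where
  two_le : 2 ≤ d 0
  zero_sum : P.tensor ∈ zeroSum d
  bounded : ∀ i, |P.tensor i| ≤ B
  incoherent : P.Incoherent μ
  cond : P.CondLE κ
  signal : cS * √(dstar d) ≤ ‖P.tensor‖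
  functional_ne : Γ ≠ 0
  support : (Finset.univ.filter fun i => Γ i ≠ 0).card ≤ M
  alignment :
    α * √((dbar d : ℝ) / dstar d) * ‖Γ‖ ≤ ‖(P.signalTangent (zeroSum d)).starProjection Γ‖

/-- Accuracy of an initial estimate: it is zero-sum and within `ε` of the truth in every entry. -/
def InitAccurate {m : ℕ} {d r : Fin (m + 1) → ℕ} (P Phat : TuckerPoint d r) (ε : ℝ) : Prop :=
  Phat.tensor ∈ zeroSum d ∧ ∀ i, |Phat.tensor i - P.tensor i| ≤ ε

/-! ### Samples, statistics, Kolmogorov distance -/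

/-- `Z₁, …, Zₙ` are i.i.d. with law `ν`. -/
structure IsIID {Ω 𝒵 : Type*} [MeasurableSpace Ω] [MeasurableSpace 𝒵] {n : ℕ}
    (Z : Fin n → Ω → 𝒵) (ν : Measure 𝒵) (Pr : Measure Ω) : Prop where
  measurable : ∀ i, Measurable (Z i)
  indep : iIndepFun Z Pr
  law_eq : ∀ i, Pr.map (Z i) = ν

/-- The standard deviation of `f` under `ν`. -/
def sd {𝒵 : Type*} [MeasurableSpace 𝒵] (f : 𝒵 → ℝ) (ν : Measure 𝒵) : ℝ := √(Var[f; ν])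

/-- `(√n v)⁻¹ ∑ᵢ f(Zᵢ)`. -/
def leadingSum {Ω 𝒵 : Type*} {n : ℕ} (Z : Fin n → Ω → 𝒵) (f : 𝒵 → ℝ) (v : ℝ) (ω : Ω) : ℝ :=
  (∑ i, f (Z i ω)) / (√n * v)

/-- `√n (ψ̂ - ψ) / v`. -/
def standardized {Ω : Type*} (n : ℕ) (est : Ω → ℝ) (ψ v : ℝ) (ω : Ω) : ℝ :=
  √n * (est ω - ψ) / v

/-- `√n R / v` with `R = ψ̂ - ψ - n⁻¹ ∑ᵢ f(Zᵢ)`. -/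
def stdRemainder {Ω 𝒵 : Type*} {n : ℕ} (Z : Fin n → Ω → 𝒵) (f : 𝒵 → ℝ) (est : Ω → ℝ) (ψ v : ℝ)
    (ω : Ω) : ℝ :=
  √n * (est ω - ψ - (∑ i, f (Z i ω)) / n) / v

/-- `sup_t |P(S ≤ t) - Φ(t)|`, with `Φ` the standard normal distribution function. -/
def kolmDist {Ω : Type*} [MeasurableSpace Ω] (Pr : Measure Ω) (S : Ω → ℝ) : ℝ :=
  ⨆ t : ℝ, |Pr.real {ω | S ω ≤ t} - cdf (gaussianReal 0 1) t|

/-- The score-whitened one-step estimator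
`⟨Γ, T̂⟩ + n⁻¹ ∑ᵢ s̃(Yᵢ, ⟨T̂, Xᵢ⟩) ⟨Ĥ, Xᵢ⟩` with `Ĥ = effDim • P̂_𝕋 Γ`; the initial estimate
`Phat` is a function of the first-stage sample `W`, and `Z` is the evaluation sample. -/
def whitenedEstimator {Ω 𝒲 : Type*} {m : ℕ} {d r : Fin (m + 1) → ℕ} {n : ℕ} (Γ : Tensor d)
    (Phat : 𝒲 → TuckerPoint d r) (W : Ω → 𝒲) (Z : Fin n → Ω → Tensor d × Bool) (ω : Ω) : ℝ :=
  let Q := Phat (W ω)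
  let H := effDim d • (Q.signalTangent (zeroSum d)).starProjection Γ
  inner ℝ Γ Q.tensor + (∑ i, btl.whitenedInfl Q.tensor H (Z i ω)) / n

/-- The efficient one-step estimator `⟨Γ, T̂⟩ + n⁻¹ ∑ᵢ s(Yᵢ, ⟨T̂, Xᵢ⟩) ⟨Ĥ, Xᵢ⟩` with
`Ĥ = (P̂_𝕋 Ĝ P̂_𝕋)⁻¹ P̂_𝕋 Γ` and `Ĝ = E[I(⟨T̂, X⟩) X ⊗ X]` the plug-in information operator. -/
def efficientEstimator {Ω 𝒲 : Type*} {m : ℕ} {d r : Fin (m + 1) → ℕ} {n : ℕ} (Γ : Tensor d)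
    (Phat : 𝒲 → TuckerPoint d r) (W : Ω → 𝒲) (Z : Fin n → Ω → Tensor d × Bool) (ω : Ω) : ℝ :=
  let Q := Phat (W ω)
  let H := infoSolve (Q.signalTangent (zeroSum d)) (btl.infoOp (uniformDesign d) Q.tensor) Γ
  inner ℝ Γ Q.tensor + (∑ i, btl.infl Q.tensor H (Z i ω)) / n

end PairwiseBE

end

open PairwiseBE

set_option linter.unusedSectionVars false

/-! ### The standard normal distribution function -/

namespace PairwiseBE

open Set Filter Topology

/-! Leading term. The summands are i.i.d. and centred, so the error is governed by the ratio `E|Z|³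
/ (√n v³)`, through a Berry–Esseen bound proved by Stein's method with leave-one-out sums
(`NormalizedArray.berry_esseen`). As `H` lies in the signal tangent space, `⟨H, X⟩ = ⟨H, P_𝕋 X⟩` is
at most `‖H‖ Cproj √(d̄/δ)`. Pulling this factor out of the cube leaves a second moment, which
isotropy evaluates as `‖H‖²/δ`. The information bounds give a lower bound of the same form for `v²`;
then `‖H‖` and `δ` cancel and `√(d̄/n)` remains. A remainder is handled by shifting the threshold,
at the price of the maximal Gaussian density (`kolmDist_add_le`).

Rates. The first stage is independent of the evaluation sample, so it may be frozen
(`abs_prob_sub_Phi_le_of_indepFun`), and bad first stages cost `p`. For a fixed initial estimate the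
estimator is a constant plus an average of bounded i.i.d. terms. Berry–Esseen is applied with the
variance of these terms, and three errors remain (`IsIID.plugin`, `ScoreBounds.plugin_clt`): the
third-moment ratio, of order `√(d̄/n)`; the relative change of the standard deviation, of order `ε`,
the entrywise accuracy of the estimate; and the standardized bias.

The bias is of second order in `ε`. Up to `O(ε²)` the mean of the plug-in score is linear in `Δ = T̂
- T⋆`. In the whitened case isotropy makes the linear term `-⟨Δ, P̂Γ⟩`; in the efficient case it is
`-⟨Δ, ĜĤ⟩`, and the normal equations for `Ĥ` apply. Either way it cancels `⟨Γ, Δ⟩` except for terms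
containing `Δ - P̂Δ = -(T⋆ - P̂T⋆)`. The entries of this vector are `O(ε²)`, because the tangent
space approximates the low-rank set to first order (`abs_sub_tangentMat_aux`). Entrywise bounds pair
with the ℓ¹ norms of the sparse `Γ` and of the direction; the latter norm is controlled by duality
from a sup-norm bound on `P̂` or on `Â⁻¹`, which is how `CA` enters. Alignment bounds `v` below by a
multiple of `√d̄ ‖Γ‖`, so the standardized bias is of order `√n ε² / √d̄`. With `ε² ≍ d̄ log^c d̄ /
n` this is the stated rate, and it dominates the other two errors.

Stability of the tangent space. Its projection is a Kronecker product of column-space projections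
plus corrections by row-space projections (`tangentMat`), and it commutes with centring. An
entrywise error `ε` moves an unfolding by at most `ε√d⋆` in operator norm, whereas its singular
values are at least a multiple of `√d⋆`; hence the projections move by `O(ε)` (`rangeProj_sub_le`),
with an additional small factor at basis vectors (`norm_sub_colProj_basisVec_le`). If `ε` exceeds a
fixed threshold, the claimed bound exceeds one and there is nothing to prove. -/

/-- The standard normal distribution function. -/
noncomputable def Phi (t : ℝ) : ℝ := cdf (gaussianReal 0 1) t

/-- The standard normal density. -/
noncomputable def phi (t : ℝ) : ℝ := gaussianPDFReal 0 1 t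

theorem phi_eq (t : ℝ) : phi t = (√(2 * Real.pi))⁻¹ * Real.exp (-(t ^ 2 / 2)) := by
  simp only [phi, gaussianPDFReal, NNReal.coe_one, mul_one, sub_zero, neg_div]

theorem phi_pos (t : ℝ) : 0 < phi t := gaussianPDFReal_pos 0 1 t one_ne_zero

theorem continuous_phi : Continuous phi := by
  have : phi = fun t => (√(2 * Real.pi))⁻¹ * Real.exp (-(t ^ 2 / 2)) := funext phi_eq
  rw [this]; fun_prop

theorem integrable_phi : Integrable phi := integrable_gaussianPDFReal 0 1

theorem Phi_eq_integral (t : ℝ) : Phi t = ∫ x in Iic t, phi x := by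
  rw [Phi, cdf_eq_real, Measure.real, gaussianReal_apply_eq_integral 0 one_ne_zero,
    ENNReal.toReal_ofReal]
  · rfl
  · exact integral_nonneg fun x => gaussianPDFReal_nonneg 0 1 x

theorem one_sub_Phi_eq_integral (t : ℝ) : 1 - Phi t = ∫ x in Ioi t, phi x := by
  have h := integral_add_compl (measurableSet_Iic (a := t)) integrable_phi
  rw [show ∫ x, phi x = 1 from integral_gaussianPDFReal_eq_one 0 one_ne_zero, compl_Iic,
    ← Phi_eq_integral] at h
  linarith

theorem Phi_nonneg (t : ℝ) : 0 ≤ Phi t := cdf_nonneg _ _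

theorem Phi_le_one (t : ℝ) : Phi t ≤ 1 := cdf_le_one _ _

theorem monotone_Phi : Monotone Phi := monotone_cdf _

theorem hasDerivAt_Phi (t : ℝ) : HasDerivAt Phi (phi t) t := by
  have h1 : Phi = fun t => Phi 0 + ∫ x in (0 : ℝ)..t, phi x := by
    funext t
    rw [Phi_eq_integral, Phi_eq_integral, ← intervalIntegral.integral_Iic_sub_Iic
      integrable_phi.integrableOn integrable_phi.integrableOn]
    ring
  rw [h1]
  exact (intervalIntegral.integral_hasDerivAt_right (continuous_phi.intervalIntegrable _ _)
    (continuous_phi.stronglyMeasurableAtFilter _ _) continuous_phi.continuousAt).const_add _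

theorem Phi_neg (t : ℝ) : Phi (-t) = 1 - Phi t := by
  rw [Phi_eq_integral, one_sub_Phi_eq_integral]
  have := integral_comp_neg_Iic (-t) phi
  rw [neg_neg] at this
  rw [← this]
  congr 1
  funext x
  simp [phi_eq]

theorem hasDerivAt_phi (t : ℝ) : HasDerivAt phi (-t * phi t) t := by
  have h : HasDerivAt (fun t : ℝ => (√(2 * Real.pi))⁻¹ * Real.exp (-(t ^ 2 / 2)))
      ((√(2 * Real.pi))⁻¹ * (Real.exp (-(t ^ 2 / 2)) * (-(2 * t / 2)))) t := by
    have h2 := ((hasDerivAt_pow 2 t).div_const 2).fun_neg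
    simpa using (h2.exp.const_mul _)
  have e : phi = fun t => (√(2 * Real.pi))⁻¹ * Real.exp (-(t ^ 2 / 2)) := funext phi_eq
  rw [phi_eq t]
  rw [e]
  exact h.congr_deriv (by ring)

theorem tendsto_phi_atTop : Tendsto phi atTop (𝓝 0) := by
  have e : phi = fun t => (√(2 * Real.pi))⁻¹ * Real.exp (-(t ^ 2 / 2)) := funext phi_eq
  rw [e, show (0 : ℝ) = (√(2 * Real.pi))⁻¹ * 0 by simp]
  refine Tendsto.const_mul _ (Real.tendsto_exp_neg_atTop_nhds_zero.comp ?_)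
  exact (tendsto_pow_atTop two_ne_zero).atTop_div_const two_pos

theorem phi_le (t : ℝ) : phi t ≤ 1 / √(2 * Real.pi) := by
  rw [phi_eq, one_div]
  have : Real.exp (-(t ^ 2 / 2)) ≤ 1 := Real.exp_le_one_iff.2 (by positivity |> neg_nonpos.2)
  have h0 : (0:ℝ) ≤ (√(2 * Real.pi))⁻¹ := by positivity
  nlinarith

/-- The Mills ratio bound. -/
theorem mul_one_sub_Phi_le (w : ℝ) : w * (1 - Phi w) ≤ phi w := by
  rcases le_or_gt w 0 with h | hw
  · exact (mul_nonpos_of_nonpos_of_nonneg h (by linarith [Phi_le_one w])).trans (phi_pos w).le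
  -- `x φ(x)` has the exact antiderivative `-φ(x)`, so replacing `w` by `x` under the tail integral
  -- gives `φ(w)`.
  have hd : ∀ x ∈ Ici w, HasDerivAt (fun x => -phi x) (x * phi x) x := fun x _ => by
    exact (hasDerivAt_phi x).fun_neg.congr_deriv (by ring)
  have ht : Tendsto (fun x => -phi x) atTop (𝓝 0) := by simpa using tendsto_phi_atTop.neg
  have hpos : ∀ x ∈ Ioi w, 0 ≤ x * phi x := fun x hx =>
    mul_nonneg (hw.le.trans (le_of_lt hx)) (phi_pos x).le
  have hi := integrableOn_Ioi_deriv_of_nonneg' hd hpos ht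
  have hI := integral_Ioi_of_hasDerivAt_of_tendsto' hd hi ht
  rw [one_sub_Phi_eq_integral, ← integral_const_mul]
  calc ∫ x in Ioi w, w * phi x ≤ ∫ x in Ioi w, x * phi x :=
        setIntegral_mono_on (integrable_phi.integrableOn.const_mul w) hi measurableSet_Ioi
          fun x hx => mul_le_mul_of_nonneg_right (le_of_lt hx) (phi_pos x).le
    _ = phi w := by rw [hI]; ring

/-! ### The solution of the Stein equation -/

/-- The Mills ratio of the standard normal law. -/
noncomputable def mills (w : ℝ) : ℝ := (1 - Phi w) / phi w

theorem mills_nonneg (w : ℝ) : 0 ≤ mills w :=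
  div_nonneg (by linarith [Phi_le_one w]) (phi_pos w).le

theorem mul_mills_le_one (w : ℝ) : w * mills w ≤ 1 := by
  rw [mills, ← mul_div_assoc, div_le_one (phi_pos w)]
  exact mul_one_sub_Phi_le w

theorem hasDerivAt_mills (w : ℝ) : HasDerivAt mills (w * mills w - 1) w := by
  have h := ((hasDerivAt_Phi w).const_sub 1).fun_div (hasDerivAt_phi w) (phi_pos w).ne'
  have := (phi_pos w).ne'
  refine h.congr_deriv ?_
  unfold mills
  field_simp
  ring

/-- The derivative is nonpositive by `mul_mills_le_one`, so the largest value on the half-line is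
the one at zero, `√(2π) / 2`. -/
theorem mills_le_of_nonneg {w : ℝ} (hw : 0 ≤ w) : mills w ≤ 2 := by
  have hanti : AntitoneOn mills (Ici 0) := by
    refine antitoneOn_of_deriv_nonpos (convex_Ici 0)
      (fun x _ => (hasDerivAt_mills x).continuousAt.continuousWithinAt)
      (fun x _ => (hasDerivAt_mills x).differentiableAt.differentiableWithinAt) fun x _ => ?_
    rw [(hasDerivAt_mills x).deriv]
    linarith [mul_mills_le_one x]
  refine (hanti self_mem_Ici hw hw).trans ?_
  have h0 : Phi 0 = 1 / 2 := by have := Phi_neg 0; rw [neg_zero] at this; linarith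
  have h1 : phi 0 = (√(2 * Real.pi))⁻¹ := by simp [phi_eq]
  rw [mills, h0, h1, div_inv_eq_mul]
  have : √(2 * Real.pi) ≤ 4 := by
    rw [Real.sqrt_le_left (by norm_num)]
    nlinarith [Real.pi_le_four]
  linarith

/-- The bounded solution of `f' w - w f w = 1{w ≤ z} - Φ(z)`. -/
noncomputable def stein (z w : ℝ) : ℝ :=
  if w ≤ z then (1 - Phi z) * mills (-w) else Phi z * mills w

/-- For negative `w` the factor `Φ(z) ≤ Φ(w)` compensates the growth of the Mills ratio: by symmetry
`Φ(w) mills w = (1 - Φ(w)) mills (-w)`. -/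
theorem Phi_mul_mills_le (z w : ℝ) (h : z ≤ w) : Phi z * mills w ≤ mills |w| := by
  rcases le_or_gt 0 w with hw | hw
  · rw [abs_of_nonneg hw]
    exact mul_le_of_le_one_left (mills_nonneg w) (Phi_le_one z)
  · rw [abs_of_neg hw]
    calc Phi z * mills w ≤ Phi w * mills w :=
          mul_le_mul_of_nonneg_right (monotone_Phi h) (mills_nonneg w)
      _ = (1 - Phi w) * mills (-w) := by
          have : phi (-w) = phi w := by simp [phi_eq]
          rw [mills, mills, Phi_neg, this]; ring
      _ ≤ mills (-w) := mul_le_of_le_one_left (mills_nonneg _) (by linarith [Phi_nonneg w])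

theorem one_sub_Phi_mul_mills_le (z w : ℝ) (h : w ≤ z) : (1 - Phi z) * mills (-w) ≤ mills |w| := by
  rw [← Phi_neg, ← abs_neg]
  exact Phi_mul_mills_le (-z) (-w) (by linarith)

theorem stein_nonneg (z w : ℝ) : 0 ≤ stein z w := by
  unfold stein
  split_ifs
  · exact mul_nonneg (by linarith [Phi_le_one z]) (mills_nonneg _)
  · exact mul_nonneg (Phi_nonneg z) (mills_nonneg _)

theorem stein_le_mills (z w : ℝ) : stein z w ≤ mills |w| := by
  unfold stein
  split_ifs with h
  · exact one_sub_Phi_mul_mills_le z w h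
  · exact Phi_mul_mills_le z w (not_le.1 h).le

theorem abs_stein_le (z w : ℝ) : |stein z w| ≤ 2 := by
  rw [abs_of_nonneg (stein_nonneg z w)]
  exact (stein_le_mills z w).trans (mills_le_of_nonneg (abs_nonneg w))

theorem abs_mul_stein_le (z w : ℝ) : |w * stein z w| ≤ 1 := by
  rw [abs_mul, abs_of_nonneg (stein_nonneg z w)]
  exact (mul_le_mul_of_nonneg_left (stein_le_mills z w) (abs_nonneg w)).trans (mul_mills_le_one _)

/-- The two branches agree at `w = z` by symmetry of the density, so each closed half-line carries a
single smooth formula. -/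
theorem stein_eq_of_ge {z w : ℝ} (h : z ≤ w) : stein z w = Phi z * mills w := by
  unfold stein
  split_ifs with h1
  · obtain rfl : w = z := le_antisymm h1 h
    have : phi (-w) = phi w := by simp [phi_eq]
    rw [mills, mills, Phi_neg, this]; ring
  · rfl

theorem stein_eq_of_le {z w : ℝ} (h : w ≤ z) : stein z w = (1 - Phi z) * mills (-w) := by
  simp [stein, h]

/-- The derivative of the Stein solution, with the value at `z` fixed by the Stein equation. -/
noncomputable def steinDeriv (z w : ℝ) : ℝ :=
  w * stein z w + (if w ≤ z then 1 else 0) - Phi z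

theorem abs_steinDeriv_le (z w : ℝ) : |steinDeriv z w| ≤ 2 := by
  have h1 := abs_le.1 (abs_mul_stein_le z w)
  have h2 := Phi_nonneg z
  have h3 := Phi_le_one z
  unfold steinDeriv
  rw [abs_le]
  split_ifs <;> constructor <;> linarith

theorem hasDerivAt_stein_left (z w : ℝ) :
    HasDerivAt (fun w => (1 - Phi z) * mills (-w)) (w * ((1 - Phi z) * mills (-w)) + 1 - Phi z) w := by
  have h : HasDerivAt (fun w => mills (-w)) ((-w * mills (-w) - 1) * (-1)) w :=
    (hasDerivAt_mills (-w)).comp w (hasDerivAt_neg w)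
  exact (h.const_mul (1 - Phi z)).congr_deriv (by ring)

theorem hasDerivAt_stein_right (z w : ℝ) :
    HasDerivAt (fun w => Phi z * mills w) (w * (Phi z * mills w) - Phi z) w := by
  exact ((hasDerivAt_mills w).const_mul (Phi z)).congr_deriv (by ring)

theorem stein_sub_le_of_le {z x y : ℝ} (hx : x ≤ z) (hy : y ≤ z) :
    |stein z y - stein z x| ≤ 2 * |y - x| := by
  rw [stein_eq_of_le hx, stein_eq_of_le hy]
  refine (convex_Iic z).norm_image_sub_le_of_norm_hasDerivWithin_le
    (f := fun w => (1 - Phi z) * mills (-w))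
    (fun w _ => (hasDerivAt_stein_left z w).hasDerivWithinAt) (fun w hw => ?_) hx hy
  have := abs_steinDeriv_le z w
  rw [steinDeriv, if_pos (show w ≤ z from hw), stein_eq_of_le hw] at this
  exact this

theorem stein_sub_le_of_ge {z x y : ℝ} (hx : z ≤ x) (hy : z ≤ y) :
    |stein z y - stein z x| ≤ 2 * |y - x| := by
  rw [stein_eq_of_ge hx, stein_eq_of_ge hy]
  refine (convex_Ici z).norm_image_sub_le_of_norm_hasDerivWithin_le
    (f := fun w => Phi z * mills w)
    (fun w _ => (hasDerivAt_stein_right z w).hasDerivWithinAt) (fun w hw => ?_) hx hy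
  -- `steinDeriv z z` follows the left-hand convention, so `abs_steinDeriv_le` does not cover the
  -- derivative of the right-hand formula at `w = z`.
  have h1 := abs_le.1 (abs_mul_stein_le z w)
  rw [stein_eq_of_ge hw] at h1
  have h2 := Phi_nonneg z
  have h3 := Phi_le_one z
  rw [Real.norm_eq_abs, abs_le]
  constructor <;> linarith

theorem stein_lipschitz (z x y : ℝ) : |stein z y - stein z x| ≤ 2 * |y - x| := by
  rcases le_total x z with hx | hx <;> rcases le_total y z with hy | hy
  · exact stein_sub_le_of_le hx hy
  · have h1 := stein_sub_le_of_le hx le_rfl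
    have h2 := stein_sub_le_of_ge le_rfl hy
    rw [abs_of_nonneg (sub_nonneg.2 hx)] at h1
    rw [abs_of_nonneg (sub_nonneg.2 hy)] at h2
    rw [abs_of_nonneg (by linarith : 0 ≤ y - x)]
    have := abs_sub_le (stein z y) (stein z z) (stein z x)
    linarith
  · have h1 := stein_sub_le_of_le le_rfl hy
    have h2 := stein_sub_le_of_ge hx le_rfl
    rw [abs_of_nonpos (by linarith : y - z ≤ 0)] at h1
    rw [abs_of_nonpos (by linarith : z - x ≤ 0)] at h2
    rw [abs_of_nonpos (by linarith : y - x ≤ 0)]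
    have := abs_sub_le (stein z y) (stein z z) (stein z x)
    linarith
  · exact stein_sub_le_of_ge hx hy

theorem mul_stein_sub_le (z x t : ℝ) :
    |(x + t) * stein z (x + t) - x * stein z x| ≤ 2 * (|x| + 1) * |t| := by
  have h1 := stein_lipschitz z x (x + t)
  have h2 := abs_stein_le z (x + t)
  rw [add_sub_cancel_left] at h1
  calc |(x + t) * stein z (x + t) - x * stein z x|
      = |x * (stein z (x + t) - stein z x) + t * stein z (x + t)| := by ring_nf
    _ ≤ |x| * (2 * |t|) + |t| * 2 := by
        refine (abs_add_le _ _).trans ?_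
        rw [abs_mul, abs_mul]
        gcongr
    _ = _ := by ring

/-- A shift shorter than the distance to the threshold cannot cross it; the jump of the Stein
derivative is thus felt only when `|x - z| ≤ |t|`. -/
theorem add_le_iff_of_abs_lt {x t z : ℝ} (h : |t| < |x - z|) : x + t ≤ z ↔ x ≤ z := by
  obtain ⟨h1, h2⟩ := abs_lt.1 h
  rcases le_total x z with hx | hx
  · rw [abs_of_nonpos (by linarith)] at h1 h2
    exact iff_of_true (by linarith) hx
  · rw [abs_of_nonneg (by linarith)] at h1 h2
    exact iff_of_false (by linarith) (by linarith)

/-- If the threshold may be crossed, two values of size at most 2 differ by at most 4. Otherwise the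
indicators agree and only the product `w * stein z w` varies. -/
theorem steinDeriv_sub_le (z x t : ℝ) :
    |steinDeriv z (x + t) - steinDeriv z x| ≤
      2 * (|x| + 1) * |t| + 4 * (if |x - z| ≤ |t| then 1 else 0) := by
  have h0 := mul_stein_sub_le z x t
  have hnn : 0 ≤ 2 * (|x| + 1) * |t| := by positivity
  split_ifs with h
  · have h1 := abs_le.1 (abs_steinDeriv_le z x)
    have h2 := abs_le.1 (abs_steinDeriv_le z (x + t))
    rw [abs_le]
    constructor <;> linarith
  · have hiff : x + t ≤ z ↔ x ≤ z := add_le_iff_of_abs_lt (not_le.1 h)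
    simp only [steinDeriv, hiff]
    ring_nf at h0 ⊢
    exact h0

/-- Near the threshold the Lipschitz bound and the bound on the derivative suffice. Away from it the
solution is smooth on the segment, and the mean value inequality applies to `s ↦ stein z (x + s) - s
* steinDeriv z x`. -/
theorem stein_taylor (z x t : ℝ) :
    |stein z (x + t) - stein z x - t * steinDeriv z x| ≤
      |t| * (2 * (|x| + 1) * |t| + 4 * (if |x - z| ≤ |t| then 1 else 0)) := by
  by_cases h : |x - z| ≤ |t|
  · rw [if_pos h]
    have h1 := stein_lipschitz z x (x + t)
    have h2 := abs_steinDeriv_le z x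
    rw [add_sub_cancel_left] at h1
    have h3 : |t * steinDeriv z x| ≤ |t| * 2 := by rw [abs_mul]; gcongr
    have h4 := abs_sub (stein z (x + t) - stein z x) (t * steinDeriv z x)
    have h5 : 0 ≤ |t| * (2 * (|x| + 1) * |t|) := by positivity
    linarith
  · have key : ∀ s ∈ uIcc 0 t, HasDerivWithinAt
        (fun s => stein z (x + s) - s * steinDeriv z x) (steinDeriv z (x + s) - steinDeriv z x)
        (uIcc 0 t) s := by
      rw [not_le] at h
      have hloc : ∀ s ∈ uIcc 0 t, (x + s ≤ z ↔ x ≤ z) := by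
        intro s hs
        have hs' : |s| ≤ |t| := by
          have := abs_sub_left_of_mem_uIcc hs
          simpa using this
        exact add_le_iff_of_abs_lt (hs'.trans_lt h)
      intro s hs
      refine HasDerivWithinAt.fun_sub ?_ (by simpa using (hasDerivWithinAt_id s _).mul_const _)
      by_cases hx : x ≤ z
      · have e : ∀ s ∈ uIcc 0 t, stein z (x + s) = (1 - Phi z) * mills (-(x + s)) :=
          fun s hs => stein_eq_of_le ((hloc s hs).2 hx)
        have hd := (hasDerivAt_stein_left z (x + s)).comp_const_add x s
        have e2 : steinDeriv z (x + s) =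
            (x + s) * ((1 - Phi z) * mills (-(x + s))) + 1 - Phi z := by
          rw [steinDeriv, if_pos ((hloc s hs).2 hx), e s hs]
        rw [e2]
        exact hd.hasDerivWithinAt.congr e (e s hs)
      · have e : ∀ s ∈ uIcc 0 t, stein z (x + s) = Phi z * mills (x + s) :=
          fun s hs => stein_eq_of_ge (not_le.1 (fun hh => hx ((hloc s hs).1 hh))).le
        have hd := (hasDerivAt_stein_right z (x + s)).comp_const_add x s
        have e2 : steinDeriv z (x + s) = (x + s) * (Phi z * mills (x + s)) - Phi z := by
          rw [steinDeriv, if_neg (fun hh => hx ((hloc s hs).1 hh)), e s hs]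
          ring
        rw [e2]
        exact hd.hasDerivWithinAt.congr e (e s hs)
    have hb : ∀ s ∈ uIcc 0 t, ‖steinDeriv z (x + s) - steinDeriv z x‖ ≤ 2 * (|x| + 1) * |t| := by
      intro s hs
      have hs' : |s| ≤ |t| := by simpa using abs_sub_left_of_mem_uIcc hs
      have h1 := steinDeriv_sub_le z x s
      rw [if_neg (fun hh => h (hh.trans hs'))] at h1
      rw [Real.norm_eq_abs]
      refine h1.trans ?_
      rw [mul_zero, add_zero]
      gcongr
    have := (convex_uIcc 0 t).norm_image_sub_le_of_norm_hasDerivWithin_le key hb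
      left_mem_uIcc right_mem_uIcc
    rw [if_neg h, mul_zero, add_zero]
    simp only [add_zero, zero_mul, sub_zero, Real.norm_eq_abs] at this
    calc _ = |stein z (x + t) - t * steinDeriv z x - stein z x| := by ring_nf
      _ ≤ _ := this
      _ = _ := by ring

theorem continuous_stein (z : ℝ) : Continuous (stein z) :=
  (LipschitzWith.of_dist_le_mul (K := 2) fun x y => by
    simpa [Real.dist_eq] using stein_lipschitz z y x).continuous

theorem measurable_steinDeriv (z : ℝ) : Measurable (steinDeriv z) := by
  unfold steinDeriv
  refine Measurable.sub_const ((measurable_id.mul (continuous_stein z).measurable).add ?_) _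
  exact Measurable.ite measurableSet_Iic measurable_const measurable_const

end PairwiseBE

/-! ### The Berry–Esseen theorem -/


namespace PairwiseBE

/-- Independent centred random variables of variance `1 / n` with third absolute moments at most
`γ / n`. -/
structure NormalizedArray {Ω : Type*} [MeasurableSpace Ω] {n : ℕ} (X : Fin n → Ω → ℝ) (γ : ℝ)
    (Pr : Measure Ω) : Prop where
  meas : ∀ i, Measurable (X i)
  indep : iIndepFun X Pr
  integrable_cube : ∀ i, Integrable (fun ω => |X i ω| ^ 3) Pr
  mean : ∀ i, ∫ ω, X i ω ∂Pr = 0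
  var : ∀ i, ∫ ω, X i ω ^ 2 ∂Pr = 1 / n
  third : ∀ i, ∫ ω, |X i ω| ^ 3 ∂Pr ≤ γ / n

/-- The test function of the concentration inequality has slope one on `[a - δ, b + δ]` and is
constant outside. From a point of `[a, b]`, a move by `x` therefore changes it by at least `min δ
|x|`. -/
theorem clamp_sub_ge {a b δ v x : ℝ} (hδ : 0 < δ) (ha : a ≤ v) (hb : v ≤ b) :
    |x| * min δ |x| ≤ x * (max (-((b - a) / 2 + δ)) (min ((b - a) / 2 + δ) (v - (a + b) / 2)) -
      max (-((b - a) / 2 + δ)) (min ((b - a) / 2 + δ) (v - x - (a + b) / 2))) := by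
  rw [min_eq_right (by linarith : v - (a + b) / 2 ≤ (b - a) / 2 + δ),
    max_eq_right (by linarith : -((b - a) / 2 + δ) ≤ v - (a + b) / 2)]
  rcases le_total 0 x with hx | hx
  · rw [abs_of_nonneg hx]
    refine mul_le_mul_of_nonneg_left ?_ hx
    rcases min_cases δ x with h | h <;>
      rcases min_cases ((b - a) / 2 + δ) (v - x - (a + b) / 2) with h1 | h1 <;>
      rcases max_cases (-((b - a) / 2 + δ)) (min ((b - a) / 2 + δ) (v - x - (a + b) / 2))
        with h2 | h2 <;> linarith
  · rw [abs_of_nonpos hx, ← neg_mul_neg x]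
    refine mul_le_mul_of_nonneg_left ?_ (by linarith)
    rcases min_cases δ (-x) with h | h <;>
      rcases min_cases ((b - a) / 2 + δ) (v - x - (a + b) / 2) with h1 | h1 <;>
      rcases max_cases (-((b - a) / 2 + δ)) (min ((b - a) / 2 + δ) (v - x - (a + b) / 2))
        with h2 | h2 <;> linarith

/-- Clamping is monotone; this disposes of the outcomes in which the sum lies outside `[a, b]`. -/
theorem mul_clamp_sub_nonneg {c m v x : ℝ} :
    0 ≤ x * (max (-c) (min c (v - m)) - max (-c) (min c (v - x - m))) := by
  rcases le_total 0 x with hx | hx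
  · refine mul_nonneg hx (sub_nonneg.2 ?_)
    gcongr; linarith
  · refine mul_nonneg_of_nonpos_of_nonpos hx (sub_nonpos.2 ?_)
    gcongr; linarith

/-- Where `δ ≤ |x|`, the gap is `|x| (|x| - 2δ)² / (4δ)`. It turns a third-moment bound into a lower
bound for a truncated second moment. -/
theorem sq_sub_cube_le {δ x : ℝ} (hδ : 0 < δ) : x ^ 2 - |x| ^ 3 / (4 * δ) ≤ |x| * min δ |x| := by
  have h0 := abs_nonneg x
  have h1 : 0 ≤ |x| ^ 3 / (4 * δ) := by positivity
  rw [← sq_abs x]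
  rcases min_cases δ |x| with ⟨h, h'⟩ | ⟨h, h'⟩ <;> rw [h]
  · rw [sub_le_iff_le_add, ← sub_le_iff_le_add', le_div_iff₀ (by positivity)]
    nlinarith [mul_nonneg h0 (sq_nonneg (2 * δ - |x|))]
  · nlinarith

/-! ### Moments, concentration and normal approximation for normalized arrays -/

namespace NormalizedArray

variable {Ω : Type*} [MeasurableSpace Ω] {Pr : Measure Ω} [IsProbabilityMeasure Pr] {n : ℕ}
  {X : Fin n → Ω → ℝ} {γ : ℝ}

theorem integrable_sq (h : NormalizedArray X γ Pr) (i : Fin n) :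
    Integrable (fun ω => X i ω ^ 2) Pr := by
  refine ((h.integrable_cube i).add (integrable_const (1 : ℝ))).mono'
    ((h.meas i).pow_const 2).aestronglyMeasurable (.of_forall fun ω => ?_)
  rw [Real.norm_eq_abs, abs_pow]
  simp only [Pi.add_apply]
  have := abs_nonneg (X i ω)
  nlinarith [mul_nonneg (sq_nonneg (|X i ω| - 1)) this]

theorem memLp (h : NormalizedArray X γ Pr) (i : Fin n) : MemLp (X i) 2 Pr :=
  (memLp_two_iff_integrable_sq (h.meas i).aestronglyMeasurable).2 (h.integrable_sq i)

theorem integrable (h : NormalizedArray X γ Pr) (i : Fin n) : Integrable (X i) Pr :=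
  (h.memLp i).integrable one_le_two

theorem measurable_sum (h : NormalizedArray X γ Pr) (s : Finset (Fin n)) :
    Measurable (fun ω => ∑ j ∈ s, X j ω) :=
  Finset.measurable_sum s fun j _ => h.meas j

theorem indep_sum (h : NormalizedArray X γ Pr) {s : Finset (Fin n)} {i : Fin n} (hi : i ∉ s) :
    IndepFun (fun ω => ∑ j ∈ s, X j ω) (X i) Pr := by
  have := h.indep.indepFun_finsetSum_of_notMem h.meas hi
  convert this using 1
  funext ω; simp

theorem memLp_sum (h : NormalizedArray X γ Pr) (s : Finset (Fin n)) :
    MemLp (fun ω => ∑ j ∈ s, X j ω) 2 Pr :=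
  memLp_finsetSum s fun i _ => h.memLp i

theorem integrable_sum (h : NormalizedArray X γ Pr) (s : Finset (Fin n)) :
    Integrable (fun ω => ∑ j ∈ s, X j ω) Pr :=
  (h.memLp_sum s).integrable one_le_two

theorem integral_sum_sq (h : NormalizedArray X γ Pr) (s : Finset (Fin n)) :
    ∫ ω, (∑ j ∈ s, X j ω) ^ 2 ∂Pr = s.card / n := by
  have hm : ∫ ω, ∑ j ∈ s, X j ω ∂Pr = 0 := by
    rw [integral_finsetSum _ fun i _ => h.integrable i]
    simp [h.mean]
  have h1 := variance_eq_sub (h.memLp_sum s)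
  rw [hm] at h1
  have h2 := IndepFun.variance_sum (s := s) (fun i _ => h.memLp i)
    (fun i _ j _ hij => h.indep.indepFun hij)
  have h3 : ∀ i, Var[X i; Pr] = 1 / n := fun i => by
    rw [variance_eq_sub (h.memLp i), h.mean]
    simpa using h.var i
  have h4 : (∑ i ∈ s, X i) = fun ω => ∑ j ∈ s, X j ω := by funext ω; simp
  rw [h4, h1] at h2
  simp only [h3, Finset.sum_const, nsmul_eq_mul, Pi.pow_apply] at h2
  rw [mul_one_div] at h2
  linarith

/-- `|V| ≤ (V² + 1) / 2`, and a partial sum has second moment `card / n ≤ 1`. -/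
theorem integral_abs_sum_le (h : NormalizedArray X γ Pr) (s : Finset (Fin n)) :
    ∫ ω, |∑ j ∈ s, X j ω| ∂Pr ≤ 1 := by
  have hc : (s.card : ℝ) / n ≤ 1 := by
    refine div_le_one_of_le₀ ?_ (Nat.cast_nonneg n)
    exact_mod_cast (Finset.card_le_univ s).trans (by simp)
  calc ∫ ω, |∑ j ∈ s, X j ω| ∂Pr ≤ ∫ ω, ((∑ j ∈ s, X j ω) ^ 2 + 1) / 2 ∂Pr := by
        refine integral_mono (h.integrable_sum s).abs
          (((h.memLp_sum s).integrable_sq.add (integrable_const 1)).div_const 2) fun ω => ?_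
        have := sq_abs (∑ j ∈ s, X j ω)
        simp only
        nlinarith [sq_nonneg (|∑ j ∈ s, X j ω| - 1)]
    _ ≤ 1 := by
        rw [integral_div, integral_add (h.memLp_sum s).integrable_sq (integrable_const 1),
          h.integral_sum_sq]
        simp; linarith

/-- The mean of `V f(V)`, `V` a partial sum, by removing one summand at a time. -/
theorem integral_sum_mul (h : NormalizedArray X γ Pr) (s : Finset (Fin n)) {f : ℝ → ℝ}
    (hf : Measurable f) {c : ℝ} (hc : ∀ x, |f x| ≤ c) :
    ∫ ω, (∑ j ∈ s, X j ω) * f (∑ j ∈ s, X j ω) ∂Pr =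
      ∑ i ∈ s, ∫ ω, X i ω * (f (∑ j ∈ s, X j ω) - f (∑ j ∈ s.erase i, X j ω)) ∂Pr := by
  have hint : ∀ i (t : Finset (Fin n)), Integrable (fun ω => X i ω * f (∑ j ∈ t, X j ω)) Pr :=
    fun i t => (h.integrable i).mul_bdd (c := c)
      (hf.comp (h.measurable_sum t)).aestronglyMeasurable (.of_forall fun ω => hc _)
  simp_rw [Finset.sum_mul]
  rw [integral_finsetSum _ fun i _ => hint i s]
  refine Finset.sum_congr rfl fun i hi => ?_
  simp_rw [mul_sub]
  rw [integral_sub (hint i s) (hint i _)]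
  -- The leave-one-out sum is independent of the centred `X i`, so subtracting its contribution is
  -- free.
  have hind : IndepFun (X i) (fun ω => f (∑ j ∈ s.erase i, X j ω)) Pr :=
    (h.indep_sum (Finset.notMem_erase i s)).symm.comp measurable_id hf
  rw [hind.integral_fun_mul_eq_mul_integral (h.meas i).aestronglyMeasurable
    (hf.comp (h.measurable_sum _)).aestronglyMeasurable, h.mean, zero_mul, sub_zero]

/-- A concentration inequality for partial sums. -/
theorem concentration (h : NormalizedArray X γ Pr) (hγ : 0 < γ) {s : Finset (Fin n)}
    (hn : 0 < n) (hs : n ≤ 2 * s.card) {a b : ℝ} (hab : a ≤ b) :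
    Pr.real {ω | a ≤ ∑ j ∈ s, X j ω ∧ ∑ j ∈ s, X j ω ≤ b} ≤ 2 * (b - a) + 8 * γ := by
  set V : Ω → ℝ := fun ω => ∑ j ∈ s, X j ω with hV
  -- The clamp extends beyond `[a, b]` by `γ` on each side. The mean of `V f(V)` is at most `c`,
  -- because `|f| ≤ c` and `E|V| ≤ 1`, and at least `P(A) μ - γ` with `μ ≥ 1/4`; hence `P(A) ≤ 4 (c
  -- + γ)`.
  set c : ℝ := (b - a) / 2 + γ with hc
  have hc0 : 0 < c := by rw [hc]; linarith
  set f : ℝ → ℝ := fun v => max (-c) (min c (v - (a + b) / 2)) with hf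
  have hfm : Measurable f := by rw [hf]; fun_prop
  have hfc : ∀ x, |f x| ≤ c := fun x => abs_le.2
    ⟨le_max_left _ _, max_le (by linarith) (min_le_left _ _)⟩
  set A : Set Ω := {ω | a ≤ V ω ∧ V ω ≤ b} with hA
  have hVm : Measurable V := h.measurable_sum s
  have hAm : MeasurableSet A := (measurableSet_le measurable_const hVm).inter
    (measurableSet_le hVm measurable_const)
  set η : Fin n → Ω → ℝ := fun j ω => |X j ω| * min γ |X j ω| with hη
  have hηm : ∀ j, Measurable (η j) := fun j => by
    have := h.meas j
    rw [hη]; fun_prop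
  have hη0 : ∀ j ω, 0 ≤ η j ω := fun j ω => by
    simp only [hη]; exact mul_nonneg (abs_nonneg _) (le_min hγ.le (abs_nonneg _))
  have hηle : ∀ j ω, η j ω ^ 2 ≤ γ ^ 2 * X j ω ^ 2 := fun j ω => by
    simp only [hη]
    rw [mul_pow, sq_abs, mul_comm]
    have h0 : 0 ≤ min γ |X j ω| := le_min hγ.le (abs_nonneg _)
    gcongr
    exact min_le_left _ _
  have hη2 : ∀ j, MemLp (η j) 2 Pr := fun j => by
    rw [memLp_two_iff_integrable_sq (hηm j).aestronglyMeasurable]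
    refine ((h.integrable_sq j).const_mul (γ ^ 2)).mono' ((hηm j).pow_const 2).aestronglyMeasurable
      (.of_forall fun ω => ?_)
    rw [Real.norm_of_nonneg (sq_nonneg _)]
    exact hηle j ω
  have hηi : ∀ j, Integrable (η j) Pr := fun j => (hη2 j).integrable one_le_two
  have hS2 : MemLp (fun ω => ∑ j ∈ s, η j ω) 2 Pr := memLp_finsetSum s fun i _ => hη2 i
  have hSi : Integrable (fun ω => ∑ j ∈ s, η j ω) Pr := hS2.integrable one_le_two
  set μ : ℝ := ∫ ω, ∑ j ∈ s, η j ω ∂Pr with hμ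
  have hSsq : Integrable (fun ω => ((∑ j ∈ s, η j ω) - μ) ^ 2) Pr :=
    (hS2.sub (memLp_const μ)).integrable_sq
  have hSabs : Integrable (fun ω => |(∑ j ∈ s, η j ω) - μ|) Pr :=
    (hSi.sub (integrable_const μ)).abs
  have hnR : (0 : ℝ) < n := by exact_mod_cast hn
  have hcard : (s.card : ℝ) ≤ n := by exact_mod_cast (Finset.card_le_univ s).trans (by simp)
  -- the mean of the truncated quadratic variation
  have hμ4 : 1 / 4 ≤ μ := by
    -- Truncating at `γ` costs at most a quarter of each variance. At least half of the summands are
    -- present, so the total is at least 3/8.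
    have h1 : ∀ j, 3 / 4 * (1 / n) ≤ ∫ ω, η j ω ∂Pr := fun j => by
      calc 3 / 4 * (1 / (n : ℝ)) ≤ ∫ ω, (X j ω ^ 2 - |X j ω| ^ 3 / (4 * γ)) ∂Pr := by
            rw [integral_sub (h.integrable_sq j) ((h.integrable_cube j).div_const _), h.var,
              integral_div]
            have : (∫ ω, |X j ω| ^ 3 ∂Pr) / (4 * γ) ≤ γ / n / (4 * γ) := by
              gcongr; exact h.third j
            have e : γ / n / (4 * γ) = 1 / 4 * (1 / n) := by field_simp
            linarith
        _ ≤ _ := integral_mono ((h.integrable_sq j).sub ((h.integrable_cube j).div_const _))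
            (hηi j) fun ω => sq_sub_cube_le hγ
    rw [hμ, integral_finsetSum _ fun i _ => hηi i]
    calc (1 / 4 : ℝ) ≤ s.card * (3 / 4 * (1 / n)) := by
          have : (n : ℝ) ≤ 2 * s.card := by exact_mod_cast hs
          rw [show (s.card : ℝ) * (3 / 4 * (1 / n)) = (3 / 4 * s.card) / n by ring,
            le_div_iff₀ hnR]
          linarith
      _ = ∑ _j ∈ s, 3 / 4 * (1 / (n : ℝ)) := by rw [Finset.sum_const, nsmul_eq_mul]
      _ ≤ _ := Finset.sum_le_sum fun j _ => h1 j
  -- its fluctuation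
  have hdev : ∫ ω, |(∑ j ∈ s, η j ω) - μ| ∂Pr ≤ γ := by
    -- Each `η j` is at most `γ |X j|`, and the variances of these independent variables add up.
    have hvar : ∫ ω, ((∑ j ∈ s, η j ω) - μ) ^ 2 ∂Pr ≤ γ ^ 2 := by
      have h1 := variance_eq_integral (μ := Pr) hS2.aestronglyMeasurable.aemeasurable
      rw [← hμ] at h1
      rw [← h1]
      have h2 := IndepFun.variance_sum (s := s) (fun i _ => hη2 i)
        (fun i _ j _ hij => (h.indep.indepFun hij).comp
          (φ := fun x => |x| * min γ |x|) (ψ := fun x => |x| * min γ |x|)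
          (by fun_prop) (by fun_prop))
      have h4 : (∑ i ∈ s, η i) = fun ω => ∑ j ∈ s, η j ω := by funext ω; simp
      rw [h4] at h2
      rw [h2]
      calc ∑ i ∈ s, Var[η i; Pr] ≤ ∑ i ∈ s, γ ^ 2 * (1 / n) := by
            refine Finset.sum_le_sum fun i _ => ?_
            refine (variance_le_expectation_sq (hηm i).aestronglyMeasurable).trans ?_
            rw [← h.var i, ← integral_const_mul]
            exact integral_mono (hη2 i).integrable_sq ((h.integrable_sq i).const_mul _) (hηle i)
        _ = γ ^ 2 * (s.card / n) := by rw [Finset.sum_const, nsmul_eq_mul]; ring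
        _ ≤ γ ^ 2 * 1 := by
            gcongr
            exact div_le_one_of_le₀ hcard hnR.le
        _ = _ := mul_one _
    calc ∫ ω, |(∑ j ∈ s, η j ω) - μ| ∂Pr
        ≤ ∫ ω, (((∑ j ∈ s, η j ω) - μ) ^ 2 / γ + γ) / 2 ∂Pr := by
          refine integral_mono hSabs
            (((hSsq.div_const γ).add
              (integrable_const γ)).div_const 2) fun ω => ?_
          simp only
          rw [le_div_iff₀ two_pos, ← sub_le_iff_le_add, le_div_iff₀ hγ,
            ← sq_abs ((∑ j ∈ s, η j ω) - μ)]
          nlinarith [sq_nonneg (|(∑ j ∈ s, η j ω) - μ| - γ)]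
      _ = ((∫ ω, ((∑ j ∈ s, η j ω) - μ) ^ 2 ∂Pr) / γ + γ) / 2 := by
          rw [integral_div, integral_add (hSsq.div_const γ)
            (integrable_const γ), integral_div]
          simp
      _ ≤ (γ ^ 2 / γ + γ) / 2 := by gcongr
      _ = γ := by field_simp; ring
  -- upper bound for the mean of `V f(V)`
  have hup : ∫ ω, V ω * f (V ω) ∂Pr ≤ c := by
    calc ∫ ω, V ω * f (V ω) ∂Pr ≤ ∫ ω, c * |V ω| ∂Pr := by
          refine integral_mono ((h.integrable_sum s).mul_bdd (c := c)
            (hfm.comp hVm).aestronglyMeasurable (.of_forall fun ω => hfc _))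
            ((h.integrable_sum s).abs.const_mul c) fun ω => ?_
          calc V ω * f (V ω) ≤ |V ω * f (V ω)| := le_abs_self _
            _ ≤ c * |V ω| := by rw [abs_mul, mul_comm]; gcongr; exact hfc _
      _ ≤ c * 1 := by
          rw [integral_const_mul]
          gcongr
          exact h.integral_abs_sum_le s
      _ = c := mul_one c
  -- lower bound
  have hint : ∀ i, Integrable
      (fun ω => X i ω * (f (V ω) - f (∑ j ∈ s.erase i, X j ω))) Pr := fun i =>
    (h.integrable i).mul_bdd (c := 2 * c)
      ((hfm.comp hVm).sub (hfm.comp (h.measurable_sum _))).aestronglyMeasurable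
      (.of_forall fun ω => by
        rw [Real.norm_eq_abs]
        refine (abs_sub _ _).trans ?_
        linarith [hfc (V ω), hfc (∑ j ∈ s.erase i, X j ω)])
  have hlow : Pr.real A * μ - γ ≤ ∫ ω, V ω * f (V ω) ∂Pr := by
    rw [h.integral_sum_mul s hfm hfc, ← integral_finsetSum _ fun i _ => hint i]
    calc Pr.real A * μ - γ
        ≤ ∫ ω, (A.indicator (fun _ => μ) ω - |(∑ j ∈ s, η j ω) - μ|) ∂Pr := by
          rw [integral_sub ((integrable_const μ).indicator hAm)
            hSabs, integral_indicator_const _ hAm, smul_eq_mul]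
          linarith
      _ ≤ _ := by
          refine integral_mono (((integrable_const μ).indicator hAm).sub
            hSabs) (integrable_finsetSum _ fun i _ => hint i)
            fun ω => ?_
          have herase : ∀ i ∈ s, ∑ j ∈ s.erase i, X j ω = V ω - X i ω := fun i hi => by
            simp only [hV, ← Finset.add_sum_erase s (fun j => X j ω) hi]; ring
          by_cases hω : ω ∈ A
          · simp only [Set.indicator_of_mem hω]
            have h1 : ∑ j ∈ s, η j ω ≤
                ∑ i ∈ s, X i ω * (f (V ω) - f (∑ j ∈ s.erase i, X j ω)) := by
              refine Finset.sum_le_sum fun i hi => ?_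
              rw [herase i hi]
              exact clamp_sub_ge hγ hω.1 hω.2
            linarith [neg_abs_le ((∑ j ∈ s, η j ω) - μ)]
          · simp only [Set.indicator_of_notMem hω]
            have h1 : 0 ≤ ∑ i ∈ s, X i ω * (f (V ω) - f (∑ j ∈ s.erase i, X j ω)) := by
              refine Finset.sum_nonneg fun i hi => ?_
              rw [herase i hi]
              exact mul_clamp_sub_nonneg
            linarith [abs_nonneg ((∑ j ∈ s, η j ω) - μ)]
  have hP : 0 ≤ Pr.real A := measureReal_nonneg
  have : Pr.real A * (1 / 4) ≤ Pr.real A * μ := by gcongr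
  change Pr.real A ≤ _
  linarith

/-- By independence `Y` may be frozen at `y`, and the concentration hypothesis is then used with
radius `|y|`. -/
theorem integral_mul_ind_le {V Y : Ω → ℝ} (hV : Measurable V)
    (hY : Measurable Y) (hVY : IndepFun V Y Pr) {z K : ℝ}
    (hconc : ∀ t, 0 ≤ t → Pr.real {ω | |V ω - z| ≤ t} ≤ 4 * t + K) {g : ℝ → ℝ} (hg : Measurable g)
    (hg0 : ∀ y, 0 ≤ g y) (hgi : Integrable (fun ω => g (Y ω)) Pr)
    (hgi' : Integrable (fun ω => g (Y ω) * |Y ω|) Pr) :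
    ∫ ω, g (Y ω) * (if |V ω - z| ≤ |Y ω| then 1 else 0) ∂Pr ≤
      4 * ∫ ω, g (Y ω) * |Y ω| ∂Pr + K * ∫ ω, g (Y ω) ∂Pr := by
  have hlaw := (indepFun_iff_map_prod_eq_prod_map_map hV.aemeasurable hY.aemeasurable).1 hVY
  have := Measure.isProbabilityMeasure_map (μ := Pr) hV.aemeasurable
  have := Measure.isProbabilityMeasure_map (μ := Pr) hY.aemeasurable
  set F : ℝ × ℝ → ℝ := fun p => g p.2 * (if |p.1 - z| ≤ |p.2| then 1 else 0) with hF
  have hFm : Measurable F := by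
    refine (hg.comp measurable_snd).mul (Measurable.ite ?_ measurable_const measurable_const)
    exact measurableSet_le (by fun_prop) (by fun_prop)
  have hgY : Integrable g (Pr.map Y) :=
    (integrable_map_measure hg.aestronglyMeasurable hY.aemeasurable).2 hgi
  have hgY' : Integrable (fun y => g y * |y|) (Pr.map Y) :=
    (integrable_map_measure (hg.mul (by fun_prop)).aestronglyMeasurable hY.aemeasurable).2 hgi'
  have hFle : ∀ p, ‖F p‖ ≤ g p.2 := fun p => by
    simp only [hF, norm_mul, Real.norm_of_nonneg (hg0 p.2)]
    split_ifs <;> simp [hg0]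
  have hFi : Integrable F ((Pr.map V).prod (Pr.map Y)) :=
    (hgY.comp_snd _).mono' hFm.aestronglyMeasurable (.of_forall hFle)
  have e : ∫ ω, g (Y ω) * (if |V ω - z| ≤ |Y ω| then 1 else 0) ∂Pr =
      ∫ y, ∫ v, F (v, y) ∂(Pr.map V) ∂(Pr.map Y) := by
    rw [← integral_prod_symm _ hFi, ← hlaw, integral_map (hV.prodMk hY).aemeasurable
      hFm.aestronglyMeasurable]
  have hin : ∀ y, ∫ v, F (v, y) ∂(Pr.map V) ≤ 4 * (g y * |y|) + K * g y := fun y => by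
    simp only [hF]
    rw [integral_const_mul, integral_map hV.aemeasurable (Measurable.ite (measurableSet_le
      (by fun_prop) measurable_const) measurable_const measurable_const).aestronglyMeasurable]
    have hms : MeasurableSet {ω | |V ω - z| ≤ |y|} :=
      measurableSet_le (by fun_prop) measurable_const
    have : ∫ ω, (if |V ω - z| ≤ |y| then (1 : ℝ) else 0) ∂Pr = Pr.real {ω | |V ω - z| ≤ |y|} := by
      rw [← integral_indicator_one hms]
      rfl
    rw [this]
    have := mul_le_mul_of_nonneg_left (hconc |y| (abs_nonneg y)) (hg0 y)
    linarith
  rw [e]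
  calc _ ≤ ∫ y, (4 * (g y * |y|) + K * g y) ∂(Pr.map Y) :=
        integral_mono hFi.integral_prod_right ((hgY'.const_mul 4).add (hgY.const_mul K)) hin
    _ = _ := by
        rw [integral_add (hgY'.const_mul 4) (hgY.const_mul K), integral_const_mul,
          integral_const_mul, integral_map hY.aemeasurable hg.aestronglyMeasurable,
          integral_map hY.aemeasurable hgY'.aestronglyMeasurable]

/-- Lyapunov's inequality in tangent form: with `τ = 1/√n`, the difference `|x|³ - (3/2) τ x² +
τ³/2` equals `(|x| + τ/2)(|x| - τ)²`. -/
theorem one_div_sqrt_le (h : NormalizedArray X γ Pr) (hn : 0 < n) : 1 / √n ≤ γ := by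
  have hnR : (0 : ℝ) < n := by exact_mod_cast hn
  set τ : ℝ := 1 / √n with hτ
  have hτ0 : 0 < τ := by positivity
  have hτ2 : τ ^ 2 = 1 / n := by rw [hτ, div_pow, Real.sq_sqrt hnR.le, one_pow]
  have h1 : ∫ ω, (3 / 2 * τ * X ⟨0, hn⟩ ω ^ 2 - τ ^ 3 / 2) ∂Pr ≤ ∫ ω, |X ⟨0, hn⟩ ω| ^ 3 ∂Pr := by
    refine integral_mono (((h.integrable_sq _).const_mul _).sub (integrable_const _))
      (h.integrable_cube _) fun ω => ?_
    simp only
    rw [← sq_abs]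
    have h0 := abs_nonneg (X ⟨0, hn⟩ ω)
    nlinarith [mul_nonneg (add_nonneg h0 (by positivity : 0 ≤ τ / 2))
      (sq_nonneg (|X ⟨0, hn⟩ ω| - τ))]
  rw [integral_sub ((h.integrable_sq _).const_mul _) (integrable_const _), integral_const_mul,
    h.var] at h1
  have h2 := h1.trans (h.third _)
  simp only [integral_const, probReal_univ, one_smul] at h2
  rw [← hτ2, div_eq_mul_one_div γ, ← hτ2] at h2
  have h3 : τ * τ ^ 2 ≤ γ * τ ^ 2 := by nlinarith
  exact le_of_mul_le_mul_right h3 (by positivity)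

/-- The first moment is at most the root of the second, `1/√n`, which the third-moment constant
dominates. -/
theorem integral_abs_le (h : NormalizedArray X γ Pr) (hn : 0 < n) (i : Fin n) :
    ∫ ω, |X i ω| ∂Pr ≤ γ := by
  refine le_trans ?_ (h.one_div_sqrt_le hn)
  have hnR : (0 : ℝ) < n := by exact_mod_cast hn
  set τ : ℝ := 1 / √n with hτ
  have hτ0 : 0 < τ := by positivity
  have hτ2 : τ ^ 2 = 1 / n := by rw [hτ, div_pow, Real.sq_sqrt hnR.le, one_pow]
  calc ∫ ω, |X i ω| ∂Pr ≤ ∫ ω, (X i ω ^ 2 / τ + τ) / 2 ∂Pr := by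
        refine integral_mono (h.integrable i).abs
          ((((h.integrable_sq i).div_const τ).add (integrable_const τ)).div_const 2) fun ω => ?_
        simp only
        rw [le_div_iff₀ two_pos, ← sub_le_iff_le_add, le_div_iff₀ hτ0, ← sq_abs]
        nlinarith [sq_nonneg (|X i ω| - τ)]
    _ = τ := by
        rw [integral_div, integral_add ((h.integrable_sq i).div_const τ) (integrable_const τ),
          integral_div, h.var, ← hτ2]
        simp only [integral_const, probReal_univ, one_smul]
        field_simp; ring

/-- The Berry–Esseen theorem for normalized arrays. -/
theorem berry_esseen (h : NormalizedArray X γ Pr) (hn : 0 < n) (z : ℝ) :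
    |Pr.real {ω | ∑ i, X i ω ≤ z} - Phi z| ≤ 104 * γ := by
  have hγn := h.one_div_sqrt_le hn
  have hnR : (0 : ℝ) < n := by exact_mod_cast hn
  have hγ : 0 < γ := lt_of_lt_of_le (by positivity) hγn
  -- Concentration of a leave-one-out sum needs `n ≤ 2 (n - 1)`. For `n = 1` the constant `γ` is at
  -- least one and the claim is trivial.
  rcases Nat.lt_or_ge n 2 with hn2 | hn2
  · obtain rfl : n = 1 := by omega
    have h1 : Pr.real {ω | ∑ i, X i ω ≤ z} ≤ 1 := measureReal_le_one
    have h2 : 0 ≤ Pr.real {ω | ∑ i, X i ω ≤ z} := measureReal_nonneg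
    have h3 := Phi_nonneg z
    have h4 := Phi_le_one z
    simp only [Nat.cast_one, Real.sqrt_one, div_one] at hγn
    rw [abs_le]; constructor <;> linarith
  set W : Ω → ℝ := fun ω => ∑ i, X i ω with hW
  set V : Fin n → Ω → ℝ := fun i ω => ∑ j ∈ Finset.univ.erase i, X j ω with hV
  have hWV : ∀ i ω, W ω = V i ω + X i ω := fun i ω => by
    simp only [hW, hV, ← Finset.add_sum_erase Finset.univ (fun j => X j ω) (Finset.mem_univ i)]
    ring
  have hWm : Measurable W := h.measurable_sum _
  have hVm : ∀ i, Measurable (V i) := fun i => h.measurable_sum _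
  have hVX : ∀ i, IndepFun (V i) (X i) Pr := fun i => h.indep_sum (Finset.notMem_erase i _)
  set f : ℝ → ℝ := stein z with hf
  set f' : ℝ → ℝ := steinDeriv z with hf'
  have hfm : Measurable f := (continuous_stein z).measurable
  have hfm' : Measurable f' := measurable_steinDeriv z
  have hf'i : ∀ {U : Ω → ℝ}, Measurable U → Integrable (fun ω => f' (U ω)) Pr := fun {U} hU =>
    Integrable.of_bound (hfm'.comp hU).aestronglyMeasurable 2
      (.of_forall fun ω => abs_steinDeriv_le z _)
  have hconc : ∀ i t, 0 ≤ t → Pr.real {ω | |V i ω - z| ≤ t} ≤ 4 * t + 8 * γ := fun i t ht => by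
    have hcard : n ≤ 2 * (Finset.univ.erase i : Finset (Fin n)).card := by
      rw [Finset.card_erase_of_mem (Finset.mem_univ i), Finset.card_univ, Fintype.card_fin]
      omega
    have := h.concentration hγ hn hcard (a := z - t) (b := z + t) (by linarith)
    have e : {ω | |V i ω - z| ≤ t} = {ω | z - t ≤ V i ω ∧ V i ω ≤ z + t} := by
      ext ω
      simp only [Set.mem_ofPred_eq, abs_le]
      constructor <;> rintro ⟨h1, h2⟩ <;> constructor <;> linarith
    rw [e]
    linarith
  -- the Stein identity
  have hid : Pr.real {ω | W ω ≤ z} - Phi z =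
      ∑ i, (1 / n * ∫ ω, (f' (W ω) - f' (V i ω)) ∂Pr -
        ∫ ω, (X i ω * (f (W ω) - f (V i ω)) - X i ω ^ 2 * f' (V i ω)) ∂Pr) := by
    have hms : MeasurableSet {ω | W ω ≤ z} := measurableSet_le hWm measurable_const
    have hWfi : Integrable (fun ω => W ω * f (W ω)) Pr :=
      (h.integrable_sum _).mul_bdd (c := 2) (hfm.comp hWm).aestronglyMeasurable
        (.of_forall fun ω => abs_stein_le z _)
    have e1 : Pr.real {ω | W ω ≤ z} - Phi z =
        (∫ ω, f' (W ω) ∂Pr) - ∫ ω, W ω * f (W ω) ∂Pr := by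
      rw [← integral_sub (hf'i hWm) hWfi]
      have : ∀ ω, f' (W ω) - W ω * f (W ω) =
          {ω | W ω ≤ z}.indicator (fun _ => (1 : ℝ)) ω - Phi z := fun ω => by
        simp only [hf', hf, steinDeriv, Set.indicator_apply, Set.mem_ofPred_eq]
        ring
      simp_rw [this]
      rw [integral_sub ((integrable_const (1 : ℝ)).indicator hms) (integrable_const _),
        integral_indicator_const _ hms]
      simp
    have e2 : ∫ ω, W ω * f (W ω) ∂Pr = ∑ i, ∫ ω, X i ω * (f (W ω) - f (V i ω)) ∂Pr :=
      h.integral_sum_mul Finset.univ hfm (abs_stein_le z)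
    have e3 : ∫ ω, f' (W ω) ∂Pr = ∑ _i : Fin n, 1 / n * ∫ ω, f' (W ω) ∂Pr := by
      rw [Finset.sum_const, Finset.card_univ, Fintype.card_fin, nsmul_eq_mul]
      field_simp
    rw [e1, e2, e3, ← Finset.sum_sub_distrib]
    refine Finset.sum_congr rfl fun i _ => ?_
    have i1 : Integrable (fun ω => X i ω * (f (W ω) - f (V i ω))) Pr :=
      (h.integrable i).mul_bdd (c := 4) ((hfm.comp hWm).sub (hfm.comp (hVm i))).aestronglyMeasurable
        (.of_forall fun ω => by
          rw [Real.norm_eq_abs]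
          have h1 := abs_stein_le z (W ω)
          have h2 := abs_stein_le z (V i ω)
          have := abs_sub (f (W ω)) (f (V i ω))
          linarith)
    have i2 : Integrable (fun ω => X i ω ^ 2 * f' (V i ω)) Pr :=
      (h.integrable_sq i).mul_bdd (c := 2) (hfm'.comp (hVm i)).aestronglyMeasurable
        (.of_forall fun ω => abs_steinDeriv_le z _)
    have hind : IndepFun (fun ω => X i ω ^ 2) (fun ω => f' (V i ω)) Pr :=
      (hVX i).symm.comp (φ := fun x => x ^ 2) (by fun_prop) hfm'
    rw [integral_sub (hf'i hWm) (hf'i (hVm i)), integral_sub i1 i2,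
      hind.integral_fun_mul_eq_mul_integral ((h.meas i).pow_const 2).aestronglyMeasurable
        (hfm'.comp (hVm i)).aestronglyMeasurable, h.var]
    ring
  have hVi : ∀ i, Integrable (V i) Pr := fun i => h.integrable_sum _
  have hV1 : ∀ i, ∫ ω, (|V i ω| + 1) ∂Pr ≤ 2 := fun i => by
    rw [integral_add (hVi i).abs (integrable_const _)]
    have := h.integral_abs_sum_le (Finset.univ.erase i)
    simp only [integral_const, probReal_univ, one_smul]
    linarith
  -- a generic bound for `g(X) (2 (|V| + 1) |X| + 4 · 1{|V - z| ≤ |X|})`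
  have hgen : ∀ i (g : ℝ → ℝ), Measurable g → (∀ y, 0 ≤ g y) →
      Integrable (fun ω => g (X i ω)) Pr → Integrable (fun ω => g (X i ω) * |X i ω|) Pr →
      Integrable (fun ω => g (X i ω) * (2 * (|V i ω| + 1) * |X i ω| +
        4 * (if |V i ω - z| ≤ |X i ω| then 1 else 0))) Pr ∧
      ∫ ω, g (X i ω) * (2 * (|V i ω| + 1) * |X i ω| +
        4 * (if |V i ω - z| ≤ |X i ω| then 1 else 0)) ∂Pr ≤
      20 * (∫ ω, g (X i ω) * |X i ω| ∂Pr) + 32 * γ * ∫ ω, g (X i ω) ∂Pr := by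
    intro i g hg hg0 hgi hgi'
    have hind : IndepFun (fun ω => g (X i ω) * |X i ω|) (fun ω => |V i ω| + 1) Pr :=
      (hVX i).symm.comp (φ := fun x => g x * |x|) (ψ := fun v => |v| + 1)
        (hg.mul (by fun_prop)) (by fun_prop)
    have hXm := h.meas i
    have hVmi := hVm i
    have i1 : Integrable (fun ω => (g (X i ω) * |X i ω|) * (|V i ω| + 1)) Pr :=
      hind.integrable_mul hgi' ((hVi i).abs.add (integrable_const 1))
    have i2 : Integrable (fun ω => g (X i ω) * (if |V i ω - z| ≤ |X i ω| then (1 : ℝ) else 0)) Pr :=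
      hgi.mul_bdd (c := 1) (Measurable.ite (measurableSet_le (by fun_prop) (by fun_prop))
        measurable_const measurable_const).aestronglyMeasurable
        (.of_forall fun ω => by split_ifs <;> simp)
    have e : (fun ω => g (X i ω) * (2 * (|V i ω| + 1) * |X i ω| +
        4 * (if |V i ω - z| ≤ |X i ω| then 1 else 0))) = fun ω =>
        2 * ((g (X i ω) * |X i ω|) * (|V i ω| + 1)) +
          4 * (g (X i ω) * (if |V i ω - z| ≤ |X i ω| then (1 : ℝ) else 0)) := by
      funext ω; ring
    rw [e]
    refine ⟨(i1.const_mul 2).add (i2.const_mul 4), ?_⟩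
    rw [integral_add (i1.const_mul 2) (i2.const_mul 4), integral_const_mul, integral_const_mul,
      hind.integral_fun_mul_eq_mul_integral hgi'.aestronglyMeasurable
        ((hVi i).abs.add (integrable_const 1)).aestronglyMeasurable]
    -- The smooth part contributes 4, since `E(|V| + 1) ≤ 2`; four times the concentration bound `4
    -- t + 8 γ` contributes 16 and `32 γ`.
    have h1 := integral_mul_ind_le hVmi hXm (hVX i) (hconc i) hg hg0 hgi hgi'
    have h2 : 0 ≤ ∫ ω, g (X i ω) * |X i ω| ∂Pr :=
      integral_nonneg fun ω => mul_nonneg (hg0 _) (abs_nonneg _)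
    have h3 := mul_le_mul_of_nonneg_left (hV1 i) h2
    linarith
  have hcubeE : ∀ i, (fun ω => X i ω ^ 2 * |X i ω|) = fun ω => |X i ω| ^ 3 := fun i => by
    funext ω; rw [← sq_abs]; ring
  have hterm : ∀ i, |1 / n * ∫ ω, (f' (W ω) - f' (V i ω)) ∂Pr -
      ∫ ω, (X i ω * (f (W ω) - f (V i ω)) - X i ω ^ 2 * f' (V i ω)) ∂Pr| ≤ 104 * γ / n := by
    intro i
    -- The weight 1 controls the increment of the Stein derivative and the weight `x²` the Taylor
    -- remainder; each yields `52 γ / n`.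
    obtain ⟨j1, k1⟩ := hgen i (fun _ => 1) measurable_const (fun _ => zero_le_one)
      (integrable_const _) (by simpa using (h.integrable i).abs)
    obtain ⟨j2, k2⟩ := hgen i (fun x => x ^ 2) (by fun_prop) (fun _ => sq_nonneg _)
      (h.integrable_sq i) (by simp only [hcubeE i]; exact h.integrable_cube i)
    simp only [hcubeE i, one_mul, h.var, integral_const, probReal_univ, one_smul] at k1 k2 j1
    have b1 : |∫ ω, (f' (W ω) - f' (V i ω)) ∂Pr| ≤ 52 * γ := by
      have := norm_integral_le_of_norm_le (f := fun ω => f' (W ω) - f' (V i ω)) j1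
        (.of_forall fun ω => by
          rw [Real.norm_eq_abs, hWV i]; exact steinDeriv_sub_le z (V i ω) (X i ω))
      rw [Real.norm_eq_abs] at this
      linarith [h.integral_abs_le hn i]
    have b2 : |∫ ω, (X i ω * (f (W ω) - f (V i ω)) - X i ω ^ 2 * f' (V i ω)) ∂Pr| ≤
        52 * γ / n := by
      have := norm_integral_le_of_norm_le
        (f := fun ω => X i ω * (f (W ω) - f (V i ω)) - X i ω ^ 2 * f' (V i ω)) j2
        (.of_forall fun ω => by
          have := stein_taylor z (V i ω) (X i ω)
          rw [hWV i, Real.norm_eq_abs, show X i ω * (f (V i ω + X i ω) - f (V i ω)) -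
            X i ω ^ 2 * f' (V i ω) = X i ω * (f (V i ω + X i ω) - f (V i ω) -
            X i ω * f' (V i ω)) by ring, abs_mul, ← sq_abs, sq, mul_assoc]
          exact mul_le_mul_of_nonneg_left this (abs_nonneg _))
      rw [Real.norm_eq_abs] at this
      have h3 := h.third i
      have e : 52 * γ / n = 20 * (γ / n) + 32 * γ * (1 / n) := by ring
      rw [e]
      linarith
    refine (abs_sub _ _).trans ?_
    rw [abs_mul, abs_of_pos (by positivity : (0 : ℝ) < 1 / n)]
    have := mul_le_mul_of_nonneg_left b1 (by positivity : (0 : ℝ) ≤ 1 / n)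
    have e : 104 * γ / n = 1 / n * (52 * γ) + 52 * γ / n := by ring
    rw [e]
    linarith
  rw [hid]
  calc _ ≤ ∑ i : Fin n, 104 * γ / n :=
        (Finset.abs_sum_le_sum_abs _ _).trans (Finset.sum_le_sum fun i _ => hterm i)
    _ = 104 * γ := by
        rw [Finset.sum_const, Finset.card_univ, Fintype.card_fin, nsmul_eq_mul]
        field_simp

end NormalizedArray

end PairwiseBE

/-! ### Kolmogorov distance -/

namespace PairwiseBE

theorem kolmDist_le {Ω : Type*} [MeasurableSpace Ω] {Pr : Measure Ω} {S : Ω → ℝ} {b : ℝ}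
    (h : ∀ t, |Pr.real {ω | S ω ≤ t} - Phi t| ≤ b) : kolmDist Pr S ≤ b :=
  ciSup_le h

theorem kolmDist_le_one {Ω : Type*} [MeasurableSpace Ω] {Pr : Measure Ω} [IsProbabilityMeasure Pr]
    (S : Ω → ℝ) : kolmDist Pr S ≤ 1 :=
  kolmDist_le fun t => by
    have h1 : Pr.real {ω | S ω ≤ t} ≤ 1 := measureReal_le_one
    have h2 : 0 ≤ Pr.real {ω | S ω ≤ t} := measureReal_nonneg
    have h3 := Phi_nonneg t
    have h4 := Phi_le_one t
    rw [abs_le]; constructor <;> linarith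

theorem Phi_add_sub_le (t : ℝ) {ρ : ℝ} (hρ : 0 ≤ ρ) : Phi (t + ρ) - Phi t ≤ ρ / √(2 * Real.pi) := by
  have := (convex_univ).norm_image_sub_le_of_norm_hasDerivWithin_le (f := Phi)
    (fun x _ => (hasDerivAt_Phi x).hasDerivWithinAt) (fun x _ => by
      rw [Real.norm_of_nonneg (phi_pos x).le]; exact phi_le x) (Set.mem_univ t)
      (Set.mem_univ (t + ρ))
  rw [add_sub_cancel_left, Real.norm_of_nonneg hρ] at this
  calc _ ≤ _ := Real.le_norm_self _
    _ ≤ _ := this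
    _ = _ := by ring

theorem abs_Phi_sub_le (s t : ℝ) : |Phi s - Phi t| ≤ |s - t| := by
  have hpi : 1 ≤ √(2 * Real.pi) := by
    rw [Real.one_le_sqrt]; nlinarith [Real.pi_gt_three]
  have key : ∀ s t : ℝ, t ≤ s → |Phi s - Phi t| ≤ |s - t| := fun s t hst => by
    have h1 := Phi_add_sub_le t (sub_nonneg.2 hst)
    rw [add_sub_cancel] at h1
    rw [abs_of_nonneg (sub_nonneg.2 (monotone_Phi hst)), abs_of_nonneg (sub_nonneg.2 hst)]
    exact h1.trans (div_le_self (sub_nonneg.2 hst) hpi)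
  rcases le_total t s with h | h
  · exact key s t h
  · rw [abs_sub_comm, abs_sub_comm s]; exact key t s h

/-- Adding a remainder to an approximately normal variable. -/
theorem kolmDist_add_le {Ω : Type*} [MeasurableSpace Ω] {Pr : Measure Ω} [IsProbabilityMeasure Pr]
    {S L R : Ω → ℝ} {b ρ : ℝ} (hρ : 0 ≤ ρ) (hS : ∀ ω, S ω = L ω + R ω)
    (hL : ∀ t, |Pr.real {ω | L ω ≤ t} - Phi t| ≤ b) :
    kolmDist Pr S ≤ b + ρ / √(2 * Real.pi) + Pr.real {ω | ρ < |R ω|} := by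
  refine kolmDist_le fun t => ?_
  have h1 : Pr.real {ω | S ω ≤ t} ≤ Pr.real {ω | L ω ≤ t + ρ} + Pr.real {ω | ρ < |R ω|} := by
    refine (measureReal_mono (fun ω hω => ?_)).trans (measureReal_union_le _ _)
    by_cases hr : ρ < |R ω|
    · exact Or.inr hr
    · left
      have hω' : S ω ≤ t := hω
      rw [hS] at hω'
      change L ω ≤ t + ρ
      linarith [neg_abs_le (R ω)]
  have h2 : Pr.real {ω | L ω ≤ t - ρ} ≤ Pr.real {ω | S ω ≤ t} + Pr.real {ω | ρ < |R ω|} := by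
    refine (measureReal_mono (fun ω hω => ?_)).trans (measureReal_union_le _ _)
    by_cases hr : ρ < |R ω|
    · exact Or.inr hr
    · left
      have hω' : L ω ≤ t - ρ := hω
      change S ω ≤ t
      rw [hS]
      linarith [le_abs_self (R ω)]
  have h3 := abs_le.1 (hL (t + ρ))
  have h4 := abs_le.1 (hL (t - ρ))
  have h5 := Phi_add_sub_le t hρ
  have h6 := Phi_add_sub_le (t - ρ) hρ
  rw [sub_add_cancel] at h6
  rw [abs_le]; constructor <;> linarith

namespace IsIID

variable {Ω 𝒵 : Type*} [MeasurableSpace Ω] [MeasurableSpace 𝒵] {n : ℕ} {Z : Fin n → Ω → 𝒵}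
  {ν : Measure 𝒵} {Pr : Measure Ω} [IsProbabilityMeasure Pr]

/-- The Berry–Esseen theorem for i.i.d. samples. -/
theorem berry_esseen (hZ : IsIID Z ν Pr) (hn : 0 < n) {f : 𝒵 → ℝ} (hf : Measurable f) {μ v ρ : ℝ}
    (hv : 0 < v) (hmean : ∫ z, (f z - μ) ∂ν = 0) (hvar : ∫ z, (f z - μ) ^ 2 ∂ν = v ^ 2)
    (hint : Integrable (fun z => |f z - μ| ^ 3) ν) (hthird : ∫ z, |f z - μ| ^ 3 ∂ν ≤ ρ) (t : ℝ) :
    |Pr.real {ω | (∑ i, (f (Z i ω) - μ)) / (√n * v) ≤ t} - Phi t| ≤ 104 * (ρ / (√n * v ^ 3)) := by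
  have hnR : (0 : ℝ) < n := by exact_mod_cast hn
  have hsn : 0 < √(n : ℝ) := Real.sqrt_pos.2 hnR
  have hc : 0 < √(n : ℝ) * v := by positivity
  have hfm : Measurable fun z => (f z - μ) / (√n * v) := (hf.sub_const μ).div_const _
  have hI : ∀ (g : 𝒵 → ℝ), AEStronglyMeasurable g ν → ∀ i, ∫ ω, g (Z i ω) ∂Pr = ∫ z, g z ∂ν :=
    fun g hg i => by
      rw [← hZ.law_eq i] at hg ⊢
      exact (integral_map (hZ.measurable i).aemeasurable hg).symm
  have harr : NormalizedArray (fun i ω => (f (Z i ω) - μ) / (√n * v)) (ρ / (√n * v ^ 3)) Pr := by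
    refine ⟨fun i => hfm.comp (hZ.measurable i), hZ.indep.comp _ fun _ => hfm, fun i => ?_,
      fun i => ?_, fun i => ?_, fun i => ?_⟩
    · simp only [abs_div, div_pow]
      refine Integrable.div_const ?_ _
      rw [← hZ.law_eq i] at hint
      exact hint.comp_measurable (hZ.measurable i)
    · rw [hI _ hfm.aestronglyMeasurable, integral_div, hmean, zero_div]
    · rw [hI _ (hfm.pow_const 2).aestronglyMeasurable]
      simp only [div_pow]
      rw [integral_div, hvar, mul_pow, Real.sq_sqrt hnR.le]
      field_simp
    · rw [hI _ (hfm.abs.pow_const 3).aestronglyMeasurable]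
      simp only [abs_div, div_pow]
      rw [integral_div, abs_of_pos hc]
      have e : ρ / (√n * v ^ 3) / n = ρ / (√n * v) ^ 3 := by
        have : √(n : ℝ) ^ 2 = n := Real.sq_sqrt hnR.le
        rw [div_div, mul_pow, pow_succ (√(n : ℝ)) 2, this]
        ring_nf
      rw [e]
      gcongr
  have := harr.berry_esseen hn t
  simp only [← Finset.sum_div] at this
  exact this

end IsIID

theorem standardized_eq {Ω 𝒵 : Type*} {n : ℕ} (Z : Fin n → Ω → 𝒵) (f : 𝒵 → ℝ) (est : Ω → ℝ)
    (ψ v : ℝ) (hn : 0 < n) (ω : Ω) :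
    standardized n est ψ v ω = leadingSum Z f v ω + stdRemainder Z f est ψ v ω := by
  have hnR : (0 : ℝ) < n := by exact_mod_cast hn
  have hsn : √(n : ℝ) ≠ 0 := (Real.sqrt_pos.2 hnR).ne'
  have h2 : √(n : ℝ) * √n = n := Real.mul_self_sqrt hnR.le
  rw [standardized, leadingSum, stdRemainder]
  -- For `v = 0` all three quotients are zero by convention.
  rcases eq_or_ne v 0 with rfl | hv
  · simp
  · rw [show (∑ i, f (Z i ω)) / (n : ℝ) = (∑ i, f (Z i ω)) / (√n * √n) by rw [h2]]
    field_simp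
    ring

/-! ### Single-index models -/

namespace SingleIndexModel

variable {𝒴 : Type*} [MeasurableSpace 𝒴] (M : SingleIndexModel 𝒴)

theorem obs_apply (η : ℝ) :
    M.obs η = M.base.withDensity fun y => ENNReal.ofReal (Real.exp (M.logLik y η)) := by
  have := M.sFinite
  rw [obs, Kernel.withDensity_apply _ _ η, Kernel.const_apply]
  exact ENNReal.measurable_ofReal.comp
    (Real.measurable_exp.comp (M.measurable_logLik.comp measurable_swap))

instance : IsMarkovKernel M.obs :=
  ⟨fun η => ⟨by rw [obs_apply, withDensity_apply _ MeasurableSet.univ, Measure.restrict_univ,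
    M.normalized]⟩⟩

theorem integral_score (η : ℝ) : ∫ y, M.score y η ∂(M.obs η) = 0 := by
  rw [obs_apply]; exact M.score_centered η

/-- Joint measurability: the derivative is the pointwise limit of difference quotients with step
`1/(k+1)`. -/
theorem measurable_score : Measurable fun p : 𝒴 × ℝ => M.score p.1 p.2 := by
  have hlim : ∀ p : 𝒴 × ℝ, Filter.Tendsto (fun k : ℕ => ((1 : ℝ) / (k + 1))⁻¹ *
      (M.logLik p.1 (p.2 + 1 / (k + 1)) - M.logLik p.1 p.2)) Filter.atTop
      (nhds (M.score p.1 p.2)) := fun p => by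
    have h := hasDerivAt_iff_tendsto_slope_zero.1 (M.differentiable p.1 p.2).hasDerivAt
    refine h.comp (tendsto_nhdsWithin_iff.2 ⟨tendsto_one_div_add_atTop_nhds_zero_nat, ?_⟩)
    exact Filter.Eventually.of_forall fun k => by
      simp only [Set.mem_compl_iff, Set.mem_singleton_iff]; positivity
  refine measurable_of_tendsto_metrizable (fun k => ?_) (tendsto_pi_nhds.2 hlim)
  refine measurable_const.mul (Measurable.sub ?_ M.measurable_logLik)
  exact M.measurable_logLik.comp (measurable_fst.prodMk (measurable_snd.add_const _))

theorem measurable_fisher : Measurable M.fisher := by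
  have := (StronglyMeasurable.integral_kernel_prod_right (κ := M.obs)
    (f := fun η y => M.score y η ^ 2)
    ((M.measurable_score.comp measurable_swap).pow_const 2).stronglyMeasurable)
  exact this.measurable

theorem measurable_whitenedScore : Measurable fun p : 𝒴 × ℝ => M.whitenedScore p.1 p.2 :=
  M.measurable_score.div (M.measurable_fisher.comp measurable_snd)

theorem integral_whitenedScore (η : ℝ) : ∫ y, M.whitenedScore y η ∂(M.obs η) = 0 := by
  simp only [whitenedScore]
  rw [integral_div, integral_score, zero_div]

theorem integral_whitenedScore_sq {η : ℝ} (h : M.fisher η ≠ 0) :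
    ∫ y, M.whitenedScore y η ^ 2 ∂(M.obs η) = 1 / M.fisher η := by
  simp only [whitenedScore, div_pow]
  rw [integral_div, ← fisher]
  field_simp

variable {m : ℕ} {d : Fin (m + 1) → ℕ}

instance (𝒟 : Measure (Tensor d)) [IsProbabilityMeasure 𝒟] (T : Tensor d) :
    IsProbabilityMeasure (M.law 𝒟 T) := by
  unfold law; infer_instance

/-- A tangent direction only sees the tangential part of the design point. This is where the
projection bound replaces the much larger norm of `x`. -/
theorem abs_inner_le_of_proj {𝕋 : Submodule ℝ (Tensor d)} {H : Tensor d} (hH : H ∈ 𝕋)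
    (x : Tensor d) : |inner ℝ H x| ≤ ‖H‖ * ‖𝕋.starProjection x‖ := by
  rw [← Submodule.starProjection_eq_self_iff.2 hH, Submodule.inner_starProjection_left_eq_right,
    Submodule.starProjection_eq_self_iff.2 hH]
  exact abs_real_inner_le_norm _ _

/-- Moments of an influence function `g(Y, η) ⟨H, X⟩` with `H` in the signal tangent space. -/
theorem influence_moments {g : 𝒴 → ℝ → ℝ} (hg : Measurable fun p : 𝒴 × ℝ => g p.1 p.2)
    {𝒟 : Measure (Tensor d)} [IsProbabilityMeasure 𝒟] {T H : Tensor d} {M₃ lam b s : ℝ}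
    (h3 : ThirdMomentLE M g 𝒟 T M₃) (h1 : ∀ η, ∫ y, g y η ∂(M.obs η) = 0)
    (h2 : ∀ᵐ x ∂𝒟, lam ≤ ∫ y, g y (inner ℝ T x) ^ 2 ∂(M.obs (inner ℝ T x)))
    (hb : ∀ᵐ x ∂𝒟, |inner ℝ H x| ≤ b) (hs : ∫ x, inner ℝ H x ^ 2 ∂𝒟 = s) :
    Integrable (fun z => |g z.2 (inner ℝ T z.1) * inner ℝ H z.1| ^ 3) (M.law 𝒟 T) ∧
    ∫ z, g z.2 (inner ℝ T z.1) * inner ℝ H z.1 ∂(M.law 𝒟 T) = 0 ∧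
    lam * s ≤ ∫ z, (g z.2 (inner ℝ T z.1) * inner ℝ H z.1) ^ 2 ∂(M.law 𝒟 T) ∧
    ∫ z, |g z.2 (inner ℝ T z.1) * inner ℝ H z.1| ^ 3 ∂(M.law 𝒟 T) ≤ M₃ * b * s := by
  set φ : Tensor d × 𝒴 → ℝ := fun z => g z.2 (inner ℝ T z.1) * inner ℝ H z.1 with hφ
  have hφm : Measurable φ :=
    (hg.comp (measurable_snd.prodMk (by fun_prop))).mul (by fun_prop)
  set κ : Kernel (Tensor d) 𝒴 := M.obs.comap (fun x => inner ℝ T x) (by fun_prop) with hκ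
  have hκa : ∀ x, κ x = M.obs (inner ℝ T x) := fun x => Kernel.comap_apply _ _ _
  have hHm : Measurable fun x : Tensor d => (inner ℝ H x : ℝ) := by fun_prop
  have hHi : ∀ k, Integrable (fun x => |inner ℝ H x| ^ k) 𝒟 := fun k =>
    Integrable.of_bound (hHm.abs.pow_const k).aestronglyMeasurable (b ^ k) (by
      filter_upwards [hb] with x hx
      rw [Real.norm_of_nonneg (by positivity)]
      gcongr)
  have habs : ∀ k x, ∫ y, |φ (x, y)| ^ k ∂κ x =
      |inner ℝ H x| ^ k * ∫ y, |g y (inner ℝ T x)| ^ k ∂(M.obs (inner ℝ T x)) := fun k x => by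
    simp only [hφ, abs_mul, mul_pow]
    rw [integral_mul_const, hκa, mul_comm]
  have hgk : ∀ k, Measurable fun x => ∫ y, |φ (x, y)| ^ k ∂κ x := fun k =>
    (StronglyMeasurable.integral_kernel_prod_right (κ := κ) (f := fun x y => |φ (x, y)| ^ k)
      (hφm.abs.pow_const k).stronglyMeasurable).measurable
  have hle : ∀ᵐ x ∂𝒟, ∫ y, |φ (x, y)| ^ 3 ∂κ x ≤ M₃ * |inner ℝ H x| ^ 3 := by
    filter_upwards [h3] with x hx
    rw [habs, mul_comm]
    gcongr
    exact hx.2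
  have hint : Integrable (fun z => |φ z| ^ 3) (𝒟 ⊗ₘ κ) := by
    rw [Measure.integrable_compProd_iff (hφm.abs.pow_const 3).aestronglyMeasurable]
    constructor
    · filter_upwards [h3] with x hx
      simp only [hφ, abs_mul, mul_pow]
      rw [hκa]
      exact hx.1.mul_const _
    · have e : ∀ x y, ‖|φ (x, y)| ^ 3‖ = |φ (x, y)| ^ 3 := fun x y =>
        Real.norm_of_nonneg (by positivity)
      simp only [e]
      refine ((hHi 3).const_mul M₃).mono' (hgk 3).aestronglyMeasurable ?_
      filter_upwards [hle] with x hx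
      rwa [Real.norm_of_nonneg (integral_nonneg fun y => by positivity)]
  -- All lower powers are dominated by `|φ|³ + 1`, so the third moment is the only integrability to
  -- establish.
  have hdom : ∀ k, k ≤ 3 → Integrable (fun z => |φ z| ^ k) (𝒟 ⊗ₘ κ) := fun k hk => by
    refine (hint.add (integrable_const (1 : ℝ))).mono' (hφm.abs.pow_const k).aestronglyMeasurable
      (.of_forall fun z => ?_)
    rw [Real.norm_of_nonneg (by positivity), Pi.add_apply]
    rcases le_total 1 |φ z| with h | h
    · linarith [pow_le_pow_right₀ h hk]
    · have := pow_le_one₀ (n := k) (abs_nonneg (φ z)) h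
      have : 0 ≤ |φ z| ^ 3 := by positivity
      linarith
  have hφi : Integrable φ (𝒟 ⊗ₘ κ) := by
    have := hdom 1 (by norm_num)
    simp only [pow_one] at this
    exact (integrable_norm_iff hφm.aestronglyMeasurable).1 this
  have hφ2 : Integrable (fun z => φ z ^ 2) (𝒟 ⊗ₘ κ) := by
    simpa only [sq_abs] using hdom 2 (by norm_num)
  have hlaw : M.law 𝒟 T = 𝒟 ⊗ₘ κ := rfl
  have hs' : ∫ x, |inner ℝ H x| ^ 2 ∂𝒟 = s := by simpa only [sq_abs] using hs
  rw [hlaw]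
  refine ⟨hint, ?_, ?_, ?_⟩
  · rw [Measure.integral_compProd hφi]
    have : ∀ x, ∫ y, φ (x, y) ∂κ x = 0 := fun x => by
      simp only [hφ]
      rw [integral_mul_const, hκa, h1, zero_mul]
    simp [this]
  · rw [Measure.integral_compProd hφ2, ← hs', ← integral_const_mul]
    have hi := ((Measure.integrable_compProd_iff (hφm.pow_const 2).aestronglyMeasurable).1 hφ2).2
    have e : ∀ x y, ‖φ (x, y) ^ 2‖ = |φ (x, y)| ^ 2 := fun x y => by
      rw [Real.norm_of_nonneg (by positivity), sq_abs]
    simp only [e] at hi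
    have e' : ∀ x, ∫ y, φ (x, y) ^ 2 ∂κ x = ∫ y, |φ (x, y)| ^ 2 ∂κ x := fun x => by
      simp only [sq_abs]
    simp only [e']
    refine integral_mono_ae ((hHi 2).const_mul lam) hi ?_
    filter_upwards [h2] with x hx
    rw [habs, mul_comm]
    simp only [sq_abs]
    gcongr
  · rw [Measure.integral_compProd hint]
    -- `M₃` bounds a nonnegative integral at some design point.
    have hM : 0 ≤ M₃ := by
      obtain ⟨x, hx⟩ := h3.exists
      exact (integral_nonneg fun y => by positivity).trans hx.2
    -- One factor `|⟨H, x⟩|` of the cube is bounded by `b`; the other two form the second moment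
    -- `s`.
    calc ∫ x, ∫ y, |φ (x, y)| ^ 3 ∂κ x ∂𝒟 ≤ ∫ x, M₃ * b * |inner ℝ H x| ^ 2 ∂𝒟 := by
          refine integral_mono_of_nonneg (.of_forall fun x => integral_nonneg fun y => by
            positivity) ((hHi 2).const_mul _) ?_
          filter_upwards [hle, hb] with x hx hbx
          refine hx.trans ?_
          have := mul_le_mul_of_nonneg_left hbx (mul_nonneg hM (sq_nonneg |inner ℝ H x|))
          calc _ = M₃ * |inner ℝ H x| ^ 2 * |inner ℝ H x| := by ring
            _ ≤ _ := this
            _ = _ := by ring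
      _ = _ := by rw [integral_const_mul, hs']

/-- Normal approximation of the leading term, and of every statistic with a small remainder. -/
theorem leading_term {r : Fin (m + 1) → ℕ} {q : ℕ} {𝒞 : Tensor d →ₗ[ℝ] (Fin q → ℝ)}
    {P : TuckerPoint d r} {g : 𝒴 → ℝ → ℝ} (hg : Measurable fun p : 𝒴 × ℝ => g p.1 p.2)
    {𝒟 : Measure (Tensor d)} [IsProbabilityMeasure 𝒟] {H : Tensor d}
    {δ cI CI Cproj M₃ lam : ℝ} (hreg : RegularDesign M 𝒟 P 𝒞 δ cI CI Cproj)
    (h3 : ThirdMomentLE M g 𝒟 P.tensor M₃) (h1 : ∀ η, ∫ y, g y η ∂(M.obs η) = 0) (hlam : 0 < lam)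
    (h2 : ∀ᵐ x ∂𝒟, lam ≤ ∫ y, g y (inner ℝ P.tensor x) ^ 2 ∂(M.obs (inner ℝ P.tensor x)))
    (hH : H ∈ P.signalTangent (LinearMap.ker 𝒞)) (hH0 : H ≠ 0) {n : ℕ} {Ω : Type*}
    [MeasurableSpace Ω] {Pr : Measure Ω} [IsProbabilityMeasure Pr] {Z : Fin n → Ω → Tensor d × 𝒴}
    (hn : 1 ≤ n) (hZ : IsIID Z (M.law 𝒟 P.tensor) Pr) {φ : Tensor d × 𝒴 → ℝ}
    (hφ : φ = fun z => g z.2 (inner ℝ P.tensor z.1) * inner ℝ H z.1) (ψ : ℝ) :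
    kolmDist Pr (leadingSum Z φ (sd φ (M.law 𝒟 P.tensor))) ≤
        (104 * (|M₃| * |Cproj| / √lam ^ 3) + 1) * √((dbar d : ℝ) / n) ∧
    ∀ (est : Ω → ℝ) (ρ : ℝ), 0 < ρ →
      kolmDist Pr (standardized n est ψ (sd φ (M.law 𝒟 P.tensor))) ≤
        (104 * (|M₃| * |Cproj| / √lam ^ 3) + 1) * √((dbar d : ℝ) / n) + ρ / √(2 * Real.pi) +
          Pr.real {ω | ρ < |stdRemainder Z φ est ψ (sd φ (M.law 𝒟 P.tensor)) ω|} := by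
  have hδ := hreg.effDim_pos
  have hiso := hreg.isotropic H hH
  have hb : ∀ᵐ x ∂𝒟, |inner ℝ H x| ≤ ‖H‖ * (|Cproj| * √((dbar d : ℝ) / δ)) := by
    filter_upwards [hreg.proj_bound] with x hx
    refine (abs_inner_le_of_proj hH x).trans ?_
    gcongr
    exact hx.trans (by gcongr; exact le_abs_self _)
  obtain ⟨i3, k1, k2, k3⟩ := M.influence_moments hg h3 h1 h2 hb hiso
  have hφm : Measurable φ := by
    rw [hφ]
    exact (hg.comp (measurable_snd.prodMk (by fun_prop))).mul (by fun_prop)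
  simp only [← congrFun hφ] at i3 k1 k2 k3
  set ν := M.law 𝒟 P.tensor with hν
  -- `a` is the `L²` norm of `⟨H, X⟩`. The third moment is at most a multiple of `√d̄ a³` and `v ≥
  -- √lam a`, so the size of `H` and the effective dimension cancel.
  set a : ℝ := ‖H‖ / √δ with ha
  have hsδ : 0 < √δ := Real.sqrt_pos.2 hδ
  have ha0 : 0 < a := div_pos (norm_pos_iff.2 hH0) hsδ
  have ha2 : ‖H‖ ^ 2 / δ = a ^ 2 := by rw [ha, div_pow, Real.sq_sqrt hδ.le]
  have hvar : Var[φ; ν] = ∫ z, φ z ^ 2 ∂ν := by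
    rw [variance_eq_integral hφm.aemeasurable, k1]; simp
  set v : ℝ := sd φ ν with hv
  have hv2 : v ^ 2 = ∫ z, φ z ^ 2 ∂ν := by
    rw [hv, sd, Real.sq_sqrt (variance_nonneg _ _), hvar]
  have hslam : 0 < √lam := Real.sqrt_pos.2 hlam
  have hva : √lam * a ≤ v := by
    refine Real.le_sqrt_of_sq_le ?_
    rw [hvar, mul_pow, Real.sq_sqrt hlam.le, ← ha2]
    exact k2
  have hv0 : 0 < v := lt_of_lt_of_le (by positivity) hva
  have hnR : (0 : ℝ) < n := by exact_mod_cast hn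
  have hBE : ∀ t, |Pr.real {ω | leadingSum Z φ v ω ≤ t} - Phi t| ≤
      (104 * (|M₃| * |Cproj| / √lam ^ 3) + 1) * √((dbar d : ℝ) / n) := fun t => by
    have := hZ.berry_esseen hn hφm (μ := 0) hv0 (by simpa using k1) (by simpa using hv2.symm)
      (by simpa using i3)
      (by simpa only [sub_zero] using k3) t
    simp only [sub_zero] at this
    refine this.trans ?_
    have hd0 : 0 ≤ √((dbar d : ℝ) / n) := Real.sqrt_nonneg _
    have key : M₃ * (‖H‖ * (|Cproj| * √((dbar d : ℝ) / δ))) * (‖H‖ ^ 2 / δ) / (√n * v ^ 3) ≤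
        |M₃| * |Cproj| / √lam ^ 3 * √((dbar d : ℝ) / n) := by
      calc _ ≤ |M₃| * (‖H‖ * (|Cproj| * √((dbar d : ℝ) / δ))) * (‖H‖ ^ 2 / δ) /
            (√n * (√lam * a) ^ 3) := by
            gcongr
            exact le_abs_self _
        _ = _ := by
            rw [ha2, Real.sqrt_div (Nat.cast_nonneg _), Real.sqrt_div (Nat.cast_nonneg _),
              show ‖H‖ = a * √δ by rw [ha]; field_simp]
            field_simp
    linarith
  refine ⟨kolmDist_le hBE, fun est ρ hρ => ?_⟩
  exact kolmDist_add_le hρ.le (standardized_eq Z φ est ψ v hn) hBE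

/-- Integrability of the matrix entries lets the double coordinate sum be exchanged with the
integral. -/
theorem inner_infoOp {𝒟 : Measure (Tensor d)} {T : Tensor d}
    (hint : ∀ i j, Integrable (fun x => M.fisher (inner ℝ T x) * (x i * x j)) 𝒟) (U V : Tensor d) :
    inner ℝ U (M.infoOp 𝒟 T V) =
      ∫ x, M.fisher (inner ℝ T x) * (inner ℝ U x * inner ℝ V x) ∂𝒟 := by
  rw [infoOp, Matrix.inner_toEuclideanCLM]
  have e : ∀ x : Tensor d, M.fisher (inner ℝ T x) * (inner ℝ U x * inner ℝ V x) =
      ∑ i, ∑ j, U i * V j * (M.fisher (inner ℝ T x) * (x i * x j)) := fun x => by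
    simp only [PiLp.inner_apply, RCLike.inner_apply, conj_trivial]
    rw [Finset.sum_mul_sum, Finset.mul_sum]
    refine Finset.sum_congr rfl fun i _ => ?_
    rw [Finset.mul_sum]
    refine Finset.sum_congr rfl fun j _ => ?_
    ring
  simp_rw [e]
  rw [integral_finsetSum _ fun i _ => integrable_finsetSum _ fun j _ => (hint i j).const_mul _]
  simp only [dotProduct, Matrix.mulVec, Matrix.of_apply, Finset.mul_sum]
  refine Finset.sum_congr rfl fun i _ => ?_
  rw [integral_finsetSum _ fun j _ => (hint i j).const_mul _]
  refine Finset.sum_congr rfl fun j _ => ?_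
  rw [integral_const_mul]
  ring

end SingleIndexModel

/-- The defining property of `A⁻¹ P_𝕋 V` when the information is positive definite on `𝕋`. -/
theorem infoSolve_spec {m : ℕ} {d : Fin (m + 1) → ℕ} {𝕋 : Submodule ℝ (Tensor d)}
    {G : Tensor d →L[ℝ] Tensor d} (hpos : ∀ u ∈ 𝕋, u ≠ 0 → 0 < inner ℝ u (G u)) (V : Tensor d) :
    infoSolve 𝕋 G V ∈ 𝕋 ∧ ∀ u ∈ 𝕋, inner ℝ u (G (infoSolve 𝕋 G V)) = inner ℝ u V := by
  set A : 𝕋 →L[ℝ] 𝕋 := 𝕋.orthogonalProjectionOnto ∘L G ∘L 𝕋.subtypeL with hA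
  have hAin : ∀ u w : 𝕋, inner ℝ u (A w) = inner ℝ (u : Tensor d) (G w) := fun u w =>
    Submodule.inner_orthogonalProjectionOnto_eq_of_mem_left u (G w)
  have hinj : Function.Injective A := by
    rw [injective_iff_map_eq_zero]
    intro u hu
    by_contra h0
    have := hpos u u.2 (by simpa using h0)
    rw [← hAin, hu, inner_zero_right] at this
    exact lt_irrefl _ this
  -- `Ring.inverse` is a genuine inverse only at a unit: positivity gives injectivity, and finite
  -- dimension gives bijectivity.
  have hunit : IsUnit A := by
    rw [ContinuousLinearMap.isUnit_iff_bijective]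
    exact ⟨hinj, LinearMap.injective_iff_surjective (f := (A : 𝕋 →ₗ[ℝ] 𝕋)).1 hinj⟩
  refine ⟨SetLike.coe_mem _, fun u hu => ?_⟩
  have h1 := congrArg (fun B : 𝕋 →L[ℝ] 𝕋 => B (𝕋.orthogonalProjectionOnto V))
    (Ring.mul_inverse_cancel A hunit)
  have h2 := hAin ⟨u, hu⟩ (Ring.inverse A (𝕋.orthogonalProjectionOnto V))
  have h3 : A (Ring.inverse A (𝕋.orthogonalProjectionOnto V)) = 𝕋.orthogonalProjectionOnto V := h1
  rw [h3] at h2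
  exact h2.symm.trans (Submodule.inner_orthogonalProjectionOnto_eq_of_mem_left ⟨u, hu⟩ V)

/-- Normal approximation with the whitened influence function. -/
theorem whitened_leading_term {cI CI M₃ Cproj : ℝ} (hcI : 0 < cI) (hCI : cI ≤ CI)
    {m : ℕ} {d r : Fin (m + 1) → ℕ} {q : ℕ} {𝒞 : Tensor d →ₗ[ℝ] (Fin q → ℝ)}
    {𝒴 : Type*} [MeasurableSpace 𝒴] {M : SingleIndexModel 𝒴} {𝒟 : Measure (Tensor d)}
    [IsProbabilityMeasure 𝒟] {P : TuckerPoint d r} {Γ : Tensor d} {δ : ℝ}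
    (hreg : RegularDesign M 𝒟 P 𝒞 δ cI CI Cproj)
    (h3 : ThirdMomentLE M M.whitenedScore 𝒟 P.tensor M₃)
    (hΓ : (P.signalTangent (LinearMap.ker 𝒞)).starProjection Γ ≠ 0) {n : ℕ} {Ω : Type*}
    [MeasurableSpace Ω] {Pr : Measure Ω} [IsProbabilityMeasure Pr] {Z : Fin n → Ω → Tensor d × 𝒴}
    (hn : 1 ≤ n) (hZ : IsIID Z (M.law 𝒟 P.tensor) Pr) {φ : Tensor d × 𝒴 → ℝ}
    (hφ : φ = M.whitenedInfl P.tensor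
      (δ • (P.signalTangent (LinearMap.ker 𝒞)).starProjection Γ)) (ψ : ℝ) :
    kolmDist Pr (leadingSum Z φ (sd φ (M.law 𝒟 P.tensor))) ≤
        (104 * (|M₃| * |Cproj| / √(1 / CI) ^ 3) + 1) * √((dbar d : ℝ) / n) ∧
    ∀ (est : Ω → ℝ) (ρ : ℝ), 0 < ρ →
      kolmDist Pr (standardized n est ψ (sd φ (M.law 𝒟 P.tensor))) ≤
        (104 * (|M₃| * |Cproj| / √(1 / CI) ^ 3) + 1) * √((dbar d : ℝ) / n) + ρ / √(2 * Real.pi) +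
          Pr.real {ω | ρ < |stdRemainder Z φ est ψ (sd φ (M.law 𝒟 P.tensor)) ω|} := by
  refine M.leading_term M.measurable_whitenedScore hreg h3 M.integral_whitenedScore
    (one_div_pos.2 (hcI.trans_le hCI)) ?_
    (Submodule.smul_mem _ δ (Submodule.starProjection_apply_mem _ Γ))
    (smul_ne_zero hreg.effDim_pos.ne' hΓ) hn hZ hφ ψ
  -- The whitened score has conditional second moment `1 / I`, whence the lower bound `1 / CI`.
  filter_upwards [hreg.fisher_bounds] with x hx
  have h0 := hcI.trans_le hx.1
  rw [M.integral_whitenedScore_sq h0.ne']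
  exact one_div_le_one_div_of_le h0 hx.2

/-- Normal approximation with the efficient influence function. -/
theorem efficient_leading_term {cI CI M₃ Cproj : ℝ} (hcI : 0 < cI)
    {m : ℕ} {d r : Fin (m + 1) → ℕ} {q : ℕ} {𝒞 : Tensor d →ₗ[ℝ] (Fin q → ℝ)}
    {𝒴 : Type*} [MeasurableSpace 𝒴] {M : SingleIndexModel 𝒴} {𝒟 : Measure (Tensor d)}
    [IsProbabilityMeasure 𝒟] {P : TuckerPoint d r} {Γ : Tensor d} {δ : ℝ}
    (hreg : RegularDesign M 𝒟 P 𝒞 δ cI CI Cproj) (hX : Integrable (fun x => ‖x‖ ^ 2) 𝒟)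
    (h3 : ThirdMomentLE M M.score 𝒟 P.tensor M₃)
    (hΓ : (P.signalTangent (LinearMap.ker 𝒞)).starProjection Γ ≠ 0) {n : ℕ} {Ω : Type*}
    [MeasurableSpace Ω] {Pr : Measure Ω} [IsProbabilityMeasure Pr] {Z : Fin n → Ω → Tensor d × 𝒴}
    (hn : 1 ≤ n) (hZ : IsIID Z (M.law 𝒟 P.tensor) Pr) {φ : Tensor d × 𝒴 → ℝ}
    (hφ : φ = M.infl P.tensor
      (infoSolve (P.signalTangent (LinearMap.ker 𝒞)) (M.infoOp 𝒟 P.tensor) Γ)) (ψ : ℝ) :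
    kolmDist Pr (leadingSum Z φ (sd φ (M.law 𝒟 P.tensor))) ≤
        (104 * (|M₃| * |Cproj| / √cI ^ 3) + 1) * √((dbar d : ℝ) / n) ∧
    ∀ (est : Ω → ℝ) (ρ : ℝ), 0 < ρ →
      kolmDist Pr (standardized n est ψ (sd φ (M.law 𝒟 P.tensor))) ≤
        (104 * (|M₃| * |Cproj| / √cI ^ 3) + 1) * √((dbar d : ℝ) / n) + ρ / √(2 * Real.pi) +
          Pr.real {ω | ρ < |stdRemainder Z φ est ψ (sd φ (M.law 𝒟 P.tensor)) ω|} := by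
  have hfm : Measurable fun x : Tensor d => M.fisher (inner ℝ P.tensor x) :=
    M.measurable_fisher.comp (by fun_prop)
  have hdom : ∀ f : Tensor d → ℝ, Measurable f → (∀ x, |f x| ≤ ‖x‖ ^ 2) → Integrable f 𝒟 :=
    fun f hf hle => hX.mono' hf.aestronglyMeasurable (.of_forall hle)
  have hfi : ∀ f : Tensor d → ℝ, Integrable f 𝒟 →
      Integrable (fun x => M.fisher (inner ℝ P.tensor x) * f x) 𝒟 := fun f hf => by
    refine hf.bdd_mul (c := CI) hfm.aestronglyMeasurable ?_
    filter_upwards [hreg.fisher_bounds] with x hx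
    rw [Real.norm_of_nonneg (hcI.le.trans hx.1)]
    exact hx.2
  have hint : ∀ i j, Integrable (fun x : Tensor d =>
      M.fisher (inner ℝ P.tensor x) * (x i * x j)) 𝒟 := fun i j => by
    refine hfi _ (hdom _ (by fun_prop) fun x => ?_)
    rw [abs_mul, sq]
    gcongr
    · exact PiLp.norm_apply_le x i
    · exact PiLp.norm_apply_le x j
  have hpos : ∀ u ∈ P.signalTangent (LinearMap.ker 𝒞), u ≠ 0 →
      0 < inner ℝ u (M.infoOp 𝒟 P.tensor u) := fun u hu h0 => by
    have hi : 0 < ∫ x, (inner ℝ u x) ^ 2 ∂𝒟 := by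
      rw [hreg.isotropic u hu]
      have := hreg.effDim_pos
      have := norm_pos_iff.2 h0
      positivity
    -- Isotropy makes this integral positive, whereas the Bochner integral of a non-integrable
    -- function is zero.
    have hui : Integrable (fun x => (inner ℝ u x : ℝ) ^ 2) 𝒟 := by
      by_contra hc
      rw [integral_undef hc] at hi
      exact lt_irrefl _ hi
    rw [M.inner_infoOp hint]
    calc 0 < cI * ∫ x, (inner ℝ u x) ^ 2 ∂𝒟 := mul_pos hcI hi
      _ ≤ _ := by
          rw [← integral_const_mul]
          simp only [← sq]
          refine integral_mono_ae (hui.const_mul cI) (hfi _ hui) ?_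
          filter_upwards [hreg.fisher_bounds] with x hx
          exact mul_le_mul_of_nonneg_right hx.1 (sq_nonneg _)
  obtain ⟨hH, hHs⟩ := infoSolve_spec hpos Γ
  refine M.leading_term M.measurable_score hreg h3 M.integral_score hcI ?_ hH (fun h0 => hΓ ?_)
    hn hZ hφ ψ
  · filter_upwards [hreg.fisher_bounds] with x hx
    exact hx.1
  -- Testing the normal equations with the projection of `Γ` shows that a vanishing direction would
  -- force this projection to vanish.
  · have h1 := hHs _ (Submodule.starProjection_apply_mem _ Γ)
    rw [h0, map_zero, inner_zero_right, Submodule.inner_starProjection_left_eq_right] at h1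
    have h2 := Submodule.re_inner_starProjection_eq_normSq (𝕜 := ℝ)
      (K := P.signalTangent (LinearMap.ker 𝒞)) Γ
    rw [Submodule.inner_starProjection_left_eq_right] at h2
    simp only [RCLike.re_to_real] at h2
    rw [← h1] at h2
    rw [Submodule.starProjection_apply]
    exact_mod_cast norm_eq_zero.1 (pow_eq_zero_iff two_ne_zero |>.1 h2.symm)

end PairwiseBE

/-! ### Perturbation of range projections -/

namespace PairwiseBE

section RangeProjection

variable {E F : Type*} [NormedAddCommGroup E] [InnerProductSpace ℝ E] [FiniteDimensional ℝ E]
  [NormedAddCommGroup F] [InnerProductSpace ℝ F] [FiniteDimensional ℝ F]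

/-- `N` is the adjoint of `M`. -/
def IsAdj (M : F →ₗ[ℝ] E) (N : E →ₗ[ℝ] F) : Prop :=
  ∀ x y, inner ℝ (M y) x = inner ℝ y (N x)

/-- All nonzero singular values of `M`, with adjoint `N`, are at least `lam`. -/
def SingularGE (M : F →ₗ[ℝ] E) (N : E →ₗ[ℝ] F) (lam : ℝ) : Prop :=
  ∀ y, lam * ‖M y‖ ≤ ‖N (M y)‖

/-- The orthogonal projection onto the range of `M`. -/
noncomputable def rangeProj (M : F →ₗ[ℝ] E) : E →L[ℝ] E := (LinearMap.range M).starProjection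

variable {M M' : F →ₗ[ℝ] E} {N N' : E →ₗ[ℝ] F} {lam η : ℝ}

theorem rangeProj_mem (M : F →ₗ[ℝ] E) (x : E) : ∃ y, M y = rangeProj M x :=
  Submodule.starProjection_apply_mem (LinearMap.range M) x

theorem rangeProj_apply_range (M : F →ₗ[ℝ] E) (y : F) : rangeProj M (M y) = M y :=
  Submodule.starProjection_eq_self_iff.2 ⟨y, rfl⟩

theorem rangeProj_idem (M : F →ₗ[ℝ] E) (x : E) : rangeProj M (rangeProj M x) = rangeProj M x := by
  obtain ⟨y, hy⟩ := rangeProj_mem M x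
  rw [← hy, rangeProj_apply_range]

theorem norm_rangeProj_le (M : F →ₗ[ℝ] E) (x : E) : ‖rangeProj M x‖ ≤ ‖x‖ :=
  Submodule.norm_starProjection_apply_le _ x

theorem inner_rangeProj (M : F →ₗ[ℝ] E) (x y : E) :
    inner ℝ (rangeProj M x) y = inner ℝ x (rangeProj M y) :=
  Submodule.inner_starProjection_left_eq_right _ _ _

theorem norm_sub_rangeProj_le (M : F →ₗ[ℝ] E) (x : E) : ‖x - rangeProj M x‖ ≤ ‖x‖ := by
  have h0 : inner ℝ (rangeProj M x) (x - rangeProj M x) = 0 := by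
    rw [inner_sub_right, ← inner_rangeProj M (rangeProj M x) x, rangeProj_idem, sub_self]
  have h := norm_add_sq_eq_norm_sq_add_norm_sq_real h0
  rw [add_sub_cancel] at h
  nlinarith [norm_nonneg (rangeProj M x), norm_nonneg (x - rangeProj M x), norm_nonneg x]

theorem IsAdj.apply_sub_rangeProj (h : IsAdj M N) (x : E) : N (x - rangeProj M x) = 0 := by
  refine ext_inner_left ℝ fun y => ?_
  rw [← h, inner_zero_right, inner_sub_right, ← inner_rangeProj, rangeProj_apply_range, sub_self]

theorem IsAdj.apply_rangeProj (h : IsAdj M N) (x : E) : N (rangeProj M x) = N x := by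
  have := h.apply_sub_rangeProj x
  rw [map_sub, sub_eq_zero] at this
  exact this.symm

/-- The projection of `x` is some `M y`, and `N` does not distinguish it from `x`. In this way the
adjoint controls projections, and all the perturbation bounds use it. -/
theorem SingularGE.norm_rangeProj_le (hs : SingularGE M N lam) (h : IsAdj M N) (x : E) :
    lam * ‖rangeProj M x‖ ≤ ‖N x‖ := by
  obtain ⟨y, hy⟩ := rangeProj_mem M x
  have := hs y
  rwa [hy, h.apply_rangeProj] at this

/-- Singular values of the adjoint. -/
theorem SingularGE.symm (hs : SingularGE M N lam) (h : IsAdj M N) : SingularGE N M lam := by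
  intro x
  set z := rangeProj M x with hz
  have hNz : N z = N x := h.apply_rangeProj x
  rw [← hNz]
  have h1 : lam * ‖z‖ ≤ ‖N z‖ := by rw [hNz]; exact hs.norm_rangeProj_le h x
  rcases (norm_nonneg z).eq_or_lt with h0 | h0
  · have : z = 0 := norm_eq_zero.1 h0.symm
    simp [this]
  -- `‖N z‖² = ⟨M N z, z⟩`; dividing by `‖z‖` and using `lam ‖z‖ ≤ ‖N z‖` gives the bound for the
  -- adjoint.
  · have h2 : ‖N z‖ * ‖N z‖ ≤ ‖M (N z)‖ * ‖z‖ := by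
      rw [← real_inner_self_eq_norm_mul_norm, ← h]
      exact real_inner_le_norm _ _
    have h3 : lam * ‖z‖ * ‖N z‖ ≤ ‖N z‖ * ‖N z‖ := by gcongr
    refine le_of_mul_le_mul_right ?_ h0
    linarith

/-- `N'` vanishes on the orthogonal complement of the range of `M'`, so `N` acts there as `-(N' -
N)`. -/
theorem rangeProj_comp_sub_le (hs : SingularGE M N lam) (h : IsAdj M N) (h' : IsAdj M' N')
    (hη : ∀ x, ‖(N' - N) x‖ ≤ η * ‖x‖) (x : E) :
    lam * ‖rangeProj M (x - rangeProj M' x)‖ ≤ η * ‖x - rangeProj M' x‖ := by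
  refine (hs.norm_rangeProj_le h _).trans ?_
  have e : N (x - rangeProj M' x) = -((N' - N) (x - rangeProj M' x)) := by
    rw [LinearMap.sub_apply, h'.apply_sub_rangeProj, zero_sub, neg_neg]
  rw [e, norm_neg]
  exact hη _

/-- `‖(1 - P') P‖ ≤ η / lam`. -/
theorem sub_rangeProj_comp_le (hlam : 0 < lam) (hs : SingularGE M N lam) (h : IsAdj M N)
    (h' : IsAdj M' N') (hη : ∀ x, ‖(N' - N) x‖ ≤ η * ‖x‖) (x : E) :
    lam * ‖rangeProj M x - rangeProj M' (rangeProj M x)‖ ≤ η * ‖rangeProj M x‖ := by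
  set z := rangeProj M x with hz
  set w := z - rangeProj M' z with hw
  have hwz : inner ℝ w z = inner ℝ w w := by
    have : inner ℝ w (rangeProj M' z) = 0 := by
      rw [← inner_rangeProj, hw, map_sub, rangeProj_idem, sub_self, inner_zero_left]
    conv_rhs => rw [hw, inner_sub_right, ← hw, this, sub_zero]
  have hzz : rangeProj M z = z := rangeProj_idem M x
  have hw' : w - rangeProj M' w = w := by
    rw [hw, map_sub, rangeProj_idem, sub_self, sub_zero]
  -- Moving the projection across the inner product reduces `(1 - P') P` to its adjoint `P (1 -
  -- P')`, which the preceding lemma bounds.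
  have h1 : ‖w‖ * ‖w‖ ≤ ‖rangeProj M w‖ * ‖z‖ := by
    rw [← real_inner_self_eq_norm_mul_norm, ← hwz]
    calc (inner ℝ w z : ℝ) = inner ℝ (rangeProj M w) z := by rw [inner_rangeProj, hzz]
      _ ≤ _ := real_inner_le_norm _ _
  have h2 := rangeProj_comp_sub_le hs h h' hη w
  rw [hw'] at h2
  rcases (norm_nonneg w).eq_or_lt with h0 | h0
  · rw [← h0, mul_zero]
    have h3 := (norm_nonneg _).trans (hη z)
    exact h3
  · refine le_of_mul_le_mul_right ?_ h0
    calc lam * ‖w‖ * ‖w‖ = lam * (‖w‖ * ‖w‖) := by ring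
      _ ≤ lam * (‖rangeProj M w‖ * ‖z‖) := by gcongr
      _ = (lam * ‖rangeProj M w‖) * ‖z‖ := by ring
      _ ≤ (η * ‖w‖) * ‖z‖ := by gcongr
      _ = _ := by ring

/-- Perturbation of a range projection at a given vector. -/
theorem rangeProj_sub_le (hlam : 0 < lam) (hs : SingularGE M N lam) (h : IsAdj M N)
    (hs' : SingularGE M' N' lam) (h' : IsAdj M' N') (hη : ∀ x, ‖(N' - N) x‖ ≤ η * ‖x‖) (x : E) :
    lam * ‖rangeProj M' x - rangeProj M x‖ ≤ ‖(N' - N) x‖ + 2 * η * ‖rangeProj M x‖ := by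
  have h1 : lam * ‖rangeProj M' (x - rangeProj M x)‖ ≤ ‖(N' - N) x‖ + η * ‖rangeProj M x‖ := by
    refine (hs'.norm_rangeProj_le h' _).trans ?_
    have e : N' (x - rangeProj M x) = (N' - N) x - (N' - N) (rangeProj M x) := by
      have := h.apply_sub_rangeProj x
      rw [← map_sub, LinearMap.sub_apply, this, sub_zero]
    rw [e]
    exact (norm_sub_le _ _).trans (by gcongr; exact hη _)
  have h2 := sub_rangeProj_comp_le hlam hs h h' hη x
  -- The splitting `P' - P = P' (1 - P) - (1 - P') P`. The first part keeps `‖(N' - N) x‖` at the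
  -- given vector, which is far below the operator norm when `x` is a basis vector.
  have e : rangeProj M' x - rangeProj M x = rangeProj M' (x - rangeProj M x) -
      (rangeProj M x - rangeProj M' (rangeProj M x)) := by
    rw [map_sub]; abel
  rw [e]
  have := mul_le_mul_of_nonneg_left (norm_sub_le (rangeProj M' (x - rangeProj M x))
    (rangeProj M x - rangeProj M' (rangeProj M x))) hlam.le
  linarith

/-- Weyl's inequality for the smallest nonzero singular value, the rank being fixed. -/
theorem SingularGE.perturb (hlam : η < lam) (hs : SingularGE M N lam)
    (h' : IsAdj M' N') (hη : ∀ x, ‖(N' - N) x‖ ≤ η * ‖x‖)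
    (hrank : Module.finrank ℝ (LinearMap.range M') ≤ Module.finrank ℝ (LinearMap.range M)) :
    SingularGE M' N' (lam - η) := by
  have key : ∀ z ∈ LinearMap.range M, (lam - η) * ‖z‖ ≤ ‖N' z‖ := by
    rintro _ ⟨y, rfl⟩
    have h1 := hs y
    have h2 := hη (M y)
    rw [LinearMap.sub_apply] at h2
    have h3 := norm_sub_norm_le (N (M y)) (N' (M y))
    rw [norm_sub_rev] at h3
    linarith
  -- Projecting one range to the other is injective by the lower bound `key`, hence bijective by the
  -- rank condition. Every `M' y` is then the projection of some `z` in the range of `M`, and `‖z‖ ≥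
  -- ‖M' y‖`.
  set f : LinearMap.range M →ₗ[ℝ] LinearMap.range M' :=
    ((LinearMap.range M').orthogonalProjectionOnto : E →ₗ[ℝ] LinearMap.range M').comp
      (LinearMap.range M).subtype with hf
  have hfc : ∀ z, ((f z : LinearMap.range M') : E) = rangeProj M' z := fun z => rfl
  have hinj : Function.Injective f := by
    rw [injective_iff_map_eq_zero]
    intro z hz
    have h1 : rangeProj M' (z : E) = 0 := by rw [← hfc, hz]; rfl
    have h2 := key z z.2
    rw [← h'.apply_rangeProj, h1, map_zero, norm_zero] at h2
    have h3 : ‖(z : E)‖ ≤ 0 := nonpos_of_mul_nonpos_right h2 (by linarith)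
    simpa using h3
  have hsurj : Function.Surjective f := by
    have he : Module.finrank ℝ (LinearMap.range M) = Module.finrank ℝ (LinearMap.range M') :=
      le_antisymm (LinearMap.finrank_le_finrank_of_injective hinj) hrank
    exact (LinearMap.injective_iff_surjective_of_finrank_eq_finrank he).1 hinj
  intro y
  obtain ⟨z, hz⟩ := hsurj ⟨M' y, y, rfl⟩
  have hz' : rangeProj M' (z : E) = M' y := by rw [← hfc, hz]
  have h1 := key z z.2
  rw [← hz', h'.apply_rangeProj]
  refine le_trans ?_ h1
  exact mul_le_mul_of_nonneg_left (PairwiseBE.norm_rangeProj_le M' z) (by linarith)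

end RangeProjection

end PairwiseBE

/-! ### Matrices acting on Euclidean spaces -/

namespace PairwiseBE

open scoped Kronecker

section Op

variable {I : Type*} [Fintype I] [DecidableEq I]

/-- The operator of a square matrix. -/
noncomputable abbrev op (A : Matrix I I ℝ) : EuclideanSpace ℝ I →L[ℝ] EuclideanSpace ℝ I :=
  Matrix.toEuclideanCLM (𝕜 := ℝ) A

/-- A canonical basis vector. -/
noncomputable abbrev basisVec (i : I) : EuclideanSpace ℝ I := EuclideanSpace.single i 1

theorem op_apply (A : Matrix I I ℝ) (z : EuclideanSpace ℝ I) (i : I) :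
    op A z i = ∑ j, A i j * z j := rfl

theorem op_mul_apply (A B : Matrix I I ℝ) (z : EuclideanSpace ℝ I) :
    op (A * B) z = op A (op B z) := by rw [op, map_mul]; rfl

theorem op_one_apply (z : EuclideanSpace ℝ I) : op 1 z = z := by rw [op, map_one]; rfl

theorem op_sub_apply (A B : Matrix I I ℝ) (z : EuclideanSpace ℝ I) :
    op (A - B) z = op A z - op B z := by rw [op, map_sub]; rfl

theorem op_add_apply (A B : Matrix I I ℝ) (z : EuclideanSpace ℝ I) :
    op (A + B) z = op A z + op B z := by rw [op, map_add]; rfl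

theorem op_sum_apply {κ : Type*} (s : Finset κ) (A : κ → Matrix I I ℝ) (z : EuclideanSpace ℝ I) :
    op (∑ k ∈ s, A k) z = ∑ k ∈ s, op (A k) z := by
  rw [op, map_sum, sum_apply]

theorem inner_op (A : Matrix I I ℝ) (x y : EuclideanSpace ℝ I) :
    inner ℝ (op A x) y = inner ℝ x (op Aᵀ y) := by
  rw [real_inner_comm, Matrix.inner_toEuclideanCLM, Matrix.inner_toEuclideanCLM,
    Matrix.mulVec_transpose, Matrix.dotProduct_mulVec, dotProduct_comm]

theorem inner_basisVec (z : EuclideanSpace ℝ I) (i : I) : inner ℝ (basisVec i) z = z i := by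
  simp [EuclideanSpace.inner_single_left]

theorem op_basisVec (A : Matrix I I ℝ) (i j : I) : op A (basisVec i) j = A j i := by
  rw [op_apply]; simp

theorem apply_eq_inner_op (A : Matrix I I ℝ) (z : EuclideanSpace ℝ I) (i : I) :
    op A z i = inner ℝ (op Aᵀ (basisVec i)) z := by
  rw [inner_op, Matrix.transpose_transpose, inner_basisVec]

theorem norm_basisVec (i : I) : ‖basisVec i‖ = 1 := by simp

/-- The vector `z` is bounded by `√|I| t` if its entries are bounded by `t`. -/
theorem norm_le_of_entries {z : EuclideanSpace ℝ I} {t : ℝ} (ht : 0 ≤ t) (hz : ∀ i, |z i| ≤ t) :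
    ‖z‖ ≤ √(Fintype.card I) * t := by
  rw [EuclideanSpace.norm_eq]
  rw [← Real.sqrt_sq ht, ← Real.sqrt_mul (Nat.cast_nonneg _)]
  refine Real.sqrt_le_sqrt ?_
  calc ∑ i, ‖z i‖ ^ 2 ≤ ∑ _i : I, t ^ 2 := Finset.sum_le_sum fun i _ => by
        rw [Real.norm_eq_abs]; gcongr; exact hz i
    _ = _ := by rw [Finset.sum_const, Finset.card_univ, nsmul_eq_mul]

/-- The operator `A` is bounded by `K` for the supremum norm. -/
def SupLE (A : Matrix I I ℝ) (K : ℝ) : Prop :=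
  ∀ (z : EuclideanSpace ℝ I) (t : ℝ), (∀ i, |z i| ≤ t) → ∀ i, |op A z i| ≤ K * t

theorem SupLE.mul {A B : Matrix I I ℝ} {K L : ℝ} (hA : SupLE A K) (hB : SupLE B L) :
    SupLE (A * B) (K * L) := fun z t hz i => by
  rw [op_mul_apply, mul_assoc]
  exact hA _ _ (hB z t hz) i

theorem SupLE.add {A B : Matrix I I ℝ} {K L : ℝ} (hA : SupLE A K) (hB : SupLE B L) :
    SupLE (A + B) (K + L) := fun z t hz i => by
  rw [op_add_apply, add_mul]
  exact (abs_add_le _ _).trans (add_le_add (hA z t hz i) (hB z t hz i))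

theorem SupLE.sub {A B : Matrix I I ℝ} {K L : ℝ} (hA : SupLE A K) (hB : SupLE B L) :
    SupLE (A - B) (K + L) := fun z t hz i => by
  rw [op_sub_apply, add_mul]
  exact (abs_sub _ _).trans (add_le_add (hA z t hz i) (hB z t hz i))

theorem SupLE.sum {κ : Type*} (s : Finset κ) {A : κ → Matrix I I ℝ} {K : κ → ℝ}
    (hA : ∀ k ∈ s, SupLE (A k) (K k)) : SupLE (∑ k ∈ s, A k) (∑ k ∈ s, K k) := fun z t hz i => by
  rw [op_sum_apply, Finset.sum_mul, WithLp.ofLp_sum, Finset.sum_apply]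
  exact (Finset.abs_sum_le_sum_abs _ _).trans (Finset.sum_le_sum fun k hk => hA k hk z t hz i)

theorem supLE_one : SupLE (1 : Matrix I I ℝ) 1 := fun z t hz i => by
  rw [op_one_apply, one_mul]; exact hz i

end Op

/-! ### Slicewise operators -/

section Slice

variable {I α β : Type*} [Fintype I] [DecidableEq I] [Fintype α] [DecidableEq α] [Fintype β]
  [DecidableEq β] (e : I ≃ α × β)

/-- The matrix that acts by `B` on each slice `{i | (e i).1 = a}`. -/
def slice (B : Matrix β β ℝ) : Matrix I I ℝ := ((1 : Matrix α α ℝ) ⊗ₖ B).submatrix e e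

theorem slice_apply (B : Matrix β β ℝ) (i j : I) :
    slice e B i j = if (e i).1 = (e j).1 then B (e i).2 (e j).2 else 0 := by
  simp [slice, Matrix.one_apply]

theorem slice_mul (B C : Matrix β β ℝ) : slice e (B * C) = slice e B * slice e C := by
  rw [slice, slice, slice, Matrix.submatrix_mul_equiv, ← Matrix.mul_kronecker_mul, one_mul]

theorem slice_one : slice e (1 : Matrix β β ℝ) = 1 := by
  rw [slice, Matrix.one_kronecker_one, Matrix.submatrix_one_equiv]

theorem slice_sub (B C : Matrix β β ℝ) : slice e (B - C) = slice e B - slice e C := by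
  ext i j; simp only [slice_apply, Matrix.sub_apply]; split_ifs <;> simp

theorem slice_transpose (B : Matrix β β ℝ) : (slice e B)ᵀ = slice e Bᵀ := by
  ext i j; simp only [slice_apply, Matrix.transpose_apply, eq_comm]

/-- Operators acting on complementary coordinates commute. -/
theorem slice_comm (A : Matrix α α ℝ) (B : Matrix β β ℝ) :
    slice e B * slice (e.trans (Equiv.prodComm α β)) A =
      slice (e.trans (Equiv.prodComm α β)) A * slice e B := by
  have h : slice (e.trans (Equiv.prodComm α β)) A =
      (A ⊗ₖ (1 : Matrix β β ℝ)).submatrix e e := by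
    ext i j
    rw [slice_apply, Matrix.submatrix_apply, Matrix.kroneckerMap_apply, Matrix.one_apply]
    change (if (e i).2 = (e j).2 then A (e i).1 (e j).1 else 0) = _
    split_ifs <;> simp
  rw [h, slice, Matrix.submatrix_mul_equiv, Matrix.submatrix_mul_equiv, ← Matrix.mul_kronecker_mul,
    ← Matrix.mul_kronecker_mul, one_mul, one_mul, mul_one, mul_one]

/-- The slice of a vector. -/
noncomputable def fib (z : EuclideanSpace ℝ I) (a : α) : EuclideanSpace ℝ β :=
  WithLp.toLp 2 fun b => z (e.symm (a, b))

theorem norm_sq_eq_sum_fib (z : EuclideanSpace ℝ I) : ‖z‖ ^ 2 = ∑ a, ‖fib e z a‖ ^ 2 := by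
  simp only [EuclideanSpace.norm_sq_eq, fib]
  rw [← Fintype.sum_prod_type', ← e.symm.sum_comp]

theorem fib_slice (B : Matrix β β ℝ) (z : EuclideanSpace ℝ I) (a : α) :
    fib e (op (slice e B) z) a = op B (fib e z a) := by
  ext b
  change op (slice e B) z (e.symm (a, b)) = op B (fib e z a) b
  rw [op_apply, op_apply, ← e.symm.sum_comp, Fintype.sum_prod_type]
  simp only [slice_apply, Equiv.apply_symm_apply, ite_mul, zero_mul]
  rw [Finset.sum_eq_single a (fun a' _ h => by simp [h.symm]) (by simp)]
  simp [fib]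

/-- Squared norms add over slices, and the operator acts on each slice by `B`. -/
theorem norm_slice_le {B : Matrix β β ℝ} {c : ℝ} (hc : 0 ≤ c) (hB : ∀ z, ‖op B z‖ ≤ c * ‖z‖)
    (z : EuclideanSpace ℝ I) : ‖op (slice e B) z‖ ≤ c * ‖z‖ := by
  refine abs_le_of_sq_le_sq' ?_ (by positivity) |>.2
  rw [mul_pow, norm_sq_eq_sum_fib e, norm_sq_eq_sum_fib e z, Finset.mul_sum]
  refine Finset.sum_le_sum fun a _ => ?_
  rw [fib_slice, ← mul_pow]
  gcongr
  exact hB _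

theorem norm_slice_basisVec (B : Matrix β β ℝ) (i : I) :
    ‖op (slice e B) (basisVec i)‖ = ‖op B (basisVec (e i).2)‖ := by
  have h : ∀ a, fib e (basisVec i) a = if a = (e i).1 then basisVec (e i).2 else 0 := fun a => by
    ext b
    have h2 : (fib e (basisVec i) a) b = if e.symm (a, b) = i then 1 else 0 := by
      simp [fib]
    have : e.symm (a, b) = i ↔ a = (e i).1 ∧ b = (e i).2 := by
      rw [Equiv.symm_apply_eq, Prod.ext_iff]
    rw [h2]
    simp only [this]
    split_ifs with ha hb hb <;> simp_all
  rw [← sq_eq_sq₀ (norm_nonneg _) (norm_nonneg _), norm_sq_eq_sum_fib e,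
    Finset.sum_eq_single (e i).1 (fun a _ ha => by
      rw [fib_slice, h, if_neg ha, map_zero, norm_zero]; norm_num) (by simp)]
  rw [fib_slice, h, if_pos rfl]

/-- An entry of the image is a row of `B` paired with a slice of norm at most `√|β| t`. Rows of norm
`O(1/√|β|)` therefore give an operator bounded in sup norm. -/
theorem abs_slice_apply_le {B : Matrix β β ℝ} {c t : ℝ} (z : EuclideanSpace ℝ I) (ht : 0 ≤ t)
    (hz : ∀ i, |z i| ≤ t) (i : I) (hB : ‖op Bᵀ (basisVec (e i).2)‖ ≤ c) :
    |op (slice e B) z i| ≤ c * √(Fintype.card β) * t := by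
  have h1 : op (slice e B) z i = op B (fib e z (e i).1) (e i).2 := by
    rw [← fib_slice]; simp [fib]
  rw [h1, apply_eq_inner_op]
  calc _ ≤ ‖op Bᵀ (basisVec (e i).2)‖ * ‖fib e z (e i).1‖ := abs_real_inner_le_norm _ _
    _ ≤ c * (√(Fintype.card β) * t) := by
        gcongr
        · exact (norm_nonneg _).trans hB
        · exact norm_le_of_entries ht fun b => hz _
    _ = _ := by ring

theorem supLE_slice {B : Matrix β β ℝ} {c : ℝ} (hB : ∀ b, ‖op Bᵀ (basisVec b)‖ ≤ c) :
    SupLE (slice e B) (c * √(Fintype.card β)) := fun z _ hz i =>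
  abs_slice_apply_le e z ((abs_nonneg _).trans (hz i)) hz i (hB _)

end Slice

/-! ### Kronecker products of families -/

section Kron

variable {ι : Type*} [Fintype ι] [DecidableEq ι] {α β γ : ι → Type*} [∀ k, Fintype (α k)]
  [∀ k, DecidableEq (α k)] [∀ k, Fintype (β k)] [∀ k, DecidableEq (β k)]

/-- The Kronecker product of a family of matrices. -/
def kron (U : ∀ k, Matrix (α k) (β k) ℝ) : Matrix (∀ k, α k) (∀ k, β k) ℝ :=
  fun i j => ∏ k, U k (i k) (j k)

theorem kron_apply (U : ∀ k, Matrix (α k) (β k) ℝ) (i : ∀ k, α k) (j : ∀ k, β k) :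
    kron U i j = ∏ k, U k (i k) (j k) := rfl

theorem kron_mul (U : ∀ k, Matrix (α k) (β k) ℝ) (V : ∀ k, Matrix (β k) (γ k) ℝ) :
    kron U * kron V = kron fun k => U k * V k := by
  ext i j
  simp only [Matrix.mul_apply, kron_apply, ← Finset.prod_mul_distrib]
  rw [Finset.prod_univ_sum, Fintype.piFinset_univ]

theorem kron_transpose (U : ∀ k, Matrix (α k) (β k) ℝ) : (kron U)ᵀ = kron fun k => (U k)ᵀ := rfl

theorem kron_one : kron (fun k => (1 : Matrix (α k) (α k) ℝ)) = 1 := by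
  ext i j
  rw [kron_apply, Matrix.one_apply]
  split_ifs with h
  · subst h; simp
  · obtain ⟨k, hk⟩ := Function.ne_iff.1 h
    exact Finset.prod_eq_zero (Finset.mem_univ k) (Matrix.one_apply_ne hk)

theorem norm_kron_basisVec (A : ∀ k, Matrix (α k) (α k) ℝ) (i : ∀ k, α k) :
    ‖op (kron A) (basisVec i)‖ = ∏ k, ‖op (A k) (basisVec (i k))‖ := by
  rw [← sq_eq_sq₀ (norm_nonneg _) (Finset.prod_nonneg fun k _ => norm_nonneg _),
    ← Finset.prod_pow]
  simp only [EuclideanSpace.norm_sq_eq, op_basisVec, Real.norm_eq_abs, sq_abs]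
  rw [Finset.prod_univ_sum, Fintype.piFinset_univ]
  simp only [kron_apply, Finset.prod_pow]

/-- The ℓ¹ norm of a row of a Kronecker product is the product of the ℓ¹ norms of the rows. -/
theorem supLE_kron {A : ∀ k, Matrix (α k) (α k) ℝ} {c : ι → ℝ}
    (hA : ∀ k a, ∑ a', |A k a a'| ≤ c k) : SupLE (kron A) (∏ k, c k) := fun z t hz i => by
  rw [op_apply]
  have ht : 0 ≤ t := (abs_nonneg _).trans (hz i)
  calc |∑ j, kron A i j * z j| ≤ ∑ j, |kron A i j| * t := by
        refine (Finset.abs_sum_le_sum_abs _ _).trans (Finset.sum_le_sum fun j _ => ?_)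
        rw [abs_mul]
        gcongr
        exact hz j
    _ = (∏ k, ∑ a', |A k (i k) a'|) * t := by
        rw [← Finset.sum_mul, Finset.prod_univ_sum, Fintype.piFinset_univ]
        simp only [kron_apply, Finset.abs_prod]
    _ ≤ _ := by
        refine mul_le_mul_of_nonneg_right (Finset.prod_le_prod (fun k _ => ?_) fun k _ => ?_) ht
        · exact Finset.sum_nonneg fun a _ => abs_nonneg _
        · exact hA _ _

/-- The `ℓ¹` norm of a row, from its `ℓ²` norm. -/
theorem sum_abs_row_le {J : Type*} [Fintype J] [DecidableEq J] {A : Matrix J J ℝ} {c : ℝ} (a : J)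
    (hA : ‖op Aᵀ (basisVec a)‖ ≤ c) : ∑ a', |A a a'| ≤ √(Fintype.card J) * c := by
  have h1 : (∑ a', |A a a'|) ^ 2 ≤ Fintype.card J * ‖op Aᵀ (basisVec a)‖ ^ 2 := by
    refine sq_sum_le_card_mul_sum_sq.trans ?_
    rw [EuclideanSpace.norm_sq_eq, Finset.card_univ]
    simp only [op_basisVec, Matrix.transpose_apply, Real.norm_eq_abs, sq_abs, le_refl]
  have h2 := Real.sqrt_le_sqrt h1
  rw [Real.sqrt_sq (Finset.sum_nonneg fun _ _ => abs_nonneg _), Real.sqrt_mul (Nat.cast_nonneg _),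
    Real.sqrt_sq (norm_nonneg _)] at h2
  exact h2.trans (by gcongr)

end Kron

/-- A matrix with orthonormal columns preserves the norm. -/
theorem norm_mulVec_of_orthonormal {I J : Type*} [Fintype I] [Fintype J] [DecidableEq J]
    {V : Matrix I J ℝ} (hV : Vᵀ * V = 1) (z : J → ℝ) :
    ‖WithLp.toLp 2 (V *ᵥ z)‖ = ‖(WithLp.toLp 2 z : EuclideanSpace ℝ J)‖ := by
  have key : (V *ᵥ z) ⬝ᵥ (V *ᵥ z) = z ⬝ᵥ z := by
    rw [Matrix.dotProduct_mulVec, Matrix.vecMul_mulVec, hV, Matrix.vecMul_one]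
  rw [← sq_eq_sq₀ (norm_nonneg _) (norm_nonneg _)]
  simp only [EuclideanSpace.norm_sq_eq, Real.norm_eq_abs, sq_abs]
  simp only [dotProduct, ← sq] at key
  exact key

end PairwiseBE

/-! ### Column-space projections of matrices -/

namespace PairwiseBE

section ColProj

variable {α β γ : Type*} [Fintype α] [DecidableEq α] [Fintype β] [DecidableEq β] [Fintype γ]
  [DecidableEq γ]

/-- The linear map of a rectangular matrix. -/
noncomputable def lin (A : Matrix α β ℝ) : EuclideanSpace ℝ β →ₗ[ℝ] EuclideanSpace ℝ α :=
  Matrix.toEuclideanLin A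

theorem lin_apply (A : Matrix α β ℝ) (y : EuclideanSpace ℝ β) (i : α) :
    lin A y i = ∑ j, A i j * y j := rfl

theorem lin_eq_toLp (A : Matrix α β ℝ) (y : EuclideanSpace ℝ β) :
    lin A y = WithLp.toLp 2 (A *ᵥ y) := rfl

theorem lin_mul_apply (A : Matrix α β ℝ) (B : Matrix β γ ℝ) (y : EuclideanSpace ℝ γ) :
    lin (A * B) y = lin A (lin B y) := by
  ext i
  change ((A * B) *ᵥ y) i = (A *ᵥ (B *ᵥ y)) i
  rw [Matrix.mulVec_mulVec]

theorem lin_sub (A B : Matrix α β ℝ) : lin (A - B) = lin A - lin B := map_sub _ _ _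

theorem isAdj_lin (A : Matrix α β ℝ) : IsAdj (lin A) (lin Aᵀ) := fun x y => by
  change x.ofLp ⬝ᵥ star (A *ᵥ y.ofLp) = (Aᵀ *ᵥ x.ofLp) ⬝ᵥ star y.ofLp
  rw [star_trivial, star_trivial, Matrix.dotProduct_mulVec, Matrix.mulVec_transpose]

/-- The matrix of the orthogonal projection onto the column space of `A`. -/
noncomputable def colProj (A : Matrix α β ℝ) : Matrix α α ℝ :=
  (Matrix.toEuclideanCLM (𝕜 := ℝ)).symm (rangeProj (lin A))

theorem op_colProj (A : Matrix α β ℝ) (x : EuclideanSpace ℝ α) :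
    op (colProj A) x = rangeProj (lin A) x := by
  rw [op, colProj]
  exact congrArg (fun f => f x) ((Matrix.toEuclideanCLM (n := α) (𝕜 := ℝ)).apply_symm_apply _)

theorem ext_op {A B : Matrix α α ℝ} (h : ∀ x, op A x = op B x) : A = B :=
  (Matrix.toEuclideanCLM (n := α) (𝕜 := ℝ)).injective (ContinuousLinearMap.ext h)

theorem colProj_transpose (A : Matrix α β ℝ) : (colProj A)ᵀ = colProj A := by
  refine ext_op fun x => ext_inner_left ℝ fun y => ?_
  rw [← inner_op, op_colProj, op_colProj, inner_rangeProj]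

theorem colProj_mul_self (A : Matrix α β ℝ) : colProj A * A = A := by
  ext i j
  have h : op (colProj A) (lin A (basisVec j)) = lin A (basisVec j) := by
    rw [op_colProj, rangeProj_apply_range]
  have h1 := congrArg (fun z => z i) h
  simp only [op_apply, lin_apply] at h1
  simpa [Matrix.mul_apply] using h1

/-- The columns of the projection are combinations of the columns of `A`; identities for `A` are
passed on to its projection in this form. -/
theorem colProj_eq_mul (A : Matrix α β ℝ) : ∃ W : Matrix β α ℝ, colProj A = A * W := by
  choose W hW using fun a => rangeProj_mem (lin A) (basisVec a)
  refine ⟨Matrix.of fun b a => W a b, ?_⟩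
  ext i j
  have h := congrArg (fun z => z i) (hW j)
  simp only [lin_apply] at h
  rw [← op_basisVec (colProj A) j i, op_colProj, ← h, Matrix.mul_apply]
  rfl

theorem norm_op_colProj_le (A : Matrix α β ℝ) (x : EuclideanSpace ℝ α) :
    ‖op (colProj A) x‖ ≤ ‖x‖ := by
  rw [op_colProj]; exact norm_rangeProj_le _ _

theorem norm_op_one_sub_colProj_le (A : Matrix α β ℝ) (x : EuclideanSpace ℝ α) :
    ‖op (1 - colProj A) x‖ ≤ ‖x‖ := by
  rw [op_sub_apply, op_one_apply, op_colProj]; exact norm_sub_rangeProj_le _ _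

/-- A matrix that fixes the columns of `A` fixes the projection onto its column space. -/
theorem mul_colProj_of_fix {A : Matrix α β ℝ} {J : Matrix α α ℝ} (h : J * A = A) :
    J * colProj A = colProj A := by
  obtain ⟨W, hW⟩ := colProj_eq_mul A
  rw [hW, ← Matrix.mul_assoc, h]

/-- A symmetric matrix that fixes the columns of `A` and has its range in the column space is the
projection onto the column space. -/
theorem eq_colProj {A : Matrix α β ℝ} {J : Matrix α α ℝ} (h : J * A = A) (hs : Jᵀ = J)
    (hr : ∃ W : Matrix β α ℝ, J = A * W) : J = colProj A := by
  obtain ⟨W, hW⟩ := hr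
  have h1 : colProj A * J = J := by rw [hW, ← Matrix.mul_assoc, colProj_mul_self]
  -- Transposing `J P = P` gives `P J = P`, while `P J = J` because the range of `J` lies in the
  -- column space.
  have h2 := mul_colProj_of_fix h
  have h3 := congrArg Matrix.transpose h2
  rw [Matrix.transpose_mul, colProj_transpose, hs, h1] at h3
  exact h3

/-- All nonzero singular values of `A` are at least `lam`. -/
def MatSingularGE (A : Matrix α β ℝ) (lam : ℝ) : Prop := SingularGE (lin A) (lin Aᵀ) lam

theorem MatSingularGE.transpose {A : Matrix α β ℝ} {lam : ℝ} (h : MatSingularGE A lam) :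
    MatSingularGE Aᵀ lam := SingularGE.symm h (isAdj_lin A)

theorem norm_lin_basisVec_le {A : Matrix α β ℝ} {b : ℝ} (hb : 0 ≤ b) (hA : ∀ i j, |A i j| ≤ b)
    (j : β) : ‖lin A (basisVec j)‖ ≤ √(Fintype.card α) * b :=
  norm_le_of_entries hb fun i => by
    rw [lin_apply]; simpa using hA i j

/-- Cauchy–Schwarz in each row: a row has norm at most `√|β| b`, and there are `|α|` rows. -/
theorem norm_lin_le {A : Matrix α β ℝ} {b : ℝ} (hb : 0 ≤ b) (hA : ∀ i j, |A i j| ≤ b)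
    (y : EuclideanSpace ℝ β) : ‖lin A y‖ ≤ √(Fintype.card α * Fintype.card β) * b * ‖y‖ := by
  have h : ‖lin A y‖ ≤ √(Fintype.card α) * (√(Fintype.card β) * b * ‖y‖) := by
    refine norm_le_of_entries (by positivity) fun i => ?_
    have h2 : lin A y i = inner ℝ (lin Aᵀ (basisVec i)) y := by
      rw [real_inner_comm, ← inner_basisVec (lin A y) i, real_inner_comm]
      exact isAdj_lin A _ _
    rw [h2]
    refine (abs_real_inner_le_norm _ _).trans ?_
    gcongr
    exact norm_lin_basisVec_le hb (fun i j => hA j i) _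
  refine h.trans (le_of_eq ?_)
  rw [Real.sqrt_mul (Nat.cast_nonneg _)]
  ring

/-- Weyl's inequality for matrices of the same rank. -/
theorem MatSingularGE.perturb {A B : Matrix α β ℝ} {lam ε : ℝ}
    (hs : MatSingularGE A (2 * lam * √(Fintype.card α * Fintype.card β)))
    (hc : 0 < Fintype.card α * Fintype.card β)
    (hlam : 0 < lam) (hε : 0 ≤ ε) (hεl : ε ≤ lam) (hAB : ∀ i j, |B i j - A i j| ≤ ε)
    (hrank : B.rank ≤ A.rank) : MatSingularGE B (lam * √(Fintype.card α * Fintype.card β)) := by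
  have hη : ∀ y, ‖(lin Bᵀ - lin Aᵀ) y‖ ≤ lam * √(Fintype.card α * Fintype.card β) * ‖y‖ := fun y => by
    rw [← lin_sub, mul_comm (Fintype.card α : ℝ)]
    refine (norm_lin_le hε (fun i j => hAB j i) y).trans ?_
    rw [mul_comm lam]
    gcongr
  have hc' : 0 < √(Fintype.card α * Fintype.card β : ℝ) :=
    Real.sqrt_pos.2 (by exact_mod_cast hc)
  have hr : ∀ C : Matrix α β ℝ, C.rank = Module.finrank ℝ (LinearMap.range (lin C)) := fun C => by
    rw [Matrix.rank_eq_finrank_range_toLin C (PiLp.basisFun 2 ℝ α) (PiLp.basisFun 2 ℝ β),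
      ← Matrix.toLpLin_eq_toLin]
    rfl
  have h := SingularGE.perturb (η := lam * √(Fintype.card α * Fintype.card β))
    (by nlinarith) hs (isAdj_lin B) hη (by rw [← hr, ← hr]; exact hrank)
  have e : 2 * lam * √(Fintype.card α * Fintype.card β : ℝ) -
    lam * √(Fintype.card α * Fintype.card β) = lam * √(Fintype.card α * Fintype.card β) := by ring
  rw [e] at h
  exact h

variable [Nonempty α] [Nonempty β]

/-- Delocalisation: `lam √(|α||β|) ‖P eₐ‖ ≤ ‖Aᵀ eₐ‖ ≤ √|β| b`. Bounded entries together with large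
singular values prevent the column space from concentrating on a coordinate. -/
theorem norm_colProj_basisVec_le {A : Matrix α β ℝ} {b lam : ℝ} (hb : 0 ≤ b)
    (hA : ∀ i j, |A i j| ≤ b) (hlam : 0 < lam)
    (hs : MatSingularGE A (lam * √(Fintype.card α * Fintype.card β))) (a : α) :
    ‖op (colProj A) (basisVec a)‖ ≤ b / lam / √(Fintype.card α) := by
  have h1 := SingularGE.norm_rangeProj_le hs (isAdj_lin A) (basisVec a)
  have h2 := norm_lin_basisVec_le (A := Aᵀ) hb (fun i j => hA j i) a
  rw [op_colProj]
  have ha : 0 < √(Fintype.card α : ℝ) := Real.sqrt_pos.2 (by exact_mod_cast Fintype.card_pos)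
  have hβ : 0 < √(Fintype.card β : ℝ) := Real.sqrt_pos.2 (by exact_mod_cast Fintype.card_pos)
  rw [Real.sqrt_mul (Nat.cast_nonneg _)] at h1
  rw [div_div, le_div_iff₀ (by positivity)]
  refine le_of_mul_le_mul_left ?_ hβ
  linarith

variable {A B : Matrix α β ℝ} {b lam ε : ℝ}

/-- `rangeProj_sub_le` with `η = ε √(|α||β|)`: the dimensions cancel against the singular-value
bound, and `3 = 1 + 2`. -/
theorem norm_sub_colProj_le (hε : 0 ≤ ε) (hAB : ∀ i j, |B i j - A i j| ≤ ε) (hlam : 0 < lam)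
    (hs : MatSingularGE A (lam * √(Fintype.card α * Fintype.card β)))
    (hs' : MatSingularGE B (lam * √(Fintype.card α * Fintype.card β)))
    (x : EuclideanSpace ℝ α) : ‖op (colProj B - colProj A) x‖ ≤ 3 * ε / lam * ‖x‖ := by
  have hη : ∀ y, ‖(lin Bᵀ - lin Aᵀ) y‖ ≤ √(Fintype.card α * Fintype.card β) * ε * ‖y‖ := fun y => by
    rw [← lin_sub, mul_comm (Fintype.card α : ℝ)]
    exact norm_lin_le hε (fun i j => hAB j i) y
  have hc : 0 < √(Fintype.card α * Fintype.card β : ℝ) :=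
    Real.sqrt_pos.2 (by exact_mod_cast Nat.mul_pos Fintype.card_pos Fintype.card_pos)
  have h := rangeProj_sub_le (by positivity) hs (isAdj_lin A) hs' (isAdj_lin B) hη x
  rw [op_sub_apply, op_colProj, op_colProj, div_mul_eq_mul_div, le_div_iff₀ hlam]
  refine le_of_mul_le_mul_left ?_ hc
  have h2 := hη x
  have h3 := mul_le_mul_of_nonneg_left (norm_rangeProj_le (lin A) x)
    (show 0 ≤ 2 * (√(Fintype.card α * Fintype.card β : ℝ) * ε) by positivity)
  linarith

/-- At a basis vector both terms of `rangeProj_sub_le` gain `1/√|α|`: a single row of `B - A` has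
norm at most `√|β| ε`, and the projected basis vector is small by delocalisation. -/
theorem norm_sub_colProj_basisVec_le (hb : 0 ≤ b) (hA : ∀ i j, |A i j| ≤ b) (hε : 0 ≤ ε)
    (hAB : ∀ i j, |B i j - A i j| ≤ ε) (hlam : 0 < lam)
    (hs : MatSingularGE A (lam * √(Fintype.card α * Fintype.card β)))
    (hs' : MatSingularGE B (lam * √(Fintype.card α * Fintype.card β))) (a : α) :
    ‖op (colProj B - colProj A) (basisVec a)‖ ≤
      ε * ((1 + 2 * (b / lam)) / lam) / √(Fintype.card α) := by
  have hη : ∀ y, ‖(lin Bᵀ - lin Aᵀ) y‖ ≤ √(Fintype.card α * Fintype.card β) * ε * ‖y‖ := fun y => by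
    rw [← lin_sub, mul_comm (Fintype.card α : ℝ)]
    exact norm_lin_le hε (fun i j => hAB j i) y
  have h4 : ‖(lin Bᵀ - lin Aᵀ) (basisVec a)‖ ≤ √(Fintype.card β) * ε := by
    rw [← lin_sub]; exact norm_lin_basisVec_le hε (fun i j => hAB j i) a
  have hc : 0 < √(Fintype.card α * Fintype.card β : ℝ) :=
    Real.sqrt_pos.2 (by exact_mod_cast Nat.mul_pos Fintype.card_pos Fintype.card_pos)
  have h := rangeProj_sub_le (by positivity) hs (isAdj_lin A) hs' (isAdj_lin B) hη (basisVec a)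
  have h1 := norm_colProj_basisVec_le hb hA hlam hs a
  rw [op_colProj] at h1
  rw [op_sub_apply, op_colProj, op_colProj]
  have ha : 0 < √(Fintype.card α : ℝ) := Real.sqrt_pos.2 (by exact_mod_cast Fintype.card_pos)
  have hβ : 0 < √(Fintype.card β : ℝ) := Real.sqrt_pos.2 (by exact_mod_cast Fintype.card_pos)
  rw [Real.sqrt_mul (Nat.cast_nonneg _)] at h
  set sa := √(Fintype.card α : ℝ)
  set sb := √(Fintype.card β : ℝ)
  have h5 : sa * sb * ε * ‖rangeProj (lin A) (basisVec a)‖ ≤ sa * sb * ε * (b / lam / sa) := by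
    gcongr
  have h6 : sa * sb * ε * (b / lam / sa) = sb * (ε * (b / lam)) := by field_simp
  set X := ‖rangeProj (lin B) (basisVec a) - rangeProj (lin A) (basisVec a)‖
  have h7 : sb * (lam * sa * X) ≤ sb * (ε * (1 + 2 * (b / lam))) := by
    linarith
  have h8 := le_of_mul_le_mul_left h7 hβ
  rw [le_div_iff₀ ha, ← mul_div_assoc, le_div_iff₀ hlam]
  linarith

end ColProj

end PairwiseBE

/-! ### Mode products, unfoldings, and the projection onto the Tucker tangent space -/

namespace PairwiseBE

section Mode

variable {m : ℕ} {d r : Fin (m + 1) → ℕ}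

/-- The multi-indices of the modes other than `k`. -/
abbrev Others (d : Fin (m + 1) → ℕ) (k : Fin (m + 1)) : Type :=
  (j : Fin m) → Fin (d (k.succAbove j))

/-- Splitting off the index of mode `k`. -/
def splitMode (d : Fin (m + 1) → ℕ) (k : Fin (m + 1)) :
    ((k : Fin (m + 1)) → Fin (d k)) ≃ Fin (d k) × Others d k :=
  (Fin.insertNthEquiv (fun k => Fin (d k)) k).symm

theorem splitMode_symm (k : Fin (m + 1)) (a : Fin (d k)) (b : Others d k) :
    (splitMode d k).symm (a, b) = Fin.insertNth (α := fun k => Fin (d k)) k a b := rfl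

theorem fib_splitMode (k : Fin (m + 1)) (T : Tensor d) (a : Fin (d k)) (b : Others d k) :
    fib (splitMode d k) T a b = unfold T k a b := rfl

theorem unfold_apply (T : Tensor d) (k : Fin (m + 1)) (i : (k : Fin (m + 1)) → Fin (d k)) :
    unfold T k (i k) (fun j => i (k.succAbove j)) = T i := by
  change T ((splitMode d k).symm (splitMode d k i)) = T i
  rw [Equiv.symm_apply_apply]

theorem unfold_injective (k : Fin (m + 1)) {S T : Tensor d} (h : unfold S k = unfold T k) :
    S = T := by
  ext i
  rw [← unfold_apply S k, ← unfold_apply T k, h]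

/-- Mode-`k` multiplication, as a matrix on tensors. -/
def modeMat (k : Fin (m + 1)) (A : Matrix (Fin (d k)) (Fin (d k)) ℝ) :
    Matrix ((k : Fin (m + 1)) → Fin (d k)) ((k : Fin (m + 1)) → Fin (d k)) ℝ :=
  kron (Function.update (fun k => (1 : Matrix (Fin (d k)) (Fin (d k)) ℝ)) k A)

/-- Two views of one operator: the Kronecker form composes with other modes, the slicewise form
gives norm bounds and commutation with `coMat`. -/
theorem modeMat_eq_slice (k : Fin (m + 1)) (A : Matrix (Fin (d k)) (Fin (d k)) ℝ) :
    modeMat k A = slice ((splitMode d k).trans (Equiv.prodComm _ _)) A := by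
  ext i j
  rw [slice_apply, modeMat, kron_apply, Fin.prod_univ_succAbove _ k, Function.update_self]
  have h : ∏ l, (Function.update (fun k => (1 : Matrix (Fin (d k)) (Fin (d k)) ℝ)) k A)
      (k.succAbove l) (i (k.succAbove l)) (j (k.succAbove l)) =
      ∏ l : Fin m, (1 : Matrix (Fin (d (k.succAbove l))) (Fin (d (k.succAbove l))) ℝ)
      (i (k.succAbove l)) (j (k.succAbove l)) := by
    refine Finset.prod_congr rfl fun l _ => ?_
    rw [Function.update_of_ne (Fin.succAbove_ne k l)]
  rw [h]
  have h2 := congrFun₂ (kron_one (ι := Fin m) (α := fun l => Fin (d (k.succAbove l))))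
    (fun l => i (k.succAbove l)) (fun l => j (k.succAbove l))
  rw [kron_apply] at h2
  rw [h2, Matrix.one_apply]
  change _ = if (fun l => i (k.succAbove l)) = (fun l => j (k.succAbove l)) then A (i k) (j k) else 0
  split_ifs <;> simp

theorem modeMat_mul (k : Fin (m + 1)) (A B : Matrix (Fin (d k)) (Fin (d k)) ℝ) :
    modeMat k (A * B) = modeMat k A * modeMat k B := by
  rw [modeMat_eq_slice, modeMat_eq_slice, modeMat_eq_slice, slice_mul]

theorem modeMat_one (k : Fin (m + 1)) :
    modeMat k (1 : Matrix (Fin (d k)) (Fin (d k)) ℝ) = 1 := by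
  rw [modeMat_eq_slice, slice_one]

theorem modeMat_sub (k : Fin (m + 1)) (A B : Matrix (Fin (d k)) (Fin (d k)) ℝ) :
    modeMat k (A - B) = modeMat k A - modeMat k B := by
  rw [modeMat_eq_slice, modeMat_eq_slice, modeMat_eq_slice, slice_sub]

theorem modeMat_transpose (k : Fin (m + 1)) (A : Matrix (Fin (d k)) (Fin (d k)) ℝ) :
    (modeMat k A)ᵀ = modeMat k Aᵀ := by
  rw [modeMat_eq_slice, modeMat_eq_slice, slice_transpose]

/-- Multiplications along different modes commute. -/
theorem modeMat_comm {k l : Fin (m + 1)} (h : k ≠ l) (A : Matrix (Fin (d k)) (Fin (d k)) ℝ)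
    (B : Matrix (Fin (d l)) (Fin (d l)) ℝ) :
    modeMat k A * modeMat l B = modeMat l B * modeMat k A := by
  rw [modeMat, modeMat, kron_mul, kron_mul]
  congr 1
  funext j
  rcases eq_or_ne j k with rfl | hk
  · rw [Function.update_self, Function.update_of_ne h, mul_one, one_mul]
  · rw [Function.update_of_ne hk, mul_one, one_mul]

theorem modeMat_mul_kron (k : Fin (m + 1)) (A : Matrix (Fin (d k)) (Fin (d k)) ℝ)
    (V : ∀ k, Matrix (Fin (d k)) (Fin (r k)) ℝ) :
    modeMat k A * kron V = kron (Function.update V k (A * V k)) := by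
  rw [modeMat, kron_mul]
  congr 1
  funext j
  rcases eq_or_ne j k with rfl | hk
  · rw [Function.update_self, Function.update_self]
  · rw [Function.update_of_ne hk, Function.update_of_ne hk, Matrix.one_mul]

/-- Multiplication along all the modes other than `k`. -/
def coMat (k : Fin (m + 1)) (B : Matrix (Others d k) (Others d k) ℝ) :
    Matrix ((k : Fin (m + 1)) → Fin (d k)) ((k : Fin (m + 1)) → Fin (d k)) ℝ :=
  slice (splitMode d k) B

theorem coMat_modeMat_comm (k : Fin (m + 1)) (A : Matrix (Fin (d k)) (Fin (d k)) ℝ)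
    (B : Matrix (Others d k) (Others d k) ℝ) :
    coMat k B * modeMat k A = modeMat k A * coMat k B := by
  rw [modeMat_eq_slice, coMat, slice_comm]

theorem unfold_modeMat (k : Fin (m + 1)) (A : Matrix (Fin (d k)) (Fin (d k)) ℝ) (T : Tensor d) :
    unfold (op (modeMat k A) T) k = A * unfold T k := by
  ext a b
  rw [modeMat_eq_slice]
  have h := fib_slice ((splitMode d k).trans (Equiv.prodComm _ _)) A T b
  have h1 := congrArg (fun z => z a) h
  simp only [op_apply] at h1
  rw [Matrix.mul_apply]
  exact h1

theorem unfold_coMat (k : Fin (m + 1)) (B : Matrix (Others d k) (Others d k) ℝ) (T : Tensor d) :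
    unfold (op (coMat k B) T) k = unfold T k * Bᵀ := by
  ext a b
  have h := fib_slice (splitMode d k) B T a
  have h1 := congrArg (fun z => z b) h
  simp only [op_apply] at h1
  rw [Matrix.mul_apply]
  refine h1.trans (Finset.sum_congr rfl fun j _ => ?_)
  rw [fib_splitMode, Matrix.transpose_apply, mul_comm]

theorem tucker_eq (C : Tensor r) (U : ∀ k, Matrix (Fin (d k)) (Fin (r k)) ℝ) :
    tucker C U = lin (kron U) C := by
  ext i
  rw [lin_apply]
  exact Finset.sum_congr rfl fun j _ => mul_comm _ _

theorem lin_square (A : Matrix ((k : Fin (m + 1)) → Fin (d k)) ((k : Fin (m + 1)) → Fin (d k)) ℝ)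
    (T : Tensor d) : lin A T = op A T := rfl

theorem op_kron_tucker (A : ∀ k, Matrix (Fin (d k)) (Fin (d k)) ℝ) (C : Tensor r)
    (U : ∀ k, Matrix (Fin (d k)) (Fin (r k)) ℝ) :
    op (kron A) (tucker C U) = tucker C fun k => A k * U k := by
  rw [tucker_eq, tucker_eq, ← lin_square, ← lin_mul_apply, kron_mul]

theorem op_modeMat_tucker (k : Fin (m + 1)) (A : Matrix (Fin (d k)) (Fin (d k)) ℝ) (C : Tensor r)
    (U : ∀ k, Matrix (Fin (d k)) (Fin (r k)) ℝ) :
    op (modeMat k A) (tucker C U) = tucker C (Function.update U k (A * U k)) := by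
  rw [tucker_eq, tucker_eq, ← lin_square, ← lin_mul_apply, modeMat_mul_kron]

theorem unfold_tucker (k : Fin (m + 1)) (C : Tensor r)
    (U : ∀ k, Matrix (Fin (d k)) (Fin (r k)) ℝ) :
    unfold (tucker C U) k =
      U k * unfold C k * (kron fun j => U (k.succAbove j))ᵀ := by
  ext a b
  rw [Matrix.mul_assoc]
  simp only [Matrix.mul_apply, Matrix.transpose_apply, kron_apply]
  change ∑ j, _ = _
  rw [← (splitMode r k).symm.sum_comp, Fintype.sum_prod_type]
  refine Finset.sum_congr rfl fun a' _ => ?_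
  rw [Finset.mul_sum]
  refine Finset.sum_congr rfl fun b' _ => ?_
  rw [Fin.prod_univ_succAbove _ k, splitMode_symm]
  simp only [Fin.insertNth_apply_same, Fin.insertNth_apply_succAbove]
  rw [unfold]
  ring

end Mode

/-! ### Tangent projection through column and row spaces -/

namespace TuckerPoint

variable {m : ℕ} {d r : Fin (m + 1) → ℕ} (P : TuckerPoint d r)

/-- The projection onto the column space of the mode-`k` unfolding. -/
noncomputable def colMat (k : Fin (m + 1)) : Matrix (Fin (d k)) (Fin (d k)) ℝ :=
  colProj (unfold P.tensor k)

/-- The projection onto the row space of the mode-`k` unfolding. -/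
noncomputable def rowMat (k : Fin (m + 1)) : Matrix (Others d k) (Others d k) ℝ :=
  colProj (unfold P.tensor k)ᵀ

/-- The matrix of the orthogonal projection onto the tangent space. -/
noncomputable def tangentMat :
    Matrix ((k : Fin (m + 1)) → Fin (d k)) ((k : Fin (m + 1)) → Fin (d k)) ℝ :=
  kron P.colMat + ∑ k, modeMat k (1 - P.colMat k) * coMat k (P.rowMat k)

theorem kron_factor_orthonormal :
    (kron P.factor)ᵀ * kron P.factor = 1 := by
  rw [kron_transpose, kron_mul, ← kron_one]
  congr 1
  funext k
  exact P.orthonormal k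

theorem kron_others_orthonormal (k : Fin (m + 1)) :
    (kron fun j => P.factor (k.succAbove j))ᵀ * (kron fun j => P.factor (k.succAbove j)) = 1 := by
  rw [kron_transpose, kron_mul, ← kron_one]
  congr 1
  funext j
  exact P.orthonormal _

theorem unfold_tensor (k : Fin (m + 1)) :
    unfold P.tensor k =
      P.factor k * unfold P.core k * (kron fun j => P.factor (k.succAbove j))ᵀ :=
  unfold_tucker k _ _

/-- The unfolding of the core has a right inverse. -/
theorem exists_core_inverse (k : Fin (m + 1)) : ∃ R : Matrix (Others r k) (Fin (r k)) ℝ,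
    unfold P.core k * R = 1 := by
  have h3 : (unfold P.core k).rank = r k := by
    have := (show LinearIndependent ℝ (unfold P.core k).row from P.full_rank k).rank_matrix
    simpa using this
  have h4 : Function.Surjective (unfold P.core k).mulVec := by
    have h5 : LinearMap.range (unfold P.core k).mulVecLin = ⊤ :=
      Submodule.eq_top_of_finrank_eq (by rw [← Matrix.rank, h3]; simp)
    exact LinearMap.range_eq_top.1 h5
  exact Matrix.mulVec_surjective_iff_exists_right_inverse.1 h4

/-- `U Uᵀ` is symmetric and fixes the unfolding. Its range stays inside the column space because the
core unfolding has a right inverse. -/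
theorem colMat_eq (k : Fin (m + 1)) : P.colMat k = P.factor k * (P.factor k)ᵀ := by
  symm
  refine eq_colProj ?_ ?_ ?_
  · rw [P.unfold_tensor, Matrix.mul_assoc (P.factor k) (unfold P.core k), ← Matrix.mul_assoc,
      Matrix.mul_assoc (P.factor k), P.orthonormal, Matrix.mul_one]
  · rw [Matrix.transpose_mul, Matrix.transpose_transpose]
  · obtain ⟨R, hR⟩ := P.exists_core_inverse k
    refine ⟨(kron fun j => P.factor (k.succAbove j)) * (R * (P.factor k)ᵀ), ?_⟩
    rw [P.unfold_tensor, Matrix.mul_assoc, ← Matrix.mul_assoc (_ᵀ), P.kron_others_orthonormal,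
      Matrix.one_mul, Matrix.mul_assoc, ← Matrix.mul_assoc (unfold P.core k), hR, Matrix.one_mul]

theorem colMat_mul_factor (k : Fin (m + 1)) : P.colMat k * P.factor k = P.factor k := by
  rw [colMat_eq, Matrix.mul_assoc, P.orthonormal, Matrix.mul_one]

/-- An identity matrix of size `r k` factors through the unfolding. The equality of ranks is what
Weyl's inequality needs when truth and estimate are compared. -/
theorem rank_unfold (k : Fin (m + 1)) : (unfold P.tensor k).rank = r k := by
  apply le_antisymm
  · rw [P.unfold_tensor, Matrix.mul_assoc]
    exact (Matrix.rank_mul_le_left _ _).trans (by simpa using (P.factor k).rank_le_width)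
  · obtain ⟨R, hR⟩ := P.exists_core_inverse k
    have h : (P.factor k)ᵀ * (unfold P.tensor k *
        ((kron fun j => P.factor (k.succAbove j)) * R)) = 1 := by
      rw [P.unfold_tensor, Matrix.mul_assoc, ← Matrix.mul_assoc (_ᵀ) _ R, P.kron_others_orthonormal,
        Matrix.one_mul, Matrix.mul_assoc, hR, Matrix.mul_one, P.orthonormal]
    have h1 := (Matrix.rank_mul_le_right (P.factor k)ᵀ _).trans
      (Matrix.rank_mul_le_left (unfold P.tensor k) ((kron fun j => P.factor (k.succAbove j)) * R))
    rw [h, Matrix.rank_one, Fintype.card_fin] at h1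
    exact h1

theorem op_modeMat_tensor_of_fix {k : Fin (m + 1)} {A : Matrix (Fin (d k)) (Fin (d k)) ℝ}
    (h : A * unfold P.tensor k = unfold P.tensor k) : op (modeMat k A) P.tensor = P.tensor :=
  unfold_injective k (by rw [unfold_modeMat, h])

theorem op_colMat_tensor (k : Fin (m + 1)) : op (modeMat k (P.colMat k)) P.tensor = P.tensor :=
  P.op_modeMat_tensor_of_fix (colProj_mul_self _)

theorem op_rowMat_tensor (k : Fin (m + 1)) : op (coMat k (P.rowMat k)) P.tensor = P.tensor := by
  refine unfold_injective k ?_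
  rw [unfold_coMat]
  have := congrArg Matrix.transpose (colProj_mul_self (unfold P.tensor k)ᵀ)
  rwa [Matrix.transpose_mul, Matrix.transpose_transpose] at this

/-- The range of the row-space projection consists of mode products of the tensor. -/
theorem exists_op_rowMat (k : Fin (m + 1)) (z : Tensor d) :
    ∃ W, op (coMat k (P.rowMat k)) z = op (modeMat k W) P.tensor := by
  obtain ⟨W, hW⟩ := colProj_eq_mul (unfold P.tensor k)ᵀ
  refine ⟨unfold z k * Wᵀ, unfold_injective k ?_⟩
  rw [unfold_coMat, unfold_modeMat, rowMat, hW, Matrix.transpose_mul, Matrix.transpose_transpose,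
    Matrix.mul_assoc]

/-- A mode product that fixes the tensor fixes the range of the row-space projections of the other
modes. -/
theorem modeMat_mul_rowMat {j k : Fin (m + 1)} (hjk : j ≠ k)
    {A : Matrix (Fin (d j)) (Fin (d j)) ℝ} (h : op (modeMat j A) P.tensor = P.tensor) :
    modeMat j A * coMat k (P.rowMat k) = coMat k (P.rowMat k) := by
  refine ext_op fun z => ?_
  obtain ⟨W, hW⟩ := P.exists_op_rowMat k z
  rw [op_mul_apply, hW, ← op_mul_apply, modeMat_comm hjk, op_mul_apply, h]

theorem coMat_rowMat_transpose (k : Fin (m + 1)) :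
    (coMat k (P.rowMat k))ᵀ = coMat k (P.rowMat k) := by
  rw [coMat, slice_transpose, rowMat, colProj_transpose]

theorem rowMat_mul_modeMat {j k : Fin (m + 1)} (hjk : j ≠ k)
    {A : Matrix (Fin (d j)) (Fin (d j)) ℝ} (hA : Aᵀ = A)
    (h : op (modeMat j A) P.tensor = P.tensor) :
    coMat k (P.rowMat k) * modeMat j A = coMat k (P.rowMat k) := by
  have := congrArg Matrix.transpose (P.modeMat_mul_rowMat hjk h)
  rwa [Matrix.transpose_mul, coMat_rowMat_transpose, modeMat_transpose, hA] at this

theorem tangentMat_transpose : P.tangentMatᵀ = P.tangentMat := by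
  rw [tangentMat, Matrix.transpose_add, Matrix.transpose_sum, kron_transpose]
  congr 1
  · congr 1
    funext k
    exact colProj_transpose _
  · refine Finset.sum_congr rfl fun k _ => ?_
    rw [Matrix.transpose_mul, coMat_rowMat_transpose, modeMat_transpose, Matrix.transpose_sub,
      Matrix.transpose_one, colMat, colProj_transpose, coMat_modeMat_comm]

theorem op_modeMat_tensor_eq (k : Fin (m + 1)) (W : Matrix (Fin (d k)) (Fin (d k)) ℝ) :
    op (modeMat k W) P.tensor = tucker P.core (Function.update P.factor k (W * P.factor k)) :=
  op_modeMat_tucker k W _ _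

theorem op_modeMat_tensor_mem (k : Fin (m + 1)) (W : Matrix (Fin (d k)) (Fin (d k)) ℝ) :
    op (modeMat k W) P.tensor ∈ P.tangent := by
  rw [op_modeMat_tensor_eq]
  exact Submodule.subset_span (Or.inr ⟨k, _, rfl⟩)

theorem kron_colMat : kron P.colMat = kron P.factor * (kron P.factor)ᵀ := by
  rw [kron_transpose, kron_mul]
  congr 1
  funext k
  exact P.colMat_eq k

/-- The Kronecker part produces directions that move the core; each correction produces a mode
product of the tensor, a direction that moves one factor. -/
theorem op_tangentMat_mem (z : Tensor d) : op P.tangentMat z ∈ P.tangent := by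
  rw [tangentMat, op_add_apply, op_sum_apply]
  refine add_mem ?_ (sum_mem fun k _ => ?_)
  · rw [kron_colMat, ← lin_square, lin_mul_apply, ← tucker_eq]
    exact Submodule.subset_span (Or.inl ⟨_, rfl⟩)
  · obtain ⟨W, hW⟩ := P.exists_op_rowMat k z
    rw [op_mul_apply, hW, ← op_mul_apply, ← modeMat_mul]
    exact P.op_modeMat_tensor_mem _ _

theorem op_one_sub_colMat_tensor (k : Fin (m + 1)) :
    op (modeMat k (1 - P.colMat k)) P.tensor = 0 := by
  rw [modeMat_sub, op_sub_apply, modeMat_one, op_one_apply, op_colMat_tensor, sub_self]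

theorem op_kron_piecewise_tensor (s : Finset (Fin (m + 1))) :
    op (kron (s.piecewise P.colMat fun _ => 1)) P.tensor = P.tensor := by
  change op _ (tucker P.core P.factor) = tucker P.core P.factor
  rw [op_kron_tucker]
  congr 1
  funext k
  by_cases hk : k ∈ s
  · rw [Finset.piecewise_eq_of_mem _ _ _ hk, colMat_mul_factor]
  · rw [Finset.piecewise_eq_of_notMem _ _ _ hk, Matrix.one_mul]

/-- The tangent matrix fixes the tangent directions that move one factor. -/
theorem op_tangentMat_modeMat_tensor (k : Fin (m + 1)) (W : Matrix (Fin (d k)) (Fin (d k)) ℝ) :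
    op P.tangentMat (op (modeMat k W) P.tensor) = op (modeMat k W) P.tensor := by
  have h1 : op (kron P.colMat) (op (modeMat k W) P.tensor) =
      op (modeMat k (P.colMat k)) (op (modeMat k W) P.tensor) := by
    rw [op_modeMat_tensor_eq, op_kron_tucker, op_modeMat_tucker]
    congr 1
    funext j
    rcases eq_or_ne j k with rfl | hj
    · rw [Function.update_self, Function.update_self]
    · rw [Function.update_of_ne hj, Function.update_of_ne hj, Function.update_of_ne hj,
        colMat_mul_factor]
  have h2 : op (coMat k (P.rowMat k)) (op (modeMat k W) P.tensor) = op (modeMat k W) P.tensor := by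
    rw [← op_mul_apply, coMat_modeMat_comm, op_mul_apply, op_rowMat_tensor]
  -- The Kronecker part and the `k`-th correction add up to the given vector. The other corrections
  -- vanish, since each contains some `1 - P.colMat j` that commutes through to the tensor and
  -- annihilates it.
  rw [tangentMat, op_add_apply, op_sum_apply, h1, Finset.sum_eq_single k]
  · rw [op_mul_apply, h2, modeMat_sub, op_sub_apply, modeMat_one, op_one_apply, add_sub_cancel]
  · intro j _ hj
    rw [← coMat_modeMat_comm, op_mul_apply, ← op_mul_apply (modeMat j _), modeMat_comm hj,
      op_mul_apply, op_one_sub_colMat_tensor, map_zero, map_zero]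
  · simp

/-- Corrections vanish on core directions, and a factor direction `W` is the mode product by `W Uᵀ`.
With the symmetry and range of the matrix, this identifies it as the orthogonal projection onto the
tangent space. -/
theorem op_tangentMat_of_mem {h : Tensor d} (hh : h ∈ P.tangent) : op P.tangentMat h = h := by
  induction hh using Submodule.span_induction with
  | mem x hx =>
    rcases hx with ⟨C', rfl⟩ | ⟨k, W, rfl⟩
    · rw [tangentMat, op_add_apply, op_sum_apply, op_kron_tucker]
      simp only [colMat_mul_factor]
      rw [Finset.sum_eq_zero, add_zero]
      intro k _
      rw [← coMat_modeMat_comm, op_mul_apply, op_modeMat_tucker, Matrix.sub_mul, Matrix.one_mul,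
        colMat_mul_factor, sub_self]
      have : tucker C' (Function.update P.factor k 0) = 0 := by
        ext i
        refine Finset.sum_eq_zero fun j _ => ?_
        rw [Finset.prod_eq_zero (Finset.mem_univ k) (by rw [Function.update_self]; rfl), mul_zero]
      rw [this, map_zero]
    · have e : tucker P.core (Function.update P.factor k W) =
          op (modeMat k (W * (P.factor k)ᵀ)) P.tensor := by
        rw [op_modeMat_tensor_eq, Matrix.mul_assoc, P.orthonormal, Matrix.mul_one]
      rw [e, op_tangentMat_modeMat_tensor]
  | zero => rw [map_zero]
  | add x y _ _ hx hy => rw [map_add, hx, hy]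
  | smul c x _ hx => rw [map_smul, hx]

theorem op_tangentMat_tensor : op P.tangentMat P.tensor = P.tensor := by
  have := P.op_tangentMat_modeMat_tensor 0 1
  rwa [modeMat_one, op_one_apply] at this

end TuckerPoint

end PairwiseBE

/-! ### The zero-sum constraint and the projection onto the signal tangent space -/

namespace PairwiseBE

/-- The centring matrix. -/
noncomputable def centerMat (n : ℕ) : Matrix (Fin n) (Fin n) ℝ :=
  1 - (n : ℝ)⁻¹ • Matrix.of fun _ _ => 1

theorem centerMat_transpose (n : ℕ) : (centerMat n)ᵀ = centerMat n := by
  rw [centerMat, Matrix.transpose_sub, Matrix.transpose_one, Matrix.transpose_smul]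
  rfl

theorem centerMat_mul_apply {n : ℕ} {β : Type*} (A : Matrix (Fin n) β ℝ) (a : Fin n) (b : β) :
    (centerMat n * A) a b = A a b - (n : ℝ)⁻¹ * ∑ a', A a' b := by
  rw [centerMat, Matrix.sub_mul, Matrix.one_mul, Matrix.sub_apply, Matrix.smul_mul,
    Matrix.smul_apply, Matrix.mul_apply]
  simp

theorem sum_centerMat_mul {n : ℕ} {β : Type*} (A : Matrix (Fin n) β ℝ) (b : β) :
    ∑ a, (centerMat n * A) a b = 0 := by
  rcases Nat.eq_zero_or_pos n with rfl | hn
  · simp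
  · simp only [centerMat_mul_apply, Finset.sum_sub_distrib, Finset.sum_const, Finset.card_univ,
      Fintype.card_fin, nsmul_eq_mul]
    rw [← mul_assoc, mul_inv_cancel₀ (by positivity), one_mul, sub_self]

section ZeroSum

variable {m : ℕ} {d r : Fin (m + 1) → ℕ}

theorem mem_zeroSum_iff_sum {T : Tensor d} : T ∈ zeroSum d ↔ ∀ b, ∑ a, unfold T 0 a b = 0 := by
  have e : ∀ a (b : Context d), Fin.insertNth (α := fun k => Fin (d k)) 0 a b =
      Fin.cons (α := fun k => Fin (d k)) a b := fun a b => by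
    funext j
    refine Fin.cases ?_ (fun j => ?_) j
    · exact Fin.insertNth_apply_same (α := fun k => Fin (d k)) 0 a b
    · exact Fin.insertNth_apply_succAbove (α := fun k => Fin (d k)) 0 a b j
  constructor
  · intro h b
    refine Eq.trans (Finset.sum_congr rfl fun a _ => ?_) (h b)
    exact congrArg T (e a b)
  · intro h b
    refine Eq.trans (Finset.sum_congr rfl fun a _ => ?_) (h b)
    exact (congrArg T (e a b)).symm

theorem mem_zeroSum_iff {T : Tensor d} :
    T ∈ zeroSum d ↔ centerMat (d 0) * unfold T 0 = unfold T 0 := by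
  rw [mem_zeroSum_iff_sum]
  constructor
  · intro h
    ext a b
    rw [centerMat_mul_apply, h, mul_zero, sub_zero]
  · intro h b
    rw [← h]
    exact sum_centerMat_mul _ _

/-- The matrix of the projection onto the zero-sum tensors. -/
noncomputable def zeroSumMat (d : Fin (m + 1) → ℕ) :
    Matrix ((k : Fin (m + 1)) → Fin (d k)) ((k : Fin (m + 1)) → Fin (d k)) ℝ :=
  modeMat 0 (centerMat (d 0))

theorem zeroSumMat_transpose : (zeroSumMat d)ᵀ = zeroSumMat d := by
  rw [zeroSumMat, modeMat_transpose, centerMat_transpose]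

theorem op_zeroSumMat_mem (z : Tensor d) : op (zeroSumMat d) z ∈ zeroSum d := by
  rw [mem_zeroSum_iff_sum]
  intro b
  rw [zeroSumMat, unfold_modeMat]
  exact sum_centerMat_mul _ _

theorem op_zeroSumMat_of_mem {z : Tensor d} (h : z ∈ zeroSum d) : op (zeroSumMat d) z = z :=
  unfold_injective 0 (by rw [zeroSumMat, unfold_modeMat, mem_zeroSum_iff.1 h])

/-- Centring is symmetric and idempotent, so `‖J z‖² = ⟨J z, z⟩`. -/
theorem norm_op_zeroSumMat_le (z : Tensor d) : ‖op (zeroSumMat d) z‖ ≤ ‖z‖ := by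
  have h : ‖op (zeroSumMat d) z‖ * ‖op (zeroSumMat d) z‖ ≤ ‖op (zeroSumMat d) z‖ * ‖z‖ := by
    rw [← real_inner_self_eq_norm_mul_norm]
    conv_lhs => rw [real_inner_comm, inner_op, zeroSumMat_transpose,
      op_zeroSumMat_of_mem (op_zeroSumMat_mem z)]
    rw [mul_comm]
    exact real_inner_le_norm _ _
  rcases (norm_nonneg (op (zeroSumMat d) z)).eq_or_lt with h0 | h0
  · rw [← h0]; exact norm_nonneg _
  · exact le_of_mul_le_mul_left h h0

/-- Each entry of the image is an entry minus an average of entries. -/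
theorem supLE_zeroSumMat : SupLE (zeroSumMat d) 2 := fun z t hz i => by
  have h : op (zeroSumMat d) z i = z i - (d 0 : ℝ)⁻¹ * ∑ a, unfold z 0 a (splitMode d 0 i).2 := by
    rw [← unfold_apply (op (zeroSumMat d) z) 0 i, zeroSumMat, unfold_modeMat, centerMat_mul_apply,
      unfold_apply]
    rfl
  have ht : 0 ≤ t := (abs_nonneg _).trans (hz i)
  have h1 : |(d 0 : ℝ)⁻¹ * ∑ a, unfold z 0 a (splitMode d 0 i).2| ≤ t := by
    rw [abs_mul, abs_of_nonneg (by positivity : (0 : ℝ) ≤ (d 0 : ℝ)⁻¹)]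
    have hd : (0 : ℝ) < d 0 := by
      have := (i 0).pos
      exact_mod_cast this
    rw [inv_mul_le_iff₀ hd]
    refine (Finset.abs_sum_le_sum_abs _ _).trans ((Finset.sum_le_sum (g := fun _ => t)
      fun a _ => hz ((splitMode d 0).symm (a, (splitMode d 0 i).2))).trans ?_)
    simp
  rw [h, two_mul]
  exact (abs_sub _ _).trans (add_le_add (hz i) h1)

/-! ### Compatibility of the zero-sum constraint with the tangent space -/

namespace TuckerPoint

variable (P : TuckerPoint d r)

/-- Centring fixes the mode-`0` column space and, because it fixes the tensor, the row spaces of the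
other modes; so it commutes with every summand. The product of the two commuting projections then
projects onto the intersection. -/
theorem zeroSumMat_comm (h : P.tensor ∈ zeroSum d) :
    zeroSumMat d * P.tangentMat = P.tangentMat * zeroSumMat d := by
  have h0 : centerMat (d 0) * unfold P.tensor 0 = unfold P.tensor 0 := mem_zeroSum_iff.1 h
  have hJ : op (modeMat 0 (centerMat (d 0))) P.tensor = P.tensor := op_zeroSumMat_of_mem h
  have h1 : centerMat (d 0) * P.colMat 0 = P.colMat 0 := mul_colProj_of_fix h0
  have h2 : P.colMat 0 * centerMat (d 0) = P.colMat 0 := by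
    have := congrArg Matrix.transpose h1
    rwa [Matrix.transpose_mul, centerMat_transpose, colMat, colProj_transpose] at this
  have h3 : zeroSumMat d * kron P.colMat = kron P.colMat := by
    rw [zeroSumMat, modeMat_mul_kron, h1, Function.update_eq_self]
  have h4 : kron P.colMat * zeroSumMat d = kron P.colMat := by
    have := congrArg Matrix.transpose h3
    have e : (kron P.colMat)ᵀ = kron P.colMat := by
      rw [kron_transpose]; congr 1; funext k; exact colProj_transpose _
    rwa [Matrix.transpose_mul, zeroSumMat_transpose, e] at this
  rw [tangentMat, Matrix.mul_add, Matrix.add_mul, h3, h4, Matrix.mul_sum, Matrix.sum_mul]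
  congr 1
  refine Finset.sum_congr rfl fun k _ => ?_
  rcases eq_or_ne k 0 with rfl | hk
  · rw [Matrix.mul_assoc, zeroSumMat, coMat_modeMat_comm, ← Matrix.mul_assoc, ← Matrix.mul_assoc,
      ← modeMat_mul, ← modeMat_mul, Matrix.mul_sub, Matrix.sub_mul, h1, h2, Matrix.mul_one,
      Matrix.one_mul]
  · rw [zeroSumMat, ← Matrix.mul_assoc, modeMat_comm hk.symm, Matrix.mul_assoc, Matrix.mul_assoc,
      P.modeMat_mul_rowMat hk.symm hJ, P.rowMat_mul_modeMat hk.symm (centerMat_transpose _) hJ]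

/-- The orthogonal projection onto the signal tangent space of a zero-sum tensor. -/
theorem signalTangent_starProjection (h : P.tensor ∈ zeroSum d) (z : Tensor d) :
    (P.signalTangent (zeroSum d)).starProjection z = op P.tangentMat (op (zeroSumMat d) z) := by
  refine Submodule.eq_starProjection_of_mem_orthogonal ⟨P.op_tangentMat_mem _, ?_⟩ ?_
  · rw [← op_mul_apply, ← P.zeroSumMat_comm h, op_mul_apply]
    exact op_zeroSumMat_mem _
  · rw [Submodule.mem_orthogonal]
    rintro u ⟨hu1, hu2⟩
    rw [inner_sub_right, ← P.tangentMat_transpose, ← inner_op, P.op_tangentMat_of_mem hu1,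
      ← zeroSumMat_transpose, ← inner_op, op_zeroSumMat_of_mem hu2, sub_self]

theorem signalTangent_starProjection' (h : P.tensor ∈ zeroSum d) (z : Tensor d) :
    (P.signalTangent (zeroSum d)).starProjection z = op (zeroSumMat d) (op P.tangentMat z) := by
  rw [P.signalTangent_starProjection h, ← op_mul_apply, ← P.zeroSumMat_comm h, op_mul_apply]

theorem tensor_mem_signalTangent (h : P.tensor ∈ zeroSum d) :
    P.tensor ∈ P.signalTangent (zeroSum d) := by
  refine ⟨?_, h⟩
  rw [← P.op_tangentMat_tensor]
  exact P.op_tangentMat_mem _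

end TuckerPoint

end ZeroSum

/-! ### Norm bounds for mode products and Kronecker products -/

section KronBounds

variable {ι : Type*} [Fintype ι] [DecidableEq ι] {α : ι → Type*} [∀ k, Fintype (α k)]
  [∀ k, DecidableEq (α k)]

theorem kron_update_sub (V : ∀ k, Matrix (α k) (α k) ℝ) (k : ι) (A B : Matrix (α k) (α k) ℝ) :
    kron (Function.update V k A) - kron (Function.update V k B) =
      kron (Function.update V k (A - B)) := by
  ext i j
  rw [Matrix.sub_apply, kron_apply, kron_apply, kron_apply]
  have e : ∀ C : Matrix (α k) (α k) ℝ, ∏ l, Function.update V k C l (i l) (j l) =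
      C (i k) (j k) * ∏ l ∈ Finset.univ.erase k, V l (i l) (j l) := fun C => by
    rw [← Finset.mul_prod_erase _ _ (Finset.mem_univ k), Function.update_self]
    congr 1
    refine Finset.prod_congr rfl fun l hl => ?_
    rw [Function.update_of_ne (Finset.ne_of_mem_erase hl)]
  rw [e, e, e, Matrix.sub_apply, sub_mul]

/-- Telescoping a difference of Kronecker products. -/
theorem norm_kron_sub_le (A B : ∀ k, Matrix (α k) (α k) ℝ) (z : EuclideanSpace ℝ (∀ k, α k))
    {t : ℝ} (h : ∀ (s : Finset ι) (k : ι), k ∉ s →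
      ‖op (kron (Function.update (s.piecewise A B) k (A k - B k))) z‖ ≤ t) :
    ‖op (kron A - kron B) z‖ ≤ Fintype.card ι * t := by
  have key : ∀ s : Finset ι, ‖op (kron (s.piecewise A B) - kron B) z‖ ≤ s.card * t := by
    intro s
    induction s using Finset.induction_on with
    | empty => rw [Finset.piecewise_empty, sub_self]; simp
    | insert k s hk ih =>
      have e : kron ((insert k s).piecewise A B) - kron B =
          kron (Function.update (s.piecewise A B) k (A k - B k)) +
            (kron (s.piecewise A B) - kron B) := by
        rw [← kron_update_sub, Finset.piecewise_insert]
        have : Function.update (s.piecewise A B) k (B k) = s.piecewise A B := by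
          rw [← Finset.piecewise_eq_of_notMem s A B hk, Function.update_eq_self]
        rw [this, sub_add_sub_cancel]
      rw [e, op_add_apply, Finset.card_insert_of_notMem hk]
      push_cast
      have := norm_add_le (op (kron (Function.update (s.piecewise A B) k (A k - B k))) z)
        (op (kron (s.piecewise A B) - kron B) z)
      have h2 := h s k hk
      linarith
  have := key Finset.univ
  rwa [Finset.piecewise_univ, Finset.card_univ] at this

/-- Norms of Kronecker columns factor, so each telescoping term is the product of the `c k` with one
factor multiplied by `η`. -/
theorem norm_kron_sub_basisVec_le {A B : ∀ k, Matrix (α k) (α k) ℝ} {i : ∀ k, α k} {c : ι → ℝ}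
    {η : ℝ} (hA : ∀ k, ‖op (A k) (basisVec (i k))‖ ≤ c k)
    (hB : ∀ k, ‖op (B k) (basisVec (i k))‖ ≤ c k)
    (hAB : ∀ k, ‖op (A k - B k) (basisVec (i k))‖ ≤ η * c k) :
    ‖op (kron A - kron B) (basisVec i)‖ ≤ Fintype.card ι * (η * ∏ k, c k) := by
  refine norm_kron_sub_le A B _ fun s k hk => ?_
  have hc : ∀ k, 0 ≤ c k := fun k => (norm_nonneg _).trans (hA k)
  rw [norm_kron_basisVec, ← Finset.mul_prod_erase _ _ (Finset.mem_univ k), Function.update_self,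
    ← Finset.mul_prod_erase _ c (Finset.mem_univ k), ← mul_assoc]
  refine mul_le_mul (hAB k) (Finset.prod_le_prod (fun l _ => norm_nonneg _) fun l hl => ?_)
    (Finset.prod_nonneg fun l _ => norm_nonneg _) ((norm_nonneg _).trans (hAB k))
  rw [Function.update_of_ne (Finset.ne_of_mem_erase hl)]
  by_cases hls : l ∈ s
  · rw [Finset.piecewise_eq_of_mem _ _ _ hls]; exact hA l
  · rw [Finset.piecewise_eq_of_notMem _ _ _ hls]; exact hB l

variable {m : ℕ} {d : Fin (m + 1) → ℕ}

theorem norm_modeMat_le {k : Fin (m + 1)} {A : Matrix (Fin (d k)) (Fin (d k)) ℝ} {c : ℝ}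
    (hc : 0 ≤ c) (hA : ∀ z, ‖op A z‖ ≤ c * ‖z‖) (z : Tensor d) :
    ‖op (modeMat k A) z‖ ≤ c * ‖z‖ := by
  rw [modeMat_eq_slice]
  exact norm_slice_le _ hc hA z

/-- A Kronecker product is a composition of mode products, each bounded slice by slice. -/
theorem norm_kron_le {A : ∀ k, Matrix (Fin (d k)) (Fin (d k)) ℝ} {c : Fin (m + 1) → ℝ}
    (hc : ∀ k, 0 ≤ c k) (hA : ∀ k z, ‖op (A k) z‖ ≤ c k * ‖z‖) (z : Tensor d) :
    ‖op (kron A) z‖ ≤ (∏ k, c k) * ‖z‖ := by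
  have key : ∀ s : Finset (Fin (m + 1)),
      ‖op (kron (s.piecewise A fun _ => 1)) z‖ ≤ (∏ k ∈ s, c k) * ‖z‖ := by
    intro s
    induction s using Finset.induction_on with
    | empty => rw [Finset.piecewise_empty, kron_one, op_one_apply]; simp
    | insert k s hk ih =>
      have e : kron ((insert k s).piecewise A fun _ => 1) =
          modeMat k (A k) * kron (s.piecewise A fun _ => 1) := by
        rw [modeMat_mul_kron, Finset.piecewise_insert, Finset.piecewise_eq_of_notMem _ _ _ hk,
          mul_one]
      rw [e, op_mul_apply, Finset.prod_insert hk, mul_assoc]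
      exact (norm_modeMat_le (hc k) (hA k) _).trans (mul_le_mul_of_nonneg_left ih (hc k))
  have := key Finset.univ
  rwa [Finset.piecewise_univ] at this

theorem norm_kron_sub_le_of_contraction {A B : ∀ k, Matrix (Fin (d k)) (Fin (d k)) ℝ} {η : ℝ}
    (hη : 0 ≤ η) (hA : ∀ k z, ‖op (A k) z‖ ≤ ‖z‖) (hB : ∀ k z, ‖op (B k) z‖ ≤ ‖z‖)
    (hAB : ∀ k z, ‖op (A k - B k) z‖ ≤ η * ‖z‖) (z : Tensor d) :
    ‖op (kron A - kron B) z‖ ≤ (m + 1) * (η * ‖z‖) := by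
  have h := norm_kron_sub_le A B z (t := η * ‖z‖) fun s k hk => by
    have h := norm_kron_le (c := Function.update (fun _ => (1 : ℝ)) k η)
      (A := Function.update (s.piecewise A B) k (A k - B k)) (fun j => by
        rcases eq_or_ne j k with rfl | hj
        · rwa [Function.update_self]
        · rw [Function.update_of_ne hj]; norm_num) (fun j z => by
        rcases eq_or_ne j k with rfl | hj
        · rw [Function.update_self, Function.update_self]; exact hAB _ _
        · rw [Function.update_of_ne hj, Function.update_of_ne hj, one_mul]
          by_cases hs : j ∈ s
          · rw [Finset.piecewise_eq_of_mem _ _ _ hs]; exact hA _ _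
          · rw [Finset.piecewise_eq_of_notMem _ _ _ hs]; exact hB _ _) z
    rwa [Finset.prod_update_of_mem (Finset.mem_univ k), Finset.prod_const_one, mul_one] at h
  rw [Fintype.card_fin] at h
  push_cast at h
  exact h

theorem supLE_modeMat {k : Fin (m + 1)} {A : Matrix (Fin (d k)) (Fin (d k)) ℝ} {c : ℝ}
    (hA : ∀ a, ‖op Aᵀ (basisVec a)‖ ≤ c) : SupLE (modeMat k A) (c * √(d k)) := by
  rw [modeMat_eq_slice]
  have := supLE_slice ((splitMode d k).trans (Equiv.prodComm _ _)) hA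
  rwa [Fintype.card_fin] at this

end KronBounds

end PairwiseBE

/-! ### Size and stability of the projection onto the signal tangent space -/

namespace PairwiseBE

variable {m : ℕ} {d r : Fin (m + 1) → ℕ}

theorem card_mul_card_others (k : Fin (m + 1)) :
    (Fintype.card (Fin (d k)) * Fintype.card (Others d k) : ℝ) = dstar d := by
  rw [dstar, Fin.prod_univ_succAbove _ k, Fintype.card_fin, Fintype.card_pi]
  push_cast
  simp

theorem le_dbar (k : Fin (m + 1)) : d k ≤ dbar d := Finset.le_sup (Finset.mem_univ k)

theorem dstar_pos (hd : ∀ k, 0 < d k) : 0 < dstar d := Finset.prod_pos fun k _ => hd k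

theorem one_le_dbar (hd : ∀ k, 0 < d k) : 1 ≤ dbar d := (hd 0).trans_le (le_dbar 0)

/-- A zero-sum tensor with bounded entries whose unfoldings are well conditioned. -/
structure TuckerPoint.Regular (P : TuckerPoint d r) (b lam : ℝ) : Prop where
  zero_sum : P.tensor ∈ zeroSum d
  bounded : ∀ i, |P.tensor i| ≤ b
  singular : ∀ k, MatSingularGE (unfold P.tensor k) (lam * √(dstar d))

/-- The constant in the row bounds for the projections. -/
noncomputable def rowConst (b lam : ℝ) : ℝ := 1 + b / lam

/-- The constant in the perturbation bounds for the projections. -/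
noncomputable def pertConst (b lam : ℝ) : ℝ := (1 + 2 * rowConst b lam) / lam

section Constants

variable {b lam : ℝ}

theorem one_le_rowConst (hb : 0 ≤ b) (hl : 0 < lam) : 1 ≤ rowConst b lam := by
  rw [rowConst]; have := div_nonneg hb hl.le; linarith

theorem pertConst_nonneg (hb : 0 ≤ b) (hl : 0 < lam) : 0 ≤ pertConst b lam := by
  have := one_le_rowConst hb hl
  rw [pertConst]; positivity

end Constants

namespace TuckerPoint

variable {P Q : TuckerPoint d r} {b lam ε : ℝ}

namespace Regular

theorem singular' (h : P.Regular b lam) (k : Fin (m + 1)) :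
    MatSingularGE (unfold P.tensor k)
      (lam * √(Fintype.card (Fin (d k)) * Fintype.card (Others d k))) := by
  rw [card_mul_card_others]; exact h.singular k

theorem singular_transpose (h : P.Regular b lam) (k : Fin (m + 1)) :
    MatSingularGE (unfold P.tensor k)ᵀ
      (lam * √(Fintype.card (Others d k) * Fintype.card (Fin (d k)))) := by
  rw [mul_comm (Fintype.card (Others d k) : ℝ)]; exact (h.singular' k).transpose

theorem entry_le (h : P.Regular b lam) (k : Fin (m + 1)) (i : Fin (d k)) (j : Others d k) :
    |unfold P.tensor k i j| ≤ b := h.bounded _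

variable (hd : ∀ k, 0 < d k) (hb : 0 ≤ b) (hl : 0 < lam)

include hd in
theorem nonempty_fin (k : Fin (m + 1)) : Nonempty (Fin (d k)) := ⟨⟨0, hd k⟩⟩

include hd in
theorem nonempty_others (k : Fin (m + 1)) : Nonempty (Others d k) := ⟨fun _ => ⟨0, hd _⟩⟩

include hd hb hl in
theorem norm_colMat_le (h : P.Regular b lam) (k : Fin (m + 1)) (a : Fin (d k)) :
    ‖op (P.colMat k) (basisVec a)‖ ≤ rowConst b lam / √(d k) := by
  have := nonempty_fin hd k
  have := nonempty_others hd k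
  have h1 := norm_colProj_basisVec_le hb (h.entry_le k) hl (h.singular' k) a
  rw [Fintype.card_fin] at h1
  refine h1.trans ?_
  rw [rowConst]
  gcongr
  linarith

include hd hb hl in
theorem norm_rowMat_le (h : P.Regular b lam) (k : Fin (m + 1)) (a : Others d k) :
    ‖op (P.rowMat k) (basisVec a)‖ ≤ rowConst b lam / √(Fintype.card (Others d k)) := by
  have := nonempty_fin hd k
  have := nonempty_others hd k
  refine (norm_colProj_basisVec_le hb (fun i j => h.entry_le k j i) hl
    (h.singular_transpose k) a).trans ?_
  rw [rowConst]
  gcongr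
  linarith

include hd hb hl in
theorem norm_colMat_sub_le (h : P.Regular b lam) (h' : Q.Regular b lam) (hε : 0 ≤ ε)
    (hPQ : ∀ i, |Q.tensor i - P.tensor i| ≤ ε) (k : Fin (m + 1)) (x : EuclideanSpace ℝ (Fin (d k))) :
    ‖op (Q.colMat k - P.colMat k) x‖ ≤ ε * pertConst b lam * ‖x‖ := by
  have := nonempty_fin hd k
  have := nonempty_others hd k
  refine (norm_sub_colProj_le hε (fun i j => hPQ _) hl (h.singular' k) (h'.singular' k) x).trans ?_
  have := one_le_rowConst hb hl
  rw [pertConst, mul_comm 3 ε, mul_div_assoc]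
  gcongr
  linarith

include hd hb hl in
theorem norm_rowMat_sub_le (h : P.Regular b lam) (h' : Q.Regular b lam) (hε : 0 ≤ ε)
    (hPQ : ∀ i, |Q.tensor i - P.tensor i| ≤ ε) (k : Fin (m + 1))
    (x : EuclideanSpace ℝ (Others d k)) :
    ‖op (Q.rowMat k - P.rowMat k) x‖ ≤ ε * pertConst b lam * ‖x‖ := by
  have := nonempty_fin hd k
  have := nonempty_others hd k
  refine (norm_sub_colProj_le hε (fun i j => hPQ _) hl (h.singular_transpose k)
    (h'.singular_transpose k) x).trans ?_
  have := one_le_rowConst hb hl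
  rw [pertConst, mul_comm 3 ε, mul_div_assoc]
  gcongr
  linarith

include hd hb hl in
theorem norm_colMat_sub_basisVec_le (h : P.Regular b lam) (h' : Q.Regular b lam) (hε : 0 ≤ ε)
    (hPQ : ∀ i, |Q.tensor i - P.tensor i| ≤ ε) (k : Fin (m + 1)) (a : Fin (d k)) :
    ‖op (Q.colMat k - P.colMat k) (basisVec a)‖ ≤ ε * pertConst b lam / √(d k) := by
  have := nonempty_fin hd k
  have := nonempty_others hd k
  have h1 := norm_sub_colProj_basisVec_le hb (h.entry_le k) hε (fun i j => hPQ _) hl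
    (h.singular' k) (h'.singular' k) a
  rw [Fintype.card_fin] at h1
  refine h1.trans ?_
  rw [pertConst, rowConst]
  gcongr
  linarith

include hd hb hl in
theorem norm_rowMat_sub_basisVec_le (h : P.Regular b lam) (h' : Q.Regular b lam) (hε : 0 ≤ ε)
    (hPQ : ∀ i, |Q.tensor i - P.tensor i| ≤ ε) (k : Fin (m + 1)) (a : Others d k) :
    ‖op (Q.rowMat k - P.rowMat k) (basisVec a)‖ ≤
      ε * pertConst b lam / √(Fintype.card (Others d k)) := by
  have := nonempty_fin hd k
  have := nonempty_others hd k
  refine (norm_sub_colProj_basisVec_le hb (fun i j => h.entry_le k j i) hε (fun i j => hPQ _) hl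
    (h.singular_transpose k) (h'.singular_transpose k) a).trans ?_
  rw [pertConst, rowConst]
  gcongr
  linarith

end Regular

end TuckerPoint

/-! #### Combining the modes -/

/-- The other modes have `d⋆ / d k` joint indices, at least `d⋆ / d̄`. -/
theorem div_sqrt_others_le (hd : ∀ k, 0 < d k) (k : Fin (m + 1)) {c : ℝ} (hc : 0 ≤ c) :
    c / √(Fintype.card (Others d k)) ≤ c * √((dbar d : ℝ) / dstar d) := by
  have h1 : (0 : ℝ) < Fintype.card (Others d k) := by
    have : Nonempty (Others d k) := ⟨fun _ => ⟨0, hd _⟩⟩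
    exact_mod_cast Fintype.card_pos
  have h2 := card_mul_card_others (d := d) k
  rw [Fintype.card_fin] at h2
  rw [div_eq_mul_inv, ← Real.sqrt_inv]
  gcongr
  rw [le_div_iff₀ (by exact_mod_cast dstar_pos hd), ← h2, mul_comm, mul_assoc,
    mul_inv_cancel₀ h1.ne', mul_one]
  exact_mod_cast le_dbar k

/-- The full product gives the smaller factor `1/√d⋆`; it is weakened to `√(d̄/d⋆)` so that all
parts of the projection share one scale. -/
theorem prod_div_sqrt_le (hd : ∀ k, 0 < d k) {c : ℝ} (hc : 0 ≤ c) :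
    ∏ k, c / √(d k) ≤ c ^ (m + 1) * √((dbar d : ℝ) / dstar d) := by
  have h0 : (0 : ℝ) < dstar d := by exact_mod_cast dstar_pos hd
  rw [Finset.prod_div_distrib, Finset.prod_const, Finset.card_univ, Fintype.card_fin,
    ← Real.sqrt_prod _ fun k _ => Nat.cast_nonneg _, div_eq_mul_inv, ← Real.sqrt_inv]
  gcongr
  rw [← Nat.cast_prod, ← dstar, inv_eq_one_div]
  gcongr
  exact_mod_cast one_le_dbar hd

namespace TuckerPoint

variable {P Q : TuckerPoint d r} {b lam ε : ℝ}

theorem norm_coMat_le {k : Fin (m + 1)} {B : Matrix (Others d k) (Others d k) ℝ} {c : ℝ}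
    (hc : 0 ≤ c) (hB : ∀ z, ‖op B z‖ ≤ c * ‖z‖) (z : Tensor d) : ‖op (coMat k B) z‖ ≤ c * ‖z‖ :=
  norm_slice_le _ hc hB z

theorem norm_coMat_basisVec (k : Fin (m + 1)) (B : Matrix (Others d k) (Others d k) ℝ)
    (i : (k : Fin (m + 1)) → Fin (d k)) :
    ‖op (coMat k B) (basisVec i)‖ = ‖op B (basisVec (splitMode d k i).2)‖ :=
  norm_slice_basisVec _ _ _

theorem norm_modeMat_one_sub_le (P : TuckerPoint d r) (k : Fin (m + 1)) (z : Tensor d) :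
    ‖op (modeMat k (1 - P.colMat k)) z‖ ≤ ‖z‖ := by
  have := norm_modeMat_le (c := 1) zero_le_one
    (fun x => by rw [one_mul]; exact norm_op_one_sub_colProj_le (unfold P.tensor k) x) z
  rwa [one_mul] at this

theorem norm_coMat_rowMat_le (P : TuckerPoint d r) (k : Fin (m + 1)) (z : Tensor d) :
    ‖op (coMat k (P.rowMat k)) z‖ ≤ ‖z‖ := by
  have := norm_coMat_le (c := 1) zero_le_one
    (fun x => by rw [one_mul]; exact norm_op_colProj_le (unfold P.tensor k)ᵀ x) z
  rwa [one_mul] at this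

theorem coMat_sub (k : Fin (m + 1)) (B C : Matrix (Others d k) (Others d k) ℝ) :
    coMat k (B - C) = coMat k B - coMat k C := slice_sub _ _ _

/-- Splitting the difference of the correction terms. -/
theorem correction_sub (P Q : TuckerPoint d r) (k : Fin (m + 1)) (z : Tensor d) :
    op (modeMat k (1 - Q.colMat k) * coMat k (Q.rowMat k)) z -
      op (modeMat k (1 - P.colMat k) * coMat k (P.rowMat k)) z =
    op (modeMat k (1 - Q.colMat k)) (op (coMat k (Q.rowMat k - P.rowMat k)) z) -
      op (modeMat k (Q.colMat k - P.colMat k)) (op (coMat k (P.rowMat k)) z) := by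
  rw [op_mul_apply, op_mul_apply, coMat_sub, op_sub_apply, map_sub (op (modeMat k _))]
  simp only [modeMat_sub, op_sub_apply]
  abel

theorem tangentMat_sub (P Q : TuckerPoint d r) (z : Tensor d) :
    op Q.tangentMat z - op P.tangentMat z = op (kron Q.colMat - kron P.colMat) z +
      ∑ k, (op (modeMat k (1 - Q.colMat k)) (op (coMat k (Q.rowMat k - P.rowMat k)) z) -
      op (modeMat k (Q.colMat k - P.colMat k)) (op (coMat k (P.rowMat k)) z)) := by
  simp only [← correction_sub, Finset.sum_sub_distrib, tangentMat, op_add_apply, op_sum_apply,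
    op_sub_apply]
  abel

/-! ### Operator, row and sup-norm bounds for the tangent matrix -/

namespace Regular

variable (hd : ∀ k, 0 < d k) (hb : 0 ≤ b) (hl : 0 < lam)

-- The row-space corrections determine the scale `√(d̄/d⋆)`. In each of them `1 - P.colMat k` is a
-- contraction and the row-space projection is delocalised.
include hd hb hl in
theorem norm_tangentMat_basisVec_le (h : P.Regular b lam) (i : (k : Fin (m + 1)) → Fin (d k)) :
    ‖op P.tangentMat (basisVec i)‖ ≤
      (rowConst b lam ^ (m + 1) + (m + 1) * rowConst b lam) * √((dbar d : ℝ) / dstar d) := by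
  have hK := one_le_rowConst hb hl
  rw [tangentMat, op_add_apply, op_sum_apply, add_mul]
  refine (norm_add_le _ _).trans (add_le_add ?_ ?_)
  · rw [norm_kron_basisVec]
    refine le_trans (Finset.prod_le_prod (fun k _ => norm_nonneg _) fun k _ =>
      h.norm_colMat_le hd hb hl k (i k)) (prod_div_sqrt_le hd (by linarith))
  · refine (norm_sum_le _ _).trans ((Finset.sum_le_sum fun k _ =>
      (?_ : _ ≤ rowConst b lam * √((dbar d : ℝ) / dstar d))).trans (le_of_eq ?_))
    · rw [op_mul_apply]
      refine (norm_modeMat_one_sub_le P k _).trans ?_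
      rw [norm_coMat_basisVec]
      exact (h.norm_rowMat_le hd hb hl k _).trans (div_sqrt_others_le hd k (by linarith))
    · simp [mul_assoc]

-- In every term of `tangentMat_sub`, one difference of projections supplies `ε`, and the
-- delocalised factor acting on the basis vector still supplies `√(d̄/d⋆)`.
include hd hb hl in
theorem norm_tangentMat_sub_basisVec_le (h : P.Regular b lam) (h' : Q.Regular b lam) (hε : 0 ≤ ε)
    (hPQ : ∀ i, |Q.tensor i - P.tensor i| ≤ ε) (i : (k : Fin (m + 1)) → Fin (d k)) :
    ‖op Q.tangentMat (basisVec i) - op P.tangentMat (basisVec i)‖ ≤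
      (m + 1) * (rowConst b lam ^ (m + 1) + 1 + rowConst b lam) * pertConst b lam * ε *
        √((dbar d : ℝ) / dstar d) := by
  have hK := one_le_rowConst hb hl
  have hE := pertConst_nonneg hb hl
  set s := √((dbar d : ℝ) / dstar d)
  have hs : 0 ≤ s := Real.sqrt_nonneg _
  have h1 : ‖op (kron Q.colMat - kron P.colMat) (basisVec i)‖ ≤
      (m + 1) * (ε * pertConst b lam * (rowConst b lam ^ (m + 1) * s)) := by
    have := norm_kron_sub_basisVec_le (A := Q.colMat) (B := P.colMat) (i := i)
      (c := fun k => rowConst b lam / √(d k)) (η := ε * pertConst b lam)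
      (fun k => h'.norm_colMat_le hd hb hl k _) (fun k => h.norm_colMat_le hd hb hl k _)
      (fun k => (h.norm_colMat_sub_basisVec_le hd hb hl h' hε hPQ k _).trans (by
        rw [mul_div_assoc']
        refine div_le_div_of_nonneg_right ?_ (Real.sqrt_nonneg _)
        exact le_mul_of_one_le_right (by positivity) hK))
    rw [Fintype.card_fin] at this
    push_cast at this
    refine this.trans ?_
    gcongr
    exact prod_div_sqrt_le hd (by linarith)
  have h2 : ∀ k, ‖op (modeMat k (1 - Q.colMat k))
      (op (coMat k (Q.rowMat k - P.rowMat k)) (basisVec i)) -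
      op (modeMat k (Q.colMat k - P.colMat k)) (op (coMat k (P.rowMat k)) (basisVec i))‖ ≤
      ε * pertConst b lam * s + ε * pertConst b lam * (rowConst b lam * s) := by
    intro k
    refine (norm_sub_le _ _).trans (add_le_add ?_ ?_)
    · refine (norm_modeMat_one_sub_le Q k _).trans ?_
      rw [norm_coMat_basisVec]
      exact (h.norm_rowMat_sub_basisVec_le hd hb hl h' hε hPQ k _).trans
        (div_sqrt_others_le hd k (by positivity))
    · refine (norm_modeMat_le (by positivity)
        (h.norm_colMat_sub_le hd hb hl h' hε hPQ k) _).trans ?_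
      gcongr
      rw [norm_coMat_basisVec]
      exact (h.norm_rowMat_le hd hb hl k _).trans (div_sqrt_others_le hd k (by linarith))
  rw [tangentMat_sub]
  refine (norm_add_le _ _).trans ((add_le_add h1 ((norm_sum_le _ _).trans
    (Finset.sum_le_sum fun k _ => h2 k))).trans (le_of_eq ?_))
  simp
  ring

include hd hb hl in
theorem norm_tangentMat_sub_le (h : P.Regular b lam) (h' : Q.Regular b lam) (hε : 0 ≤ ε)
    (hPQ : ∀ i, |Q.tensor i - P.tensor i| ≤ ε) (z : Tensor d) :
    ‖op Q.tangentMat z - op P.tangentMat z‖ ≤ (m + 1) * 3 * pertConst b lam * ε * ‖z‖ := by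
  have hE := pertConst_nonneg hb hl
  have h1 : ‖op (kron Q.colMat - kron P.colMat) z‖ ≤ (m + 1) * (ε * pertConst b lam * ‖z‖) :=
    norm_kron_sub_le_of_contraction (by positivity) (fun k z => norm_op_colProj_le _ z)
      (fun k z => norm_op_colProj_le _ z) (h.norm_colMat_sub_le hd hb hl h' hε hPQ) z
  have h2 : ∀ k, ‖op (modeMat k (1 - Q.colMat k)) (op (coMat k (Q.rowMat k - P.rowMat k)) z) -
      op (modeMat k (Q.colMat k - P.colMat k)) (op (coMat k (P.rowMat k)) z)‖ ≤
      ε * pertConst b lam * ‖z‖ + ε * pertConst b lam * ‖z‖ := by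
    intro k
    refine (norm_sub_le _ _).trans (add_le_add ?_ ?_)
    · refine (norm_modeMat_one_sub_le Q k _).trans ?_
      exact norm_coMat_le (by positivity) (h.norm_rowMat_sub_le hd hb hl h' hε hPQ k) z
    · refine (norm_modeMat_le (by positivity)
        (h.norm_colMat_sub_le hd hb hl h' hε hPQ k) _).trans ?_
      gcongr
      exact norm_coMat_rowMat_le P k z
  rw [tangentMat_sub]
  refine (norm_add_le _ _).trans ((add_le_add h1 ((norm_sum_le _ _).trans
    (Finset.sum_le_sum fun k _ => h2 k))).trans (le_of_eq ?_))
  simp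
  ring

-- Rows of norm `O(1/√(d k))` meet fibres of length `d k`, so the dimension cancels.
include hd hb hl in
theorem supLE_colMat (h : P.Regular b lam) (k : Fin (m + 1)) :
    SupLE (modeMat k (P.colMat k)) (rowConst b lam) := by
  have h1 := supLE_modeMat (k := k) (A := P.colMat k) (c := rowConst b lam / √(d k)) fun a => by
    rw [colMat, colProj_transpose]; exact h.norm_colMat_le hd hb hl k a
  have h2 : 0 < √(d k : ℝ) := Real.sqrt_pos.2 (by exact_mod_cast hd k)
  rwa [div_mul_cancel₀ _ h2.ne'] at h1

include hd hb hl in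
theorem supLE_rowMat (h : P.Regular b lam) (k : Fin (m + 1)) :
    SupLE (coMat k (P.rowMat k)) (rowConst b lam) := by
  have h1 : SupLE (coMat k (P.rowMat k)) _ := supLE_slice (splitMode d k) (B := P.rowMat k)
    (c := rowConst b lam / √(Fintype.card (Others d k))) fun a => by
      rw [rowMat, colProj_transpose]; exact h.norm_rowMat_le hd hb hl k a
  have h2 : 0 < √(Fintype.card (Others d k) : ℝ) := by
    have := nonempty_others hd k
    exact Real.sqrt_pos.2 (by exact_mod_cast Fintype.card_pos)
  rwa [div_mul_cancel₀ _ h2.ne'] at h1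

include hd hb hl in
theorem supLE_colMat_sub (h : P.Regular b lam) (h' : Q.Regular b lam) (hε : 0 ≤ ε)
    (hPQ : ∀ i, |Q.tensor i - P.tensor i| ≤ ε) (k : Fin (m + 1)) :
    SupLE (modeMat k (Q.colMat k - P.colMat k)) (ε * pertConst b lam) := by
  have h1 := supLE_modeMat (k := k) (A := Q.colMat k - P.colMat k)
    (c := ε * pertConst b lam / √(d k)) fun a => by
      rw [Matrix.transpose_sub, colMat, colMat, colProj_transpose, colProj_transpose]
      exact h.norm_colMat_sub_basisVec_le hd hb hl h' hε hPQ k a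
  have h2 : 0 < √(d k : ℝ) := Real.sqrt_pos.2 (by exact_mod_cast hd k)
  rwa [div_mul_cancel₀ _ h2.ne'] at h1

-- The ℓ¹ norm of a row of a delocalised projection is at most `rowConst`, which also dominates the
-- value 1 for identity factors.
include hd hb hl in
theorem supLE_kron (h : P.Regular b lam) (s : Finset (Fin (m + 1))) :
    SupLE (kron (s.piecewise P.colMat fun _ => 1)) (rowConst b lam ^ (m + 1)) := by
  have hK := one_le_rowConst hb hl
  have h1 := PairwiseBE.supLE_kron (A := s.piecewise P.colMat fun _ => 1)
    (c := fun _ => rowConst b lam) fun k a => by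
      by_cases hk : k ∈ s
      · rw [Finset.piecewise_eq_of_mem _ _ _ hk]
        have h2 : 0 < √(d k : ℝ) := Real.sqrt_pos.2 (by exact_mod_cast hd k)
        have := sum_abs_row_le (A := P.colMat k) (c := rowConst b lam / √(d k)) a (by
          rw [colMat, colProj_transpose]; exact h.norm_colMat_le hd hb hl k a)
        rwa [Fintype.card_fin, mul_div_cancel₀ _ h2.ne'] at this
      · rw [Finset.piecewise_eq_of_notMem _ _ _ hk]
        rw [Finset.sum_eq_single a (fun j _ hj => by rw [Matrix.one_apply_ne hj.symm, abs_zero])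
          (by simp)]
        simpa using hK
  simpa using h1

include hd hb hl in
theorem supLE_tangentMat (h : P.Regular b lam) :
    SupLE P.tangentMat
      (rowConst b lam ^ (m + 1) + (m + 1) * ((1 + rowConst b lam) * rowConst b lam)) := by
  rw [tangentMat]
  refine SupLE.add ?_ ?_
  · have := h.supLE_kron hd hb hl Finset.univ
    rwa [Finset.piecewise_univ] at this
  · have := SupLE.sum Finset.univ (A := fun k => modeMat k (1 - P.colMat k) * coMat k (P.rowMat k))
      (K := fun _ => (1 + rowConst b lam) * rowConst b lam) fun k _ => by
        refine SupLE.mul ?_ (h.supLE_rowMat hd hb hl k)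
        rw [modeMat_sub, modeMat_one]
        exact supLE_one.sub (h.supLE_colMat hd hb hl k)
    simpa using this

/-- The curvature of the set of low-rank tensors is of second order, entry by entry. -/
theorem abs_sub_tangentMat_aux (s : Finset (Fin (m + 1))) (hd : ∀ k, 0 < d k) (hb : 0 ≤ b)
    (hl : 0 < lam) (h : P.Regular b lam) (h' : Q.Regular b lam) (hε : 0 ≤ ε)
    (hPQ : ∀ i, |Q.tensor i - P.tensor i| ≤ ε) (i : (k : Fin (m + 1)) → Fin (d k)) :
    |(P.tensor - op (kron (s.piecewise Q.colMat fun _ => 1)) P.tensor -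
      ∑ k ∈ s, op (modeMat k (1 - Q.colMat k) * coMat k (Q.rowMat k)) P.tensor) i| ≤
      s.card * ((rowConst b lam ^ (m + 1) + rowConst b lam) * pertConst b lam * ε ^ 2) := by
  induction s using Finset.induction_on with
  | empty =>
    rw [Finset.piecewise_empty, kron_one, op_one_apply]
    simp
  | insert k s hk ih =>
    have e : kron ((insert k s).piecewise Q.colMat fun _ => 1) =
        modeMat k (Q.colMat k) * kron (s.piecewise Q.colMat fun _ => 1) := by
      rw [modeMat_mul_kron, Finset.piecewise_insert, Finset.piecewise_eq_of_notMem _ _ _ hk,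
        mul_one]
    set X := kron (s.piecewise Q.colMat fun _ => (1 : Matrix (Fin (d _)) (Fin (d _)) ℝ)) with hX
    set Y := coMat k (Q.rowMat k) with hY
    have hXc : ∀ A : Matrix (Fin (d k)) (Fin (d k)) ℝ, X * modeMat k A = modeMat k A * X := by
      intro A
      rw [modeMat_mul_kron, hX, modeMat, kron_mul]
      congr 1
      funext j
      rcases eq_or_ne j k with rfl | hj
      · rw [Function.update_self, Function.update_self, Finset.piecewise_eq_of_notMem _ _ _ hk,
          one_mul, mul_one]
      · rw [Function.update_of_ne hj, Function.update_of_ne hj, mul_one]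
    have hPfix : ∀ Z, Z * modeMat k (P.colMat k) = modeMat k (P.colMat k) * Z →
        op (modeMat k (P.colMat k)) (op Z P.tensor) = op Z P.tensor := fun Z hZ => by
      rw [← op_mul_apply, ← hZ, op_mul_apply, op_colMat_tensor]
    -- Both `X` and `Y` fix `Q.tensor`, so their difference sees only the estimation error and `w`
    -- is of order `ε`.
    set w := op (X - Y) (Q.tensor - P.tensor) with hw
    have hw' : w = op Y P.tensor - op X P.tensor := by
      rw [hw, op_sub_apply, map_sub, map_sub, hX, op_kron_piecewise_tensor, hY, op_rowMat_tensor]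
      abel
    have h1 : P.tensor - op (modeMat k (Q.colMat k) * X) P.tensor -
        (op (modeMat k (1 - Q.colMat k) * Y) P.tensor +
          ∑ k ∈ s, op (modeMat k (1 - Q.colMat k) * coMat k (Q.rowMat k)) P.tensor) =
        (P.tensor - op X P.tensor -
          ∑ k ∈ s, op (modeMat k (1 - Q.colMat k) * coMat k (Q.rowMat k)) P.tensor) +
        op (modeMat k (Q.colMat k - P.colMat k)) w := by
      rw [hw', map_sub, modeMat_sub, modeMat_sub, op_sub_apply, op_sub_apply,
        hPfix X (hXc _), hPfix Y (coMat_modeMat_comm _ _ _), op_mul_apply, op_mul_apply,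
        op_sub_apply, modeMat_one, op_one_apply]
      abel
    rw [e, Finset.sum_insert hk, h1, Finset.card_insert_of_notMem hk, PiLp.add_apply]
    -- Second order arises here: one `ε` from the moving column space, one from `w`.
    have h2 : |op (modeMat k (Q.colMat k - P.colMat k)) w i| ≤
        ε * pertConst b lam * ((rowConst b lam ^ (m + 1) + rowConst b lam) * ε) :=
      h.supLE_colMat_sub hd hb hl h' hε hPQ k w _
        (fun j => ((h'.supLE_kron hd hb hl s).sub (h'.supLE_rowMat hd hb hl k)) _ _
          (fun l => by rw [PiLp.sub_apply]; exact hPQ l) j) i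
    refine (abs_add_le _ _).trans ((add_le_add ih h2).trans (le_of_eq ?_))
    push_cast
    ring

include hd hb hl in
theorem abs_sub_tangentMat_le (h : P.Regular b lam) (h' : Q.Regular b lam) (hε : 0 ≤ ε)
    (hPQ : ∀ i, |Q.tensor i - P.tensor i| ≤ ε) (i : (k : Fin (m + 1)) → Fin (d k)) :
    |P.tensor i - op Q.tangentMat P.tensor i| ≤
      (m + 1) * ((rowConst b lam ^ (m + 1) + rowConst b lam) * pertConst b lam * ε ^ 2) := by
  have := abs_sub_tangentMat_aux Finset.univ hd hb hl h h' hε hPQ i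
  rw [Finset.piecewise_univ, Finset.card_univ, Fintype.card_fin, ← op_sum_apply, sub_sub,
    ← op_add_apply] at this
  push_cast at this
  exact this

end Regular

end TuckerPoint

end PairwiseBE

/-! ### Consequences for the signal tangent spaces of the truth and of an estimate -/

namespace PairwiseBE

variable {m : ℕ} {d r : Fin (m + 1) → ℕ}

/-- The projection onto the signal tangent space under the zero-sum constraint. -/
noncomputable abbrev TuckerPoint.proj (P : TuckerPoint d r) : Tensor d →L[ℝ] Tensor d :=
  (P.signalTangent (zeroSum d)).starProjection

/-- Size of the projections at two nearby tensors, and their difference. -/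
structure ProjBounds (P Q : TuckerPoint d r) (ε C : ℝ) : Prop where
  row : ∀ i, ‖Q.proj (basisVec i)‖ ≤ C * √((dbar d : ℝ) / dstar d)
  row_sub : ∀ i, ‖Q.proj (basisVec i) - P.proj (basisVec i)‖ ≤ C * ε * √((dbar d : ℝ) / dstar d)
  op_sub : ∀ z, ‖Q.proj z - P.proj z‖ ≤ C * ε * ‖z‖
  sup : ∀ (z : Tensor d) (t : ℝ), (∀ i, |z i| ≤ t) → ∀ i, |Q.proj z i| ≤ C * t
  curvature : ∀ i, |P.tensor i - Q.proj P.tensor i| ≤ C * ε ^ 2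

theorem exists_projBounds (m : ℕ) {b lam : ℝ} (hb : 0 ≤ b) (hl : 0 < lam) :
    ∃ C : ℝ, 1 ≤ C ∧ ∀ (d r : Fin (m + 1) → ℕ) (P Q : TuckerPoint d r) (ε : ℝ),
      (∀ k, 0 < d k) → P.Regular b lam → Q.Regular b lam → 0 ≤ ε →
      (∀ i, |Q.tensor i - P.tensor i| ≤ ε) → ProjBounds P Q ε C := by
  have hK := one_le_rowConst hb hl
  have hE := pertConst_nonneg hb hl
  set K := rowConst b lam with hKdef
  set E := pertConst b lam with hEdef
  have hK0 : 0 ≤ K := by linarith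
  set c1 := K ^ (m + 1) + (m + 1) * K with hc1
  set c2 := (m + 1) * (K ^ (m + 1) + 1 + K) * E with hc2
  set c3 := (m + 1) * 3 * E with hc3
  -- The factor 2 is the sup-norm bound of the centring matrix.
  set c4 := (K ^ (m + 1) + (m + 1) * ((1 + K) * K)) * 2 with hc4
  set c5 := (m + 1) * ((K ^ (m + 1) + K) * E) with hc5
  have h1 : 0 ≤ c1 := by positivity
  have h2 : 0 ≤ c2 := by positivity
  have h3 : 0 ≤ c3 := by positivity
  have h4 : 0 ≤ c4 := by positivity
  have h5 : 0 ≤ c5 := by positivity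
  refine ⟨1 + c1 + c2 + c3 + c4 + c5, by linarith, fun d r P Q ε hd hP hQ hε hPQ => ?_⟩
  have hs : 0 ≤ √((dbar d : ℝ) / dstar d) := Real.sqrt_nonneg _
  have hrow : ∀ P : TuckerPoint d r, P.Regular b lam → ∀ i, ‖P.proj (basisVec i)‖ ≤
      (1 + c1 + c2 + c3 + c4 + c5) * √((dbar d : ℝ) / dstar d) := fun P hP i => by
    -- With centring applied last, the basis vector meets the tangent matrix directly and the
    -- contraction afterwards is harmless; the bounds for general vectors below use the other order.
    rw [TuckerPoint.proj, P.signalTangent_starProjection' hP.zero_sum]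
    refine (norm_op_zeroSumMat_le _).trans ((hP.norm_tangentMat_basisVec_le hd hb hl i).trans ?_)
    rw [← hKdef, ← hc1]
    gcongr
    linarith
  refine ⟨hrow Q hQ, fun i => ?_, fun z => ?_, fun z t hz i => ?_, fun i => ?_⟩
  · rw [TuckerPoint.proj, TuckerPoint.proj, P.signalTangent_starProjection' hP.zero_sum,
      Q.signalTangent_starProjection' hQ.zero_sum, ← map_sub]
    refine (norm_op_zeroSumMat_le _).trans
      ((hP.norm_tangentMat_sub_basisVec_le hd hb hl hQ hε hPQ i).trans ?_)
    rw [← hKdef, ← hEdef, ← hc2]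
    gcongr
    linarith
  · rw [TuckerPoint.proj, TuckerPoint.proj, P.signalTangent_starProjection hP.zero_sum,
      Q.signalTangent_starProjection hQ.zero_sum]
    refine (hP.norm_tangentMat_sub_le hd hb hl hQ hε hPQ _).trans ?_
    rw [← hEdef, ← hc3]
    gcongr
    · linarith
    · exact norm_op_zeroSumMat_le _
  · rw [TuckerPoint.proj, Q.signalTangent_starProjection hQ.zero_sum]
    have ht : 0 ≤ t := (abs_nonneg _).trans (hz i)
    have := hQ.supLE_tangentMat hd hb hl _ _ (supLE_zeroSumMat z t hz) i
    rw [← hKdef, ← mul_assoc, ← hc4] at this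
    refine this.trans ?_
    gcongr
    linarith
  · rw [TuckerPoint.proj, Q.signalTangent_starProjection hQ.zero_sum,
      op_zeroSumMat_of_mem hP.zero_sum]
    have := hP.abs_sub_tangentMat_le hd hb hl hQ hε hPQ i
    rw [← hKdef, ← hEdef, ← mul_assoc, ← hc5] at this
    refine this.trans ?_
    gcongr
    linarith

theorem lin_square_one {α : Type*} [Fintype α] [DecidableEq α] (x : EuclideanSpace ℝ α) :
    lin (1 : Matrix α α ℝ) x = x := by
  rw [lin_eq_toLp, Matrix.one_mulVec]

/-! ### From core singular values to unfolding singular values -/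

namespace TuckerPoint

theorem norm_tensor (P : TuckerPoint d r) : ‖P.tensor‖ = ‖P.core‖ := by
  rw [tensor, tucker_eq, lin_eq_toLp, norm_mulVec_of_orthonormal P.kron_factor_orthonormal]

/-- Singular values of an unfolding of the tensor, from those of the core. -/
theorem matSingularGE_of_core {P : TuckerPoint d r} {k : Fin (m + 1)} {lam : ℝ}
    (h : ∀ x : EuclideanSpace ℝ (Fin (r k)), lam * ‖x‖ ≤ ‖lin (unfold P.core k)ᵀ x‖) :
    MatSingularGE (unfold P.tensor k) lam := by
  intro y
  set V := kron fun j => P.factor (k.succAbove j) with hV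
  have hU : ∀ x, ‖lin (P.factor k) x‖ = ‖x‖ := fun x => norm_mulVec_of_orthonormal (P.orthonormal k) x
  have hVn : ∀ x, ‖lin V x‖ = ‖x‖ := fun x =>
    norm_mulVec_of_orthonormal (P.kron_others_orthonormal k) x
  set x := lin (unfold P.core k * Vᵀ) y with hx
  have e1 : lin (unfold P.tensor k) y = lin (P.factor k) x := by
    rw [P.unfold_tensor, Matrix.mul_assoc, lin_mul_apply]
  have e2 : lin (unfold P.tensor k)ᵀ (lin (P.factor k) x) = lin V (lin (unfold P.core k)ᵀ x) := by
    have e3 : lin (P.factor k)ᵀ (lin (P.factor k) x) = x := by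
      rw [← lin_mul_apply, P.orthonormal, lin_square_one]
    rw [P.unfold_tensor, Matrix.transpose_mul, Matrix.transpose_mul, Matrix.transpose_transpose,
      lin_mul_apply, lin_mul_apply, e3]
  rw [e1, e2, hU, hVn]
  exact h x

/-- The `r k` rows of the core unfolding are images of unit vectors, each of norm at most `κ lam`. A
lower bound on the Frobenius norm thereby becomes one on `lam`. -/
theorem norm_core_sq_le {P : TuckerPoint d r} {κ lam : ℝ} {k : Fin (m + 1)}
    (h : ∀ x : EuclideanSpace ℝ (Fin (r k)), ‖lin (unfold P.core k)ᵀ x‖ ≤ κ * lam * ‖x‖) :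
    ‖P.core‖ ^ 2 ≤ r k * (κ * lam) ^ 2 := by
  rw [norm_sq_eq_sum_fib (splitMode r k)]
  have : ∀ a ∈ Finset.univ, ‖fib (splitMode r k) P.core a‖ ^ 2 ≤ (κ * lam) ^ 2 := fun a _ => by
    have h1 := h (basisVec a)
    rw [norm_basisVec, mul_one] at h1
    have e : fib (splitMode r k) P.core a = lin (unfold P.core k)ᵀ (basisVec a) := by
      ext b
      rw [lin_apply, fib_splitMode]
      simp
    rw [e]
    gcongr
  refine (Finset.sum_le_sum this).trans ?_
  simp

end TuckerPoint

/-- The lower bound on the singular values, relative to the square root of the number of entries. -/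
noncomputable def signalConst (r0 : ℕ) (κ cS : ℝ) : ℝ := cS / (√r0 * |κ| + 1)

theorem signalConst_pos (r0 : ℕ) (κ : ℝ) {cS : ℝ} (h : 0 < cS) : 0 < signalConst r0 κ cS := by
  rw [signalConst]; positivity

/-! ### Common regularity of the truth and of accurate estimates -/

namespace SignalAssumptions

variable {P Q : TuckerPoint d r} {Γ : Tensor d} {μ κ B cS α ε : ℝ} {M : ℕ}

/-- A nonzero entry of `Γ` exhibits a multi-index, so no mode is empty. -/
theorem d_pos (h : SignalAssumptions P Γ μ κ B cS α M) (k : Fin (m + 1)) : 0 < d k := by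
  have : ∃ i, Γ i ≠ 0 := by
    by_contra! hc
    exact h.functional_ne (by ext i; exact hc i)
  obtain ⟨i, _⟩ := this
  exact (i k).pos

/-- `cS √d⋆ ≤ ‖T⋆‖ = ‖core‖ ≤ √(r 0) |κ| lam` bounds the smallest singular value from below. -/
theorem singular (h : SignalAssumptions P Γ μ κ B cS α M) (k : Fin (m + 1)) :
    MatSingularGE (unfold P.tensor k) (signalConst (r 0) κ cS * √(dstar d)) := by
  obtain ⟨lam, hlam, hc⟩ := h.cond
  have h1 := TuckerPoint.norm_core_sq_le (P := P) (k := 0) (κ := κ) (lam := lam)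
    fun x => (hc 0 x).2
  have h2 : ‖P.core‖ ≤ √(r 0) * |κ| * lam := by
    refine abs_le_of_sq_le_sq' ?_ (by positivity) |>.2
    rw [mul_pow, mul_pow, Real.sq_sqrt (Nat.cast_nonneg _), sq_abs]
    linarith
  have h3 := h.signal
  rw [P.norm_tensor] at h3
  have h4 : signalConst (r 0) κ cS * √(dstar d) ≤ lam := by
    rw [signalConst, div_mul_eq_mul_div, div_le_iff₀ (by positivity)]
    nlinarith
  intro y
  refine le_trans ?_ (TuckerPoint.matSingularGE_of_core (lam := lam) (fun x => (hc k x).1) y)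
  gcongr

/-- The constants are deliberately loose, with half of the singular value given up and the entry
bound enlarged, so that every estimate within `signalConst / 2` satisfies the same condition. -/
theorem regular (h : SignalAssumptions P Γ μ κ B cS α M) (hcS : 0 < cS) :
    P.Regular (|B| + signalConst (r 0) κ cS) (signalConst (r 0) κ cS / 2) := by
  have hs := signalConst_pos (r 0) κ hcS
  refine ⟨h.zero_sum, fun i => ?_, fun k y => le_trans ?_ (h.singular k y)⟩
  · have := h.bounded i
    have := le_abs_self B
    linarith
  · gcongr
    linarith

theorem regular_of_initAccurate (h : SignalAssumptions P Γ μ κ B cS α M) (hcS : 0 < cS)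
    (hε : 0 ≤ ε) (hε' : ε ≤ signalConst (r 0) κ cS / 2) (hQ : InitAccurate P Q ε) :
    Q.Regular (|B| + signalConst (r 0) κ cS) (signalConst (r 0) κ cS / 2) := by
  have hs := signalConst_pos (r 0) κ hcS
  refine ⟨hQ.1, fun i => ?_, fun k => ?_⟩
  · have h1 := h.bounded i
    have h2 := hQ.2 i
    have h3 := le_abs_self B
    have h4 := abs_add_le (Q.tensor i - P.tensor i) (P.tensor i)
    rw [sub_add_cancel] at h4
    linarith
  · have h1 := h.singular k
    have e := card_mul_card_others (d := d) k
    rw [← e] at h1 ⊢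
    have e2 : 2 * (signalConst (r 0) κ cS / 2) = signalConst (r 0) κ cS := by ring
    have hpos : (0 : ℝ) < Fintype.card (Fin (d k)) * Fintype.card (Others d k) := by
      rw [e]; exact_mod_cast dstar_pos h.d_pos
    refine MatSingularGE.perturb (A := unfold P.tensor k) (by rw [e2]; exact h1)
      (by exact_mod_cast hpos) (by linarith) hε hε' (fun i j => hQ.2 _) ?_
    rw [P.rank_unfold, Q.rank_unfold]

/-- Bounds for the projections at the truth and at an accurate estimate. -/
theorem exists_projBounds (m : ℕ) (r : Fin (m + 1) → ℕ) (κ B : ℝ) {cS : ℝ} (hcS : 0 < cS) :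
    ∃ C : ℝ, 1 ≤ C ∧ ∀ (d : Fin (m + 1) → ℕ) (P Q : TuckerPoint d r) (Γ : Tensor d) (μ α ε : ℝ)
      (M : ℕ), SignalAssumptions P Γ μ κ B cS α M → 0 ≤ ε → ε ≤ signalConst (r 0) κ cS / 2 →
      InitAccurate P Q ε → ProjBounds P Q ε C := by
  have hs := signalConst_pos (r 0) κ hcS
  obtain ⟨C, hC, h⟩ := PairwiseBE.exists_projBounds m
    (b := |B| + signalConst (r 0) κ cS) (lam := signalConst (r 0) κ cS / 2)
    (by positivity) (by positivity)
  exact ⟨C, hC, fun d P Q Γ μ α ε M hP hε hε' hQ => h d r P Q ε hP.d_pos (hP.regular hcS)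
    (hP.regular_of_initAccurate hcS hε hε' hQ) hε hQ.2⟩

end SignalAssumptions

end PairwiseBE

/-! ### The logistic model: scores and their bounds -/

namespace PairwiseBE

open Real (sigmoid)

theorem exp_div_one_add_exp (η : ℝ) : Real.exp η / (1 + Real.exp η) = sigmoid η := by
  have h := Real.exp_pos η
  rw [Real.sigmoid_def, Real.exp_neg]
  field_simp
  ring

theorem btl_score (y : Bool) (η : ℝ) : btl.score y η = (if y then 1 else 0) - sigmoid η := by
  rw [← exp_div_one_add_exp]
  exact btl_deriv y η

/-- The mean of a function of the outcome. -/
theorem btl_integral_obs (f : Bool → ℝ) (η : ℝ) :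
    ∫ y, f y ∂(btl.obs η) = sigmoid η * f true + (1 - sigmoid η) * f false := by
  have hpos : (0 : ℝ) < 1 + Real.exp η := by positivity
  have hm : Measurable fun y => ENNReal.ofReal (Real.exp (btl.logLik y η)) := by fun_prop
  rw [SingleIndexModel.obs_apply, integral_withDensity_eq_integral_toReal_smul hm
    (Filter.Eventually.of_forall fun _ => ENNReal.ofReal_lt_top)]
  change ∫ y, _ ∂Measure.count = _
  rw [integral_fintype (Integrable.of_finite)]
  have e : ∀ x : ℝ, (ENNReal.ofReal (Real.exp x)).toReal = Real.exp x := fun x =>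
    ENNReal.toReal_ofReal (Real.exp_pos x).le
  simp only [e, Fintype.sum_bool, Measure.real, Measure.count_singleton, ENNReal.toReal_one,
    smul_eq_mul, one_mul]
  have h1 : Real.exp (btl.logLik true η) = sigmoid η := by
    rw [← exp_div_one_add_exp]
    simp only [btl, if_true, Real.exp_sub, Real.exp_log hpos]
  have h2 : Real.exp (btl.logLik false η) = 1 - sigmoid η := by
    rw [← exp_div_one_add_exp]
    simp only [btl, Bool.false_eq_true, if_false, Real.exp_sub, Real.exp_log hpos, Real.exp_zero]
    field_simp
    ring
  rw [h1, h2]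

theorem btl_fisher (η : ℝ) : btl.fisher η = sigmoid η * (1 - sigmoid η) := by
  rw [SingleIndexModel.fisher, btl_integral_obs]
  simp only [btl_score, if_true, Bool.false_eq_true, if_false]
  ring

theorem btl_fisher_pos (η : ℝ) : 0 < btl.fisher η := by
  rw [btl_fisher]
  exact mul_pos (Real.sigmoid_pos η) (sub_pos.2 (Real.sigmoid_lt_one η))

theorem btl_fisher_le (η : ℝ) : btl.fisher η ≤ 1 := by
  rw [btl_fisher]
  nlinarith [Real.sigmoid_pos η, Real.sigmoid_lt_one η]

theorem sigmoid_ge {R η : ℝ} (h : |η| ≤ R) : Real.exp (-R) / 2 ≤ sigmoid η := by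
  have h1 := (abs_le.1 h).1
  have hR : 0 ≤ R := (abs_nonneg _).trans h
  refine le_trans ?_ (Real.sigmoid_le h1)
  have h2 : Real.exp (-R) ≤ 1 := Real.exp_le_one_iff.2 (by linarith)
  rw [← exp_div_one_add_exp]
  have := Real.exp_pos (-R)
  gcongr
  linarith

theorem one_sub_sigmoid_ge {R η : ℝ} (h : |η| ≤ R) : Real.exp (-R) / 2 ≤ 1 - sigmoid η := by
  rw [← Real.sigmoid_neg]
  exact sigmoid_ge (by rwa [abs_neg])

theorem btl_fisher_ge {R η : ℝ} (h : |η| ≤ R) : Real.exp (-R) ^ 2 / 4 ≤ btl.fisher η := by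
  rw [btl_fisher]
  have h1 := mul_le_mul (sigmoid_ge h) (one_sub_sigmoid_ge h)
    (by positivity) (Real.sigmoid_nonneg η)
  linarith

/-- The mean value theorem for either order of the arguments; `σ(1 - σ)` is both the derivative of
the sigmoid and the Fisher information. -/
theorem exists_sigmoid_sub (a b : ℝ) :
    ∃ ξ, |ξ - b| ≤ |a - b| ∧ sigmoid a - sigmoid b = sigmoid ξ * (1 - sigmoid ξ) * (a - b) := by
  have key : ∀ a b : ℝ, a < b → ∃ ξ ∈ Set.Ioo a b,
      sigmoid b - sigmoid a = sigmoid ξ * (1 - sigmoid ξ) * (b - a) := fun a b h => by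
    obtain ⟨ξ, hξ, h1⟩ := exists_hasDerivAt_eq_slope sigmoid _ h
      continuous_sigmoid.continuousOn fun x _ => Real.hasDerivAt_sigmoid x
    refine ⟨ξ, hξ, ?_⟩
    rw [h1, div_mul_cancel₀ _ (sub_pos.2 h).ne']
  rcases lt_trichotomy a b with h | rfl | h
  · obtain ⟨ξ, hξ, h1⟩ := key a b h
    refine ⟨ξ, ?_, by linarith⟩
    rw [abs_of_neg (by linarith [hξ.2]), abs_of_neg (by linarith)]
    linarith [hξ.1]
  · exact ⟨a, by simp, by simp⟩
  · obtain ⟨ξ, hξ, h1⟩ := key b a h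
    refine ⟨ξ, ?_, h1⟩
    rw [abs_of_pos (by linarith [hξ.1]), abs_of_pos (by linarith)]
    linarith [hξ.2]

theorem abs_sigmoid_sub_le (a b : ℝ) : |sigmoid a - sigmoid b| ≤ |a - b| := by
  obtain ⟨ξ, _, h⟩ := exists_sigmoid_sub a b
  rw [h, abs_mul, ← btl_fisher, abs_of_pos (btl_fisher_pos ξ)]
  exact mul_le_of_le_one_left (abs_nonneg _) (btl_fisher_le ξ)

theorem abs_fisher_sub_le (a b : ℝ) : |btl.fisher a - btl.fisher b| ≤ |a - b| := by
  rw [btl_fisher, btl_fisher]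
  have e : sigmoid a * (1 - sigmoid a) - sigmoid b * (1 - sigmoid b) =
      (sigmoid a - sigmoid b) * (1 - sigmoid a - sigmoid b) := by ring
  rw [e, abs_mul]
  refine (mul_le_of_le_one_right (abs_nonneg _) ?_).trans (abs_sigmoid_sub_le a b)
  rw [abs_le]
  constructor <;> linarith [Real.sigmoid_pos a, Real.sigmoid_lt_one a, Real.sigmoid_pos b,
    Real.sigmoid_lt_one b]

/-- The mean value form of the increment, combined with the Lipschitz bound for the Fisher
information. -/
theorem abs_sigmoid_taylor_le (a b : ℝ) :
    |sigmoid a - sigmoid b - btl.fisher b * (a - b)| ≤ (a - b) ^ 2 := by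
  obtain ⟨ξ, h1, h⟩ := exists_sigmoid_sub a b
  rw [h, ← btl_fisher, ← sub_mul, abs_mul, ← sq_abs, sq]
  exact mul_le_mul_of_nonneg_right ((abs_fisher_sub_le ξ b).trans h1) (abs_nonneg _)

/-- Bounds for a score-type function on the indices of size at most `R`; `w` is the negative mean
derivative. -/
structure ScoreBounds (s : Bool → ℝ → ℝ) (w : ℝ → ℝ) (R S s₀ : ℝ) : Prop where
  measurable : Measurable fun p : Bool × ℝ => s p.1 p.2
  const_pos : 0 < S
  var_pos : 0 < s₀
  bounded : ∀ y η, |η| ≤ R → |s y η| ≤ S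
  lipschitz : ∀ y η η', |η| ≤ R → |η'| ≤ R → |s y η - s y η'| ≤ S * |η - η'|
  centred : ∀ η, ∫ y, s y η ∂(btl.obs η) = 0
  variance : ∀ η, |η| ≤ R → s₀ ≤ ∫ y, s y η ^ 2 ∂(btl.obs η)
  taylor : ∀ η η', |η| ≤ R → |η'| ≤ R →
    |∫ y, s y η' ∂(btl.obs η) - w η' * (η - η')| ≤ S * (η - η') ^ 2

/-- Under index `η`, the score evaluated at `η'` has mean exactly `σ(η) - σ(η')`; the Taylor bound
for the sigmoid therefore gives the weight `I(η')`. -/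
theorem scoreBounds_score (R : ℝ) :
    ScoreBounds btl.score btl.fisher R 1 (Real.exp (-R) ^ 2 / 4) where
  measurable := btl.measurable_score
  const_pos := one_pos
  var_pos := by positivity
  bounded y η _ := by
    rw [btl_score, abs_le]
    have h1 := Real.sigmoid_pos η
    have h2 := Real.sigmoid_lt_one η
    cases y <;> simp <;> constructor <;> linarith
  lipschitz y η η' _ _ := by
    rw [btl_score, btl_score, sub_sub_sub_cancel_left, one_mul, abs_sub_comm η]
    exact abs_sigmoid_sub_le _ _
  centred := btl.integral_score
  variance η h := btl_fisher_ge h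
  taylor η η' _ _ := by
    rw [btl_integral_obs, one_mul]
    simp only [btl_score, if_true, Bool.false_eq_true, if_false]
    have e : sigmoid η * (1 - sigmoid η') + (1 - sigmoid η) * (0 - sigmoid η') =
        sigmoid η - sigmoid η' := by ring
    rw [e]
    exact abs_sigmoid_taylor_le η η'

theorem btl_whitenedScore_true (η : ℝ) : btl.whitenedScore true η = (sigmoid η)⁻¹ := by
  rw [SingleIndexModel.whitenedScore, btl_score, btl_fisher, if_pos rfl]
  have h1 := Real.sigmoid_pos η
  have h2 := sub_pos.2 (Real.sigmoid_lt_one η)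
  field_simp

theorem btl_whitenedScore_false (η : ℝ) : btl.whitenedScore false η = -(1 - sigmoid η)⁻¹ := by
  rw [SingleIndexModel.whitenedScore, btl_score, btl_fisher, if_neg (by simp)]
  have h1 := Real.sigmoid_pos η
  have h2 := sub_pos.2 (Real.sigmoid_lt_one η)
  field_simp
  ring

theorem abs_inv_sub_inv_le {x y t : ℝ} (ht : 0 < t) (hx : t ≤ x) (hy : t ≤ y) :
    |x⁻¹ - y⁻¹| ≤ (t ^ 2)⁻¹ * |x - y| := by
  have hx0 : 0 < x := ht.trans_le hx
  have hy0 : 0 < y := ht.trans_le hy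
  rw [inv_sub_inv hx0.ne' hy0.ne', abs_div, abs_of_pos (mul_pos hx0 hy0), abs_sub_comm,
    div_eq_inv_mul, sq]
  gcongr

/-- The whitened score is `1/σ` or `-1/(1 - σ)`, and both denominators are at least `t = e^{-R}/2`
in the range: hence the bound `1/t` and the Lipschitz constant `1/t²`. Dividing by the information
normalizes the weight to 1, and the variance `1/I` is at least 1. -/
theorem scoreBounds_whitenedScore (R : ℝ) :
    ScoreBounds btl.whitenedScore (fun _ => 1) R (((Real.exp (-R) / 2) ^ 2)⁻¹ + 1 +
      (Real.exp (-R) / 2)⁻¹) 1 where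
  measurable := btl.measurable_whitenedScore
  const_pos := by positivity
  var_pos := one_pos
  bounded y η h := by
    have ht : 0 < Real.exp (-R) / 2 := by positivity
    have h0 : 0 < ((Real.exp (-R) / 2) ^ 2)⁻¹ := by positivity
    cases y
    · rw [btl_whitenedScore_false, abs_neg, abs_of_pos
        (inv_pos.2 (ht.trans_le (one_sub_sigmoid_ge h)))]
      have := inv_anti₀ ht (one_sub_sigmoid_ge h)
      linarith
    · rw [btl_whitenedScore_true, abs_of_pos (inv_pos.2 (ht.trans_le (sigmoid_ge h)))]
      have := inv_anti₀ ht (sigmoid_ge h)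
      linarith
  lipschitz y η η' h h' := by
    have ht : 0 < Real.exp (-R) / 2 := by positivity
    have h0 : 0 < ((Real.exp (-R) / 2) ^ 2)⁻¹ := by positivity
    have h1 : 0 < (Real.exp (-R) / 2)⁻¹ := by positivity
    have key : ((Real.exp (-R) / 2) ^ 2)⁻¹ * |sigmoid η - sigmoid η'| ≤
        (((Real.exp (-R) / 2) ^ 2)⁻¹ + 1 + (Real.exp (-R) / 2)⁻¹) * |η - η'| := by
      refine mul_le_mul (by linarith) (abs_sigmoid_sub_le _ _) (abs_nonneg _) (by positivity)
    refine le_trans ?_ key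
    cases y
    · rw [btl_whitenedScore_false, btl_whitenedScore_false, neg_sub_neg, abs_sub_comm]
      refine (abs_inv_sub_inv_le ht (one_sub_sigmoid_ge h) (one_sub_sigmoid_ge h')).trans
        (le_of_eq ?_)
      rw [sub_sub_sub_cancel_left, abs_sub_comm]
    · rw [btl_whitenedScore_true, btl_whitenedScore_true]
      exact abs_inv_sub_inv_le ht (sigmoid_ge h) (sigmoid_ge h')
  centred := btl.integral_whitenedScore
  variance η _ := by
    rw [btl.integral_whitenedScore_sq (btl_fisher_pos η).ne', le_div_iff₀ (btl_fisher_pos η),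
      one_mul]
    exact btl_fisher_le η
  taylor η η' _ h' := by
    have ht : 0 < Real.exp (-R) / 2 := by positivity
    have hI := btl_fisher_pos η'
    rw [btl_integral_obs, btl_whitenedScore_true, btl_whitenedScore_false, one_mul]
    have h1 := Real.sigmoid_pos η'
    have h2 := sub_pos.2 (Real.sigmoid_lt_one η')
    have e : sigmoid η * (sigmoid η')⁻¹ + (1 - sigmoid η) * -(1 - sigmoid η')⁻¹ - (η - η') =
        (sigmoid η - sigmoid η' - btl.fisher η' * (η - η')) / btl.fisher η' := by
      rw [btl_fisher]
      field_simp
      ring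
    rw [e, abs_div, abs_of_pos hI, div_le_iff₀ hI]
    refine (abs_sigmoid_taylor_le η η').trans ?_
    have h3 : 1 ≤ ((Real.exp (-R) / 2) ^ 2)⁻¹ * btl.fisher η' := by
      rw [← div_eq_inv_mul, one_le_div (by positivity)]
      have := btl_fisher_ge h'
      rw [div_pow]
      linarith
    have h4 : 0 ≤ (1 + (Real.exp (-R) / 2)⁻¹) * btl.fisher η' := by positivity
    nlinarith [sq_nonneg (η - η')]

end PairwiseBE

/-! ### The uniform comparison design -/

namespace PairwiseBE

/-- Ordered pairs count each unordered pair twice and the diagonal contributes nothing; sums over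
comparisons become free double sums. -/
theorem two_mul_sum_Ioi {n : ℕ} (g : Fin n → Fin n → ℝ) (hs : ∀ a b, g a b = g b a)
    (h0 : ∀ a, g a a = 0) : 2 * ∑ a, ∑ b ∈ Finset.Ioi a, g a b = ∑ a, ∑ b, g a b := by
  have e1 : ∀ a, ∑ b ∈ Finset.Ioi a, g a b = ∑ b, if a < b then g a b else 0 := fun a => by
    rw [← Finset.sum_filter]
    refine Finset.sum_congr ?_ fun _ _ => rfl
    ext b; simp
  have e2 : ∑ a, ∑ b, (if a < b then g a b else 0) = ∑ a, ∑ b, if b < a then g a b else 0 := by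
    rw [Finset.sum_comm]
    refine Finset.sum_congr rfl fun a _ => Finset.sum_congr rfl fun b _ => ?_
    rw [hs]
  simp only [e1]
  rw [two_mul]
  conv_lhs => rw [e2]
  nth_rw 2 [← e2]
  rw [← Finset.sum_add_distrib]
  refine Finset.sum_congr rfl fun a _ => ?_
  rw [← Finset.sum_add_distrib]
  refine Finset.sum_congr rfl fun b _ => ?_
  rcases lt_trichotomy a b with h | rfl | h
  · simp [h, h.not_gt]
  · simp [h0]
  · simp [h, h.not_gt]

section Design

variable {m : ℕ} {d : Fin (m + 1) → ℕ}

theorem inner_atom (H : Tensor d) (u : Context d) (a b : Fin (d 0)) :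
    inner ℝ H (atom u a b) = H (Fin.cons (α := fun k => Fin (d k)) a u) -
      H (Fin.cons (α := fun k => Fin (d k)) b u) := by
  rw [atom, inner_sub_right, EuclideanSpace.inner_single_right, EuclideanSpace.inner_single_right]
  simp

/-- The number of comparisons. -/
theorem card_comparisons :
    ((Fintype.card (Context d) * (d 0).choose 2 : ℕ) : ℝ) = dstar d * ((d 0 : ℝ) - 1) / 2 := by
  rw [dstar, Fin.prod_univ_succ, Fintype.card_pi]
  push_cast
  rw [Nat.cast_choose_two]
  simp only [Fintype.card_fin]
  ring

theorem effDim_eq : effDim d * d 0 = dstar d * ((d 0 : ℝ) - 1) / 2 := by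
  rw [effDim, dstar, Fin.prod_univ_succ]
  push_cast
  ring

theorem integrable_design (f : Tensor d → ℝ) : Integrable f (uniformDesign d) := by
  -- Without comparisons the normalizing factor is infinite, but the sum of Dirac masses is empty
  -- and the measure is zero.
  by_cases h : Fintype.card (Context d) * (d 0).choose 2 = 0
  · have : uniformDesign d = 0 := by
      rw [uniformDesign]
      rcases Nat.mul_eq_zero.1 h with h1 | h1
      · have : IsEmpty (Context d) := Fintype.card_eq_zero_iff.1 h1
        simp
      · have h2 : ∀ a : Fin (d 0), Finset.Ioi a = ∅ := fun a => by
          by_contra hne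
          obtain ⟨b, hb⟩ := Finset.nonempty_iff_ne_empty.2 hne
          have h3 := Finset.mem_Ioi.1 hb
          have h4 := Nat.choose_eq_zero_iff.1 h1
          have h5 := b.isLt
          have h6 : (a : ℕ) < b := h3
          omega
        simp [h2]
    rw [this]
    exact integrable_zero_measure
  · rw [uniformDesign]
    refine Integrable.smul_measure ?_ (ENNReal.inv_ne_top.2 (by exact_mod_cast h))
    refine integrable_finsetSum_measure.2 fun u _ => integrable_finsetSum_measure.2 fun a _ =>
      integrable_finsetSum_measure.2 fun b _ => ?_
    exact integrable_dirac (by simp)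

theorem integral_design (f : Tensor d → ℝ) : ∫ x, f x ∂(uniformDesign d) =
    ((Fintype.card (Context d) * (d 0).choose 2 : ℕ) : ℝ)⁻¹ *
      ∑ u : Context d, ∑ a : Fin (d 0), ∑ b ∈ Finset.Ioi a, f (atom u a b) := by
  have hi : ∀ x : Tensor d, Integrable f (Measure.dirac x) := fun x => integrable_dirac (by simp)
  rw [uniformDesign, integral_smul_measure, ENNReal.toReal_inv, ENNReal.toReal_natCast, smul_eq_mul,
    integral_finsetSum_measure fun u _ => integrable_finsetSum_measure.2 fun a _ =>
      integrable_finsetSum_measure.2 fun b _ => hi _]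
  congr 1
  refine Finset.sum_congr rfl fun u _ => ?_
  rw [integral_finsetSum_measure fun a _ => integrable_finsetSum_measure.2 fun b _ => hi _]
  refine Finset.sum_congr rfl fun a _ => ?_
  rw [integral_finsetSum_measure fun b _ => hi _]
  simp

theorem ae_design {p : Tensor d → Prop} (hp : ∀ u a b, p (atom u a b)) :
    ∀ᵐ x ∂(uniformDesign d), p x := by
  rw [uniformDesign]
  refine Measure.ae_smul_measure ?_ _
  rw [ae_iff, Measure.finsetSum_apply]
  refine Finset.sum_eq_zero fun u _ => ?_
  rw [Measure.finsetSum_apply]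
  refine Finset.sum_eq_zero fun a _ => ?_
  rw [Measure.finsetSum_apply]
  refine Finset.sum_eq_zero fun b _ => ?_
  rw [← ae_iff, ae_dirac_eq]
  exact hp u a b

theorem isProbabilityMeasure_uniformDesign (hd : ∀ k, 0 < d k) (hd0 : 2 ≤ d 0) :
    IsProbabilityMeasure (uniformDesign d) := by
  have hfin : IsFiniteMeasure (uniformDesign d) := by
    have := integrable_design (d := d) fun _ => 1
    rwa [integrable_const_iff_isFiniteMeasure one_ne_zero] at this
  have hc : 0 < Fintype.card (Context d) * (d 0).choose 2 := by
    have : Nonempty (Context d) := ⟨fun j => ⟨0, hd _⟩⟩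
    exact Nat.mul_pos Fintype.card_pos (Nat.choose_pos hd0)
  have h1 := integral_design (d := d) fun _ => 1
  have h2 : ∑ a : Fin (d 0), ((Finset.Ioi a).card : ℝ) = (d 0).choose 2 := by
    have h3 := two_mul_sum_Ioi (n := d 0) (fun a b => if a = b then 0 else 1)
      (fun a b => by simp [eq_comm]) (fun a => by simp)
    have h4 : ∀ a : Fin (d 0), ∑ b ∈ Finset.Ioi a, (if a = b then (0 : ℝ) else 1) =
        ((Finset.Ioi a).card : ℝ) := fun a => by
      rw [Finset.card_eq_sum_ones, Nat.cast_sum]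
      refine Finset.sum_congr rfl fun b hb => ?_
      rw [if_neg (Finset.mem_Ioi.1 hb).ne]
      simp
    have h5 : ∀ a : Fin (d 0), ∑ b, (if a = b then (0 : ℝ) else 1) = d 0 - 1 := fun a => by
      have : ∀ b, (if a = b then (0 : ℝ) else 1) = 1 - if a = b then 1 else 0 := fun b => by
        split_ifs <;> norm_num
      simp [this, Finset.sum_sub_distrib]
    simp only [h4, h5] at h3
    rw [Nat.cast_choose_two]
    simp only [Finset.sum_const, Finset.card_univ, Fintype.card_fin, nsmul_eq_mul] at h3
    linarith
  simp only [Finset.sum_const, nsmul_eq_mul, mul_one, h2, Finset.card_univ] at h1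
  rw [← Nat.cast_mul, inv_mul_cancel₀ (by exact_mod_cast hc.ne')] at h1
  simp only [integral_const, smul_eq_mul, mul_one] at h1
  rw [measureReal_def] at h1
  exact ⟨by rw [← ENNReal.ofReal_toReal (measure_ne_top (uniformDesign d) Set.univ), h1]; simp⟩

theorem sum_eq_sum_context (f : ((k : Fin (m + 1)) → Fin (d k)) → ℝ) :
    ∑ i, f i = ∑ u : Context d, ∑ a : Fin (d 0), f (Fin.cons (α := fun k => Fin (d k)) a u) := by
  rw [← (Fin.consEquiv fun k => Fin (d k)).sum_comp, Fintype.sum_prod_type, Finset.sum_comm]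
  rfl

/-- The design is isotropic on the zero-sum tensors. -/
theorem integral_inner_mul_inner (hd : ∀ k, 0 < d k) (hd0 : 2 ≤ d 0) {U V : Tensor d}
    (hU : U ∈ zeroSum d) :
    ∫ x, inner ℝ U x * inner ℝ V x ∂(uniformDesign d) = inner ℝ U V / effDim d := by
  have hD : (0 : ℝ) < dstar d := by exact_mod_cast dstar_pos hd
  have h2 : (2 : ℝ) ≤ d 0 := by exact_mod_cast hd0
  rw [integral_design, card_comparisons]
  have h1 : ∀ u : Context d, ∑ a : Fin (d 0), ∑ b ∈ Finset.Ioi a,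
      inner ℝ U (atom u a b) * inner ℝ V (atom u a b) =
      d 0 * ∑ a, U (Fin.cons (α := fun k => Fin (d k)) a u) *
        V (Fin.cons (α := fun k => Fin (d k)) a u) := fun u => by
    set f : Fin (d 0) → ℝ := fun a => U (Fin.cons (α := fun k => Fin (d k)) a u)
    set g : Fin (d 0) → ℝ := fun a => V (Fin.cons (α := fun k => Fin (d k)) a u)
    have hf : ∑ a, f a = 0 := hU u
    have h3 := two_mul_sum_Ioi (n := d 0) (fun a b => (f a - f b) * (g a - g b))
      (fun a b => by ring) (fun a => by ring)
    simp only [inner_atom]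
    -- After summing over `a`, the cross term vanishes since `∑ f = 0`, and `2 d₀ ∑ f g` remains.
    -- Only one of the two tensors needs to be zero-sum.
    have h4 : ∀ a, ∑ b, (f a - f b) * (g a - g b) =
        d 0 * (f a * g a) - f a * ∑ b, g b + ∑ b, f b * g b := fun a => by
      have : ∀ b, (f a - f b) * (g a - g b) = f a * g a - f a * g b - f b * g a + f b * g b :=
        fun b => by ring
      simp only [this, Finset.sum_add_distrib, Finset.sum_sub_distrib, ← Finset.mul_sum,
        ← Finset.sum_mul, hf]
      simp
      ring
    simp only [h4, Finset.sum_add_distrib, Finset.sum_sub_distrib, ← Finset.mul_sum,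
      ← Finset.sum_mul, hf] at h3
    simp at h3
    linarith
  simp only [h1]
  rw [← Finset.mul_sum, ← sum_eq_sum_context fun i => U i * V i]
  have e : ∑ i, U i * V i = inner ℝ U V := by
    simp [PiLp.inner_apply, mul_comm]
  rw [e]
  have h5 := effDim_eq (d := d)
  have h6 : effDim d ≠ 0 := by
    intro h0
    rw [h0, zero_mul] at h5
    have : (0 : ℝ) < dstar d * ((d 0 : ℝ) - 1) / 2 := by
      have : (0 : ℝ) < (d 0 : ℝ) - 1 := by linarith
      positivity
    linarith
  rw [← h5]
  field_simp

/-- `effDim` is `d⋆` times `(d₀ - 1) / (2 d₀)`, a ratio between 1/4 and 1/2 once `d₀ ≥ 2`. -/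
theorem effDim_bounds (hd : ∀ k, 0 < d k) (hd0 : 2 ≤ d 0) :
    (dstar d : ℝ) / 4 ≤ effDim d ∧ effDim d ≤ dstar d := by
  have hD : (0 : ℝ) < dstar d := by exact_mod_cast dstar_pos hd
  have h2 : (2 : ℝ) ≤ d 0 := by exact_mod_cast hd0
  have h := effDim_eq (d := d)
  constructor
  · refine le_of_mul_le_mul_right ?_ (by linarith : (0 : ℝ) < d 0)
    rw [h]; nlinarith
  · refine le_of_mul_le_mul_right ?_ (by linarith : (0 : ℝ) < d 0)
    rw [h]; nlinarith

theorem effDim_pos (hd : ∀ k, 0 < d k) (hd0 : 2 ≤ d 0) : 0 < effDim d := by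
  have hD : (0 : ℝ) < dstar d := by exact_mod_cast dstar_pos hd
  linarith [(effDim_bounds hd hd0).1]

theorem integral_inner_sq (hd : ∀ k, 0 < d k) (hd0 : 2 ≤ d 0) {U : Tensor d} (hU : U ∈ zeroSum d) :
    ∫ x, inner ℝ U x ^ 2 ∂(uniformDesign d) = ‖U‖ ^ 2 / effDim d := by
  rw [← real_inner_self_eq_norm_sq, ← integral_inner_mul_inner hd hd0 hU]
  simp only [sq]

/-- The entrywise `ℓ¹` norm. -/
def entrySum (H : Tensor d) : ℝ := ∑ i, |H i|

theorem entrySum_nonneg (H : Tensor d) : 0 ≤ entrySum H := Finset.sum_nonneg fun _ _ => abs_nonneg _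

/-- Each entry takes part in `d₀ - 1` of the `d⋆ (d₀ - 1) / 2` comparisons, and `|H_a - H_b| ≤ |H_a|
+ |H_b|`. -/
theorem integral_abs_inner_le (hd : ∀ k, 0 < d k) (hd0 : 2 ≤ d 0) (H : Tensor d) :
    ∫ x, |inner ℝ H x| ∂(uniformDesign d) ≤ 2 * entrySum H / dstar d := by
  have hD : (0 : ℝ) < dstar d := by exact_mod_cast dstar_pos hd
  have h2 : (2 : ℝ) ≤ d 0 := by exact_mod_cast hd0
  rw [integral_design, card_comparisons]
  have h1 : ∀ u : Context d, ∑ a : Fin (d 0), ∑ b ∈ Finset.Ioi a, |inner ℝ H (atom u a b)| ≤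
      ((d 0 : ℝ) - 1) * ∑ a, |H (Fin.cons (α := fun k => Fin (d k)) a u)| := fun u => by
    set f : Fin (d 0) → ℝ := fun a => H (Fin.cons (α := fun k => Fin (d k)) a u)
    have h3 := two_mul_sum_Ioi (n := d 0) (fun a b => if a = b then 0 else |f a| + |f b|)
      (fun a b => if_congr eq_comm rfl (add_comm _ _)) (fun a => by simp)
    have h4 : ∑ a : Fin (d 0), ∑ b ∈ Finset.Ioi a, |inner ℝ H (atom u a b)| ≤
        ∑ a, ∑ b ∈ Finset.Ioi a, (if a = b then 0 else |f a| + |f b|) := by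
      refine Finset.sum_le_sum fun a _ => Finset.sum_le_sum fun b hb => ?_
      rw [inner_atom, if_neg (Finset.mem_Ioi.1 hb).ne]
      exact abs_sub _ _
    have h5 : ∀ a : Fin (d 0), ∑ b, (if a = b then (0 : ℝ) else |f a| + |f b|) =
        d 0 * |f a| + ∑ b, |f b| - 2 * |f a| := fun a => by
      have : ∀ b, (if a = b then (0 : ℝ) else |f a| + |f b|) =
          |f a| + |f b| - if a = b then 2 * |f a| else 0 := fun b => by
        split_ifs with h
        · rw [← h]; ring
        · ring
      simp [this, Finset.sum_sub_distrib, Finset.sum_add_distrib]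
    simp only [h5, Finset.sum_add_distrib, Finset.sum_sub_distrib, ← Finset.mul_sum] at h3
    simp only [Finset.sum_const, Finset.card_univ, Fintype.card_fin, nsmul_eq_mul] at h3
    refine h4.trans ?_
    linarith
  have h6 : (0 : ℝ) < (d 0 : ℝ) - 1 := by linarith
  refine (mul_le_mul_of_nonneg_left (Finset.sum_le_sum fun u _ => h1 u) (by positivity)).trans ?_
  rw [← Finset.mul_sum, ← sum_eq_sum_context fun i => |H i|]
  change _ * (_ * entrySum H) ≤ _
  refine le_of_eq ?_
  field_simp

theorem abs_inner_atom_le {H : Tensor d} {t : ℝ} (hH : ∀ i, |H i| ≤ t) (u : Context d)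
    (a b : Fin (d 0)) : |inner ℝ H (atom u a b)| ≤ 2 * t := by
  rw [inner_atom, two_mul]
  exact (abs_sub _ _).trans (add_le_add (hH _) (hH _))

end Design

/-! ### Integrals against the law of a comparison -/

section Law

variable {m : ℕ} {d : Fin (m + 1) → ℕ}

theorem integrable_law (T : Tensor d) {F : Tensor d × Bool → ℝ} (hF : Measurable F)
    [IsProbabilityMeasure (uniformDesign d)] :
    Integrable F (btl.law (uniformDesign d) T) := by
  rw [SingleIndexModel.law, Measure.integrable_compProd_iff hF.aestronglyMeasurable]
  exact ⟨Filter.Eventually.of_forall fun x => Integrable.of_finite, integrable_design _⟩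

theorem integral_law (T : Tensor d) {F : Tensor d × Bool → ℝ} (hF : Measurable F)
    [IsProbabilityMeasure (uniformDesign d)] :
    ∫ z, F z ∂(btl.law (uniformDesign d) T) =
      ∫ x, ∫ y, F (x, y) ∂(btl.obs (inner ℝ T x)) ∂(uniformDesign d) := by
  have h := integrable_law T hF
  rw [SingleIndexModel.law] at h ⊢
  rw [Measure.integral_compProd h]
  rfl

theorem ae_law (T : Tensor d) {p : Tensor d → Prop} [IsProbabilityMeasure (uniformDesign d)]
    (hp : ∀ u a b, p (atom u a b)) : ∀ᵐ z ∂(btl.law (uniformDesign d) T), p z.1 := by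
  have h1 : (btl.law (uniformDesign d) T).map Prod.fst = uniformDesign d := by
    rw [SingleIndexModel.law]
    exact Measure.fst_compProd _ _
  refine ae_of_ae_map measurable_fst.aemeasurable ?_
  rw [h1]
  exact ae_design hp

end Law

end PairwiseBE

/-! ### Normal approximation for a plug-in average -/

namespace PairwiseBE

/-- `|x| ≤ 1 + x²/2 ≤ exp(x²/2)`. This bounds the sensitivity of `Φ` to a change of scale. -/
theorem abs_mul_phi_le (x : ℝ) : |x| * phi x ≤ 1 := by
  have h1 : 1 ≤ √(2 * Real.pi) := by rw [Real.one_le_sqrt]; nlinarith [Real.pi_gt_three]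
  rw [phi_eq]
  have h2 : |x| * Real.exp (-(x ^ 2 / 2)) ≤ 1 := by
    have h3 : |x| ≤ Real.exp (x ^ 2 / 2) := by
      refine le_trans ?_ (Real.add_one_le_exp _)
      rw [← sq_abs]
      nlinarith [sq_nonneg (|x| - 1)]
    have h4 : Real.exp (-(x ^ 2 / 2)) = (Real.exp (x ^ 2 / 2))⁻¹ :=
      Real.exp_neg _
    rw [h4, ← div_eq_mul_inv, div_le_one (Real.exp_pos _)]
    exact h3
  have h5 : 0 ≤ |x| * Real.exp (-(x ^ 2 / 2)) := by positivity
  have h6 : (√(2 * Real.pi))⁻¹ ≤ 1 := inv_le_one_of_one_le₀ h1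
  have h7 : 0 ≤ (√(2 * Real.pi))⁻¹ := by positivity
  nlinarith

/-- The normal distribution function under a change of scale. -/
theorem abs_Phi_div_sub_le {a : ℝ} (ha : 1 / 2 ≤ a) (t : ℝ) : |Phi (t / a) - Phi t| ≤ 2 * |a - 1| := by
  have ha0 : 0 < a := by linarith
  -- On the logarithmic scale the derivative of `Φ(eˢ t)` is `x φ(x)`, bounded by one uniformly in
  -- `t`; then `|log a| ≤ 2 |a - 1|` for `a ≥ 1/2`.
  have hder : ∀ s : ℝ, HasDerivAt (fun s => Phi (Real.exp s * t))
      (phi (Real.exp s * t) * (Real.exp s * t)) s := fun s =>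
    (hasDerivAt_Phi _).comp s ((Real.hasDerivAt_exp s).mul_const t)
  have h := (convex_univ).norm_image_sub_le_of_norm_hasDerivWithin_le (C := 1)
    (f := fun s => Phi (Real.exp s * t)) (fun x _ => (hder x).hasDerivWithinAt) (fun x _ => by
      rw [Real.norm_eq_abs, abs_mul, mul_comm, abs_of_pos (phi_pos _)]
      exact abs_mul_phi_le _) (Set.mem_univ 0) (Set.mem_univ (-Real.log a))
  simp only [Real.exp_zero, one_mul, sub_zero, Real.norm_eq_abs, abs_neg, Real.exp_neg,
    Real.exp_log ha0] at h
  rw [div_eq_inv_mul]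
  refine h.trans ?_
  have h1 := Real.log_le_sub_one_of_pos ha0
  have h2 := Real.log_le_sub_one_of_pos (inv_pos.2 ha0)
  rw [Real.log_inv] at h2
  have h3 : a⁻¹ - 1 ≤ 2 * |a - 1| := by
    rcases le_total 1 a with h | h
    · have := inv_le_one_of_one_le₀ h
      have := abs_nonneg (a - 1)
      linarith
    · rw [abs_of_nonpos (by linarith)]
      have : a⁻¹ - 1 = (1 - a) * a⁻¹ := by field_simp
      rw [this]
      have : a⁻¹ ≤ 2 := by
        rw [inv_le_comm₀ ha0 two_pos]; linarith
      nlinarith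
  have h4 := le_abs_self (a - 1)
  have h5 := abs_nonneg (a - 1)
  rw [abs_le]
  constructor <;> linarith

/-- Berry–Esseen for an average of bounded terms, standardized with a nearby standard deviation. -/
theorem IsIID.plugin {Ω 𝒵 : Type*} [MeasurableSpace Ω] [MeasurableSpace 𝒵] {n : ℕ}
    {Z : Fin n → Ω → 𝒵} {ν : Measure 𝒵} [IsProbabilityMeasure ν] {Pr : Measure Ω}
    [IsProbabilityMeasure Pr] (hZ : IsIID Z ν Pr) (hn : 0 < n) {g : 𝒵 → ℝ} (hg : Measurable g)
    {G v vg e₀ ψ : ℝ} (hG : ∀ᵐ z ∂ν, |g z| ≤ G) (hv : 0 < v) (hvg : v ≤ 2 * vg)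
    (hvar : ∫ z, (g z - ∫ z, g z ∂ν) ^ 2 ∂ν = vg ^ 2) (t : ℝ) :
    |Pr.real {ω | standardized n (fun ω => e₀ + (∑ i, g (Z i ω)) / n) ψ v ω ≤ t} - Phi t| ≤
      416 * (G / (√n * v)) + 2 * |vg / v - 1| + √n * |e₀ - ψ + ∫ z, g z ∂ν| / v := by
  set μ := ∫ z, g z ∂ν with hμ
  have hvg0 : 0 < vg := by linarith
  have hnR : (0 : ℝ) < n := by exact_mod_cast hn
  have hsn : 0 < √(n : ℝ) := Real.sqrt_pos.2 hnR
  have hgi : Integrable g ν := Integrable.of_bound hg.aestronglyMeasurable G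
    (hG.mono fun z hz => hz)
  have hG0 : 0 ≤ G := by
    obtain ⟨z, hz⟩ := hG.exists
    exact (abs_nonneg _).trans hz
  have hμG : |μ| ≤ G := by
    have h1 := norm_integral_le_of_norm_le_const (μ := ν) (f := g) (C := G)
      (hG.mono fun z hz => hz)
    simpa using h1
  have hdev : ∀ᵐ z ∂ν, |g z - μ| ≤ 2 * G := hG.mono fun z hz => by
    have := abs_sub (g z) μ
    linarith
  have hm : Measurable fun z => g z - μ := hg.sub_const μ
  have hi3 : Integrable (fun z => |g z - μ| ^ 3) ν :=
    Integrable.of_bound (hm.abs.pow_const 3).aestronglyMeasurable ((2 * G) ^ 3)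
      (hdev.mono fun z hz => by
        rw [Real.norm_of_nonneg (by positivity)]
        gcongr)
  have hi2 : Integrable (fun z => (g z - μ) ^ 2) ν :=
    Integrable.of_bound (hm.pow_const 2).aestronglyMeasurable ((2 * G) ^ 2)
      (hdev.mono fun z hz => by
        rw [Real.norm_of_nonneg (by positivity), ← sq_abs]
        gcongr)
  have h3 : ∫ z, |g z - μ| ^ 3 ∂ν ≤ 2 * G * vg ^ 2 := by
    rw [← hvar, ← integral_const_mul]
    refine integral_mono_ae hi3 (hi2.const_mul _) (hdev.mono fun z hz => ?_)
    simp only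
    rw [pow_succ, sq_abs, mul_comm]
    gcongr
  have hmean : ∫ z, (g z - μ) ∂ν = 0 := by
    rw [integral_sub hgi (integrable_const _), ← hμ]
    simp
  set a := vg / v with ha
  have ha2 : 1 / 2 ≤ a := by rw [ha, le_div_iff₀ hv]; linarith
  have ha0 : 0 < a := by linarith
  -- In terms of the centred sum normalized by its own `vg`, the event has threshold `(t - b) / a`:
  -- `b` is the standardized bias and `a` the ratio of standard deviations.
  set b := √n * (e₀ - ψ + μ) / v with hb
  have hbe := hZ.berry_esseen hn hg (μ := μ) hvg0 hmean hvar hi3 h3 ((t - b) / a)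
  have hset : {ω | standardized n (fun ω => e₀ + (∑ i, g (Z i ω)) / n) ψ v ω ≤ t} =
      {ω | (∑ i, (g (Z i ω) - μ)) / (√n * vg) ≤ (t - b) / a} := by
    ext ω
    simp only [Set.mem_ofPred_eq]
    rw [le_div_iff₀ ha0, le_sub_iff_add_le, standardized]
    have h2 : √(n : ℝ) * √n = n := Real.mul_self_sqrt hnR.le
    have e : (∑ i, (g (Z i ω) - μ)) / (√n * vg) * a + b =
        √n * (e₀ + (∑ i, g (Z i ω)) / n - ψ) / v := by
      rw [Finset.sum_sub_distrib, ha, hb]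
      simp only [Finset.sum_const, Finset.card_univ, Fintype.card_fin, nsmul_eq_mul]
      set s := √(n : ℝ) with hs
      rw [← h2]
      field_simp
      ring
    rw [e]
  have hb1 : |b| = √n * |e₀ - ψ + μ| / v := by
    rw [hb, abs_div, abs_mul, abs_of_pos hsn, abs_of_pos hv]
  rw [hset]
  have h4 := abs_Phi_div_sub_le ha2 (t - b)
  have h5 := abs_Phi_sub_le (t - b) t
  have h6 : |t - b - t| = |b| := by rw [← abs_neg]; congr 1; ring
  rw [h6, hb1] at h5
  -- `416 = 104 · 2 · 2`, from `|g - μ| ≤ 2 G` and from `v ≤ 2 vg`.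
  have h7 : 104 * (2 * G * vg ^ 2 / (√n * vg ^ 3)) ≤ 416 * (G / (√n * v)) := by
    have e : 2 * G * vg ^ 2 / (√n * vg ^ 3) = 2 * (G / (√n * vg)) := by field_simp
    have h8 : G / (√n * vg) ≤ 2 * (G / (√n * v)) := by
      rw [mul_div_assoc', div_le_div_iff₀ (by positivity) (by positivity)]
      have := mul_le_mul_of_nonneg_left hvg (by positivity : 0 ≤ G * √(n : ℝ))
      linarith
    rw [e]
    linarith
  have tri : ∀ x y z w : ℝ, |x - w| ≤ |x - y| + |y - z| + |z - w| := fun x y z w =>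
    (abs_sub_le x z w).trans (by gcongr; exact abs_sub_le x y z)
  refine (tri _ (Phi ((t - b) / a)) (Phi (t - b)) _).trans ?_
  linarith

/-! ### Plug-in averages under the comparison design -/

section Plugin

variable {m : ℕ} {d : Fin (m + 1) → ℕ}

/-- `s(Y, ⟨T, X⟩) ⟨H, X⟩`. -/
noncomputable def scoreInfl (s : Bool → ℝ → ℝ) (T H : Tensor d) (z : Tensor d × Bool) : ℝ :=
  s z.2 (inner ℝ T z.1) * inner ℝ H z.1

theorem measurable_scoreInfl {s : Bool → ℝ → ℝ} (hs : Measurable fun p : Bool × ℝ => s p.1 p.2)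
    (T H : Tensor d) : Measurable (scoreInfl s T H) := by
  have h1 : Measurable fun z : Tensor d × Bool => s z.2 (inner ℝ T z.1) :=
    hs.comp (measurable_snd.prodMk (by fun_prop))
  exact h1.mul (by fun_prop)

/-- Cauchy–Schwarz for the design. -/
theorem integral_abs_inner_mul_le (hd : ∀ k, 0 < d k) (hd0 : 2 ≤ d 0) {U V : Tensor d}
    (hU : U ∈ zeroSum d) (hV : V ∈ zeroSum d) :
    ∫ x, |inner ℝ U x| * |inner ℝ V x| ∂(uniformDesign d) ≤ ‖U‖ * ‖V‖ / effDim d := by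
  have hδ := effDim_pos hd hd0
  rcases eq_or_ne U 0 with rfl | hU0
  · simp
  rcases eq_or_ne V 0 with rfl | hV0
  · simp
  have hu : 0 < ‖U‖ := norm_pos_iff.2 hU0
  have hv : 0 < ‖V‖ := norm_pos_iff.2 hV0
  have h : ∫ x, 2 * ‖U‖ * ‖V‖ * (|inner ℝ U x| * |inner ℝ V x|) ∂(uniformDesign d) ≤
      ∫ x, (‖V‖ ^ 2 * inner ℝ U x ^ 2 + ‖U‖ ^ 2 * inner ℝ V x ^ 2) ∂(uniformDesign d) := by
    refine integral_mono (integrable_design _) (integrable_design _) fun x => ?_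
    simp only
    rw [← sq_abs (inner ℝ U x), ← sq_abs (inner ℝ V x)]
    nlinarith [sq_nonneg (‖V‖ * |inner ℝ U x| - ‖U‖ * |inner ℝ V x|)]
  rw [integral_const_mul, integral_add (integrable_design _) (integrable_design _),
    integral_const_mul, integral_const_mul, integral_inner_sq hd hd0 hU,
    integral_inner_sq hd hd0 hV] at h
  refine le_of_mul_le_mul_left ?_ (by positivity : 0 < 2 * ‖U‖ * ‖V‖)
  refine h.trans (le_of_eq ?_)
  field_simp
  ring

variable {s : Bool → ℝ → ℝ} {w : ℝ → ℝ} {R S s₀ ε : ℝ}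

/-- The bias of a plug-in average. -/
theorem ScoreBounds.abs_integral_add_le (hs : ScoreBounds s w R S s₀) (hd : ∀ k, 0 < d k)
    (hd0 : 2 ≤ d 0) {T That H : Tensor d}
    (hT : ∀ u a b, |inner ℝ T (atom u a b)| ≤ R) (hT' : ∀ u a b, |inner ℝ That (atom u a b)| ≤ R)
    (hTT : ∀ i, |That i - T i| ≤ ε) :
    |∫ z, scoreInfl s That H z ∂(btl.law (uniformDesign d) T) +
      ∫ x, w (inner ℝ That x) * (inner ℝ (That - T) x * inner ℝ H x) ∂(uniformDesign d)| ≤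
      8 * S * ε ^ 2 * entrySum H / dstar d := by
  have := isProbabilityMeasure_uniformDesign hd hd0
  rw [integral_law T (measurable_scoreInfl hs.measurable That H),
    ← integral_add (integrable_design _) (integrable_design _)]
  have hS := hs.const_pos
  have h1 : ∀ᵐ x ∂(uniformDesign d),
      ‖∫ y, scoreInfl s That H (x, y) ∂(btl.obs (inner ℝ T x)) +
      w (inner ℝ That x) * (inner ℝ (That - T) x * inner ℝ H x)‖ ≤
      4 * S * ε ^ 2 * |inner ℝ H x| := by
    refine ae_design fun u a b => ?_
    have h2 := hs.taylor _ _ (hT u a b) (hT' u a b)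
    have h3 := abs_inner_atom_le (H := That - T) (fun i => hTT i) u a b
    simp only [scoreInfl]
    rw [integral_mul_const, Real.norm_eq_abs]
    set x := atom u a b
    have e : (∫ y, s y (inner ℝ That x) ∂(btl.obs (inner ℝ T x))) * inner ℝ H x +
        w (inner ℝ That x) * (inner ℝ (That - T) x * inner ℝ H x) =
        (∫ y, s y (inner ℝ That x) ∂(btl.obs (inner ℝ T x)) -
          w (inner ℝ That x) * (inner ℝ T x - inner ℝ That x)) * inner ℝ H x := by
      rw [inner_sub_left]; ring
    rw [e, abs_mul]
    refine mul_le_mul_of_nonneg_right (h2.trans ?_) (abs_nonneg _)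
    -- A comparison involves two entries, so the index error is at most `2ε`; averaging `|⟨H, X⟩|`
    -- supplies the other factor 2 of the constant 8.
    have h4 : (inner ℝ T x - inner ℝ That x) ^ 2 ≤ (2 * ε) ^ 2 := by
      rw [← sq_abs, abs_sub_comm, ← inner_sub_left]
      gcongr
    nlinarith
  have h5 := norm_integral_le_of_norm_le (integrable_design _) h1
  rw [integral_const_mul, Real.norm_eq_abs] at h5
  refine h5.trans ((mul_le_mul_of_nonneg_left (integral_abs_inner_le hd hd0 H)
    (by positivity)).trans (le_of_eq ?_))
  ring

/-- Mean and variance of the influence function at the truth. -/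
theorem ScoreBounds.influence_variance (hs : ScoreBounds s w R S s₀) (hd : ∀ k, 0 < d k)
    (hd0 : 2 ≤ d 0) {T H : Tensor d} (hT : ∀ u a b, |inner ℝ T (atom u a b)| ≤ R)
    (hH : H ∈ zeroSum d) :
    ∫ z, scoreInfl s T H z ∂(btl.law (uniformDesign d) T) = 0 ∧
    s₀ * ‖H‖ ^ 2 / effDim d ≤ ∫ z, scoreInfl s T H z ^ 2 ∂(btl.law (uniformDesign d) T) := by
  have := isProbabilityMeasure_uniformDesign hd hd0
  have hm := measurable_scoreInfl hs.measurable T H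
  constructor
  · rw [integral_law T hm]
    simp only [scoreInfl, integral_mul_const, hs.centred, zero_mul, integral_zero]
  · rw [integral_law T (hm.pow_const 2), mul_div_assoc, ← integral_inner_sq hd hd0 hH,
      ← integral_const_mul]
    refine integral_mono_ae (integrable_design _) (integrable_design _) (ae_design fun u a b => ?_)
    simp only [scoreInfl, mul_pow, integral_mul_const]
    exact mul_le_mul_of_nonneg_right (hs.variance _ (hT u a b)) (sq_nonneg _)

/-- The second moments of two influence functions are close. -/
theorem ScoreBounds.integral_abs_sub_mul_le (hs : ScoreBounds s w R S s₀) (hd : ∀ k, 0 < d k)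
    (hd0 : 2 ≤ d 0) {T That H Hhat : Tensor d}
    (hT : ∀ u a b, |inner ℝ T (atom u a b)| ≤ R) (hT' : ∀ u a b, |inner ℝ That (atom u a b)| ≤ R)
    (hε : 0 ≤ ε) (hTT : ∀ i, |That i - T i| ≤ ε) (hH : H ∈ zeroSum d) (hH' : Hhat ∈ zeroSum d) :
    ∫ z, |scoreInfl s That Hhat z - scoreInfl s T H z| *
      (|scoreInfl s That Hhat z| + |scoreInfl s T H z|) ∂(btl.law (uniformDesign d) T) ≤
      S ^ 2 * ((2 * ε * ‖Hhat‖ + ‖Hhat - H‖) * (‖Hhat‖ + ‖H‖)) / effDim d := by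
  have := isProbabilityMeasure_uniformDesign hd hd0
  have hm := measurable_scoreInfl hs.measurable T H
  have hm' := measurable_scoreInfl hs.measurable That Hhat
  have hS := hs.const_pos
  have hmm : Measurable fun z => |scoreInfl s That Hhat z - scoreInfl s T H z| *
      (|scoreInfl s That Hhat z| + |scoreInfl s T H z|) :=
    (hm'.sub hm).abs.mul (hm'.abs.add hm.abs)
  rw [integral_law T hmm]
  have key : ∀ᵐ x ∂(uniformDesign d),
      ∫ y, |scoreInfl s That Hhat (x, y) - scoreInfl s T H (x, y)| *
      (|scoreInfl s That Hhat (x, y)| + |scoreInfl s T H (x, y)|) ∂(btl.obs (inner ℝ T x)) ≤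
      S ^ 2 * (2 * ε * (|inner ℝ Hhat x| * |inner ℝ Hhat x|) +
        2 * ε * (|inner ℝ Hhat x| * |inner ℝ H x|) +
        |inner ℝ (Hhat - H) x| * |inner ℝ Hhat x| + |inner ℝ (Hhat - H) x| * |inner ℝ H x|) := by
    refine ae_design fun u a b => ?_
    set x := atom u a b
    have h1 : ∀ y, |scoreInfl s That Hhat (x, y) - scoreInfl s T H (x, y)| *
        (|scoreInfl s That Hhat (x, y)| + |scoreInfl s T H (x, y)|) ≤
        S * (2 * ε * |inner ℝ Hhat x| + |inner ℝ (Hhat - H) x|) *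
          (S * (|inner ℝ Hhat x| + |inner ℝ H x|)) := fun y => by
      have b1 := hs.bounded y _ (hT u a b)
      have b2 := hs.bounded y _ (hT' u a b)
      have b3 := hs.lipschitz y _ _ (hT' u a b) (hT u a b)
      have b4 := abs_inner_atom_le (H := That - T) (fun i => hTT i) u a b
      rw [← inner_sub_left] at b3
      have b5 : |s y (inner ℝ That x) - s y (inner ℝ T x)| ≤ S * (2 * ε) :=
        b3.trans (by gcongr)
      simp only [scoreInfl]
      refine mul_le_mul ?_ ?_ (by positivity) (by positivity)
      -- The change of the score is charged to the estimated direction, the change of direction to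
      -- the score at the truth.
      · have e : s y (inner ℝ That x) * inner ℝ Hhat x - s y (inner ℝ T x) * inner ℝ H x =
            (s y (inner ℝ That x) - s y (inner ℝ T x)) * inner ℝ Hhat x +
              s y (inner ℝ T x) * inner ℝ (Hhat - H) x := by
          rw [inner_sub_left]; ring
        rw [e]
        refine (abs_add_le _ _).trans ?_
        rw [abs_mul, abs_mul]
        have c1 := mul_le_mul_of_nonneg_right b5 (abs_nonneg (inner ℝ Hhat x : ℝ))
        have c2 := mul_le_mul_of_nonneg_right b1 (abs_nonneg (inner ℝ (Hhat - H) x : ℝ))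
        linarith
      · rw [abs_mul, abs_mul, mul_add]
        exact add_le_add (mul_le_mul_of_nonneg_right b2 (abs_nonneg _))
          (mul_le_mul_of_nonneg_right b1 (abs_nonneg _))
    refine (integral_mono Integrable.of_finite (integrable_const _) h1).trans (le_of_eq ?_)
    rw [integral_const, probReal_univ, one_smul]
    ring
  refine (integral_mono_ae (integrable_design _) (integrable_design _) key).trans ?_
  rw [integral_const_mul, integral_add (integrable_design _) (integrable_design _),
    integral_add (integrable_design _) (integrable_design _),
    integral_add (integrable_design _) (integrable_design _), integral_const_mul,
    integral_const_mul]
  have c1 := integral_abs_inner_mul_le hd hd0 hH' hH'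
  have c2 := integral_abs_inner_mul_le hd hd0 hH' hH
  have c3 := integral_abs_inner_mul_le hd hd0 (sub_mem hH' hH) hH'
  have c4 := integral_abs_inner_mul_le hd hd0 (sub_mem hH' hH) hH
  rw [mul_div_assoc]
  gcongr
  have c1' := mul_le_mul_of_nonneg_left c1 (by linarith : 0 ≤ 2 * ε)
  have c2' := mul_le_mul_of_nonneg_left c2 (by linarith : 0 ≤ 2 * ε)
  refine (add_le_add (add_le_add (add_le_add c1' c2') c3) c4).trans (le_of_eq ?_)
  ring

/-- The standard deviation of the influence function at the truth. -/
theorem ScoreBounds.le_sd_sq (hs : ScoreBounds s w R S s₀) (hd : ∀ k, 0 < d k)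
    (hd0 : 2 ≤ d 0) {T H : Tensor d} (hT : ∀ u a b, |inner ℝ T (atom u a b)| ≤ R)
    (hH : H ∈ zeroSum d) :
    sd (scoreInfl s T H) (btl.law (uniformDesign d) T) ^ 2 =
      ∫ z, scoreInfl s T H z ^ 2 ∂(btl.law (uniformDesign d) T) ∧
    s₀ * ‖H‖ ^ 2 / effDim d ≤ sd (scoreInfl s T H) (btl.law (uniformDesign d) T) ^ 2 := by
  have := isProbabilityMeasure_uniformDesign hd hd0
  have hm := measurable_scoreInfl hs.measurable T H
  obtain ⟨h1, h2⟩ := hs.influence_variance hd hd0 hT hH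
  have e : sd (scoreInfl s T H) (btl.law (uniformDesign d) T) ^ 2 =
      ∫ z, scoreInfl s T H z ^ 2 ∂(btl.law (uniformDesign d) T) := by
    rw [sd, Real.sq_sqrt (variance_nonneg _ _), variance_eq_integral hm.aemeasurable, h1]
    simp
  exact ⟨e, by rw [e]; exact h2⟩

/-- Normal approximation for a plug-in average whose direction is close to the ideal one. -/
theorem ScoreBounds.plugin_clt (hs : ScoreBounds s w R S s₀) (hd : ∀ k, 0 < d k)
    (hd0 : 2 ≤ d 0) {T That H Hhat : Tensor d} {K A : ℝ}
    (hT : ∀ u a b, |inner ℝ T (atom u a b)| ≤ R) (hT' : ∀ u a b, |inner ℝ That (atom u a b)| ≤ R)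
    (hε : 0 ≤ ε) (hTT : ∀ i, |That i - T i| ≤ ε) (hH : H ∈ zeroSum d) (hH' : Hhat ∈ zeroSum d)
    (hH0 : H ≠ 0) (hK : 0 ≤ K) (hHH : ‖Hhat - H‖ ≤ K * ε * ‖H‖) (hA : 0 ≤ A)
    (hsup : ∀ u a b, |inner ℝ Hhat (atom u a b)| ≤ A * ‖H‖ * √((dbar d : ℝ) / dstar d))
    (h1 : K * ε ≤ 1) (h2 : 6 * S ^ 2 * (4 + K) / s₀ * ε ≤ 1 / 2) {n : ℕ} {Ω : Type*}
    [MeasurableSpace Ω] {Pr : Measure Ω} [IsProbabilityMeasure Pr] {Z : Fin n → Ω → Tensor d × Bool}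
    (hZ : IsIID Z (btl.law (uniformDesign d) T) Pr) (hn : 0 < n) (e₀ ψ t : ℝ) :
    |Pr.real {ω | standardized n (fun ω => e₀ + (∑ i, scoreInfl s That Hhat (Z i ω)) / n) ψ
      (sd (scoreInfl s T H) (btl.law (uniformDesign d) T)) ω ≤ t} - Phi t| ≤
      416 * S * A / √s₀ * √((dbar d : ℝ) / n) + 2 * (6 * S ^ 2 * (4 + K) / s₀ * ε) +
      √n * |e₀ - ψ + ∫ z, scoreInfl s That Hhat z ∂(btl.law (uniformDesign d) T)| /
        sd (scoreInfl s T H) (btl.law (uniformDesign d) T) := by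
  have := isProbabilityMeasure_uniformDesign hd hd0
  have hm := measurable_scoreInfl hs.measurable T H
  have hm' := measurable_scoreInfl hs.measurable That Hhat
  have hS := hs.const_pos
  have hs0 := hs.var_pos
  have hδ := effDim_pos hd hd0
  have hδ' := (effDim_bounds hd hd0).2
  have hD : (0 : ℝ) < dstar d := by exact_mod_cast dstar_pos hd
  have hHn : 0 < ‖H‖ := norm_pos_iff.2 hH0
  have hnR : (0 : ℝ) < n := by exact_mod_cast hn
  set ν := btl.law (uniformDesign d) T with hν
  set g := scoreInfl s That Hhat with hg
  set φ := scoreInfl s T H with hφ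
  set v := sd φ ν with hv
  set E := 6 * S ^ 2 * (4 + K) / s₀ with hE
  have hE0 : 0 ≤ E := by positivity
  obtain ⟨hv2, hvge⟩ := hs.le_sd_sq hd hd0 hT hH
  have hvpos : 0 < v := by
    have h3 : 0 < v ^ 2 := lt_of_lt_of_le (by positivity) hvge
    have h4 : 0 ≤ v := Real.sqrt_nonneg _
    exact lt_of_le_of_ne h4 fun h => by rw [← h] at h3; norm_num at h3
  set μ := ∫ z, g z ∂ν with hμ
  have hφ0 : ∫ z, φ z ∂ν = 0 := (hs.influence_variance hd hd0 hT hH).1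
  set X := ∫ z, |g z - φ z| * (|g z| + |φ z|) ∂ν with hX
  -- `X` dominates both `|E g² - E φ²|` and `(E g)²`, so the variance changes by at most `2X`; hence
  -- half of `E` here. The factor `3 (4 + K)` comes from `‖Hhat‖ ≤ 2 ‖H‖`.
  have hXle : X ≤ E / 2 * ε * v ^ 2 := by
    refine (hs.integral_abs_sub_mul_le hd hd0 hT hT' hε hTT hH hH').trans ?_
    have h3 : ‖Hhat‖ ≤ 2 * ‖H‖ := by
      have h4 := norm_add_le (Hhat - H) H
      rw [sub_add_cancel] at h4
      have h5 : K * ε * ‖H‖ ≤ 1 * ‖H‖ := by gcongr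
      linarith
    have h4 : S ^ 2 * ((2 * ε * ‖Hhat‖ + ‖Hhat - H‖) * (‖Hhat‖ + ‖H‖)) / effDim d ≤
        S ^ 2 * ((2 * ε * (2 * ‖H‖) + K * ε * ‖H‖) * (2 * ‖H‖ + ‖H‖)) / effDim d := by
      gcongr
    refine h4.trans ?_
    calc _ = E / 2 * ε * (s₀ * ‖H‖ ^ 2 / effDim d) := by rw [hE]; field_simp; ring
      _ ≤ _ := by gcongr
  have i1 : ∀ {F : Tensor d × Bool → ℝ}, Measurable F → Integrable F ν := fun h => integrable_law T h
  have hmX : Measurable fun z => |g z - φ z| * (|g z| + |φ z|) :=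
    (hm'.sub hm).abs.mul (hm'.abs.add hm.abs)
  have hsq : |∫ z, g z ^ 2 ∂ν - v ^ 2| ≤ X := by
    rw [hv2, ← integral_sub (i1 (hm'.pow_const 2)) (i1 (hm.pow_const 2)), ← Real.norm_eq_abs]
    refine norm_integral_le_of_norm_le (i1 hmX) (Filter.Eventually.of_forall fun z => ?_)
    rw [Real.norm_eq_abs, sq_sub_sq, abs_mul, mul_comm]
    gcongr
    exact abs_add_le _ _
  have hμ2 : μ ^ 2 ≤ X := by
    have e1 : μ = ∫ z, (g z - φ z) ∂ν := by
      rw [integral_sub (i1 hm') (i1 hm), hφ0, sub_zero]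
    have e2 := variance_nonneg (g - φ) ν
    rw [variance_eq_sub ((memLp_two_iff_integrable_sq (hm'.sub hm).aestronglyMeasurable).2
      (i1 ((hm'.sub hm).pow_const 2)))] at e2
    change _ ≤ _ - (∫ z, (g z - φ z) ∂ν) ^ 2 at e2
    rw [← e1] at e2
    have e3 : ∫ z, (g z - φ z) ^ 2 ∂ν ≤ X := by
      refine integral_mono (i1 ((hm'.sub hm).pow_const 2)) (i1 hmX) fun z => ?_
      simp only
      rw [← sq_abs, sq]
      gcongr
      exact abs_sub _ _
    have e4 : ∫ z, ((g - φ) ^ 2) z ∂ν = ∫ z, (g z - φ z) ^ 2 ∂ν := rfl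
    rw [e4] at e2
    linarith
  have hvar : ∫ z, (g z - μ) ^ 2 ∂ν = ∫ z, g z ^ 2 ∂ν - μ ^ 2 := by
    have e1 : ∀ z, (g z - μ) ^ 2 = g z ^ 2 - 2 * μ * g z + μ ^ 2 := fun z => by ring
    simp only [e1]
    have i2 : Integrable (fun z => g z ^ 2 - 2 * μ * g z) ν :=
      (i1 (hm'.pow_const 2)).sub ((i1 hm').const_mul _)
    rw [integral_add i2 (integrable_const _), integral_sub (i1 (hm'.pow_const 2)) ((i1 hm').const_mul _), integral_const_mul, ← hμ]
    simp
    ring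
  set vg := √(∫ z, (g z - μ) ^ 2 ∂ν) with hvg
  have hvg2 : ∫ z, (g z - μ) ^ 2 ∂ν = vg ^ 2 :=
    (Real.sq_sqrt (integral_nonneg fun z => sq_nonneg _)).symm
  have hdiff : |vg ^ 2 - v ^ 2| ≤ E * ε * v ^ 2 := by
    rw [← hvg2, hvar]
    have h3 := abs_le.1 hsq
    have h4 := sq_nonneg μ
    rw [abs_le]
    constructor <;> linarith [h3.1, h3.2]
  have hvg0 : 0 ≤ vg := Real.sqrt_nonneg _
  have hvvg : v ≤ 2 * vg := by
    have h3 := (abs_le.1 hdiff).1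
    have h4 : E * ε * v ^ 2 ≤ 1 / 2 * v ^ 2 := by gcongr
    refine abs_le_of_sq_le_sq' ?_ (by positivity) |>.2
    nlinarith [sq_nonneg v]
  have hratio : |vg / v - 1| ≤ E * ε := by
    have e1 : vg / v - 1 = (vg ^ 2 - v ^ 2) / (v * (vg + v)) := by
      field_simp
      ring
    rw [e1, abs_div, abs_of_pos (by positivity : 0 < v * (vg + v)), div_le_iff₀ (by positivity)]
    refine hdiff.trans ?_
    have h3 : v ^ 2 ≤ v * (vg + v) := by nlinarith
    gcongr
  have hGae : ∀ᵐ z ∂ν, |g z| ≤ S * (A * ‖H‖ * √((dbar d : ℝ) / dstar d)) := by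
    have h3 := ae_law (d := d) T (p := fun x => |inner ℝ That x| ≤ R ∧
      |inner ℝ Hhat x| ≤ A * ‖H‖ * √((dbar d : ℝ) / dstar d)) fun u a b => ⟨hT' u a b, hsup u a b⟩
    refine h3.mono fun z hz => ?_
    rw [hg, scoreInfl, abs_mul]
    exact mul_le_mul (hs.bounded _ _ hz.1) hz.2 (abs_nonneg _) hS.le
  have hfin := hZ.plugin hn hm' (e₀ := e₀) (ψ := ψ) hGae hvpos hvvg hvg2 t
  have hlead : 416 * (S * (A * ‖H‖ * √((dbar d : ℝ) / dstar d)) / (√n * v)) ≤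
      416 * S * A / √s₀ * √((dbar d : ℝ) / n) := by
    -- Since `effDim ≤ d⋆`, the lower bound on `v` cancels the `√d⋆` in the sup bound of the
    -- direction and leaves `√(d̄/n)`.
    have h3 : √s₀ * ‖H‖ ≤ √(effDim d) * v := by
      refine abs_le_of_sq_le_sq' ?_ (by positivity) |>.2
      rw [mul_pow, mul_pow, Real.sq_sqrt hs0.le, Real.sq_sqrt hδ.le]
      rw [div_le_iff₀ hδ] at hvge
      linarith
    have h4 : √s₀ * ‖H‖ ≤ √(dstar d) * v := h3.trans (by gcongr)
    rw [Real.sqrt_div (Nat.cast_nonneg _), Real.sqrt_div (Nat.cast_nonneg _)]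
    have hs0' : 0 < √s₀ := Real.sqrt_pos.2 hs0
    have hD' : 0 < √(dstar d : ℝ) := Real.sqrt_pos.2 hD
    have hn' : 0 < √(n : ℝ) := Real.sqrt_pos.2 hnR
    rw [mul_div_assoc', div_mul_div_comm, div_le_div_iff₀ (by positivity) (by positivity)]
    have e1 : 416 * (S * (A * ‖H‖ * (√(dbar d : ℝ) / √(dstar d : ℝ)))) * (√s₀ * √n) =
        416 * S * A * √(dbar d : ℝ) * √n / √(dstar d : ℝ) * (√s₀ * ‖H‖) := by
      field_simp
    have e2 : 416 * S * A * √(dbar d : ℝ) * (√n * v) =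
        416 * S * A * √(dbar d : ℝ) * √n / √(dstar d : ℝ) * (√(dstar d) * v) := by
      field_simp
    rw [e1, e2]
    gcongr
  refine hfin.trans ?_
  linarith

end Plugin

end PairwiseBE

/-! ### One-step estimators with a deterministic initial estimate -/

namespace PairwiseBE

/-! ### Entrywise ℓ¹ norms and duality -/

section EntrySum

variable {m : ℕ} {d : Fin (m + 1) → ℕ}

theorem abs_inner_le_entrySum {U V : Tensor d} {t : ℝ} (hU : ∀ i, |U i| ≤ t) :
    |inner ℝ U V| ≤ t * entrySum V := by
  rw [PiLp.inner_apply, entrySum, Finset.mul_sum]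
  refine (Finset.abs_sum_le_sum_abs _ _).trans (Finset.sum_le_sum fun i _ => ?_)
  rw [RCLike.inner_apply, conj_trivial, abs_mul, mul_comm]
  exact mul_le_mul_of_nonneg_right (hU i) (abs_nonneg _)

/-- The vector of signs. -/
noncomputable def signVec (V : Tensor d) : Tensor d := WithLp.toLp 2 fun i => if 0 ≤ V i then 1 else -1

theorem abs_signVec_le (V : Tensor d) (i : (k : Fin (m + 1)) → Fin (d k)) : |signVec V i| ≤ 1 := by
  change |if 0 ≤ V i then (1 : ℝ) else -1| ≤ 1
  split_ifs <;> simp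

theorem inner_signVec (V : Tensor d) : inner ℝ (signVec V) V = entrySum V := by
  rw [PiLp.inner_apply, entrySum]
  refine Finset.sum_congr rfl fun i _ => ?_
  rw [RCLike.inner_apply, conj_trivial]
  change V i * (if 0 ≤ V i then (1 : ℝ) else -1) = _
  split_ifs with h
  · rw [abs_of_nonneg h, mul_one]
  · rw [abs_of_neg (not_le.1 h), mul_neg, mul_one]

theorem entrySum_le_of_support {V : Tensor d} {M : ℕ}
    (h : (Finset.univ.filter fun i => V i ≠ 0).card ≤ M) : entrySum V ≤ √M * ‖V‖ := by
  have e : entrySum V = ∑ i ∈ Finset.univ.filter fun i => V i ≠ 0, |V i| := by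
    rw [entrySum, Finset.sum_filter]
    refine Finset.sum_congr rfl fun i _ => ?_
    split_ifs with h
    · rfl
    · rw [not_not.1 h, abs_zero]
  have h1 : entrySum V ^ 2 ≤ M * ‖V‖ ^ 2 := by
    rw [e]
    refine sq_sum_le_card_mul_sum_sq.trans ?_
    have h2 : ∑ i ∈ Finset.univ.filter fun i => V i ≠ 0, |V i| ^ 2 ≤ ‖V‖ ^ 2 := by
      rw [EuclideanSpace.norm_sq_eq]
      simp only [Real.norm_eq_abs]
      exact Finset.sum_le_sum_of_subset_of_nonneg (Finset.filter_subset _ _)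
        fun i _ _ => sq_nonneg _
    have h3 : ((Finset.univ.filter fun i => V i ≠ 0).card : ℝ) ≤ M := by exact_mod_cast h
    gcongr
  refine abs_le_of_sq_le_sq' ?_ (by positivity) |>.2
  rw [mul_pow, Real.sq_sqrt (Nat.cast_nonneg _)]
  exact h1

/-- A bound on basis vectors gives a bound in terms of the `ℓ¹` norm. -/
theorem norm_map_le_entrySum (f : Tensor d →L[ℝ] Tensor d) {t : ℝ}
    (hf : ∀ i, ‖f (basisVec i)‖ ≤ t) (V : Tensor d) : ‖f V‖ ≤ t * entrySum V := by
  have e : V = ∑ i, V i • basisVec i := by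
    ext j
    simp [WithLp.ofLp_sum, Finset.sum_apply, Pi.single_apply]
  conv_lhs => rw [e, map_sum]
  rw [entrySum, Finset.mul_sum]
  refine (norm_sum_le _ _).trans (Finset.sum_le_sum fun i _ => ?_)
  rw [map_smul, norm_smul, Real.norm_eq_abs, mul_comm]
  exact mul_le_mul_of_nonneg_right (hf i) (abs_nonneg _)

end EntrySum

/-! ### From a bias bound to normal approximation -/

section OneStep

variable {m : ℕ} {d r : Fin (m + 1) → ℕ} {P Q : TuckerPoint d r} {Γ : Tensor d}
  {μ κ B cS α ε C₀ : ℝ} {M : ℕ}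

theorem TuckerPoint.proj_mem (P : TuckerPoint d r) (z : Tensor d) :
    P.proj z ∈ P.signalTangent (zeroSum d) := Submodule.starProjection_apply_mem _ _

theorem TuckerPoint.proj_mem_zeroSum (P : TuckerPoint d r) (z : Tensor d) :
    P.proj z ∈ zeroSum d := (P.proj_mem z).2

theorem TuckerPoint.inner_proj (P : TuckerPoint d r) (x y : Tensor d) :
    inner ℝ (P.proj x) y = inner ℝ x (P.proj y) :=
  Submodule.inner_starProjection_left_eq_right _ _ _

theorem TuckerPoint.proj_of_mem {P : TuckerPoint d r} {z : Tensor d}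
    (h : z ∈ P.signalTangent (zeroSum d)) : P.proj z = z := Submodule.starProjection_eq_self_iff.2 h

/-- The projection is self-adjoint, so its ℓ¹ bound is dual to its sup bound: pair the image with
its sign vector. -/
theorem ProjBounds.entrySum_proj_le (h : ProjBounds P Q ε C₀) (V : Tensor d) :
    entrySum (Q.proj V) ≤ C₀ * entrySum V := by
  rw [← inner_signVec, ← TuckerPoint.inner_proj, ← mul_one C₀]
  exact (le_abs_self _).trans (abs_inner_le_entrySum (h.sup _ 1 (abs_signVec_le _)))

/-- Sparsity passes from basis vectors to `Γ` at cost `√M`. Alignment then converts the factor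
`√(d̄/d⋆) ‖Γ‖` into `‖P.proj Γ‖`, so the error is relative. -/
theorem ProjBounds.norm_proj_sub_le (h : ProjBounds P Q ε C₀) (hΓ : SignalAssumptions P Γ μ κ B cS α M)
    (hC : 0 ≤ C₀) (hε : 0 ≤ ε) (hα : 0 < α) :
    ‖Q.proj Γ - P.proj Γ‖ ≤ C₀ * √M / α * ε * ‖P.proj Γ‖ := by
  have h1 := norm_map_le_entrySum (Q.proj - P.proj) (t := C₀ * ε * √((dbar d : ℝ) / dstar d))
    (fun i => h.row_sub i) Γ
  have h2 := entrySum_le_of_support hΓ.support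
  have h3 := hΓ.alignment
  refine h1.trans ?_
  calc C₀ * ε * √((dbar d : ℝ) / dstar d) * entrySum Γ
      ≤ C₀ * ε * √((dbar d : ℝ) / dstar d) * (√M * ‖Γ‖) := by gcongr
    _ = C₀ * √M / α * ε * (α * √((dbar d : ℝ) / dstar d) * ‖Γ‖) := by field_simp
    _ ≤ _ := by gcongr

theorem SignalAssumptions.norm_proj_pos (hΓ : SignalAssumptions P Γ μ κ B cS α M) (hα : 0 < α) :
    0 < ‖P.proj Γ‖ := by
  refine lt_of_lt_of_le ?_ hΓ.alignment
  have h1 : 0 < ‖Γ‖ := norm_pos_iff.2 hΓ.functional_ne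
  have h2 : (0 : ℝ) < dbar d := by exact_mod_cast one_le_dbar hΓ.d_pos
  have h3 : (0 : ℝ) < dstar d := by exact_mod_cast dstar_pos hΓ.d_pos
  positivity

/-- The entries of the residual of the estimation error. -/
theorem ProjBounds.abs_residual_le (h : ProjBounds P Q ε C₀) (hQ : Q.tensor ∈ zeroSum d)
    (i : (k : Fin (m + 1)) → Fin (d k)) :
    |((Q.tensor - P.tensor) - Q.proj (Q.tensor - P.tensor)) i| ≤ C₀ * ε ^ 2 := by
  have e : (Q.tensor - P.tensor) - Q.proj (Q.tensor - P.tensor) =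
      -(P.tensor - Q.proj P.tensor) := by
    rw [map_sub, TuckerPoint.proj_of_mem (Q.tensor_mem_signalTangent hQ)]
    abel
  rw [e, PiLp.neg_apply, abs_neg]
  exact h.curvature i

/-- A comparison is a difference of two basis vectors, and each has a small tangential part. -/
theorem ProjBounds.abs_inner_atom_le (h : ProjBounds P Q ε C₀) {H : Tensor d}
    (hH : H ∈ Q.signalTangent (zeroSum d)) (u : Context d) (a b : Fin (d 0)) :
    |inner ℝ H (atom u a b)| ≤ 2 * C₀ * ‖H‖ * √((dbar d : ℝ) / dstar d) := by
  refine (SingleIndexModel.abs_inner_le_of_proj hH _).trans ?_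
  have h1 : ‖Q.proj (atom u a b)‖ ≤ 2 * (C₀ * √((dbar d : ℝ) / dstar d)) := by
    rw [atom, map_sub, two_mul]
    exact (norm_sub_le _ _).trans (add_le_add (h.row _) (h.row _))
  refine (mul_le_mul_of_nonneg_left h1 (norm_nonneg _)).trans (le_of_eq (by ring))

variable {s : Bool → ℝ → ℝ} {w : ℝ → ℝ} {R S s₀ K Cb : ℝ}

/-- Assembling the normal approximation of a one-step estimator from a bound on its bias. -/
theorem ScoreBounds.one_step (hs : ScoreBounds s w R S s₀)
    (hΓ : SignalAssumptions P Γ μ κ B cS α M) (hα : 0 < α) (hpb : ProjBounds P Q ε C₀)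
    (hC : 0 ≤ C₀) (hT : ∀ u a b, |inner ℝ P.tensor (atom u a b)| ≤ R)
    (hT' : ∀ u a b, |inner ℝ Q.tensor (atom u a b)| ≤ R) (hε : 0 ≤ ε) (hacc : InitAccurate P Q ε)
    {H Hhat : Tensor d} (hH : H ∈ zeroSum d) (hHn : effDim d * ‖P.proj Γ‖ ≤ ‖H‖)
    (hH' : Hhat ∈ Q.signalTangent (zeroSum d)) (hK : 0 ≤ K) (hHH : ‖Hhat - H‖ ≤ K * ε * ‖H‖)
    (h1 : K * ε ≤ 1) (h2 : 6 * S ^ 2 * (4 + K) / s₀ * ε ≤ 1 / 2) {n : ℕ} {Ω : Type*}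
    [MeasurableSpace Ω] {Pr : Measure Ω} [IsProbabilityMeasure Pr] {Z : Fin n → Ω → Tensor d × Bool}
    (hZ : IsIID Z (btl.law (uniformDesign d) P.tensor) Pr) (hn : 0 < n)
    (hbias : |inner ℝ Γ Q.tensor - inner ℝ Γ P.tensor +
      ∫ z, scoreInfl s Q.tensor Hhat z ∂(btl.law (uniformDesign d) P.tensor)| ≤ Cb * ε ^ 2 * ‖Γ‖)
    (t : ℝ) :
    |Pr.real {ω | standardized n
      (fun ω => inner ℝ Γ Q.tensor + (∑ i, scoreInfl s Q.tensor Hhat (Z i ω)) / n)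
      (inner ℝ Γ P.tensor)
      (sd (scoreInfl s P.tensor H) (btl.law (uniformDesign d) P.tensor)) ω ≤ t} - Phi t| ≤
      416 * S * (4 * C₀) / √s₀ * √((dbar d : ℝ) / n) + 2 * (6 * S ^ 2 * (4 + K) / s₀ * ε) +
      2 / (√s₀ * α) * Cb * (√n * ε ^ 2 / √(dbar d)) := by
  have hd := hΓ.d_pos
  have hd0 := hΓ.two_le
  have hs0 := hs.var_pos
  have hδ := effDim_pos hd hd0
  have hD : (0 : ℝ) < dstar d := by exact_mod_cast dstar_pos hd
  have hb : (0 : ℝ) < dbar d := by exact_mod_cast one_le_dbar hd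
  have hnR : (0 : ℝ) < n := by exact_mod_cast hn
  have hG : 0 < ‖Γ‖ := norm_pos_iff.2 hΓ.functional_ne
  have hPpos := hΓ.norm_proj_pos hα
  have hHpos : 0 < ‖H‖ := lt_of_lt_of_le (by positivity) hHn
  have hHhat : ‖Hhat‖ ≤ 2 * ‖H‖ := by
    have h4 := norm_add_le (Hhat - H) H
    rw [sub_add_cancel] at h4
    have h5 : K * ε * ‖H‖ ≤ 1 * ‖H‖ := by gcongr
    linarith
  have hsup : ∀ u a b, |inner ℝ Hhat (atom u a b)| ≤
      4 * C₀ * ‖H‖ * √((dbar d : ℝ) / dstar d) := fun u a b => by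
    refine (hpb.abs_inner_atom_le hH' u a b).trans ?_
    have : 2 * C₀ * ‖Hhat‖ ≤ 4 * C₀ * ‖H‖ := by nlinarith
    gcongr
  have hmain := hs.plugin_clt hd hd0 hT hT' hε hacc.2 hH hH'.2 (norm_pos_iff.1 hHpos) hK hHH
    (by positivity) hsup h1 h2 hZ hn (inner ℝ Γ Q.tensor) (inner ℝ Γ P.tensor) t
  refine hmain.trans (add_le_add le_rfl ?_)
  set v := sd (scoreInfl s P.tensor H) (btl.law (uniformDesign d) P.tensor)
  -- The variance is at least `s₀ ‖H‖² / effDim`, with `‖H‖ ≥ effDim ‖P.proj Γ‖`. Alignment and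
  -- `effDim ≥ d⋆/4` turn this into a multiple of `√d̄ ‖Γ‖`.
  have hv : √s₀ * α / 2 * √(dbar d) * ‖Γ‖ ≤ v := by
    have h3 := (hs.le_sd_sq hd hd0 hT hH).2
    refine abs_le_of_sq_le_sq' ?_ (Real.sqrt_nonneg _) |>.2
    refine le_trans ?_ h3
    have h4 : (effDim d * (α * √((dbar d : ℝ) / dstar d) * ‖Γ‖)) ^ 2 ≤ ‖H‖ ^ 2 := by
      gcongr
      exact (mul_le_mul_of_nonneg_left hΓ.alignment hδ.le).trans hHn
    rw [le_div_iff₀ hδ]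
    refine le_trans ?_ (mul_le_mul_of_nonneg_left h4 hs0.le)
    have h5 := (effDim_bounds hd hd0).1
    simp only [mul_pow, div_pow]
    rw [Real.sq_sqrt hs0.le, Real.sq_sqrt hb.le, Real.sq_sqrt (by positivity)]
    have e1 : s₀ * (effDim d ^ 2 * (α ^ 2 * ((dbar d : ℝ) / dstar d) * ‖Γ‖ ^ 2)) =
        s₀ * α ^ 2 * dbar d * ‖Γ‖ ^ 2 * effDim d * (effDim d / dstar d) := by
      field_simp
    have e2 : s₀ * α ^ 2 / 2 ^ 2 * dbar d * ‖Γ‖ ^ 2 * effDim d =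
        s₀ * α ^ 2 * dbar d * ‖Γ‖ ^ 2 * effDim d * (1 / 4) := by ring
    rw [e1, e2]
    refine mul_le_mul_of_nonneg_left ?_ (by positivity)
    rw [le_div_iff₀ hD]
    linarith
  have hvpos : 0 < √s₀ * α / 2 * √(dbar d) * ‖Γ‖ := by
    have := Real.sqrt_pos.2 hs0
    positivity
  have hs0' := Real.sqrt_pos.2 hs0
  have hb' := Real.sqrt_pos.2 hb
  have hnum : 0 ≤ √(n : ℝ) * (Cb * ε ^ 2 * ‖Γ‖) :=
    mul_nonneg (Real.sqrt_nonneg _) ((abs_nonneg _).trans hbias)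
  calc _ ≤ √n * (Cb * ε ^ 2 * ‖Γ‖) / (√s₀ * α / 2 * √(dbar d) * ‖Γ‖) := by gcongr
    _ = _ := by field_simp

end OneStep

/-! ### The whitened estimator -/

section Whitened

variable {m : ℕ} {d r : Fin (m + 1) → ℕ} {P Q : TuckerPoint d r} {Γ : Tensor d}
  {μ κ B cS α ε C₀ R S s₀ : ℝ} {M : ℕ}

/-- The bias of the whitened one-step estimator. -/
theorem whitened_bias_le (hs : ScoreBounds btl.whitenedScore (fun _ => 1) R S s₀)
    (hΓ : SignalAssumptions P Γ μ κ B cS α M) (hpb : ProjBounds P Q ε C₀)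
    (hC : 0 ≤ C₀) (hT : ∀ u a b, |inner ℝ P.tensor (atom u a b)| ≤ R)
    (hT' : ∀ u a b, |inner ℝ Q.tensor (atom u a b)| ≤ R) (hacc : InitAccurate P Q ε) :
    |inner ℝ Γ Q.tensor - inner ℝ Γ P.tensor +
      ∫ z, scoreInfl btl.whitenedScore Q.tensor (effDim d • Q.proj Γ) z
        ∂(btl.law (uniformDesign d) P.tensor)| ≤ (C₀ + 8 * S * C₀) * √M * ε ^ 2 * ‖Γ‖ := by
  have hS0 := hs.const_pos
  have hd := hΓ.d_pos
  have hd0 := hΓ.two_le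
  have hδ := effDim_pos hd hd0
  have hD : (0 : ℝ) < dstar d := by exact_mod_cast dstar_pos hd
  have hΔ : Q.tensor - P.tensor ∈ zeroSum d := sub_mem hacc.1 hΓ.zero_sum
  have hsum := entrySum_le_of_support hΓ.support
  have h1 := hs.abs_integral_add_le hd hd0 (H := effDim d • Q.proj Γ) hT hT' hacc.2
  simp only [one_mul] at h1
  rw [integral_inner_mul_inner hd hd0 hΔ, inner_smul_right,
    mul_div_cancel_left₀ _ hδ.ne'] at h1
  have h2 : entrySum (effDim d • Q.proj Γ) ≤ dstar d * (C₀ * entrySum Γ) := by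
    have e : entrySum (effDim d • Q.proj Γ) = effDim d * entrySum (Q.proj Γ) := by
      simp only [entrySum, Finset.mul_sum, PiLp.smul_apply, smul_eq_mul, abs_mul, abs_of_pos hδ]
    rw [e]
    exact mul_le_mul (effDim_bounds hd hd0).2 (hpb.entrySum_proj_le Γ) (entrySum_nonneg _) hD.le
  have h3 : 8 * S * ε ^ 2 * entrySum (effDim d • Q.proj Γ) / dstar d ≤
      8 * S * C₀ * ε ^ 2 * entrySum Γ := by
    rw [div_le_iff₀ hD]
    have := mul_le_mul_of_nonneg_left h2 (by positivity : 0 ≤ 8 * S * ε ^ 2)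
    linarith
  have h4 := abs_inner_le_entrySum (V := Γ) (hpb.abs_residual_le hacc.1)
  -- The tangential part of the error is removed by the linear term of the correction; `Γ` meets
  -- only the residual, whose entries are of second order.
  have e : inner ℝ Γ Q.tensor - inner ℝ Γ P.tensor +
      ∫ z, scoreInfl btl.whitenedScore Q.tensor (effDim d • Q.proj Γ) z
        ∂(btl.law (uniformDesign d) P.tensor) =
      inner ℝ ((Q.tensor - P.tensor) - Q.proj (Q.tensor - P.tensor)) Γ +
      (∫ z, scoreInfl btl.whitenedScore Q.tensor (effDim d • Q.proj Γ) z
        ∂(btl.law (uniformDesign d) P.tensor) +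
        inner ℝ (Q.tensor - P.tensor) (Q.proj Γ)) := by
    rw [inner_sub_left, TuckerPoint.inner_proj, inner_sub_left Q.tensor, real_inner_comm Γ,
      real_inner_comm Γ]
    ring
  rw [e]
  refine (abs_add_le _ _).trans ((add_le_add h4 (h1.trans h3)).trans ?_)
  calc C₀ * ε ^ 2 * entrySum Γ + 8 * S * C₀ * ε ^ 2 * entrySum Γ =
      (C₀ + 8 * S * C₀) * ε ^ 2 * entrySum Γ := by ring
    _ ≤ (C₀ + 8 * S * C₀) * ε ^ 2 * (√M * ‖Γ‖) := by gcongr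
    _ = _ := by ring

/-- The direction of the whitened one-step estimator. -/
theorem whitened_direction_sub_le (hΓ : SignalAssumptions P Γ μ κ B cS α M)
    (hpb : ProjBounds P Q ε C₀) (hC : 0 ≤ C₀) (hε : 0 ≤ ε) (hα : 0 < α) :
    ‖effDim d • Q.proj Γ - effDim d • P.proj Γ‖ ≤ C₀ * √M / α * ε * ‖effDim d • P.proj Γ‖ := by
  have hδ := effDim_pos hΓ.d_pos hΓ.two_le
  rw [← smul_sub, norm_smul, norm_smul, Real.norm_of_nonneg hδ.le]
  have := mul_le_mul_of_nonneg_left (hpb.norm_proj_sub_le hΓ hC hε hα) hδ.le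
  linarith

end Whitened

/-- The index bound at the truth and at an accurate estimate. -/
noncomputable def indexBound (r0 : ℕ) (κ B cS : ℝ) : ℝ := 2 * (|B| + signalConst r0 κ cS)

/-- Combining constants. -/
theorem combine_bounds {c1 E c3 ε p q x : ℝ} (h1 : 0 ≤ c1) (hE : 0 ≤ E) (h3 : 0 ≤ c3) (hε : 0 ≤ ε)
    (hp : 0 ≤ p) (hq : 0 ≤ q) (hx : x ≤ c1 * p + 2 * (E * ε) + c3 * q) :
    x ≤ (c1 + 2 * E + c3 + 1) * (p + ε + q) := by
  nlinarith [mul_nonneg h1 hε, mul_nonneg h1 hq, mul_nonneg hE hp, mul_nonneg hE hq,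
    mul_nonneg h3 hp, mul_nonneg h3 hε]

theorem small_of_le_min {K E ε a : ℝ} (hK : 0 ≤ K) (hE : 0 ≤ E) (hε : 0 ≤ ε)
    (h : ε ≤ min a (min (1 / (K + 1)) (1 / (2 * E + 1)))) :
    ε ≤ a ∧ K * ε ≤ 1 ∧ E * ε ≤ 1 / 2 := by
  have hε1 := h.trans (min_le_left _ _)
  have hε2 := (h.trans (min_le_right _ _)).trans (min_le_left _ _)
  have hε3 := (h.trans (min_le_right _ _)).trans (min_le_right _ _)
  rw [le_div_iff₀ (by positivity)] at hε2 hε3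
  exact ⟨hε1, by linarith, by linarith⟩

/-- The whitened one-step estimator with a deterministic initial estimate. -/
theorem exists_whitened_one_step (m : ℕ) (r : Fin (m + 1) → ℕ) (κ B : ℝ) {cS α : ℝ} (M : ℕ)
    (hcS : 0 < cS) (hα : 0 < α) : ∃ C ε₀ : ℝ, 0 < C ∧ 0 < ε₀ ∧
    ∀ (d : Fin (m + 1) → ℕ) (P Q : TuckerPoint d r) (Γ : Tensor d) (μ ε : ℝ),
    SignalAssumptions P Γ μ κ B cS α M → 0 ≤ ε → ε ≤ ε₀ → InitAccurate P Q ε →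
    ∀ (n : ℕ) (Ω : Type*) [MeasurableSpace Ω] (Pr : Measure Ω) [IsProbabilityMeasure Pr]
      (Z : Fin n → Ω → Tensor d × Bool), 0 < n →
      IsIID Z (btl.law (uniformDesign d) P.tensor) Pr → ∀ t,
    |Pr.real {ω | standardized n
      (fun ω => inner ℝ Γ Q.tensor +
        (∑ i, scoreInfl btl.whitenedScore Q.tensor (effDim d • Q.proj Γ) (Z i ω)) / n)
      (inner ℝ Γ P.tensor) (sd (scoreInfl btl.whitenedScore P.tensor (effDim d • P.proj Γ))
        (btl.law (uniformDesign d) P.tensor)) ω ≤ t} - Phi t| ≤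
      C * (√((dbar d : ℝ) / n) + ε + √n * ε ^ 2 / √(dbar d)) := by
  obtain ⟨C₀, hC₀, hpb⟩ := SignalAssumptions.exists_projBounds m r κ B hcS
  have hsc := signalConst_pos (r 0) κ hcS
  obtain ⟨S, s₀, hs⟩ : ∃ S s₀, ScoreBounds btl.whitenedScore (fun _ => 1)
      (indexBound (r 0) κ B cS) S s₀ := ⟨_, _, scoreBounds_whitenedScore _⟩
  have hS0 := hs.const_pos
  have hs0 := hs.var_pos
  have hC0 : 0 ≤ C₀ := by linarith
  have hK0 : 0 ≤ C₀ * √M / α := by positivity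
  have hE0 : 0 ≤ 6 * S ^ 2 * (4 + C₀ * √M / α) / s₀ := by positivity
  have hc1 : 0 ≤ 416 * S * (4 * C₀) / √s₀ := by positivity
  have hc3 : 0 ≤ 2 / (√s₀ * α) * ((C₀ + 8 * S * C₀) * √M) := by positivity
  -- The threshold combines three demands: stable singular values, `K ε ≤ 1` for the direction, and
  -- relative variance change at most one half.
  refine ⟨416 * S * (4 * C₀) / √s₀ + 2 * (6 * S ^ 2 * (4 + C₀ * √M / α) / s₀) +
    2 / (√s₀ * α) * ((C₀ + 8 * S * C₀) * √M) + 1, min (signalConst (r 0) κ cS / 2)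
      (min (1 / (C₀ * √M / α + 1)) (1 / (2 * (6 * S ^ 2 * (4 + C₀ * √M / α) / s₀) + 1))),
    by linarith, lt_min (by positivity) (lt_min (by positivity) (by positivity)), ?_⟩
  intro d P Q Γ μ ε hΓ hε hε₀ hacc n Ω _ Pr _ Z hn hZ t
  obtain ⟨hε1, hε2, hε3⟩ := small_of_le_min hK0 hE0 hε hε₀
  have hpb := hpb d P Q Γ μ α ε M hΓ hε hε1 hacc
  have hδ := effDim_pos hΓ.d_pos hΓ.two_le
  have hT : ∀ u a b, |inner ℝ P.tensor (atom u a b)| ≤ indexBound (r 0) κ B cS :=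
    abs_inner_atom_le (hΓ.regular hcS).bounded
  have hT' : ∀ u a b, |inner ℝ Q.tensor (atom u a b)| ≤ indexBound (r 0) κ B cS :=
    abs_inner_atom_le (hΓ.regular_of_initAccurate hcS hε hε1 hacc).bounded
  have hnorm : effDim d * ‖P.proj Γ‖ ≤ ‖effDim d • P.proj Γ‖ := by
    rw [norm_smul, Real.norm_of_nonneg hδ.le]
  exact combine_bounds hc1 hE0 hc3 hε (Real.sqrt_nonneg _) (by positivity)
    (hs.one_step hΓ hα hpb hC0 hT hT' hε hacc
      (Submodule.smul_mem _ _ (P.proj_mem_zeroSum Γ)) hnorm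
      (Submodule.smul_mem _ _ (Q.proj_mem Γ)) hK0
      (whitened_direction_sub_le hΓ hpb hC0 hε hα) hε2 hε3 hZ hn
      (whitened_bias_le hs hΓ hpb hC0 hT hT' hacc) t)

end PairwiseBE

/-! ### The efficient one-step estimator with a deterministic initial estimate -/

namespace PairwiseBE

/-! ### The information form on zero-sum tensors -/

section InfoOp

variable {m : ℕ} {d : Fin (m + 1) → ℕ} {T T' U V : Tensor d} {R ε : ℝ}

theorem inner_infoOp_uniformDesign (T U V : Tensor d) :
    inner ℝ U (btl.infoOp (uniformDesign d) T V) =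
      ∫ x, btl.fisher (inner ℝ T x) * (inner ℝ U x * inner ℝ V x) ∂(uniformDesign d) :=
  btl.inner_infoOp (fun _ _ => integrable_design _) U V

theorem abs_inner_infoOp_le_integral (T U V : Tensor d) :
    |inner ℝ U (btl.infoOp (uniformDesign d) T V)| ≤
      ∫ x, |inner ℝ U x| * |inner ℝ V x| ∂(uniformDesign d) := by
  rw [inner_infoOp_uniformDesign]
  refine abs_integral_le_integral_abs.trans
    (integral_mono (integrable_design _) (integrable_design _) fun x => ?_)
  change |_ * (_ * _)| ≤ |_| * |_|
  rw [abs_mul, ← abs_mul (inner ℝ U x), abs_of_pos (btl_fisher_pos _)]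
  exact mul_le_of_le_one_left (abs_nonneg _) (btl_fisher_le _)

theorem abs_inner_infoOp_le (hd : ∀ k, 0 < d k) (hd0 : 2 ≤ d 0) (hU : U ∈ zeroSum d)
    (hV : V ∈ zeroSum d) :
    |inner ℝ U (btl.infoOp (uniformDesign d) T V)| ≤ ‖U‖ * ‖V‖ / effDim d :=
  (abs_inner_infoOp_le_integral T U V).trans (integral_abs_inner_mul_le hd hd0 hU hV)

theorem abs_inner_infoOp_le_entrySum (hd : ∀ k, 0 < d k) (hd0 : 2 ≤ d 0) {t : ℝ}
    (hU : ∀ i, |U i| ≤ t) (ht : 0 ≤ t) :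
    |inner ℝ U (btl.infoOp (uniformDesign d) T V)| ≤ 4 * t * entrySum V / dstar d := by
  have h1 : ∫ x, |inner ℝ U x| * |inner ℝ V x| ∂(uniformDesign d) ≤
      ∫ x, 2 * t * |inner ℝ V x| ∂(uniformDesign d) := by
    refine integral_mono_ae (integrable_design _) (integrable_design _) (ae_design fun u a b => ?_)
    exact mul_le_mul_of_nonneg_right (abs_inner_atom_le hU u a b) (abs_nonneg _)
  refine (abs_inner_infoOp_le_integral T U V).trans (h1.trans ?_)
  rw [integral_const_mul]
  refine (mul_le_mul_of_nonneg_left (integral_abs_inner_le hd hd0 V) (by positivity)).trans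
    (le_of_eq (by ring))

theorem le_inner_infoOp (hd : ∀ k, 0 < d k) (hd0 : 2 ≤ d 0) (hU : U ∈ zeroSum d)
    (hT : ∀ u a b, |inner ℝ T (atom u a b)| ≤ R) :
    Real.exp (-R) ^ 2 / 4 * ‖U‖ ^ 2 / effDim d ≤
      inner ℝ U (btl.infoOp (uniformDesign d) T U) := by
  rw [inner_infoOp_uniformDesign, mul_div_assoc, ← integral_inner_sq hd hd0 hU,
    ← integral_const_mul]
  refine integral_mono_ae (integrable_design _) (integrable_design _) (ae_design fun u a b => ?_)
  change _ * _ ≤ _ * (_ * _)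
  rw [← sq]
  exact mul_le_mul_of_nonneg_right (btl_fisher_ge (hT u a b)) (sq_nonneg _)

/-- Only strict positivity is wanted, so the crude entry bound `∑ |T j|` provides a sufficient index
range for any tensor. -/
theorem inner_infoOp_pos (hd : ∀ k, 0 < d k) (hd0 : 2 ≤ d 0) (T : Tensor d) (hU : U ∈ zeroSum d)
    (hU0 : U ≠ 0) : 0 < inner ℝ U (btl.infoOp (uniformDesign d) T U) := by
  have hδ := effDim_pos hd hd0
  have h := norm_pos_iff.2 hU0
  have hT : ∀ i, |T i| ≤ ∑ j, |T j| := fun i =>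
    Finset.single_le_sum (f := fun j => |T j|) (fun j _ => abs_nonneg _) (Finset.mem_univ i)
  exact lt_of_lt_of_le (by positivity) (le_inner_infoOp hd hd0 hU (abs_inner_atom_le hT))

theorem abs_inner_infoOp_sub_le (hd : ∀ k, 0 < d k) (hd0 : 2 ≤ d 0) (hU : U ∈ zeroSum d)
    (hV : V ∈ zeroSum d) (hε : 0 ≤ ε) (hTT : ∀ i, |T' i - T i| ≤ ε) :
    |inner ℝ U (btl.infoOp (uniformDesign d) T V) -
      inner ℝ U (btl.infoOp (uniformDesign d) T' V)| ≤ 2 * ε * (‖U‖ * ‖V‖) / effDim d := by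
  rw [inner_infoOp_uniformDesign, inner_infoOp_uniformDesign,
    ← integral_sub (integrable_design _) (integrable_design _), mul_div_assoc]
  refine le_trans ?_ (mul_le_mul_of_nonneg_left (integral_abs_inner_mul_le hd hd0 hU hV)
    (by positivity : 0 ≤ 2 * ε))
  rw [← integral_const_mul]
  refine abs_integral_le_integral_abs.trans
    (integral_mono_ae (integrable_design _) (integrable_design _) (ae_design fun u a b => ?_))
  change |_ * (_ * _) - _ * (_ * _)| ≤ _ * (|_| * |_|)
  rw [← sub_mul, abs_mul, abs_mul (inner ℝ U _)]
  refine mul_le_mul_of_nonneg_right ((abs_fisher_sub_le _ _).trans ?_) (by positivity)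
  rw [abs_sub_comm, ← inner_sub_left]
  exact abs_inner_atom_le (H := T' - T) hTT u a b

end InfoOp

/-! ### The efficient direction and its stability -/

section Efficient

variable {m : ℕ} {d r : Fin (m + 1) → ℕ} {P Q : TuckerPoint d r} {Γ : Tensor d}
  {μ κ B cS α ε C₀ R CA : ℝ} {M : ℕ}

/-- The information operator of the uniform comparison design. -/
noncomputable abbrev TuckerPoint.info (P : TuckerPoint d r) : Tensor d →L[ℝ] Tensor d :=
  btl.infoOp (uniformDesign d) P.tensor

/-- The efficient direction for the functional `Γ`. -/
noncomputable abbrev TuckerPoint.effDir (P : TuckerPoint d r) (V : Tensor d) : Tensor d :=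
  infoSolve (P.signalTangent (zeroSum d)) P.info V

theorem TuckerPoint.effDir_spec (hd : ∀ k, 0 < d k) (hd0 : 2 ≤ d 0) (P : TuckerPoint d r)
    (V : Tensor d) : P.effDir V ∈ P.signalTangent (zeroSum d) ∧
      ∀ u ∈ P.signalTangent (zeroSum d), inner ℝ u (P.info (P.effDir V)) = inner ℝ u V :=
  infoSolve_spec (𝕋 := P.signalTangent (zeroSum d)) (G := P.info)
    (fun _ hu hu0 => inner_infoOp_pos hd hd0 _ hu.2 hu0) V

/-- Two solutions of the normal equations differ by a tangent vector of zero information, which must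
vanish. -/
theorem TuckerPoint.effDir_eq (hd : ∀ k, 0 < d k) (hd0 : 2 ≤ d 0) (P : TuckerPoint d r)
    {V H : Tensor d} (hH : H ∈ P.signalTangent (zeroSum d))
    (h : ∀ u ∈ P.signalTangent (zeroSum d), inner ℝ u (P.info H) = inner ℝ u V) :
    P.effDir V = H := by
  obtain ⟨h1, h2⟩ := P.effDir_spec hd hd0 V
  have h3 := sub_mem h1 hH
  by_contra hne
  have h4 := inner_infoOp_pos hd hd0 P.tensor h3.2 (sub_ne_zero.2 hne)
  rw [map_sub, inner_sub_right, h2 _ h3, h _ h3, sub_self] at h4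
  exact lt_irrefl _ h4

/-- Testing the normal equations with the projection of `V`, and using that the information is at
most one, gives `‖P V‖² ≤ ‖P V‖ ‖H‖ / effDim`. -/
theorem TuckerPoint.norm_proj_le_effDir (hd : ∀ k, 0 < d k) (hd0 : 2 ≤ d 0) (P : TuckerPoint d r)
    (V : Tensor d) : effDim d * ‖P.proj V‖ ≤ ‖P.effDir V‖ := by
  have hδ := effDim_pos hd hd0
  obtain ⟨h1, h2⟩ := P.effDir_spec hd hd0 V
  rcases eq_or_ne (P.proj V) 0 with h0 | h0
  · rw [h0, norm_zero, mul_zero]; exact norm_nonneg _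
  have hp := norm_pos_iff.2 h0
  have h3 : ‖P.proj V‖ ^ 2 = inner ℝ (P.proj V) (P.info (P.effDir V)) := by
    rw [h2 _ (P.proj_mem V), ← real_inner_self_eq_norm_sq, P.inner_proj,
      TuckerPoint.proj_of_mem (P.proj_mem V), ← P.inner_proj]
  have h4 := (le_abs_self _).trans
    (abs_inner_infoOp_le (T := P.tensor) hd hd0 (P.proj_mem V).2 h1.2)
  rw [← h3, le_div_iff₀ hδ] at h4
  nlinarith

/-- The `ℓ¹` norm of the efficient direction. -/
theorem TuckerPoint.entrySum_effDir_le (hd : ∀ k, 0 < d k) (hd0 : 2 ≤ d 0) (P : TuckerPoint d r)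
    {c : ℝ} (hA : InfoInvNormLE (P.signalTangent (zeroSum d)) P.info c) (V : Tensor d) :
    entrySum (P.effDir V) ≤ c * entrySum V := by
  obtain ⟨h1, h2⟩ := P.effDir_spec hd hd0 V
  obtain ⟨h3, h4⟩ := P.effDir_spec hd hd0 (signVec (P.effDir V))
  -- Symmetry of the information makes the solution operator self-adjoint, so its ℓ¹ bound is dual
  -- to the sup bound.
  have e : inner ℝ (P.effDir V) (P.info (P.effDir (signVec (P.effDir V)))) =
      inner ℝ (P.effDir (signVec (P.effDir V))) (P.info (P.effDir V)) := by
    rw [inner_infoOp_uniformDesign, inner_infoOp_uniformDesign]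
    simp only [mul_comm]
  rw [← inner_signVec, real_inner_comm, ← h4 _ h1, e, h2 _ h3]
  exact (le_abs_self _).trans (abs_inner_le_entrySum (hA _ (abs_signVec_le _)))

/-- The inverse information operator is not small in the supremum norm. -/
theorem TuckerPoint.quarter_le_of_infoInvNormLE (hd : ∀ k, 0 < d k) (hd0 : 2 ≤ d 0)
    (P : TuckerPoint d r)
    (hA : InfoInvNormLE (P.signalTangent (zeroSum d)) P.info (CA * dstar d)) {H : Tensor d}
    (hH : H ∈ P.signalTangent (zeroSum d)) (hH0 : H ≠ 0) : 1 / 4 ≤ CA := by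
  have hD : (0 : ℝ) < dstar d := by exact_mod_cast dstar_pos hd
  have : Nonempty ((k : Fin (m + 1)) → Fin (d k)) := ⟨fun k => ⟨0, hd k⟩⟩
  obtain ⟨i, hi⟩ := Finite.exists_max fun i => |H i|
  have hpos : 0 < |H i| := by
    obtain ⟨j, hj⟩ : ∃ j, H j ≠ 0 := by
      by_contra! h
      exact hH0 (by ext j; exact h j)
    exact (abs_pos.2 hj).trans_le (hi j)
  -- `G H` has entries at most `4 |H i| / d⋆`, so after this rescaling it is an admissible input.
  -- The solution is the rescaled `H`, whose `i`-th entry has modulus `d⋆ / 4`.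
  have hc : 0 < dstar d / (4 * |H i|) := by positivity
  have hmem := Submodule.smul_mem _ ((dstar d : ℝ) / (4 * |H i|)) hH
  have h1 := P.effDir_eq hd hd0 (V := ((dstar d : ℝ) / (4 * |H i|)) • P.info H) hmem
    fun u _ => by rw [map_smul]
  have h2 : ∀ j, |(((dstar d : ℝ) / (4 * |H i|)) • P.info H) j| ≤ 1 := fun j => by
    have h3 := abs_inner_infoOp_le_entrySum (T := P.tensor) (V := basisVec j) hd hd0 hi hpos.le
    have h4 : entrySum (basisVec j : Tensor d) = 1 := by
      simp [entrySum, PiLp.single_apply, apply_ite abs]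
    have e : inner ℝ H (P.info (basisVec j)) = P.info H j := by
      rw [← inner_basisVec, inner_infoOp_uniformDesign, inner_infoOp_uniformDesign]
      simp only [mul_comm]
    rw [e, h4, mul_one] at h3
    rw [PiLp.smul_apply, smul_eq_mul, abs_mul, abs_of_pos hc]
    refine (mul_le_mul_of_nonneg_left h3 hc.le).trans (le_of_eq ?_)
    field_simp
  have h3 := hA _ h2 i
  rw [show infoSolve (P.signalTangent (zeroSum d)) P.info
    (((dstar d : ℝ) / (4 * |H i|)) • P.info H) = _ from h1, PiLp.smul_apply, smul_eq_mul, abs_mul,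
    abs_of_pos hc] at h3
  have h5 : (dstar d : ℝ) / (4 * |H i|) * |H i| = 1 / 4 * dstar d := by field_simp
  rw [h5] at h3
  exact le_of_mul_le_mul_right h3 hD

/-- The bias of the efficient one-step estimator. -/
theorem efficient_bias_le (hΓ : SignalAssumptions P Γ μ κ B cS α M) (hpb : ProjBounds P Q ε C₀)
    (hC : 0 ≤ C₀) (hT : ∀ u a b, |inner ℝ P.tensor (atom u a b)| ≤ R)
    (hT' : ∀ u a b, |inner ℝ Q.tensor (atom u a b)| ≤ R) (hacc : InitAccurate P Q ε)
    (hCA : 1 / 4 ≤ CA)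
    (hA : InfoInvNormLE (Q.signalTangent (zeroSum d)) Q.info (CA * dstar d)) :
    |inner ℝ Γ Q.tensor - inner ℝ Γ P.tensor +
      ∫ z, scoreInfl btl.score Q.tensor (Q.effDir Γ) z
        ∂(btl.law (uniformDesign d) P.tensor)| ≤ (8 * C₀ + 8) * CA * √M * ε ^ 2 * ‖Γ‖ := by
  have hd := hΓ.d_pos
  have hd0 := hΓ.two_le
  have hD : (0 : ℝ) < dstar d := by exact_mod_cast dstar_pos hd
  have hsum := entrySum_le_of_support hΓ.support
  have hS := entrySum_nonneg Γ
  have h1 := (scoreBounds_score R).abs_integral_add_le hd hd0 (H := Q.effDir Γ) hT hT' hacc.2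
  rw [← inner_infoOp_uniformDesign] at h1
  obtain ⟨h2, h3⟩ := Q.effDir_spec hd hd0 Γ
  have h4 := Q.entrySum_effDir_le hd hd0 hA Γ
  have h5 := abs_inner_le_entrySum (V := Γ) (hpb.abs_residual_le hacc.1)
  have h6 := abs_inner_infoOp_le_entrySum (T := Q.tensor) (V := Q.effDir Γ) hd hd0
    (hpb.abs_residual_le hacc.1) (by positivity)
  set Δ := Q.tensor - P.tensor with hΔ
  -- The normal equations identify the pairings of the tangential part with `Γ` and with `Ĝ Ĥ`; both
  -- leftovers involve only the second-order residual.
  have e : inner ℝ Γ Q.tensor - inner ℝ Γ P.tensor +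
      ∫ z, scoreInfl btl.score Q.tensor (Q.effDir Γ) z ∂(btl.law (uniformDesign d) P.tensor) =
      inner ℝ (Δ - Q.proj Δ) Γ - inner ℝ (Δ - Q.proj Δ) (Q.info (Q.effDir Γ)) +
      (∫ z, scoreInfl btl.score Q.tensor (Q.effDir Γ) z ∂(btl.law (uniformDesign d) P.tensor) +
        inner ℝ Δ (Q.info (Q.effDir Γ))) := by
    rw [inner_sub_left Δ, inner_sub_left Δ, h3 _ (Q.proj_mem Δ), hΔ, inner_sub_left Q.tensor P.tensor Γ,
      real_inner_comm Γ Q.tensor, real_inner_comm Γ P.tensor]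
    ring
  rw [e]
  have h7 : entrySum (Q.effDir Γ) / dstar d ≤ CA * entrySum Γ := by
    rw [div_le_iff₀ hD]; linarith
  have h8 : 4 * (C₀ * ε ^ 2) * entrySum (Q.effDir Γ) / dstar d ≤
      4 * (C₀ * ε ^ 2) * (CA * entrySum Γ) := by
    rw [mul_div_assoc]; gcongr
  have h9 : 8 * 1 * ε ^ 2 * entrySum (Q.effDir Γ) / dstar d ≤ 8 * ε ^ 2 * (CA * entrySum Γ) := by
    rw [mul_div_assoc, mul_one]; gcongr
  have h10 : C₀ * ε ^ 2 * entrySum Γ ≤ 4 * (C₀ * ε ^ 2) * (CA * entrySum Γ) := by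
    have : 0 ≤ C₀ * ε ^ 2 * entrySum Γ := by positivity
    nlinarith
  calc _ ≤ 4 * (C₀ * ε ^ 2) * (CA * entrySum Γ) + 4 * (C₀ * ε ^ 2) * (CA * entrySum Γ) +
      8 * ε ^ 2 * (CA * entrySum Γ) :=
        (abs_add_le _ _).trans (add_le_add ((abs_sub _ _).trans
          (add_le_add (h5.trans h10) (h6.trans h8))) (h1.trans h9))
    _ = (8 * C₀ + 8) * CA * ε ^ 2 * entrySum Γ := by ring
    _ ≤ (8 * C₀ + 8) * CA * ε ^ 2 * (√M * ‖Γ‖) := by gcongr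
    _ = _ := by ring

/-- The direction of the efficient one-step estimator. -/
theorem efficient_direction_sub_le (hΓ : SignalAssumptions P Γ μ κ B cS α M)
    (hpb : ProjBounds P Q ε C₀) (hC : 0 ≤ C₀) (hε : 0 ≤ ε) (hα : 0 < α)
    (hT' : ∀ u a b, |inner ℝ Q.tensor (atom u a b)| ≤ R) (hacc : InitAccurate P Q ε) :
    ‖Q.effDir Γ - P.effDir Γ‖ ≤
      ((C₀ * √M / α + 2 * C₀ + 2) / (Real.exp (-R) ^ 2 / 4) + C₀) * ε * ‖P.effDir Γ‖ := by
  have hd := hΓ.d_pos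
  have hd0 := hΓ.two_le
  have hδ := effDim_pos hd hd0
  obtain ⟨h2, h3⟩ := Q.effDir_spec hd hd0 Γ
  obtain ⟨h4, h5⟩ := P.effDir_spec hd hd0 Γ
  have h6 := P.norm_proj_le_effDir hd hd0 Γ
  have h7 := hpb.norm_proj_sub_le hΓ hC hε hα
  have hs0 : 0 < Real.exp (-R) ^ 2 / 4 := by positivity
  set H := P.effDir Γ with hH
  set s₀ := Real.exp (-R) ^ 2 / 4
  set C₁ := C₀ * √M / α with hC₁
  have hC1 : 0 ≤ C₁ := by positivity
  -- Comparing with the projection of `H` instead of `H` keeps the difference in the estimated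
  -- tangent space, where it is a legitimate test vector.
  obtain ⟨D, hDef⟩ : ∃ D, D = Q.effDir Γ - Q.proj H := ⟨_, rfl⟩
  have hDm : D ∈ Q.signalTangent (zeroSum d) := hDef ▸ sub_mem h2 (Q.proj_mem H)
  have hPH : P.proj H = H := TuckerPoint.proj_of_mem h4
  have hQD : Q.proj D = D := TuckerPoint.proj_of_mem hDm
  -- Four error sources: the projected functional, the change of tangent space, the change of
  -- information, and the part of `H` outside the estimated tangent space. Each is at most a
  -- multiple of `ε ‖D‖ ‖H‖ / effDim`.
  have e : inner ℝ D (Q.info D) = inner ℝ D (Q.proj Γ - P.proj Γ) -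
      inner ℝ (Q.proj D - P.proj D) (P.info H) +
      (inner ℝ D (P.info H) - inner ℝ D (Q.info H)) +
      inner ℝ D (Q.info (H - Q.proj H)) := by
    conv_lhs => rw [hDef, map_sub, inner_sub_right, ← hDef, h3 _ hDm]
    have e1 : inner ℝ D (Q.proj Γ) = inner ℝ D Γ := by rw [← Q.inner_proj, hQD]
    have e2 : inner ℝ D (P.proj Γ) = inner ℝ (P.proj D) (P.info H) := by
      rw [← P.inner_proj, h5 _ (P.proj_mem D)]
    rw [inner_sub_right, e1, e2, hQD, inner_sub_left, map_sub, inner_sub_right]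
    ring
  have b0 := le_inner_infoOp hd hd0 hDm.2 hT'
  have b1 : inner ℝ D (Q.proj Γ - P.proj Γ) ≤ C₁ * ε * (‖D‖ * ‖H‖ / effDim d) := by
    refine (real_inner_le_norm _ _).trans ?_
    have h8 : ‖P.proj Γ‖ ≤ ‖H‖ / effDim d := by rw [le_div_iff₀ hδ]; linarith
    calc _ ≤ ‖D‖ * (C₁ * ε * (‖H‖ / effDim d)) := by
          refine mul_le_mul_of_nonneg_left (h7.trans ?_) (norm_nonneg _)
          gcongr
      _ = _ := by ring
  have b2 : -inner ℝ (Q.proj D - P.proj D) (P.info H) ≤ C₀ * ε * (‖D‖ * ‖H‖ / effDim d) := by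
    refine (neg_le_abs _).trans ((abs_inner_infoOp_le (T := P.tensor) hd hd0
      (sub_mem (Q.proj_mem_zeroSum D) (P.proj_mem_zeroSum D)) h4.2).trans ?_)
    calc _ ≤ C₀ * ε * ‖D‖ * ‖H‖ / effDim d := by
          have := hpb.op_sub D
          gcongr
      _ = _ := by ring
  have b3 := (le_abs_self _).trans
    (abs_inner_infoOp_sub_le hd hd0 hDm.2 h4.2 hε hacc.2)
  have b4 : inner ℝ D (Q.info (H - Q.proj H)) ≤ C₀ * ε * (‖D‖ * ‖H‖ / effDim d) := by
    refine (le_abs_self _).trans ((abs_inner_infoOp_le (T := Q.tensor) hd hd0 hDm.2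
      (sub_mem h4.2 (Q.proj_mem_zeroSum H))).trans ?_)
    have h9 : ‖H - Q.proj H‖ ≤ C₀ * ε * ‖H‖ := by
      rw [norm_sub_rev]
      simpa only [hPH] using hpb.op_sub H
    calc _ ≤ ‖D‖ * (C₀ * ε * ‖H‖) / effDim d := by gcongr
      _ = _ := by ring
  have b5 : s₀ * ‖D‖ ^ 2 / effDim d ≤ (C₁ + 2 * C₀ + 2) * ε * (‖D‖ * ‖H‖ / effDim d) := by
    refine b0.trans ?_
    change inner ℝ D (Q.info D) ≤ _
    rw [e]
    have e3 : 2 * ε * (‖D‖ * ‖H‖) / effDim d = 2 * ε * (‖D‖ * ‖H‖ / effDim d) := by ring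
    rw [e3] at b3
    change inner ℝ D (P.info H) - inner ℝ D (Q.info H) ≤ _ at b3
    linarith
  have b6 : ‖D‖ ≤ (C₁ + 2 * C₀ + 2) / s₀ * ε * ‖H‖ := by
    rcases eq_or_ne D 0 with h0 | h0
    · rw [h0, norm_zero]; positivity
    have hp := norm_pos_iff.2 h0
    have b7 : s₀ * ‖D‖ * (‖D‖ / effDim d) ≤ (C₁ + 2 * C₀ + 2) * ε * ‖H‖ * (‖D‖ / effDim d) := by
      refine le_trans (le_of_eq (by ring)) (b5.trans (le_of_eq (by ring)))
    have b8 := le_of_mul_le_mul_right b7 (by positivity)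
    rw [div_mul_eq_mul_div, div_mul_eq_mul_div, le_div_iff₀ hs0]
    linarith
  have b9 : ‖Q.proj H - H‖ ≤ C₀ * ε * ‖H‖ := by simpa only [hPH] using hpb.op_sub H
  have e4 : Q.effDir Γ - H = D + (Q.proj H - H) := by rw [hDef]; abel
  rw [e4]
  refine (norm_add_le _ _).trans ((add_le_add b6 b9).trans (le_of_eq (by ring)))

/-- The efficient one-step estimator with a deterministic initial estimate. -/
theorem exists_efficient_one_step (m : ℕ) (r : Fin (m + 1) → ℕ) (κ B : ℝ) {cS α : ℝ} (M : ℕ)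
    (hcS : 0 < cS) (hα : 0 < α) : ∃ C ε₀ : ℝ, 0 < C ∧ 0 < ε₀ ∧
    ∀ (d : Fin (m + 1) → ℕ) (P Q : TuckerPoint d r) (Γ : Tensor d) (μ ε CA : ℝ),
    SignalAssumptions P Γ μ κ B cS α M → 0 ≤ ε → ε ≤ ε₀ → InitAccurate P Q ε → 1 / 4 ≤ CA →
    InfoInvNormLE (Q.signalTangent (zeroSum d)) Q.info (CA * dstar d) →
    ∀ (n : ℕ) (Ω : Type*) [MeasurableSpace Ω] (Pr : Measure Ω) [IsProbabilityMeasure Pr]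
      (Z : Fin n → Ω → Tensor d × Bool), 0 < n →
      IsIID Z (btl.law (uniformDesign d) P.tensor) Pr → ∀ t,
    |Pr.real {ω | standardized n
      (fun ω => inner ℝ Γ Q.tensor +
        (∑ i, scoreInfl btl.score Q.tensor (Q.effDir Γ) (Z i ω)) / n)
      (inner ℝ Γ P.tensor) (sd (scoreInfl btl.score P.tensor (P.effDir Γ))
        (btl.law (uniformDesign d) P.tensor)) ω ≤ t} - Phi t| ≤
      C * CA * (√((dbar d : ℝ) / n) + ε + √n * ε ^ 2 / √(dbar d)) := by
  obtain ⟨C₀, hC₀, hpb⟩ := SignalAssumptions.exists_projBounds m r κ B hcS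
  have hsc := signalConst_pos (r 0) κ hcS
  obtain ⟨s₀, hs0eq⟩ : ∃ s₀, s₀ = Real.exp (-indexBound (r 0) κ B cS) ^ 2 / 4 := ⟨_, rfl⟩
  have hs : ScoreBounds btl.score btl.fisher (indexBound (r 0) κ B cS) 1 s₀ :=
    hs0eq ▸ scoreBounds_score _
  have hs0 := hs.var_pos
  have hC0 : 0 ≤ C₀ := by linarith
  obtain ⟨K, hKeq⟩ : ∃ K, K = (C₀ * √M / α + 2 * C₀ + 2) / s₀ + C₀ := ⟨_, rfl⟩
  have hK0 : 0 ≤ K := by rw [hKeq]; positivity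
  obtain ⟨E, hEeq⟩ : ∃ E, E = 6 * (1 : ℝ) ^ 2 * (4 + K) / s₀ := ⟨_, rfl⟩
  have hE0 : 0 ≤ E := by rw [hEeq]; positivity
  obtain ⟨c1, hc1eq⟩ : ∃ c, c = 416 * (1 : ℝ) * (4 * C₀) / √s₀ := ⟨_, rfl⟩
  have hc1 : 0 ≤ c1 := by rw [hc1eq]; positivity
  obtain ⟨c3, hc3eq⟩ : ∃ c, c = 2 / (√s₀ * α) * ((8 * C₀ + 8) * √M) := ⟨_, rfl⟩
  have hc3 : 0 ≤ c3 := by rw [hc3eq]; positivity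
  -- Only the bias carries `CA`; the factor 4 absorbs the other terms, since `4 CA ≥ 1`.
  refine ⟨4 * (c1 + 2 * E + c3 + 1), min (signalConst (r 0) κ cS / 2)
      (min (1 / (K + 1)) (1 / (2 * E + 1))),
    by linarith, lt_min (by positivity) (lt_min (by positivity) (by positivity)), ?_⟩
  intro d P Q Γ μ ε CA hΓ hε hε₀ hacc hCA hA n Ω _ Pr _ Z hn hZ t
  obtain ⟨hε1, hε2, hε3⟩ := small_of_le_min hK0 hE0 hε hε₀
  have hpb := hpb d P Q Γ μ α ε M hΓ hε hε1 hacc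
  have hT : ∀ u a b, |inner ℝ P.tensor (atom u a b)| ≤ indexBound (r 0) κ B cS :=
    abs_inner_atom_le (hΓ.regular hcS).bounded
  have hT' : ∀ u a b, |inner ℝ Q.tensor (atom u a b)| ≤ indexBound (r 0) κ B cS :=
    abs_inner_atom_le (hΓ.regular_of_initAccurate hcS hε hε1 hacc).bounded
  have hdir := efficient_direction_sub_le hΓ hpb hC0 hε hα hT' hacc
  rw [← hs0eq, ← hKeq] at hdir
  have hmain := hs.one_step hΓ hα hpb hC0 hT hT' hε hacc
      (P.effDir_spec hΓ.d_pos hΓ.two_le Γ).1.2 (P.norm_proj_le_effDir hΓ.d_pos hΓ.two_le Γ)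
      (Q.effDir_spec hΓ.d_pos hΓ.two_le Γ).1 hK0 hdir hε2 (by rw [← hEeq]; exact hε3) hZ hn
      (efficient_bias_le hΓ hpb hC0 hT hT' hacc hCA hA) t
  rw [← hEeq, ← hc1eq] at hmain
  have e : 2 / (√s₀ * α) * ((8 * C₀ + 8) * CA * √M) = c3 * CA := by rw [hc3eq]; ring
  rw [e] at hmain
  have hq : 0 ≤ √n * ε ^ 2 / √(dbar d : ℝ) := by positivity
  have hp := Real.sqrt_nonneg ((dbar d : ℝ) / n)
  have hCA0 : 0 ≤ 4 * CA := by linarith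
  have h2 := combine_bounds (c3 := c3) (x := c1 * √((dbar d : ℝ) / n) + 2 * (E * ε) +
    c3 * (√n * ε ^ 2 / √(dbar d : ℝ))) hc1 hE0 hc3 hε hp hq le_rfl
  have h3 := mul_le_mul_of_nonneg_left h2 hCA0
  have h4 : c1 * √((dbar d : ℝ) / n) ≤ 4 * CA * (c1 * √((dbar d : ℝ) / n)) :=
    le_mul_of_one_le_left (by positivity) (by linarith)
  have h5 : 2 * (E * ε) ≤ 4 * CA * (2 * (E * ε)) :=
    le_mul_of_one_le_left (by positivity) (by linarith)
  have h6 : 0 ≤ c3 * CA * (√n * ε ^ 2 / √(dbar d : ℝ)) := by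
    have : 0 ≤ CA := by linarith
    positivity
  linarith

end Efficient

end PairwiseBE

/-! ### Integrating out an independent first stage -/

namespace PairwiseBE

section Mixture

variable {Ω 𝒲 𝒵 : Type*} [MeasurableSpace Ω] [MeasurableSpace 𝒲] [MeasurableSpace 𝒵]
  {Pr : Measure Ω} [IsProbabilityMeasure Pr]

/-- If conditionally on a good first stage a statistic is close to normal, then so it is up to
the probability of a bad first stage. -/
theorem abs_prob_sub_Phi_le_of_indepFun {W : Ω → 𝒲} {Z : Ω → 𝒵} (hW : Measurable W)
    (hZ : Measurable Z) (hind : IndepFun W Z Pr) {good : Set 𝒲} (hgood : MeasurableSet good)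
    {F : 𝒲 × 𝒵 → ℝ} (hF : Measurable F) {S : Ω → ℝ}
    (hS : ∀ ω, W ω ∈ good → S ω = F (W ω, Z ω)) {b p t : ℝ} (hb0 : 0 ≤ b)
    (hb : ∀ w ∈ good, |Pr.real {ω | F (w, Z ω) ≤ t} - Phi t| ≤ b)
    (hp : Pr.real {ω | W ω ∉ good} ≤ p) : |Pr.real {ω | S ω ≤ t} - Phi t| ≤ b + p := by
  have hμW : IsProbabilityMeasure (Pr.map W) := Measure.isProbabilityMeasure_map hW.aemeasurable
  have hμZ : IsProbabilityMeasure (Pr.map Z) := Measure.isProbabilityMeasure_map hZ.aemeasurable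
  set E : Set (𝒲 × 𝒵) := {q | q.1 ∈ good ∧ F q ≤ t} with hE
  have hEm : MeasurableSet E := (measurable_fst hgood).inter (measurableSet_le hF measurable_const)
  have hN : MeasurableSet {ω | W ω ∉ good} := (hW hgood).compl
  have hG : MeasurableSet {ω | W ω ∈ good} := hW hgood
  -- the good part
  have h1 : Pr.real ({ω | S ω ≤ t} \ {ω | W ω ∉ good}) =
      ((Pr.map W).prod (Pr.map Z)).real E := by
    rw [← (indepFun_iff_map_prod_eq_prod_map_map hW.aemeasurable hZ.aemeasurable).1 hind,
      map_measureReal_apply (hW.prodMk hZ) hEm]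
    congr 1
    ext ω
    simp only [Set.mem_sdiff, Set.mem_ofPred_eq, not_not, Set.mem_preimage, hE]
    constructor
    · rintro ⟨h, h'⟩
      exact ⟨h', by rw [← hS ω h']; exact h⟩
    · rintro ⟨h, h'⟩
      exact ⟨by rw [hS ω h]; exact h', h⟩
  have hsec : ∀ w, MeasurableSet (Prod.mk w ⁻¹' E) := fun w => measurable_prodMk_left hEm
  have h2 : ((Pr.map W).prod (Pr.map Z)).real E =
      ∫ w, (Pr.map Z).real (Prod.mk w ⁻¹' E) ∂(Pr.map W) := by
    simp only [Measure.real]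
    rw [Measure.prod_apply hEm, integral_toReal (measurable_measure_prodMk_left hEm).aemeasurable
      (Filter.Eventually.of_forall fun w => measure_lt_top _ _)]
  have h3 : (Pr.map W).real good = ∫ w, good.indicator (fun _ => (1 : ℝ)) w ∂(Pr.map W) := by
    rw [integral_indicator hgood]; simp
  have hi1 : Integrable (fun w => (Pr.map Z).real (Prod.mk w ⁻¹' E)) (Pr.map W) := by
    refine Integrable.of_bound (C := 1)
      (measurable_measure_prodMk_left hEm).ennreal_toReal.aestronglyMeasurable
      (Filter.Eventually.of_forall fun w => ?_)
    rw [Real.norm_of_nonneg measureReal_nonneg]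
    exact measureReal_le_one
  have hi2 : Integrable (fun w => good.indicator (fun _ => (1 : ℝ)) w * Phi t) (Pr.map W) :=
    ((integrable_const _).indicator hgood).mul_const _
  have h4 : |((Pr.map W).prod (Pr.map Z)).real E - (Pr.map W).real good * Phi t| ≤ b := by
    rw [h2, h3, ← integral_mul_const, ← integral_sub hi1 hi2]
    have h5 := norm_integral_le_of_norm_le_const (μ := Pr.map W) (C := b)
      (f := fun w => (Pr.map Z).real (Prod.mk w ⁻¹' E) -
        good.indicator (fun _ => (1 : ℝ)) w * Phi t) (Filter.Eventually.of_forall fun w => ?_)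
    · simpa using h5
    · by_cases hw : w ∈ good
      · rw [Set.indicator_of_mem hw, one_mul, map_measureReal_apply hZ (hsec w), Real.norm_eq_abs]
        refine le_trans (le_of_eq ?_) (hb w hw)
        congr 3
        ext ω
        simp [hE, hw]
      · have : Prod.mk w ⁻¹' E = ∅ := by
          ext z; simp [hE, hw]
        rw [Set.indicator_of_notMem hw, this]
        simpa using hb0
  have h6 : (Pr.map W).real good = 1 - Pr.real {ω | W ω ∉ good} := by
    rw [map_measureReal_apply hW hgood, ← probReal_compl_eq_one_sub hN]
    congr 1
    ext ω
    simp
  have h7 := measureReal_inter_add_sdiff (μ := Pr) (s := {ω | S ω ≤ t}) hN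
  have h8 : Pr.real ({ω | S ω ≤ t} ∩ {ω | W ω ∉ good}) ≤ Pr.real {ω | W ω ∉ good} :=
    measureReal_mono Set.inter_subset_right
  have h9 : 0 ≤ Pr.real ({ω | S ω ≤ t} ∩ {ω | W ω ∉ good}) := measureReal_nonneg
  rw [← h1, h6] at h4
  have hΦ0 := Phi_nonneg t
  have hΦ1 := Phi_le_one t
  have hq : 0 ≤ Pr.real {ω | W ω ∉ good} := measureReal_nonneg
  -- The bad part of the event and `q Φ(t)`, where `q` is the probability of a bad first stage, both
  -- lie in `[0, q]`, so they differ by at most `q ≤ p`.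
  rw [abs_le] at h4 ⊢
  constructor <;> nlinarith

end Mixture

/-! ### Measurability of matrices with measurable entries -/

section MeasMat

variable {𝒲 : Type*} [MeasurableSpace 𝒲] {α β γ : Type*} [Fintype α] [Fintype β] [Fintype γ]
  [DecidableEq α] [DecidableEq β] [DecidableEq γ]

/-- All the entries are measurable. -/
def MeasMat (A : 𝒲 → Matrix α β ℝ) : Prop := ∀ i j, Measurable fun w => A w i j

theorem MeasMat.mul {A : 𝒲 → Matrix α β ℝ} {B : 𝒲 → Matrix β γ ℝ} (hA : MeasMat A)
    (hB : MeasMat B) : MeasMat fun w => A w * B w := fun i j => by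
  simp only [Matrix.mul_apply]
  exact Finset.measurable_sum _ fun k _ => (hA i k).mul (hB k j)

theorem MeasMat.transpose {A : 𝒲 → Matrix α β ℝ} (hA : MeasMat A) : MeasMat fun w => (A w)ᵀ :=
  fun i j => hA j i

theorem MeasMat.add {A B : 𝒲 → Matrix α β ℝ} (hA : MeasMat A) (hB : MeasMat B) :
    MeasMat fun w => A w + B w := fun i j => (hA i j).add (hB i j)

theorem MeasMat.sub {A B : 𝒲 → Matrix α β ℝ} (hA : MeasMat A) (hB : MeasMat B) :
    MeasMat fun w => A w - B w := fun i j => (hA i j).sub (hB i j)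

theorem measMat_const (A : Matrix α β ℝ) : MeasMat fun _ : 𝒲 => A := fun _ _ => measurable_const

theorem MeasMat.sum {κ : Type*} (s : Finset κ) {A : κ → 𝒲 → Matrix α β ℝ}
    (hA : ∀ k ∈ s, MeasMat (A k)) : MeasMat fun w => ∑ k ∈ s, A k w := fun i j => by
  simp only [Matrix.sum_apply]
  exact Finset.measurable_sum _ fun k hk => hA k hk i j

theorem MeasMat.det {A : 𝒲 → Matrix α α ℝ} (hA : MeasMat A) : Measurable fun w => (A w).det := by
  simp only [Matrix.det_apply]
  exact Finset.measurable_sum _ fun σ _ =>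
    (Finset.measurable_prod _ fun i _ => hA _ _).const_smul _

/-- Cramer's rule: determinants are polynomials in the entries, and real inversion is measurable
even with its conventional value at zero. -/
theorem MeasMat.inv {A : 𝒲 → Matrix α α ℝ} (hA : MeasMat A) : MeasMat fun w => (A w)⁻¹ :=
  fun i j => by
  simp only [Matrix.inv_def, Matrix.smul_apply, Matrix.adjugate_apply, Ring.inverse_eq_inv',
    smul_eq_mul]
  refine hA.det.inv.mul (MeasMat.det fun k l => ?_)
  simp only [Matrix.updateRow_apply]
  split_ifs
  · exact measurable_const
  · exact hA k l

theorem MeasMat.op_apply {A : 𝒲 → Matrix α α ℝ} (hA : MeasMat A) {z : 𝒲 → EuclideanSpace ℝ α}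
    (hz : ∀ j, Measurable fun w => z w j) (i : α) : Measurable fun w => op (A w) (z w) i := by
  simp only [PairwiseBE.op_apply]
  exact Finset.measurable_sum _ fun j _ => (hA i j).mul (hz j)

theorem measurable_of_entries {z : 𝒲 → EuclideanSpace ℝ α} (hz : ∀ j, Measurable fun w => z w j) :
    Measurable z :=
  (WithLp.measurable_toLp 2 (α → ℝ)).comp (measurable_pi_lambda _ hz)

theorem MeasMat.kron {ι : Type*} [Fintype ι] [DecidableEq ι] {a b : ι → Type*}
    [∀ k, Fintype (a k)] [∀ k, DecidableEq (a k)] [∀ k, Fintype (b k)] [∀ k, DecidableEq (b k)]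
    {A : 𝒲 → ∀ k, Matrix (a k) (b k) ℝ} (hA : ∀ k, MeasMat fun w => A w k) :
    MeasMat fun w => kron (A w) := fun i j => by
  simp only [kron_apply]
  exact Finset.measurable_prod _ fun k _ => hA k _ _

end MeasMat

/-! ### Measurability of the plug-in projection and of the plug-in direction -/

section MeasTucker

variable {m : ℕ} {d r : Fin (m + 1) → ℕ}

theorem TuckerPoint.core_gram_isUnit (P : TuckerPoint d r) (k : Fin (m + 1)) :
    IsUnit (unfold P.core k * (unfold P.core k)ᵀ).det := by
  rw [← Matrix.isUnit_iff_isUnit_det, ← Matrix.mulVec_injective_iff_isUnit]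
  obtain ⟨R, hR⟩ := P.exists_core_inverse k
  rw [← Matrix.coe_mulVecLin, injective_iff_map_eq_zero]
  intro x hx
  rw [Matrix.mulVecLin_apply, ← Matrix.mulVec_mulVec] at hx
  have h1 : (unfold P.core k)ᵀ *ᵥ x ⬝ᵥ ((unfold P.core k)ᵀ *ᵥ x) = 0 := by
    rw [Matrix.dotProduct_mulVec, Matrix.vecMul_transpose, hx, zero_dotProduct]
  have h2 := dotProduct_self_eq_zero.1 h1
  have h3 : (Rᵀ * (unfold P.core k)ᵀ) *ᵥ x = 0 := by
    rw [← Matrix.mulVec_mulVec, h2, Matrix.mulVec_zero]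
  rwa [← Matrix.transpose_mul, hR, Matrix.transpose_one, Matrix.one_mulVec] at h3

/-- The projection onto the row space of an unfolding in terms of the factors. -/
theorem TuckerPoint.rowMat_eq (P : TuckerPoint d r) (k : Fin (m + 1)) :
    P.rowMat k = (unfold P.tensor k)ᵀ * (P.factor k *
      (unfold P.core k * (unfold P.core k)ᵀ)⁻¹ * (P.factor k)ᵀ * unfold P.tensor k) := by
  symm
  -- Moving `Uᵀ` past the Gram matrix of the unfolding produces the Gram matrix of the core, which
  -- the inverse in the formula cancels.
  have hUA : (P.factor k)ᵀ * (unfold P.tensor k * (unfold P.tensor k)ᵀ) =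
      unfold P.core k * (unfold P.core k)ᵀ * (P.factor k)ᵀ := by
    rw [P.unfold_tensor]
    simp only [Matrix.transpose_mul, Matrix.transpose_transpose, Matrix.mul_assoc]
    rw [← Matrix.mul_assoc (P.factor k)ᵀ (P.factor k), P.orthonormal, Matrix.one_mul,
      ← Matrix.mul_assoc _ (kron fun j => P.factor (k.succAbove j)), P.kron_others_orthonormal,
      Matrix.one_mul]
  have hAU : P.factor k * (P.factor k)ᵀ * unfold P.tensor k = unfold P.tensor k := by
    rw [← P.colMat_eq]; exact colProj_mul_self _
  refine eq_colProj ?_ ?_ ⟨_, rfl⟩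
  · have e : (unfold P.tensor k)ᵀ * (P.factor k * (unfold P.core k * (unfold P.core k)ᵀ)⁻¹ *
        (P.factor k)ᵀ * unfold P.tensor k) * (unfold P.tensor k)ᵀ =
        (unfold P.tensor k)ᵀ * (P.factor k * ((unfold P.core k * (unfold P.core k)ᵀ)⁻¹ *
        ((P.factor k)ᵀ * (unfold P.tensor k * (unfold P.tensor k)ᵀ)))) := by
      simp only [Matrix.mul_assoc]
    rw [e, hUA, ← Matrix.mul_assoc _⁻¹, Matrix.nonsing_inv_mul _ (P.core_gram_isUnit k),
      Matrix.one_mul]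
    have := congrArg Matrix.transpose hAU
    rwa [Matrix.transpose_mul, Matrix.transpose_mul, Matrix.transpose_transpose] at this
  · simp only [Matrix.transpose_mul, Matrix.transpose_transpose, Matrix.transpose_nonsing_inv,
      Matrix.mul_assoc]

/-- The matrix of the projection onto the signal tangent space of a zero-sum tensor. -/
noncomputable def TuckerPoint.projMat (P : TuckerPoint d r) :
    Matrix ((k : Fin (m + 1)) → Fin (d k)) ((k : Fin (m + 1)) → Fin (d k)) ℝ :=
  P.tangentMat * zeroSumMat d

theorem TuckerPoint.proj_eq_op {P : TuckerPoint d r} (h : P.tensor ∈ zeroSum d) (z : Tensor d) :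
    P.proj z = op P.projMat z := by
  rw [projMat, op_mul_apply]
  exact P.signalTangent_starProjection h z

/-- The matrix of the information operator. -/
noncomputable def infoMat (T : Tensor d) :
    Matrix ((k : Fin (m + 1)) → Fin (d k)) ((k : Fin (m + 1)) → Fin (d k)) ℝ :=
  Matrix.of fun i j => ∫ x, btl.fisher (inner ℝ T x) * (x i * x j) ∂(uniformDesign d)

/-- The matrix of `V ↦ A⁻¹ P_𝕋 V` at a zero-sum tensor. -/
noncomputable def TuckerPoint.solveMat (P : TuckerPoint d r) :
    Matrix ((k : Fin (m + 1)) → Fin (d k)) ((k : Fin (m + 1)) → Fin (d k)) ℝ :=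
  (P.projMat * infoMat P.tensor * P.projMat + (1 - P.projMat))⁻¹ * P.projMat

/-- Adding `1 - P` makes the compressed information invertible on the whole space without changing
it on the tangent space. The direction becomes a rational expression in measurable matrices. -/
theorem TuckerPoint.effDir_eq_op {P : TuckerPoint d r} (hd : ∀ k, 0 < d k) (hd0 : 2 ≤ d 0)
    (h : P.tensor ∈ zeroSum d) (V : Tensor d) : P.effDir V = op P.solveMat V := by
  set S := P.projMat with hS
  set A := S * infoMat P.tensor * S + (1 - S) with hA
  have hG : ∀ z, op (infoMat P.tensor) z = P.info z := fun z => rfl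
  have hproj : ∀ z, op S z = P.proj z := fun z => (P.proj_eq_op h z).symm
  have hAz : ∀ z, op A z = P.proj (P.info (P.proj z)) + (z - P.proj z) := fun z => by
    rw [hA, op_add_apply, op_mul_apply, op_mul_apply, op_sub_apply, op_one_apply, hproj, hproj, hG]
  have hidem : ∀ z, P.proj (P.proj z) = P.proj z := fun z => TuckerPoint.proj_of_mem (P.proj_mem z)
  obtain ⟨h1, h2⟩ := P.effDir_spec hd hd0 V
  have hH : op A (P.effDir V) = P.proj V := by
    rw [hAz, TuckerPoint.proj_of_mem h1, sub_self, add_zero]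
    refine ext_inner_left ℝ fun y => ?_
    rw [← P.inner_proj, h2 _ (P.proj_mem y), P.inner_proj]
  have hunit : IsUnit A.det := by
    rw [← Matrix.isUnit_iff_isUnit_det, ← Matrix.mulVec_injective_iff_isUnit,
      ← Matrix.coe_mulVecLin, injective_iff_map_eq_zero]
    intro x hx
    have hx' : op A (WithLp.toLp 2 x) = 0 := by
      ext i; exact congrFun hx i
    rw [hAz] at hx'
    set z : Tensor d := WithLp.toLp 2 x with hz
    have h3 : P.proj (P.info (P.proj z)) = 0 := by
      have := congrArg P.proj hx'
      rwa [map_add, map_sub, hidem, hidem, sub_self, add_zero, map_zero] at this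
    have h4 : P.proj z = 0 := by
      by_contra hne
      have h5 := inner_infoOp_pos hd hd0 P.tensor (P.proj_mem_zeroSum z) hne
      rw [← hidem, P.inner_proj, hidem] at h5
      change 0 < inner ℝ (P.proj z) (P.proj (P.info (P.proj z))) at h5
      rw [h3, inner_zero_right] at h5
      exact lt_irrefl _ h5
    rw [h3, h4, zero_add, sub_zero] at hx'
    exact congrArg WithLp.ofLp hx'
  change _ = op (A⁻¹ * S) V
  rw [op_mul_apply, hproj, ← hH, ← op_mul_apply, Matrix.nonsing_inv_mul _ hunit, op_one_apply]

/-- The `ℓ^∞` norm of a matrix through its row sums. -/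
theorem infoInvNormLE_iff {P : TuckerPoint d r} (hd : ∀ k, 0 < d k) (hd0 : 2 ≤ d 0)
    (h : P.tensor ∈ zeroSum d) {c : ℝ} :
    InfoInvNormLE (P.signalTangent (zeroSum d)) P.info c ↔ ∀ i, ∑ j, |P.solveMat i j| ≤ c := by
  have e : ∀ V i, infoSolve (P.signalTangent (zeroSum d)) P.info V i = ∑ j, P.solveMat i j * V j :=
    fun V i => congrArg (fun z : Tensor d => z i) (P.effDir_eq_op hd hd0 h V)
  constructor
  · intro hA i
    have h1 := hA _ (abs_signVec_le (WithLp.toLp 2 (P.solveMat i))) i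
    refine le_trans (le_of_eq ?_) ((le_abs_self _).trans h1)
    rw [e]
    refine Finset.sum_congr rfl fun j _ => ?_
    change _ = P.solveMat i j * (if 0 ≤ P.solveMat i j then (1 : ℝ) else -1)
    split_ifs with h0
    · rw [abs_of_nonneg h0, mul_one]
    · rw [abs_of_neg (not_le.1 h0), mul_neg, mul_one]
  · intro hA V hV i
    rw [e]
    refine (Finset.abs_sum_le_sum_abs _ _).trans (le_trans (Finset.sum_le_sum fun j _ => ?_) (hA i))
    rw [abs_mul]
    exact mul_le_of_le_one_right (abs_nonneg _) (hV j)

variable {𝒲 : Type*} [MeasurableSpace 𝒲] {Phat : 𝒲 → TuckerPoint d r}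

/-- A random Tucker point with measurable core and factors. -/
structure MeasPoint (Phat : 𝒲 → TuckerPoint d r) : Prop where
  core : Measurable fun w => (Phat w).core
  factor : ∀ k a j, Measurable fun w => (Phat w).factor k a j

theorem MeasPoint.core_entry (h : MeasPoint Phat) (i : (k : Fin (m + 1)) → Fin (r k)) :
    Measurable fun w => (Phat w).core i := by
  have h1 : Measurable fun w => (WithLp.ofLp (Phat w).core) :=
    (WithLp.measurable_ofLp 2 _).comp h.core
  exact (measurable_pi_iff.1 h1) i

theorem MeasPoint.entry (h : MeasPoint Phat) (i : (k : Fin (m + 1)) → Fin (d k)) :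
    Measurable fun w => (Phat w).tensor i := by
  change Measurable fun w => ∑ j : (k : Fin (m + 1)) → Fin (r k), (Phat w).core j *
    ∏ k, (Phat w).factor k (i k) (j k)
  exact Finset.measurable_sum _ fun j _ =>
    (h.core_entry j).mul (Finset.measurable_prod _ fun k _ => h.factor k _ _)

theorem MeasPoint.tensor (h : MeasPoint Phat) : Measurable fun w => (Phat w).tensor :=
  measurable_of_entries h.entry

theorem MeasPoint.colMat (h : MeasPoint Phat) (k : Fin (m + 1)) :
    MeasMat fun w => (Phat w).colMat k := by
  simp only [TuckerPoint.colMat_eq]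
  have : MeasMat fun w => (Phat w).factor k := h.factor k
  exact this.mul this.transpose

theorem MeasPoint.rowMat (h : MeasPoint Phat) (k : Fin (m + 1)) :
    MeasMat fun w => (Phat w).rowMat k := by
  simp only [TuckerPoint.rowMat_eq]
  have h1 : MeasMat fun w => (Phat w).factor k := h.factor k
  have h2 : MeasMat fun w => unfold (Phat w).tensor k := fun a b => h.entry _
  have h3 : MeasMat fun w => unfold (Phat w).core k := fun a b => h.core_entry _
  exact h2.transpose.mul (((h1.mul (h3.mul h3.transpose).inv).mul h1.transpose).mul h2)

theorem MeasPoint.projMat (h : MeasPoint Phat) : MeasMat fun w => (Phat w).projMat := by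
  refine MeasMat.mul ((MeasMat.kron fun k => h.colMat k).add
    (MeasMat.sum _ fun k _ => MeasMat.mul ?_ ?_)) (measMat_const _)
  · refine MeasMat.kron (A := fun w => Function.update (fun k => 1) k (1 - (Phat w).colMat k))
      fun j => ?_
    rcases eq_or_ne j k with rfl | hj
    · simp only [Function.update_self]
      exact (measMat_const 1).sub (h.colMat j)
    · simp only [Function.update_of_ne hj]
      exact measMat_const 1
  · intro i j
    simp only [coMat, slice_apply]
    split_ifs
    · exact h.rowMat k _ _
    · exact measurable_const

theorem MeasPoint.infoMat (h : MeasPoint Phat) : MeasMat fun w => infoMat (Phat w).tensor := by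
  intro i j
  simp only [PairwiseBE.infoMat, Matrix.of_apply, integral_design]
  refine Measurable.const_mul (Finset.measurable_sum _ fun u _ => Finset.measurable_sum _ fun a _ =>
    Finset.measurable_sum _ fun b _ => Measurable.mul_const ?_ _) _
  exact btl.measurable_fisher.comp (h.tensor.inner measurable_const)

theorem MeasPoint.solveMat (h : MeasPoint Phat) : MeasMat fun w => (Phat w).solveMat :=
  ((h.projMat.mul h.infoMat).mul h.projMat |>.add ((measMat_const 1).sub h.projMat)).inv.mul
    h.projMat

theorem MeasPoint.measurableSet_initAccurate (h : MeasPoint Phat) (P : TuckerPoint d r) (ε : ℝ) :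
    MeasurableSet {w | InitAccurate P (Phat w) ε} := by
  have e : {w | InitAccurate P (Phat w) ε} =
      (⋂ u : Context d, {w | ∑ a, (Phat w).tensor (Fin.cons (α := fun k => Fin (d k)) a u) = 0}) ∩
      ⋂ i, {w | |(Phat w).tensor i - P.tensor i| ≤ ε} := by
    ext w
    simp only [Set.mem_inter_iff, Set.mem_iInter, Set.mem_ofPred_eq]
    rfl
  rw [e]
  refine (MeasurableSet.iInter fun u => ?_).inter (MeasurableSet.iInter fun i => ?_)
  · have hm : Measurable fun w => ∑ a : Fin (d 0),
        (Phat w).tensor (Fin.cons (α := fun k => Fin (d k)) a u) :=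
      Finset.measurable_sum _ fun a _ => h.entry (Fin.cons (α := fun k => Fin (d k)) a u)
    exact measurableSet_eq_fun hm measurable_const
  · exact measurableSet_le ((h.entry i).sub_const _).abs measurable_const

/-- Row sums reduce uncountably many constraints to finitely many. The matrix formula requires a
zero-sum tensor, so the two events are treated together. -/
theorem MeasPoint.measurableSet_infoInvNormLE (h : MeasPoint Phat) (hd : ∀ k, 0 < d k)
    (hd0 : 2 ≤ d 0) (P : TuckerPoint d r) (ε c : ℝ) :
    MeasurableSet {w | InitAccurate P (Phat w) ε ∧
      InfoInvNormLE ((Phat w).signalTangent (zeroSum d)) (Phat w).info c} := by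
  have hS : MeasurableSet (⋂ i, {w | ∑ j, |(Phat w).solveMat i j| ≤ c}) :=
    MeasurableSet.iInter fun i =>
      measurableSet_le (Finset.measurable_sum _ fun j _ => (h.solveMat i j).abs) measurable_const
  convert (h.measurableSet_initAccurate P ε).inter hS using 1
  refine Set.ext fun w => ⟨fun hw => ⟨hw.1, Set.mem_iInter.2 fun i => ?_⟩, fun hw => ⟨hw.1, ?_⟩⟩
  · exact (infoInvNormLE_iff hd hd0 hw.1.1).1 hw.2 i
  · exact (infoInvNormLE_iff hd hd0 hw.1.1).2 fun i => Set.mem_iInter.1 hw.2 i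

end MeasTucker

end PairwiseBE

/-! ### Rates for the one-step estimators -/

namespace PairwiseBE

/-- The constant that compares the error terms with the rate. -/
noncomputable def rateConst (c C₁ : ℝ) : ℝ :=
  (Real.log 2 ^ c)⁻¹ + C₁ / √(Real.log 2 ^ c) + C₁ ^ 2

theorem rateConst_pos (c : ℝ) {C₁ : ℝ} (hC : 0 < C₁) : 0 < rateConst c C₁ := by
  have h : 0 < Real.log 2 := Real.log_pos one_lt_two
  have h1 : 0 < Real.log 2 ^ c := Real.rpow_pos_of_pos h c
  rw [rateConst]
  positivity

/-- With `y = √(D/n)` and `L = log^c D`, the terms are `y`, `C₁ √L y` and exactly `C₁² L y`, while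
the target is `L y`. The first two are absorbed using `L ≥ (log 2)^c`, valid as `D ≥ 2`. -/
theorem error_terms_le {c C₁ : ℝ} (hc : 0 < c) (hC : 0 < C₁) {D n : ℕ} (hD : 2 ≤ D) (hn : 1 ≤ n) :
    √((D : ℝ) / n) + C₁ * √((D : ℝ) * Real.log D ^ c / n) +
      √n * (C₁ * √((D : ℝ) * Real.log D ^ c / n)) ^ 2 / √D ≤
    rateConst c C₁ * √((D : ℝ) * Real.log D ^ (2 * c) / n) := by
  have hD2 : (2 : ℝ) ≤ D := by exact_mod_cast hD
  have hD0 : (0 : ℝ) < D := by linarith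
  have hn0 : (0 : ℝ) < n := by exact_mod_cast hn
  have hl2 : 0 < Real.log 2 := Real.log_pos one_lt_two
  have hlog : Real.log 2 ≤ Real.log D := Real.log_le_log two_pos hD2
  obtain ⟨L, hL⟩ : ∃ L, L = Real.log D ^ c := ⟨_, rfl⟩
  obtain ⟨l, hl⟩ : ∃ l, l = Real.log 2 ^ c := ⟨_, rfl⟩
  have hl0 : 0 < l := hl ▸ Real.rpow_pos_of_pos hl2 c
  have hlL : l ≤ L := by rw [hl, hL]; exact Real.rpow_le_rpow hl2.le hlog hc.le
  have hL0 : 0 < L := hl0.trans_le hlL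
  have hL2 : Real.log D ^ (2 * c) = L ^ 2 := by
    rw [hL, mul_comm, Real.rpow_mul (hl2.le.trans hlog)]
    norm_num
  rw [rateConst, hL2, ← hL, ← hl]
  obtain ⟨y, hy⟩ : ∃ y, y = √((D : ℝ) / n) := ⟨_, rfl⟩
  have hy0 : 0 ≤ y := hy ▸ Real.sqrt_nonneg _
  have e1 : √((D : ℝ) * L ^ 2 / n) = L * y := by
    rw [mul_div_right_comm, mul_comm, Real.sqrt_mul (sq_nonneg _), Real.sqrt_sq hL0.le, hy]
  have e2 : √((D : ℝ) * L / n) = √L * y := by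
    rw [mul_div_right_comm, mul_comm, Real.sqrt_mul hL0.le, hy]
  have e3 : √(n : ℝ) * y = √D := by
    rw [hy, ← Real.sqrt_mul hn0.le]
    congr 1
    field_simp
  rw [e1, e2, ← hy]
  have hsl := Real.sqrt_pos.2 hl0
  have hsD := Real.sqrt_pos.2 hD0
  have t1 : y ≤ l⁻¹ * (L * y) := by
    rw [← mul_assoc]
    refine le_mul_of_one_le_left hy0 ?_
    rw [inv_mul_eq_div, one_le_div hl0]
    exact hlL
  have t2 : C₁ * (√L * y) ≤ C₁ / √l * (L * y) := by
    have h1 : √L ≤ L / √l := by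
      rw [le_div_iff₀ hsl]
      calc √L * √l ≤ √L * √L := by gcongr
        _ = L := Real.mul_self_sqrt hL0.le
    calc C₁ * (√L * y) ≤ C₁ * (L / √l * y) := by gcongr
      _ = _ := by ring
  have t3 : √n * (C₁ * (√L * y)) ^ 2 / √D = C₁ ^ 2 * (L * y) := by
    rw [div_eq_iff hsD.ne', ← e3, mul_pow, mul_pow, Real.sq_sqrt hL0.le]
    ring
  rw [t3]
  linarith

section Plugin

variable {Ω 𝒲 : Type*} [MeasurableSpace Ω] [MeasurableSpace 𝒲] {Pr : Measure Ω}
  [IsProbabilityMeasure Pr] {m : ℕ} {d : Fin (m + 1) → ℕ} {n : ℕ}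

/-- From a deterministic to an independent random initial estimate. -/
theorem kolmDist_one_step_le {s : Bool → ℝ → ℝ} (hs : Measurable fun p : Bool × ℝ => s p.1 p.2)
    {Z : Fin n → Ω → Tensor d × Bool} (hZ : ∀ i, Measurable (Z i)) {W : Ω → 𝒲} (hW : Measurable W)
    (hind : IndepFun W (fun ω i => Z i ω) Pr) {good : 𝒲 → Prop}
    (hgood : MeasurableSet {w | good w}) {T H : 𝒲 → Tensor d} (hT : Measurable T)
    (hH : Measurable H) (Γ : Tensor d) {est : Ω → ℝ} {ψ v b p : ℝ}
    (hest : ∀ ω, good (W ω) → est ω =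
      inner ℝ Γ (T (W ω)) + (∑ i, scoreInfl s (T (W ω)) (H (W ω)) (Z i ω)) / n)
    (hb0 : 0 ≤ b) (hb : ∀ w, good w → ∀ t, |Pr.real {ω | standardized n (fun ω =>
      inner ℝ Γ (T w) + (∑ i, scoreInfl s (T w) (H w) (Z i ω)) / n) ψ v ω ≤ t} - Phi t| ≤ b)
    (hp : Pr.real {ω | ¬ good (W ω)} ≤ p) : kolmDist Pr (standardized n est ψ v) ≤ b + p := by
  have hF : Measurable fun q : 𝒲 × (Fin n → Tensor d × Bool) =>
      √n * (inner ℝ Γ (T q.1) + (∑ i, scoreInfl s (T q.1) (H q.1) (q.2 i)) / n - ψ) / v := by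
    have hi : ∀ i, Measurable fun q : 𝒲 × (Fin n → Tensor d × Bool) =>
        scoreInfl s (T q.1) (H q.1) (q.2 i) := fun i => by
      have hz : Measurable fun q : 𝒲 × (Fin n → Tensor d × Bool) => q.2 i :=
        (measurable_pi_apply i).comp measurable_snd
      have hx := measurable_fst.comp hz
      have h1 : Measurable fun q : 𝒲 × (Fin n → Tensor d × Bool) =>
          s (q.2 i).2 (inner ℝ (T q.1) (q.2 i).1) :=
        hs.comp ((measurable_snd.comp hz).prodMk ((hT.comp measurable_fst).inner hx))
      exact h1.mul ((hH.comp measurable_fst).inner hx)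
    have hsum := Finset.measurable_sum Finset.univ fun i _ => hi i
    exact ((((measurable_const.inner (hT.comp measurable_fst)).add
      (hsum.div_const _)).sub_const _).const_mul _).div_const _
  refine kolmDist_le fun t => ?_
  refine abs_prob_sub_Phi_le_of_indepFun hW (measurable_pi_lambda _ hZ) hind hgood hF
    (fun ω hω => ?_) hb0 (fun w hw => hb w hw t) hp
  rw [standardized, hest ω hω]

end Plugin

/-- The rate of the whitened one-step estimator. -/
theorem exists_whitened_rate (m : ℕ) (r : Fin (m + 1) → ℕ) (μ κ B cS α c C₁ : ℝ) (M : ℕ)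
    (hcS : 0 < cS) (hα : 0 < α) (hc : 0 < c) (hC₁ : 0 < C₁) : ∃ C : ℝ, 0 < C ∧
      ∀ (d : Fin (m + 1) → ℕ) (P : TuckerPoint d r) (Γ : Tensor d),
      SignalAssumptions P Γ μ κ B cS α M →
      ∀ (n : ℕ) (Ω 𝒲 : Type*) [MeasurableSpace Ω] [MeasurableSpace 𝒲]
        (Pr : Measure Ω) [IsProbabilityMeasure Pr]
        (Z : Fin n → Ω → Tensor d × Bool) (W : Ω → 𝒲) (Phat : 𝒲 → TuckerPoint d r) (p : ℝ),
      1 ≤ n → IsIID Z (btl.law (uniformDesign d) P.tensor) Pr →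
      Measurable W → IndepFun W (fun ω i => Z i ω) Pr →
      Measurable (fun w => (Phat w).core) →
      (∀ k a j, Measurable fun w => (Phat w).factor k a j) →
      Pr.real {ω | ¬ InitAccurate P (Phat (W ω))
        (C₁ * √((dbar d : ℝ) * Real.log (dbar d) ^ c / n))} ≤ p →
      let H : Tensor d := effDim d • (P.signalTangent (zeroSum d)).starProjection Γ
      let v : ℝ := sd (btl.whitenedInfl P.tensor H) (btl.law (uniformDesign d) P.tensor)
      kolmDist Pr (standardized n (whitenedEstimator Γ Phat W Z) (inner ℝ Γ P.tensor) v) ≤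
        C * √((dbar d : ℝ) * Real.log (dbar d) ^ (2 * c) / n) + p := by
  obtain ⟨C, ε₀, hC, hε₀, hmain⟩ := exists_whitened_one_step m r κ B M hcS hα
  have hK := rateConst_pos c hC₁
  refine ⟨C * rateConst c C₁ + rateConst c C₁ / ε₀, by positivity, ?_⟩
  intro d P Γ hΓ n Ω 𝒲 _ _ Pr _ Z W Phat p hn hZ hW hind hcore hfac hp H v
  have hdb : 2 ≤ dbar d := hΓ.two_le.trans (Finset.le_sup (Finset.mem_univ 0))
  have hp0 : 0 ≤ p := measureReal_nonneg.trans hp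
  have herr := error_terms_le hc hC₁ hdb hn
  obtain ⟨x, hx⟩ : ∃ x, x = √((dbar d : ℝ) * Real.log (dbar d) ^ (2 * c) / n) := ⟨_, rfl⟩
  obtain ⟨ε, hε⟩ : ∃ ε, ε = C₁ * √((dbar d : ℝ) * Real.log (dbar d) ^ c / n) := ⟨_, rfl⟩
  have hx0 : 0 ≤ x := hx ▸ Real.sqrt_nonneg _
  have hεn : 0 ≤ ε := by rw [hε]; positivity
  rw [← hx, ← hε] at herr
  rw [← hε] at hp
  rw [← hx]
  have h1 := Real.sqrt_nonneg ((dbar d : ℝ) / n)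
  have h2 : 0 ≤ √n * ε ^ 2 / √(dbar d : ℝ) := by positivity
  -- Since `ε` is at most `rateConst` times the rate, `ε > ε₀` makes the claimed bound exceed one.
  rcases le_or_gt ε ε₀ with hle | hgt
  · have hQ : MeasPoint Phat := ⟨hcore, hfac⟩
    have hgood := hQ.measurableSet_initAccurate P ε
    -- The matrix formula is measurable in the first stage and agrees with the projection at
    -- zero-sum estimates; only the good event matters.
    have hH' : Measurable fun w => effDim d • op (Phat w).projMat Γ :=
      (measurable_of_entries fun j =>
        hQ.projMat.op_apply (z := fun _ => Γ) (fun _ => measurable_const) j).const_smul (effDim d)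
    have hb := kolmDist_one_step_le (b := C * (rateConst c C₁ * x)) btl.measurable_whitenedScore
      hZ.measurable hW hind hgood hQ.tensor hH' Γ
      (est := whitenedEstimator Γ Phat W Z) (ψ := inner ℝ Γ P.tensor) (v := v) (p := p)
      (fun ω hω => by rw [← TuckerPoint.proj_eq_op hω.1]; rfl) (by positivity)
      (fun w hw t => by
        rw [← TuckerPoint.proj_eq_op hw.1]
        exact (hmain d P (Phat w) Γ μ ε hΓ hεn hle hw n Ω Pr Z hn hZ t).trans
          (mul_le_mul_of_nonneg_left herr hC.le)) hp
    refine hb.trans ?_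
    have : 0 ≤ rateConst c C₁ / ε₀ * x := by positivity
    linarith
  · have h3 : 1 ≤ rateConst c C₁ / ε₀ * x := by
      rw [div_mul_eq_mul_div, one_le_div hε₀]
      linarith
    have h4 : 0 ≤ C * rateConst c C₁ * x := by positivity
    refine (kolmDist_le_one _).trans ?_
    linarith

/-- The rate of the efficient one-step estimator. -/
theorem exists_efficient_rate (m : ℕ) (r : Fin (m + 1) → ℕ) (μ κ B cS α c C₁ : ℝ) (M : ℕ)
    (hcS : 0 < cS) (hα : 0 < α) (hc : 0 < c) (hC₁ : 0 < C₁) : ∃ C : ℝ, 0 < C ∧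
      ∀ (d : Fin (m + 1) → ℕ) (P : TuckerPoint d r) (Γ : Tensor d) (CA : ℝ),
      SignalAssumptions P Γ μ κ B cS α M →
      InfoInvNormLE (P.signalTangent (zeroSum d)) (btl.infoOp (uniformDesign d) P.tensor)
        (CA * dstar d) →
      ∀ (n : ℕ) (Ω 𝒲 : Type*) [MeasurableSpace Ω] [MeasurableSpace 𝒲]
        (Pr : Measure Ω) [IsProbabilityMeasure Pr]
        (Z : Fin n → Ω → Tensor d × Bool) (W : Ω → 𝒲) (Phat : 𝒲 → TuckerPoint d r) (p : ℝ),
      1 ≤ n → IsIID Z (btl.law (uniformDesign d) P.tensor) Pr →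
      Measurable W → IndepFun W (fun ω i => Z i ω) Pr →
      Measurable (fun w => (Phat w).core) →
      (∀ k a j, Measurable fun w => (Phat w).factor k a j) →
      Pr.real {ω | ¬ (InitAccurate P (Phat (W ω))
          (C₁ * √((dbar d : ℝ) * Real.log (dbar d) ^ c / n)) ∧
        InfoInvNormLE ((Phat (W ω)).signalTangent (zeroSum d))
          (btl.infoOp (uniformDesign d) (Phat (W ω)).tensor) (CA * dstar d))} ≤ p →
      let H : Tensor d :=
        infoSolve (P.signalTangent (zeroSum d)) (btl.infoOp (uniformDesign d) P.tensor) Γ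
      let v : ℝ := sd (btl.infl P.tensor H) (btl.law (uniformDesign d) P.tensor)
      kolmDist Pr (standardized n (efficientEstimator Γ Phat W Z) (inner ℝ Γ P.tensor) v) ≤
        C * (CA * √((dbar d : ℝ) * Real.log (dbar d) ^ (2 * c) / n)) + p := by
  obtain ⟨C, ε₀, hC, hε₀, hmain⟩ := exists_efficient_one_step m r κ B M hcS hα
  have hK := rateConst_pos c hC₁
  refine ⟨C * rateConst c C₁ + 4 * (rateConst c C₁ / ε₀), by positivity, ?_⟩
  intro d P Γ CA hΓ hA n Ω 𝒲 _ _ Pr _ Z W Phat p hn hZ hW hind hcore hfac hp H v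
  have hd := hΓ.d_pos
  have hd0 := hΓ.two_le
  -- The sup-norm bound at the truth enters here: it keeps `CA` away from zero.
  have hCA : 1 / 4 ≤ CA := P.quarter_le_of_infoInvNormLE hd hd0 hA (P.proj_mem Γ)
    (norm_pos_iff.1 (hΓ.norm_proj_pos hα))
  have hCA0 : 0 < CA := by linarith
  have hdb : 2 ≤ dbar d := hΓ.two_le.trans (Finset.le_sup (Finset.mem_univ 0))
  have hp0 : 0 ≤ p := measureReal_nonneg.trans hp
  have herr := error_terms_le hc hC₁ hdb hn
  obtain ⟨x, hx⟩ : ∃ x, x = √((dbar d : ℝ) * Real.log (dbar d) ^ (2 * c) / n) := ⟨_, rfl⟩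
  obtain ⟨ε, hε⟩ : ∃ ε, ε = C₁ * √((dbar d : ℝ) * Real.log (dbar d) ^ c / n) := ⟨_, rfl⟩
  have hx0 : 0 ≤ x := hx ▸ Real.sqrt_nonneg _
  have hεn : 0 ≤ ε := by rw [hε]; positivity
  rw [← hx, ← hε] at herr
  rw [← hε] at hp
  rw [← hx]
  have h1 := Real.sqrt_nonneg ((dbar d : ℝ) / n)
  have h2 : 0 ≤ √n * ε ^ 2 / √(dbar d : ℝ) := by positivity
  rcases le_or_gt ε ε₀ with hle | hgt
  · have hQ : MeasPoint Phat := ⟨hcore, hfac⟩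
    have hgood := hQ.measurableSet_infoInvNormLE hd hd0 P ε (CA * dstar d)
    have hH' : Measurable fun w => op (Phat w).solveMat Γ :=
      measurable_of_entries fun j =>
        hQ.solveMat.op_apply (z := fun _ => Γ) (fun _ => measurable_const) j
    have hb := kolmDist_one_step_le (b := C * CA * (rateConst c C₁ * x)) btl.measurable_score
      hZ.measurable hW hind hgood hQ.tensor hH' Γ
      (est := efficientEstimator Γ Phat W Z) (ψ := inner ℝ Γ P.tensor) (v := v) (p := p)
      (fun ω hω => by rw [← TuckerPoint.effDir_eq_op hd hd0 hω.1.1]; rfl) (by positivity)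
      (fun w hw t => by
        rw [← TuckerPoint.effDir_eq_op hd hd0 hw.1.1]
        exact (hmain d P (Phat w) Γ μ ε CA hΓ hεn hle hw.1 hCA hw.2 n Ω Pr Z hn hZ t).trans
          (mul_le_mul_of_nonneg_left herr (by positivity))) hp
    refine hb.trans ?_
    have : 0 ≤ rateConst c C₁ / ε₀ * (CA * x) := by positivity
    linarith
  · have h3 : 1 ≤ rateConst c C₁ / ε₀ * x := by
      rw [div_mul_eq_mul_div, one_le_div hε₀]
      linarith
    have h4 : 0 ≤ C * rateConst c C₁ * (CA * x) := by positivity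
    have h5 : 1 ≤ 4 * (rateConst c C₁ / ε₀) * (CA * x) := by
      have := mul_le_mul_of_nonneg_left hCA (by positivity : 0 ≤ 4 * (rateConst c C₁ / ε₀ * x))
      linarith
    refine (kolmDist_le_one _).trans ?_
    linarith

end PairwiseBE

theorem mainTheorem12 :
    -- leading term and general combined bound, whitened influence function
    (∀ cI CI M₃ Cproj : ℝ, 0 < cI → cI ≤ CI → ∃ C : ℝ, 0 < C ∧
      ∀ (m : ℕ) (d r : Fin (m + 1) → ℕ) (q : ℕ) (𝒞 : Tensor d →ₗ[ℝ] (Fin q → ℝ))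
        (𝒴 : Type*) [MeasurableSpace 𝒴] (M : SingleIndexModel 𝒴)
        (𝒟 : Measure (Tensor d)) [IsProbabilityMeasure 𝒟]
        (P : TuckerPoint d r) (Γ : Tensor d) (δ : ℝ),
      RegularDesign M 𝒟 P 𝒞 δ cI CI Cproj →
      ThirdMomentLE M M.whitenedScore 𝒟 P.tensor M₃ →
      (P.signalTangent (LinearMap.ker 𝒞)).starProjection Γ ≠ 0 →
      ∀ (n : ℕ) (Ω : Type*) [MeasurableSpace Ω] (Pr : Measure Ω) [IsProbabilityMeasure Pr]
        (Z : Fin n → Ω → Tensor d × 𝒴),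
      1 ≤ n → IsIID Z (M.law 𝒟 P.tensor) Pr →
      let H : Tensor d := δ • (P.signalTangent (LinearMap.ker 𝒞)).starProjection Γ
      let φ : Tensor d × 𝒴 → ℝ := M.whitenedInfl P.tensor H
      let v : ℝ := sd φ (M.law 𝒟 P.tensor)
      kolmDist Pr (leadingSum Z φ v) ≤ C * √((dbar d : ℝ) / n) ∧
      ∀ (est : Ω → ℝ) (ρ : ℝ), Measurable est → 0 < ρ →
        kolmDist Pr (standardized n est (inner ℝ Γ P.tensor) v) ≤
          C * √((dbar d : ℝ) / n) + ρ / √(2 * Real.pi) +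
            Pr.real {ω | ρ < |stdRemainder Z φ est (inner ℝ Γ P.tensor) v ω|}) ∧
    -- leading term and general combined bound, efficient influence function
    (∀ cI CI M₃ Cproj : ℝ, 0 < cI → cI ≤ CI → ∃ C : ℝ, 0 < C ∧
      ∀ (m : ℕ) (d r : Fin (m + 1) → ℕ) (q : ℕ) (𝒞 : Tensor d →ₗ[ℝ] (Fin q → ℝ))
        (𝒴 : Type*) [MeasurableSpace 𝒴] (M : SingleIndexModel 𝒴)
        (𝒟 : Measure (Tensor d)) [IsProbabilityMeasure 𝒟]
        (P : TuckerPoint d r) (Γ : Tensor d) (δ : ℝ),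
      RegularDesign M 𝒟 P 𝒞 δ cI CI Cproj →
      Integrable (fun x => ‖x‖ ^ 2) 𝒟 →
      ThirdMomentLE M M.score 𝒟 P.tensor M₃ →
      (P.signalTangent (LinearMap.ker 𝒞)).starProjection Γ ≠ 0 →
      ∀ (n : ℕ) (Ω : Type*) [MeasurableSpace Ω] (Pr : Measure Ω) [IsProbabilityMeasure Pr]
        (Z : Fin n → Ω → Tensor d × 𝒴),
      1 ≤ n → IsIID Z (M.law 𝒟 P.tensor) Pr →
      let H : Tensor d :=
        infoSolve (P.signalTangent (LinearMap.ker 𝒞)) (M.infoOp 𝒟 P.tensor) Γ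
      let φ : Tensor d × 𝒴 → ℝ := M.infl P.tensor H
      let v : ℝ := sd φ (M.law 𝒟 P.tensor)
      kolmDist Pr (leadingSum Z φ v) ≤ C * √((dbar d : ℝ) / n) ∧
      ∀ (est : Ω → ℝ) (ρ : ℝ), Measurable est → 0 < ρ →
        kolmDist Pr (standardized n est (inner ℝ Γ P.tensor) v) ≤
          C * √((dbar d : ℝ) / n) + ρ / √(2 * Real.pi) +
            Pr.real {ω | ρ < |stdRemainder Z φ est (inner ℝ Γ P.tensor) v ω|}) ∧
    -- rate for the whitened one-step estimator
    (∀ (m : ℕ) (r : Fin (m + 1) → ℕ) (μ κ B cS α c C₁ : ℝ) (M : ℕ),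
      0 < cS → 0 < α → 0 < c → 0 < C₁ → ∃ C : ℝ, 0 < C ∧
      ∀ (d : Fin (m + 1) → ℕ) (P : TuckerPoint d r) (Γ : Tensor d),
      SignalAssumptions P Γ μ κ B cS α M →
      ∀ (n : ℕ) (Ω 𝒲 : Type*) [MeasurableSpace Ω] [MeasurableSpace 𝒲]
        (Pr : Measure Ω) [IsProbabilityMeasure Pr]
        (Z : Fin n → Ω → Tensor d × Bool) (W : Ω → 𝒲) (Phat : 𝒲 → TuckerPoint d r) (p : ℝ),
      1 ≤ n → IsIID Z (btl.law (uniformDesign d) P.tensor) Pr →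
      Measurable W → IndepFun W (fun ω i => Z i ω) Pr →
      Measurable (fun w => (Phat w).core) →
      (∀ k a j, Measurable fun w => (Phat w).factor k a j) →
      Pr.real {ω | ¬ InitAccurate P (Phat (W ω))
        (C₁ * √((dbar d : ℝ) * Real.log (dbar d) ^ c / n))} ≤ p →
      let H : Tensor d := effDim d • (P.signalTangent (zeroSum d)).starProjection Γ
      let v : ℝ := sd (btl.whitenedInfl P.tensor H) (btl.law (uniformDesign d) P.tensor)
      kolmDist Pr (standardized n (whitenedEstimator Γ Phat W Z) (inner ℝ Γ P.tensor) v) ≤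
        C * √((dbar d : ℝ) * Real.log (dbar d) ^ (2 * c) / n) + p) ∧
    -- rate for the efficient one-step estimator
    (∀ (m : ℕ) (r : Fin (m + 1) → ℕ) (μ κ B cS α c C₁ : ℝ) (M : ℕ),
      0 < cS → 0 < α → 0 < c → 0 < C₁ → ∃ C : ℝ, 0 < C ∧
      ∀ (d : Fin (m + 1) → ℕ) (P : TuckerPoint d r) (Γ : Tensor d) (CA : ℝ),
      SignalAssumptions P Γ μ κ B cS α M →
      InfoInvNormLE (P.signalTangent (zeroSum d)) (btl.infoOp (uniformDesign d) P.tensor)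
        (CA * dstar d) →
      ∀ (n : ℕ) (Ω 𝒲 : Type*) [MeasurableSpace Ω] [MeasurableSpace 𝒲]
        (Pr : Measure Ω) [IsProbabilityMeasure Pr]
        (Z : Fin n → Ω → Tensor d × Bool) (W : Ω → 𝒲) (Phat : 𝒲 → TuckerPoint d r) (p : ℝ),
      1 ≤ n → IsIID Z (btl.law (uniformDesign d) P.tensor) Pr →
      Measurable W → IndepFun W (fun ω i => Z i ω) Pr →
      Measurable (fun w => (Phat w).core) →
      (∀ k a j, Measurable fun w => (Phat w).factor k a j) →
      Pr.real {ω | ¬ (InitAccurate P (Phat (W ω))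
          (C₁ * √((dbar d : ℝ) * Real.log (dbar d) ^ c / n)) ∧
        InfoInvNormLE ((Phat (W ω)).signalTangent (zeroSum d))
          (btl.infoOp (uniformDesign d) (Phat (W ω)).tensor) (CA * dstar d))} ≤ p →
      let H : Tensor d :=
        infoSolve (P.signalTangent (zeroSum d)) (btl.infoOp (uniformDesign d) P.tensor) Γ
      let v : ℝ := sd (btl.infl P.tensor H) (btl.law (uniformDesign d) P.tensor)
      kolmDist Pr (standardized n (efficientEstimator Γ Phat W Z) (inner ℝ Γ P.tensor) v) ≤
        C * (CA * √((dbar d : ℝ) * Real.log (dbar d) ^ (2 * c) / n)) + p) := by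
  -- The variance floors are `1 / CI` and `cI` respectively. The added 1 makes the constant
  -- positive, and it is harmless because it multiplies a nonnegative rate.
  refine ⟨fun cI CI M₃ Cproj hcI hCI =>
      ⟨104 * (|M₃| * |Cproj| / √(1 / CI) ^ 3) + 1, by positivity, ?_⟩,
    fun cI CI M₃ Cproj hcI _ => ⟨104 * (|M₃| * |Cproj| / √cI ^ 3) + 1, by positivity, ?_⟩,
    exists_whitened_rate, exists_efficient_rate⟩
  · intro m d r q 𝒞 𝒴 _ M 𝒟 _ P Γ δ hreg h3 hΓ n Ω _ Pr _ Z hn hZ H φ v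
    obtain ⟨h1, h2⟩ := whitened_leading_term hcI hCI hreg h3 hΓ hn hZ (φ := φ) rfl
      (inner ℝ Γ P.tensor)
    exact ⟨h1, fun est ρ _ hρ => h2 est ρ hρ⟩
  · intro m d r q 𝒞 𝒴 _ M 𝒟 _ P Γ δ hreg hX h3 hΓ n Ω _ Pr _ Z hn hZ H φ v
    obtain ⟨h1, h2⟩ := efficient_leading_term hcI hreg hX h3 hΓ hn hZ (φ := φ) rfl
      (inner ℝ Γ P.tensor)
    exact ⟨h1, fun est ρ _ hρ => h2 est ρ hρ⟩
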